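/- **Theorem.** Let $q>0$ be real, $q\neq1$, and let $n\ge3$. Let $U'_q(\mathrm{so}_n)$ be the associative unital complex algebra generated by $I_{i,i-1}$, $i=2,\dots,n$, with defining relations $$I_{i,i-1}I_{i-1,i-2}^2-(q+q^{-1})I_{i-1,i-2}I_{i,i-1}I_{i-1,i-2}+I_{i-1,i-2}^2I_{i,i-1}=-I_{i,i-1},$$ $$I_{i,i-1}^2I_{i-1,i-2}-(q+q^{-1})I_{i,i-1}I_{i-1,i-2}I_{i,i-1}+I_{i-1,i-2}I_{i,i-1}^2=-I_{i-1,i-2},$$ $$I_{i,i-1}I_{j,j-1}=I_{j,j-1}I_{i,i-1}\quad(|i-j|>1).$$ Put $[a]=\frac{q^a-q^{-a}}{q-q^{-1}}$ and $[a]_+=\frac{q^a+q^{-a}}{q-q^{-1}}$. "Half-integral" means lying in $\mathbb Z+\frac12$, and $\lfloor\cdot\rfloor$ is the integral part. *Nonclassical data.* Let $\epsilon=(\epsilon_2,\dots,\epsilon_n)$, $\epsilon_i=\pm1$, and let $\mathbf m_n=(m_{1,n},\dots,m_{\lfloor n/2\rfloor,n})$ be half-integral numbers with $m_{1,n}\ge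 m_{2,n}\ge\dots\ge m_{\lfloor n/2\rfloor,n}\ge\frac12$. Let $V_{\mathbf m_n}$ be the complex vector space with basis $|\xi\rangle$, where $\xi$ runs over the tableaux with rows $\mathbf m_n,\mathbf m_{n-1},\dots,\mathbf m_2$ (top row the given $\mathbf m_n$, row $\mathbf m_k=(m_{1,k},\dots,m_{\lfloor k/2\rfloor,k})$) of half-integral numbers such that $$m_{1,2p+1}\ge m_{1,2p}\ge m_{2,2p+1}\ge m_{2,2p}\ge\dots\ge m_{p,2p+1}\ge m_{p,2p}\ge\tfrac12\qquad(3\le 2p+1\le n),$$ $$m_{1,2p}\ge m_{1,2p-1}\ge m_{2,2p}\ge\dots\ge m_{p-1,2p-1}\ge m_{p,2p}\qquad(4\le 2p\le n).$$ Put $l_{j,2p+1}=m_{j,2p+1}+p-j+1$ and $l_{j,2p}=m_{j,2p}+p-j$. Let $\xi^{\pm j}_k$ be $\xi$ with $m_{j,k}$ replaced by $m_{j,k}\pm1$, and let $|\xi^{\pm j}_k\rangle=0$ if this is not an admissible tableau. Put $$A^j_{2p}(\xi)=\left(\frac{\prod_{i=1}^p[l_{i,2p+1}+l_{j,2p}][l_{i,2p+1}-l_{j,2p}-1]\prod_{i=1}^{p-1}[l_{i,2p-1}+l_{j,2p}][l_{i,2p-1}-l_{j,2p}-1]}{\prod_{i\ne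 j}[l_{i,2p}+l_{j,2p}][l_{i,2p}-l_{j,2p}][l_{i,2p}+l_{j,2p}+1][l_{i,2p}-l_{j,2p}-1]}\right)^{1/2},$$ $$B^j_{2p-1}(\xi)=\left(\frac{\prod_{i=1}^p[l_{i,2p}+l_{j,2p-1}][l_{i,2p}-l_{j,2p-1}]\prod_{i=1}^{p-1}[l_{i,2p-2}+l_{j,2p-1}][l_{i,2p-2}-l_{j,2p-1}]}{\prod_{i\ne j}[l_{i,2p-1}+l_{j,2p-1}][l_{i,2p-1}-l_{j,2p-1}][l_{i,2p-1}+l_{j,2p-1}-1][l_{i,2p-1}-l_{j,2p-1}-1]}\right)^{1/2},$$ $$\hat C_{2p-1}(\xi)=\frac{\prod_{s=1}^p[l_{s,2p}]_+\prod_{s=1}^{p-1}[l_{s,2p-2}]_+}{\prod_{s=1}^{p-1}[l_{s,2p-1}]_+[l_{s,2p-1}-1]_+},\qquad D_{2p}(\xi)=\frac{\prod_{i=1}^p[l_{i,2p+1}-\frac12]\prod_{i=1}^{p-1}[l_{i,2p-1}-\frac12]}{\prod_{i=1}^{p-1}[l_{i,2p}+\frac12][l_{i,2p}-\frac12]}.$$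 Let $T_{\epsilon,\mathbf m_n}$ be given on $V_{\mathbf m_n}$ by $$T_{\epsilon,\mathbf m_n}(I_{2p+1,2p})|\xi\rangle=\delta_{m_{p,2p},1/2}\frac{\epsilon_{2p+1}}{q^{1/2}-q^{-1/2}}D_{2p}(\xi)|\xi\rangle+\sum_{j=1}^p\frac{A^j_{2p}(\xi)}{q^{l_{j,2p}}-q^{-l_{j,2p}}}|\xi^{+j}_{2p}\rangle-\sum_{j=1}^p\frac{A^j_{2p}(\xi^{-j}_{2p})}{q^{l_{j,2p}}-q^{-l_{j,2p}}}|\xi^{-j}_{2p}\rangle,$$ $$T_{\epsilon,\mathbf m_n}(I_{2p,2p-1})|\xi\rangle=\sum_{j=1}^{p-1}\frac{B^j_{2p-1}(\xi)}{[2l_{j,2p-1}-1][l_{j,2p-1}]_+}|\xi^{+j}_{2p-1}\rangle-\sum_{j=1}^{p-1}\frac{B^j_{2p-1}(\xi^{-j}_{2p-1})}{[2l_{j,2p-1}-1][l_{j,2p-1}-1]_+}|\xi^{-j}_{2p-1}\rangle+\epsilon_{2p}\hat C_{2p-1}(\xi)|\xi\rangle.$$ *Classical data.* Let $\mathbf m'_n$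 consist of $\lfloor n/2\rfloor$ numbers, all integral or all half-integral, with $m'_{1,n}\ge\dots\ge m'_{p,n}\ge0$ if $n=2p+1$ and $m'_{1,n}\ge\dots\ge m'_{p-1,n}\ge|m'_{p,n}|$ if $n=2p$. The operators $T_{\mathbf m'_n}(I_{i,i-1})$ of the classical type representation act on the space whose basis is given by the tableaux with top row $\mathbf m'_n$ and entries all integral or all half-integral such that $m_{1,2p+1}\ge m_{1,2p}\ge\dots\ge m_{p,2p+1}\ge m_{p,2p}\ge-m_{p,2p+1}$ and $m_{1,2p}\ge m_{1,2p-1}\ge\dots\ge m_{p-1,2p-1}\ge|m_{p,2p}|$. They are given by the two formulas above with the following changes: the $\delta$-term is omitted, $q^{l}-q^{-l}$ is replaced by $q^{l}+q^{-l}$ in the denominators, $[\cdot]_+$ is replaced by $[\cdot]$, and $\epsilon_{2p}\hat C_{2p-1}$ is replaced by $\mathrm i\,C_{2p-1}$, where $C_{2p-1}=\frac{\prod_{s=1}^p[l_{s,2p}]\prod_{s=1}^{p-1}[l_{s,2p-2}]}{\prod_{s=1}^{p-1}[l_{s,2p-1}][l_{s,2p-1}-1]}$ (read as $0$ if $l_{p,2p}=0$).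 Then, for all such data: 1. $T_{\epsilon,\mathbf m_n}$ is a finite-dimensional representation of $U'_q(\mathrm{so}_n)$, and it is irreducible. 2. If $(\epsilon,\mathbf m_n)\ne(\epsilon',\mathbf m'_n)$ are two nonclassical data, then $T_{\epsilon,\mathbf m_n}$ and $T_{\epsilon',\mathbf m'_n}$ are not equivalent. 3. No $T_{\epsilon,\mathbf m_n}$ is equivalent to a classical type $T_{\mathbf m'_n}$: no linear isomorphism of the spaces intertwines the operators of all $I_{i,i-1}$, $i=2,\dots,n$. -/

import Mathlib

open Finset

noncomputable section

/-! ### The algebra `U'_q(so_n)` -/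

/-- Indices `i = 2, 3, …, n`; the index `i` stands for the generator `I_{i,i-1}`. -/
abbrev GenIndex (n : ℕ) : Type := {i : ℕ // i ∈ Icc 2 n}

/-- The defining relations of `U'_q(so_n)` in the free algebra on the symbols `I_{i,i-1}`. -/
inductive USoRel (q : ℝ) (n : ℕ) :
    FreeAlgebra ℂ (GenIndex n) → FreeAlgebra ℂ (GenIndex n) → Prop
  | serre_left (i j : GenIndex n) (h : i.1 = j.1 + 1) :
      USoRel q n
        (FreeAlgebra.ι ℂ i * FreeAlgebra.ι ℂ j ^ 2
          - ((q + q⁻¹ : ℝ) : ℂ) • (FreeAlgebra.ι ℂ j * FreeAlgebra.ι ℂ i * FreeAlgebra.ι ℂ j)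
          + FreeAlgebra.ι ℂ j ^ 2 * FreeAlgebra.ι ℂ i)
        (-FreeAlgebra.ι ℂ i)
  | serre_right (i j : GenIndex n) (h : i.1 = j.1 + 1) :
      USoRel q n
        (FreeAlgebra.ι ℂ i ^ 2 * FreeAlgebra.ι ℂ j
          - ((q + q⁻¹ : ℝ) : ℂ) • (FreeAlgebra.ι ℂ i * FreeAlgebra.ι ℂ j * FreeAlgebra.ι ℂ i)
          + FreeAlgebra.ι ℂ j * FreeAlgebra.ι ℂ i ^ 2)
        (-FreeAlgebra.ι ℂ j)
  | commute (i j : GenIndex n) (h : i.1 + 1 < j.1 ∨ j.1 + 1 < i.1) :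
      USoRel q n (FreeAlgebra.ι ℂ i * FreeAlgebra.ι ℂ j) (FreeAlgebra.ι ℂ j * FreeAlgebra.ι ℂ i)

/-- The associative unital complex algebra `U'_q(so_n)`. -/
abbrev USo (q : ℝ) (n : ℕ) : Type := RingQuot (USoRel q n)

/-- The generator `I_{i,i-1}` of `U'_q(so_n)`. -/
def USo.gen (q : ℝ) (n : ℕ) (i : GenIndex n) : USo q n :=
  RingQuot.mkAlgHom ℂ (USoRel q n) (FreeAlgebra.ι ℂ i)

/-! ### Irreducibility and equivalence of representations of an algebra -/

section Rep

variable {A : Type*} [Ring A] [Algebra ℂ A]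
  {V : Type*} [AddCommGroup V] [Module ℂ V] {W : Type*} [AddCommGroup W] [Module ℂ W]

/-- A representation is irreducible if its space is nonzero and has no invariant subspace
other than `0` and itself. -/
def IsIrreducibleRep (ρ : A →ₐ[ℂ] Module.End ℂ V) : Prop :=
  Nontrivial V ∧ ∀ S : Submodule ℂ V, (∀ a : A, ∀ v ∈ S, ρ a v ∈ S) → S = ⊥ ∨ S = ⊤

/-- Two representations are equivalent if a linear isomorphism intertwines them. -/
def EquivalentReps (ρ : A →ₐ[ℂ] Module.End ℂ V) (σ : A →ₐ[ℂ] Module.End ℂ W) : Prop :=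
  ∃ f : V ≃ₗ[ℂ] W, ∀ (a : A) (v : V), f (ρ a v) = σ a (f v)

end Rep

/-! ### Weights and tableaux -/

/-- `x` is half-integral, i.e. `x ∈ ℤ + 1/2`. -/
def IsHalfIntegral (x : ℝ) : Prop := ∃ z : ℤ, x = z + 1 / 2

/-- `x` is integral. -/
def IsIntegerValued (x : ℝ) : Prop := ∃ z : ℤ, x = z

/-- Indices `j = 1, …, {n/2}` of the components of `m_n` (`{·}` is the integral part). -/
abbrev WeightIndex (n : ℕ) : Type := {j : ℕ // j ∈ Icc 1 (n / 2)}

/-- Parameters of the nonclassical representations: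
half-integral, `m_{1,n} ≥ m_{2,n} ≥ … ≥ 1/2`. -/
def IsNonclassicalWeight (n : ℕ) (m : WeightIndex n → ℝ) : Prop :=
  (∀ j, IsHalfIntegral (m j)) ∧ Antitone m ∧ ∀ j, 1 / 2 ≤ m j

/-- Parameters of the classical type representations: all integral or all half-integral, and
`m_{1,n} ≥ … ≥ m_{p,n} ≥ 0` for `n = 2p + 1`, `m_{1,n} ≥ … ≥ m_{p-1,n} ≥ |m_{p,n}|` for
`n = 2p`. -/
def IsClassicalWeight (n : ℕ) (m : WeightIndex n → ℝ) : Prop :=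
  ((∀ j, IsIntegerValued (m j)) ∨ ∀ j, IsHalfIntegral (m j)) ∧
  Antitone m ∧
  (Odd n → ∀ j, 0 ≤ m j) ∧
  (Even n → ∀ i j, i < j → |m j| ≤ m i)

/-- The positions of a tableau with rows `m_n, m_{n-1}, …, m_2`: the component `m_{j,k}` exists
for `2 ≤ k ≤ n` and `1 ≤ j ≤ {k/2}`. -/
def IsPosition (n k j : ℕ) : Prop := 2 ≤ k ∧ k ≤ n ∧ 1 ≤ j ∧ j ≤ k / 2

/-- An array `ξ`, with `ξ k j = m_{j,k}` (and `0` where there is no such component),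
with top row `m`. -/
def HasShape (n : ℕ) (m : WeightIndex n → ℝ) (ξ : ℕ → ℕ → ℝ) : Prop :=
  (∀ k j, ¬ IsPosition n k j → ξ k j = 0) ∧ ∀ j : WeightIndex n, ξ n j.1 = m j

/-- Tableaux that label the basis of the nonclassical representation space. -/
def IsNonclassicalTableau (n : ℕ) (m : WeightIndex n → ℝ) (ξ : ℕ → ℕ → ℝ) : Prop :=
  HasShape n m ξ ∧
  (∀ k j, IsPosition n k j → IsHalfIntegral (ξ k j)) ∧
  -- `m_{1,2p+1} ≥ m_{1,2p} ≥ m_{2,2p+1} ≥ … ≥ m_{p,2p+1} ≥ m_{p,2p} ≥ 1/2`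
  (∀ p, 1 ≤ p → 2 * p + 1 ≤ n →
    (∀ j ∈ Icc 1 p, ξ (2 * p) j ≤ ξ (2 * p + 1) j) ∧
    (∀ j ∈ Icc 1 (p - 1), ξ (2 * p + 1) (j + 1) ≤ ξ (2 * p) j) ∧
    1 / 2 ≤ ξ (2 * p) p) ∧
  -- `m_{1,2p} ≥ m_{1,2p-1} ≥ m_{2,2p} ≥ … ≥ m_{p-1,2p-1} ≥ m_{p,2p}`
  (∀ p, 2 ≤ p → 2 * p ≤ n →
    ∀ j ∈ Icc 1 (p - 1), ξ (2 * p - 1) j ≤ ξ (2 * p) j ∧ ξ (2 * p) (j + 1) ≤ ξ (2 * p - 1) j)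

/-- Gel'fand–Tsetlin tableaux that label the basis of the classical type representation space. -/
def IsClassicalTableau (n : ℕ) (m : WeightIndex n → ℝ) (ξ : ℕ → ℕ → ℝ) : Prop :=
  HasShape n m ξ ∧
  ((∀ k j, IsPosition n k j → IsIntegerValued (ξ k j)) ∨
    ∀ k j, IsPosition n k j → IsHalfIntegral (ξ k j)) ∧
  -- `m_{1,2p+1} ≥ m_{1,2p} ≥ m_{2,2p+1} ≥ … ≥ m_{p,2p+1} ≥ m_{p,2p} ≥ -m_{p,2p+1}`
  (∀ p, 1 ≤ p → 2 * p + 1 ≤ n →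
    (∀ j ∈ Icc 1 p, ξ (2 * p) j ≤ ξ (2 * p + 1) j) ∧
    (∀ j ∈ Icc 1 (p - 1), ξ (2 * p + 1) (j + 1) ≤ ξ (2 * p) j) ∧
    -ξ (2 * p + 1) p ≤ ξ (2 * p) p) ∧
  -- `m_{1,2p} ≥ m_{1,2p-1} ≥ m_{2,2p} ≥ … ≥ m_{p-1,2p-1} ≥ |m_{p,2p}|`
  (∀ p, 2 ≤ p → 2 * p ≤ n →
    (∀ j ∈ Icc 1 (p - 1),
      ξ (2 * p - 1) j ≤ ξ (2 * p) j ∧ ξ (2 * p) (j + 1) ≤ ξ (2 * p - 1) j) ∧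
    |ξ (2 * p) p| ≤ ξ (2 * p - 1) (p - 1))

/-- The space of the nonclassical representation: the complex space with the tableaux as basis. -/
abbrev NonclassicalSpace (n : ℕ) (m : WeightIndex n → ℝ) : Type :=
  {ξ : ℕ → ℕ → ℝ // IsNonclassicalTableau n m ξ} →₀ ℂ

/-- The space of the classical type representation. -/
abbrev ClassicalSpace (n : ℕ) (m : WeightIndex n → ℝ) : Type :=
  {ξ : ℕ → ℕ → ℝ // IsClassicalTableau n m ξ} →₀ ℂ

open Classical in
/-- The basis vector `|ξ⟩`; as usual it is `0` when the array `ξ` is not a tableau. -/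
def ket (P : (ℕ → ℕ → ℝ) → Prop) (ξ : ℕ → ℕ → ℝ) : {ξ : ℕ → ℕ → ℝ // P ξ} →₀ ℂ :=
  if h : P ξ then Finsupp.single ⟨ξ, h⟩ 1 else 0

/-- The array obtained from `ξ` by replacing the component `m_{j,k}` by `m_{j,k} + d`. -/
def shift (ξ : ℕ → ℕ → ℝ) (k j : ℕ) (d : ℝ) : ℕ → ℕ → ℝ :=
  Function.update ξ k (Function.update (ξ k) j (ξ k j + d))

/-! ### Matrix elements -/

/-- `[a] = (q^a - q^{-a}) / (q - q^{-1})`. -/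
def qNum (q a : ℝ) : ℝ := (q ^ a - q ^ (-a)) / (q - q⁻¹)

/-- `[a]_+ = (q^a + q^{-a}) / (q - q^{-1})`. -/
def qNumPlus (q a : ℝ) : ℝ := (q ^ a + q ^ (-a)) / (q - q⁻¹)

/-- The `l`-coordinate `l_{j,k}`: `l_{j,2p+1} = m_{j,2p+1} + p - j + 1` and
`l_{j,2p} = m_{j,2p} + p - j`. -/
def lCoord (ξ : ℕ → ℕ → ℝ) (k j : ℕ) : ℝ := ξ k j + ((k + 1) / 2 : ℕ) - j

/-- The coefficient `A^j_{2p}(ξ)`. -/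
def coeffA (q : ℝ) (ξ : ℕ → ℕ → ℝ) (p j : ℕ) : ℝ :=
  let l := lCoord ξ
  Real.sqrt
    (((∏ i ∈ Icc 1 p,
        qNum q (l (2 * p + 1) i + l (2 * p) j) * qNum q (l (2 * p + 1) i - l (2 * p) j - 1)) *
      ∏ i ∈ Icc 1 (p - 1),
        qNum q (l (2 * p - 1) i + l (2 * p) j) * qNum q (l (2 * p - 1) i - l (2 * p) j - 1)) /
      ∏ i ∈ (Icc 1 p).erase j,
        qNum q (l (2 * p) i + l (2 * p) j) * qNum q (l (2 * p) i - l (2 * p) j) *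
          qNum q (l (2 * p) i + l (2 * p) j + 1) * qNum q (l (2 * p) i - l (2 * p) j - 1))

/-- The coefficient `B^j_{2p-1}(ξ)`. -/
def coeffB (q : ℝ) (ξ : ℕ → ℕ → ℝ) (p j : ℕ) : ℝ :=
  let l := lCoord ξ
  Real.sqrt
    (((∏ i ∈ Icc 1 p,
        qNum q (l (2 * p) i + l (2 * p - 1) j) * qNum q (l (2 * p) i - l (2 * p - 1) j)) *
      ∏ i ∈ Icc 1 (p - 1),
        qNum q (l (2 * p - 2) i + l (2 * p - 1) j) *
          qNum q (l (2 * p - 2) i - l (2 * p - 1) j)) /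
      ∏ i ∈ (Icc 1 (p - 1)).erase j,
        qNum q (l (2 * p - 1) i + l (2 * p - 1) j) * qNum q (l (2 * p - 1) i - l (2 * p - 1) j) *
          qNum q (l (2 * p - 1) i + l (2 * p - 1) j - 1) *
          qNum q (l (2 * p - 1) i - l (2 * p - 1) j - 1))

/-- The coefficient `C_{2p-1}(ξ)`; if `[l_{s,2p-1} - 1] = 0` for some `s`, then `l_{p,2p} = 0`
and the coefficient is `0`. -/
def coeffC (q : ℝ) (ξ : ℕ → ℕ → ℝ) (p : ℕ) : ℝ :=
  let l := lCoord ξ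
  ((∏ s ∈ Icc 1 p, qNum q (l (2 * p) s)) * ∏ s ∈ Icc 1 (p - 1), qNum q (l (2 * p - 2) s)) /
    ∏ s ∈ Icc 1 (p - 1), qNum q (l (2 * p - 1) s) * qNum q (l (2 * p - 1) s - 1)

/-- The coefficient `Ĉ_{2p-1}(ξ)`. -/
def coeffCHat (q : ℝ) (ξ : ℕ → ℕ → ℝ) (p : ℕ) : ℝ :=
  let l := lCoord ξ
  ((∏ s ∈ Icc 1 p, qNumPlus q (l (2 * p) s)) *
      ∏ s ∈ Icc 1 (p - 1), qNumPlus q (l (2 * p - 2) s)) /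
    ∏ s ∈ Icc 1 (p - 1), qNumPlus q (l (2 * p - 1) s) * qNumPlus q (l (2 * p - 1) s - 1)

/-- The coefficient `D_{2p}(ξ)`. -/
def coeffD (q : ℝ) (ξ : ℕ → ℕ → ℝ) (p : ℕ) : ℝ :=
  let l := lCoord ξ
  ((∏ i ∈ Icc 1 p, qNum q (l (2 * p + 1) i - 1 / 2)) *
      ∏ i ∈ Icc 1 (p - 1), qNum q (l (2 * p - 1) i - 1 / 2)) /
    ∏ i ∈ Icc 1 (p - 1), qNum q (l (2 * p) i + 1 / 2) * qNum q (l (2 * p) i - 1 / 2)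

/-! ### The nonclassical representations -/

/-- The vector `T_{ε,m}(I_{2p+1,2p}) |ξ⟩`, where `s = ε_{2p+1}`. (If `m_{p,2p} = 1/2`, then
lowering `m_{p,2p}` does not give a tableau, so the last sum has no term `j = p`.) -/
def nonclassicalOddImage (q : ℝ) (n : ℕ) (m : WeightIndex n → ℝ) (s : ℤˣ) (p : ℕ)
    (ξ : ℕ → ℕ → ℝ) : NonclassicalSpace n m :=
  let e := ket (IsNonclassicalTableau n m)
  let l := lCoord ξ
  (if ξ (2 * p) p = 1 / 2 then
      ((((s : ℤ) : ℝ) / (q ^ (1 / 2 : ℝ) - q ^ (-(1 / 2) : ℝ)) * coeffD q ξ p : ℝ) : ℂ) • e ξ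
    else 0)
  + ∑ j ∈ Icc 1 p,
      ((coeffA q ξ p j / (q ^ l (2 * p) j - q ^ (-l (2 * p) j)) : ℝ) : ℂ) •
        e (shift ξ (2 * p) j 1)
  - ∑ j ∈ Icc 1 p,
      ((coeffA q (shift ξ (2 * p) j (-1)) p j / (q ^ l (2 * p) j - q ^ (-l (2 * p) j)) : ℝ) : ℂ) •
        e (shift ξ (2 * p) j (-1))

/-- The vector `T_{ε,m}(I_{2p,2p-1}) |ξ⟩`, where `s = ε_{2p}`. -/
def nonclassicalEvenImage (q : ℝ) (n : ℕ) (m : WeightIndex n → ℝ) (s : ℤˣ) (p : ℕ)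
    (ξ : ℕ → ℕ → ℝ) : NonclassicalSpace n m :=
  let e := ket (IsNonclassicalTableau n m)
  let l := lCoord ξ
  ∑ j ∈ Icc 1 (p - 1),
      ((coeffB q ξ p j /
        (qNum q (2 * l (2 * p - 1) j - 1) * qNumPlus q (l (2 * p - 1) j)) : ℝ) : ℂ) •
        e (shift ξ (2 * p - 1) j 1)
  - ∑ j ∈ Icc 1 (p - 1),
      ((coeffB q (shift ξ (2 * p - 1) j (-1)) p j /
        (qNum q (2 * l (2 * p - 1) j - 1) * qNumPlus q (l (2 * p - 1) j - 1)) : ℝ) : ℂ) •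
        e (shift ξ (2 * p - 1) j (-1))
  + ((((s : ℤ) : ℝ) * coeffCHat q ξ p : ℝ) : ℂ) • e ξ

/-- The operator `T_{ε,m}(I_{i,i-1})` of the nonclassical representation. -/
def nonclassicalOp (q : ℝ) (n : ℕ) (ε : GenIndex n → ℤˣ) (m : WeightIndex n → ℝ)
    (i : GenIndex n) : Module.End ℂ (NonclassicalSpace n m) :=
  Finsupp.linearCombination ℂ fun ξ =>
    if Even i.1 then nonclassicalEvenImage q n m (ε i) (i.1 / 2) ξ.1
    else nonclassicalOddImage q n m (ε i) (i.1 / 2) ξ.1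

/-! ### The representations of the classical type -/

/-- The vector `T_m(I_{2p+1,2p}) |ξ⟩`. -/
def classicalOddImage (q : ℝ) (n : ℕ) (m : WeightIndex n → ℝ) (p : ℕ)
    (ξ : ℕ → ℕ → ℝ) : ClassicalSpace n m :=
  let e := ket (IsClassicalTableau n m)
  let l := lCoord ξ
  ∑ j ∈ Icc 1 p,
      ((coeffA q ξ p j / (q ^ l (2 * p) j + q ^ (-l (2 * p) j)) : ℝ) : ℂ) •
        e (shift ξ (2 * p) j 1)
  - ∑ j ∈ Icc 1 p,
      ((coeffA q (shift ξ (2 * p) j (-1)) p j / (q ^ l (2 * p) j + q ^ (-l (2 * p) j)) : ℝ) : ℂ) •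
        e (shift ξ (2 * p) j (-1))

/-- The vector `T_m(I_{2p,2p-1}) |ξ⟩`. -/
def classicalEvenImage (q : ℝ) (n : ℕ) (m : WeightIndex n → ℝ) (p : ℕ)
    (ξ : ℕ → ℕ → ℝ) : ClassicalSpace n m :=
  let e := ket (IsClassicalTableau n m)
  let l := lCoord ξ
  ∑ j ∈ Icc 1 (p - 1),
      ((coeffB q ξ p j /
        (qNum q (2 * l (2 * p - 1) j - 1) * qNum q (l (2 * p - 1) j)) : ℝ) : ℂ) •
        e (shift ξ (2 * p - 1) j 1)
  - ∑ j ∈ Icc 1 (p - 1),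
      ((coeffB q (shift ξ (2 * p - 1) j (-1)) p j /
        (qNum q (2 * l (2 * p - 1) j - 1) * qNum q (l (2 * p - 1) j - 1)) : ℝ) : ℂ) •
        e (shift ξ (2 * p - 1) j (-1))
  + (Complex.I * (coeffC q ξ p : ℂ)) • e ξ

/-- The operator `T_m(I_{i,i-1})` of the representation of the classical type. -/
def classicalOp (q : ℝ) (n : ℕ) (m : WeightIndex n → ℝ)
    (i : GenIndex n) : Module.End ℂ (ClassicalSpace n m) :=
  Finsupp.linearCombination ℂ fun ξ =>
    if Even i.1 then classicalEvenImage q n m (i.1 / 2) ξ.1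
    else classicalOddImage q n m (i.1 / 2) ξ.1

end

/-!
The proof works with the coordinates `u_{j,k} = m_{j,k} + k/2 - j`. In them adjacent rows of a
tableau interlace strictly (`Interlacing`), and the coefficients `A` and `B` take one form: the step
of row `k` that replaces an entry `x` by `x + s`, `s = ±1`, depends on `w = s x` through a prefactor
and a root whose numerator is the product of `[u]² - [w + 1/2]²` over the two adjacent rows and whose
denominator involves the squares `[u]²` of the other entries of row `k` (`stepCoef`). Everything is
even in the entries. All the representation spaces lie in one space, spanned by all tableaux with
arbitrary top row, and the operators are restrictions of operators on it (`ambientOp`,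
`embed_nonclassicalOp`).

*The relations.* Generators of rows that are not adjacent commute because their coefficients do not
see each other. Take the cubic relation `L T² - (q + q⁻¹) T L T + T² L = -L` for adjacent rows, `T`
acting on row `k`. Fix the step of `L` and sort the paths by the two steps of `T`. Two steps that are
not inverse to each other cancel against the same steps in the opposite order: the roots contribute
a common factor, and what remains is an identity of `q`-numbers (`serreTerm_add_swap`). The paths in
which the second step of `T` undoes the first add up to the right hand side by Lagrange's
interpolation formula with the nodes `[s u_b + 1/2]²`, `b` an entry of row `k`
(`Interlacing.sum_eval_div_rowDen`); in an odd row the diagonal term `Ĉ` supplies one more node.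
Nodes may collide, when two entries of row `k` are at distance `1`; then an entry of an adjacent row
is squeezed between them and makes the numerator vanish, so that the formula survives
(`sum_eval_div_prod_sub_eq_one`). Both parts are in `Interlacing.serre`.

Steps that leave the set of tableaux have coefficient `0`, with one exception: the last entry `1/2`
of an even row may go to `-1/2`. The term with `D` is exactly this step, if an array and its
reflection, in which the last entry of the row changes sign, are identified up to the sign `-ε`
(`coeffD_eq`, `foldKet`). As the coefficients are even, the identification is compatible with
the operators (`ambientOp_foldKet`). Two adjacent rows include just one even row, so one reflection
suffices for each relation.

*Irreducibility.* By induction on `k`, every subspace invariant under the operators of the rows below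
`k` is invariant under the matrix units that replace the rows `≤ k` of one tableau by those of
another one with the same row `k` (`hasUnits`). In the inductive step the matrix units cut the
operator of row `k` into its single steps. Raising an entry of row `k` repeatedly and lowering it
again is then a diagonal operator that detects how large the entry of row `k + 1` above it is
(`exists_loopOp`); if `k` is odd, the last entry of row `k + 1` has nothing below it, and the
diagonal coefficient detects it (`eq_of_foldCoef_none_eq`; this uses that `[·]_+` does not vanish).
Thus the projections to single rows `k + 1` are obtained, and the steps connect all rows `k` below a
given row `k + 1` (`exists_maximal_row`).

*Separation.* The same matrix units separate the weights: the graph of an isomorphism between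
representations with different weights would contain its components (`weight_eq_of_intertwining`).
The trace of `I_{i,i-1}` is `ε_i` times a nonzero number whose sign depends on `i` only, because all
diagonal coefficients have the same sign (`exists_trace_sign`); this separates the signs `ε`. For
odd `i` the trace vanishes in the classical type representations (`trace_classicalOp_of_odd`).
-/

noncomputable section

/-! ### `q`-numbers -/

section QNumbers

variable {q : ℝ}

lemma q_sub_inv_ne_zero (hq : 0 < q) (hq1 : q ≠ 1) : q - q⁻¹ ≠ 0 := by
  intro h
  have h1 : q * q = 1 := by field_simp at h; nlinarith
  have : (q - 1) * (q + 1) = 0 := by linarith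
  rcases mul_eq_zero.1 this with h2 | h2
  · exact hq1 (by linarith)
  · linarith

lemma qNum_neg (q x : ℝ) : qNum q (-x) = -qNum q x := by
  unfold qNum; rw [neg_neg]; ring

lemma qNumPlus_neg (q x : ℝ) : qNumPlus q (-x) = qNumPlus q x := by
  unfold qNumPlus; rw [neg_neg]; ring

lemma qNum_zero (q : ℝ) : qNum q 0 = 0 := by simp [qNum]

lemma qNum_one (hq : 0 < q) (hq1 : q ≠ 1) : qNum q 1 = 1 := by
  have := q_sub_inv_ne_zero hq hq1
  unfold qNum
  rw [Real.rpow_neg hq.le, Real.rpow_one, div_self this]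

lemma rpow_sub_rpow_neg (hq : 0 < q) (hq1 : q ≠ 1) (x : ℝ) :
    q ^ x - q ^ (-x) = (q - q⁻¹) * qNum q x := by
  have := q_sub_inv_ne_zero hq hq1
  rw [qNum, mul_div_cancel₀ _ this]

lemma qNum_pos (hq : 0 < q) (hq1 : q ≠ 1) {x : ℝ} (hx : 0 < x) : 0 < qNum q x := by
  unfold qNum
  rcases lt_or_gt_of_ne hq1 with h | h
  · apply div_pos_of_neg_of_neg
    · have := Real.rpow_lt_rpow_of_exponent_gt hq h (show -x < x by linarith)
      linarith
    · have := (one_lt_inv₀ hq).2 h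
      linarith
  · apply div_pos
    · have := Real.rpow_lt_rpow_of_exponent_lt h (show -x < x by linarith)
      linarith
    · have := inv_lt_one_of_one_lt₀ h
      linarith

lemma qNum_ne_zero (hq : 0 < q) (hq1 : q ≠ 1) {x : ℝ} (hx : x ≠ 0) : qNum q x ≠ 0 := by
  rcases lt_or_gt_of_ne hx with h | h
  · have := qNum_pos hq hq1 (x := -x) (by linarith)
    rw [qNum_neg] at this; linarith
  · exact (qNum_pos hq hq1 h).ne'

lemma qNum_nonneg (hq : 0 < q) (hq1 : q ≠ 1) {x : ℝ} (hx : 0 ≤ x) : 0 ≤ qNum q x := by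
  rcases hx.eq_or_lt with rfl | h
  · rw [qNum_zero]
  · exact (qNum_pos hq hq1 h).le

lemma qNum_nonpos (hq : 0 < q) (hq1 : q ≠ 1) {x : ℝ} (hx : x ≤ 0) : qNum q x ≤ 0 := by
  have := qNum_nonneg hq hq1 (x := -x) (by linarith)
  rw [qNum_neg] at this; linarith

lemma mul_qNumPlus_pos (hq : 0 < q) (hq1 : q ≠ 1) (x : ℝ) : 0 < (q - q⁻¹) * qNumPlus q x := by
  have := q_sub_inv_ne_zero hq hq1
  unfold qNumPlus
  rw [mul_div_cancel₀ _ this]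
  have := Real.rpow_pos_of_pos hq x
  have := Real.rpow_pos_of_pos hq (-x)
  linarith

lemma qNumPlus_ne_zero (hq : 0 < q) (hq1 : q ≠ 1) (x : ℝ) : qNumPlus q x ≠ 0 := by
  intro h
  have := mul_qNumPlus_pos hq hq1 x
  rw [h] at this; simp at this

lemma qNum_add_mul_qNum_sub (hq : 0 < q) (hq1 : q ≠ 1) (a b : ℝ) :
    qNum q (a + b) * qNum q (a - b) = qNum q a ^ 2 - qNum q b ^ 2 := by
  have := q_sub_inv_ne_zero hq hq1
  have ha := Real.rpow_pos_of_pos hq a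
  have hb := Real.rpow_pos_of_pos hq b
  simp only [qNum, Real.rpow_neg hq.le, Real.rpow_add hq, Real.rpow_sub hq]
  field_simp
  ring

lemma qNumPlus_add_mul_qNumPlus_sub (hq : 0 < q) (hq1 : q ≠ 1) (a b : ℝ) :
    qNumPlus q (a + b) * qNumPlus q (a - b) = qNum q a ^ 2 + qNumPlus q b ^ 2 := by
  have := q_sub_inv_ne_zero hq hq1
  have ha := Real.rpow_pos_of_pos hq a
  have hb := Real.rpow_pos_of_pos hq b
  simp only [qNum, qNumPlus, Real.rpow_neg hq.le, Real.rpow_add hq, Real.rpow_sub hq]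
  field_simp
  ring

lemma qNumPlus_sq (hq : 0 < q) (hq1 : q ≠ 1) (a : ℝ) :
    qNumPlus q a ^ 2 = qNum q a ^ 2 + (2 / (q - q⁻¹)) ^ 2 := by
  have := q_sub_inv_ne_zero hq hq1
  have ha := Real.rpow_pos_of_pos hq a
  simp only [qNum, qNumPlus, Real.rpow_neg hq.le]
  rw [div_pow, div_pow, div_pow, ← add_div]
  congr 1
  field_simp
  ring

lemma qNum_two_mul (hq : 0 < q) (hq1 : q ≠ 1) (w : ℝ) :
    qNum q (2 * w) = (q - q⁻¹) * qNum q w * qNumPlus q w := by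
  have := q_sub_inv_ne_zero hq hq1
  have hw := Real.rpow_pos_of_pos hq w
  simp only [qNum, qNumPlus, Real.rpow_neg hq.le, two_mul, Real.rpow_add hq]
  rw [mul_div_cancel₀ _ this, ← mul_div_assoc]
  congr 1
  field_simp
  ring

lemma mul_qNum (hq : 0 < q) (hq1 : q ≠ 1) (x : ℝ) :
    (q + q⁻¹) * qNum q x = qNum q (x + 1) + qNum q (x - 1) := by
  have := q_sub_inv_ne_zero hq hq1
  have hx := Real.rpow_pos_of_pos hq x
  simp only [qNum, Real.rpow_neg hq.le, Real.rpow_add hq, Real.rpow_sub hq, Real.rpow_one]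
  rw [← add_div, ← mul_div_assoc]
  congr 1
  field_simp
  ring

lemma mul_qNumPlus (hq : 0 < q) (hq1 : q ≠ 1) (x : ℝ) :
    (q + q⁻¹) * qNumPlus q x = qNumPlus q (x + 1) + qNumPlus q (x - 1) := by
  have := q_sub_inv_ne_zero hq hq1
  have hx := Real.rpow_pos_of_pos hq x
  simp only [qNumPlus, Real.rpow_neg hq.le, Real.rpow_add hq, Real.rpow_sub hq, Real.rpow_one]
  rw [← add_div, ← mul_div_assoc]
  congr 1
  field_simp
  ring

lemma qNum_mul_sub (hq : 0 < q) (hq1 : q ≠ 1) (x y : ℝ) :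
    qNum q x * qNum q y - qNum q (x - 1) * qNum q (y + 1) = qNum q (y - x + 1) := by
  have h0 := q_sub_inv_ne_zero hq hq1
  have hx := Real.rpow_pos_of_pos hq x
  have hy := Real.rpow_pos_of_pos hq y
  simp only [qNum, Real.rpow_neg hq.le, Real.rpow_add hq, Real.rpow_sub hq, Real.rpow_one]
  rw [div_mul_div_comm, div_mul_div_comm, ← sub_div, div_eq_div_iff (mul_ne_zero h0 h0) h0]
  field_simp
  ring

lemma qNum_mul_qNumPlus_sub (hq : 0 < q) (hq1 : q ≠ 1) (x y : ℝ) :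
    qNum q x * qNumPlus q y - qNum q (x - 1) * qNumPlus q (y + 1) = qNumPlus q (y - x + 1) := by
  have h0 := q_sub_inv_ne_zero hq hq1
  have hx := Real.rpow_pos_of_pos hq x
  have hy := Real.rpow_pos_of_pos hq y
  simp only [qNum, qNumPlus, Real.rpow_neg hq.le, Real.rpow_add hq, Real.rpow_sub hq,
    Real.rpow_one]
  rw [div_mul_div_comm, div_mul_div_comm, ← sub_div, div_eq_div_iff (mul_ne_zero h0 h0) h0]
  field_simp
  ring

lemma qNumPlus_mul_sub (hq : 0 < q) (hq1 : q ≠ 1) (x y : ℝ) :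
    qNumPlus q x * qNumPlus q y - qNumPlus q (x + 1) * qNumPlus q (y - 1)
      = -qNum q (x - y + 1) := by
  have h0 := q_sub_inv_ne_zero hq hq1
  have hx := Real.rpow_pos_of_pos hq x
  have hy := Real.rpow_pos_of_pos hq y
  simp only [qNum, qNumPlus, Real.rpow_neg hq.le, Real.rpow_add hq, Real.rpow_sub hq,
    Real.rpow_one]
  rw [div_mul_div_comm, div_mul_div_comm, ← sub_div, ← neg_div,
    div_eq_div_iff (mul_ne_zero h0 h0) h0]
  field_simp
  ring

lemma two_mul_qNumPlus_sub (hq : 0 < q) (hq1 : q ≠ 1) (w : ℝ) :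
    2 * qNumPlus q w - (q + q⁻¹) * qNumPlus q (w + 1) = -((q - q⁻¹) * qNum q (w + 1)) := by
  have h0 := q_sub_inv_ne_zero hq hq1
  have hw := Real.rpow_pos_of_pos hq w
  simp only [qNum, qNumPlus, Real.rpow_neg hq.le, Real.rpow_add hq, Real.rpow_one]
  rw [← mul_div_assoc, ← mul_div_assoc, ← mul_div_assoc, ← sub_div, ← neg_div]
  congr 1
  field_simp
  ring

/-- The cubic relation for the diagonal coefficients: the contribution of the path that stays. -/
lemma qNumPlus_sq_add_sq (hq : 0 < q) (hq1 : q ≠ 1) (v : ℝ) :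
    qNumPlus q v ^ 2 - (q + q⁻¹) * (qNumPlus q v * qNumPlus q (v + 1)) + qNumPlus q (v + 1) ^ 2
      = -1 := by
  have h0 := q_sub_inv_ne_zero hq hq1
  have hv := Real.rpow_pos_of_pos hq v
  simp only [qNumPlus, Real.rpow_neg hq.le, Real.rpow_add hq, Real.rpow_one]
  rw [div_mul_div_comm, ← mul_div_assoc, div_pow, div_pow, ← pow_two, ← sub_div, ← add_div,
    div_eq_iff (pow_ne_zero 2 h0)]
  field_simp
  ring

/-- The local form of the relation on a path that leaves and returns. -/
lemma qNum_return (hq : 0 < q) (hq1 : q ≠ 1) (a w : ℝ) :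
    qNum q (a + w) * qNum q (a - w - 1) - (q + q⁻¹) * (qNum q (a + w + 1) * qNum q (a - w - 1))
      + qNum q (a + w + 1) * qNum q (a - w) = qNum q (2 * (w + 1)) := by
  have h1 := mul_qNum hq hq1 (a + w + 1)
  have h2 := qNum_mul_sub hq hq1 (a - w) (a + w + 1)
  rw [show a + w + 1 - (a - w) + 1 = 2 * (w + 1) by ring] at h2
  rw [show a + w + 1 - 1 = a + w by ring] at h1
  linear_combination (-qNum q (a - w - 1)) * h1 + h2

lemma qNum_sq_sub_sq_eq (hq : 0 < q) (hq1 : q ≠ 1) (w : ℝ) :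
    qNum q (w + 1 / 2) ^ 2 - qNum q (w - 1 / 2) ^ 2 = qNum q (2 * w) := by
  have := qNum_add_mul_qNum_sub hq hq1 (w + 1 / 2) (w - 1 / 2)
  rw [← this, show w + 1 / 2 + (w - 1 / 2) = 2 * w by ring,
    show w + 1 / 2 - (w - 1 / 2) = 1 by ring, qNum_one hq hq1, mul_one]

lemma qNum_sq_lt (hq : 0 < q) (hq1 : q ≠ 1) {a b : ℝ} (h : |b| < |a|) :
    qNum q b ^ 2 < qNum q a ^ 2 := by
  have key : ∀ x : ℝ, qNum q |x| ^ 2 = qNum q x ^ 2 := by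
    intro x
    rcases abs_choice x with h | h <;> rw [h]
    rw [qNum_neg]; ring
  rw [← key a, ← key b, ← sub_pos, ← qNum_add_mul_qNum_sub hq hq1]
  have := abs_nonneg b
  exact mul_pos (qNum_pos hq hq1 (by linarith)) (qNum_pos hq hq1 (by linarith))

lemma qNum_sq_le (hq : 0 < q) (hq1 : q ≠ 1) {a b : ℝ} (h : |b| ≤ |a|) :
    qNum q b ^ 2 ≤ qNum q a ^ 2 := by
  rcases h.lt_or_eq with h | h
  · exact (qNum_sq_lt hq hq1 h).le
  · rcases abs_eq_abs.1 h with h | h <;> rw [h]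
    rw [qNum_neg]; simp

lemma qNum_sq_eq_iff (hq : 0 < q) (hq1 : q ≠ 1) {a b : ℝ} :
    qNum q a ^ 2 = qNum q b ^ 2 ↔ |a| = |b| := by
  constructor
  · intro h
    rcases lt_trichotomy |a| |b| with h1 | h1 | h1
    · exact absurd h (qNum_sq_lt hq hq1 h1).ne
    · exact h1
    · exact absurd h (qNum_sq_lt hq hq1 h1).ne'
  · intro h
    exact le_antisymm (qNum_sq_le hq hq1 h.le) (qNum_sq_le hq hq1 h.ge)

end QNumbers

/-! ### Lagrange interpolation with colliding nodes -/

open Polynomial in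
/-- Lagrange interpolation for the leading coefficient of a monic polynomial `P`, where nodes may
collide: at every colliding node the denominator is `0`, hence so is the term (by the convention
`x / 0 = 0`), and the identity survives if `P` vanishes at all the colliding nodes with
multiplicity. -/
lemma sum_eval_div_prod_sub_eq_one {ι κ : Type*} [DecidableEq ι] [DecidableEq κ]
    (W : Finset ι) (Z : ι → ℝ) (A : Finset κ) (V : κ → ℝ) (P : ℝ[X]) (hP : P.Monic)
    (hdeg : P.natDegree + 1 = #W) (hdvd : (∏ a ∈ A, (X - C (V a))) ∣ P)
    (h : ι → κ)
    (hA : ∀ i ∈ W, (∃ j ∈ W, j ≠ i ∧ Z j = Z i) → h i ∈ A ∧ V (h i) = Z i)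
    (hinj : ∀ i ∈ W, ∀ i' ∈ W, (∃ j ∈ W, j ≠ i ∧ Z j = Z i) →
      (∃ j ∈ W, j ≠ i' ∧ Z j = Z i') → h i = h i' → i = i') :
    ∑ i ∈ W, P.eval (Z i) / ∏ j ∈ W.erase i, (Z i - Z j) = 1 := by
  classical
  set D := W.filter (fun i => ∃ j ∈ W, j ≠ i ∧ Z j = Z i) with hD
  set G := W.filter (fun i => ¬ ∃ j ∈ W, j ≠ i ∧ Z j = Z i) with hG
  have hDdvd : (∏ i ∈ D, (X - C (Z i))) ∣ P := by
    refine dvd_trans ?_ hdvd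
    have e1 : ∏ i ∈ D, (X - C (Z i)) = ∏ a ∈ D.image h, (X - C (V a)) := by
      rw [prod_image]
      · refine prod_congr rfl fun i hi => ?_
        rw [hD, mem_filter] at hi
        rw [(hA i hi.1 hi.2).2]
      · intro i hi i' hi' e
        rw [hD, mem_coe, mem_filter] at hi hi'
        exact hinj i hi.1 i' hi'.1 hi.2 hi'.2 e
    rw [e1]
    refine prod_dvd_prod_of_subset _ _ _ ?_
    intro a ha
    obtain ⟨i, hi, rfl⟩ := mem_image.1 ha
    rw [hD, mem_filter] at hi
    exact (hA i hi.1 hi.2).1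
  obtain ⟨R, hR⟩ := hDdvd
  have hmon : (∏ i ∈ D, (X - C (Z i))).Monic := monic_prod_X_sub_C _ _
  have hRm : R.Monic := hmon.of_mul_monic_left (hR ▸ hP)
  have hcard : #D + #G = #W := card_filter_add_card_filter_not _
  have hRdeg : R.natDegree + 1 = #G := by
    have := hmon.natDegree_mul hRm
    rw [← hR, natDegree_prod_of_monic _ _ (fun i _ => monic_X_sub_C _)] at this
    simp at this
    omega
  have hinjG : Set.InjOn Z G := by
    intro i hi j hj e
    rw [hG, mem_coe, mem_filter] at hi hj
    by_contra hne
    exact hi.2 ⟨j, hj.1, Ne.symm hne, e.symm⟩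
  have hGsum := Lagrange.leadingCoeff_eq_sum (s := G) (v := Z) hinjG (P := R) (by
    rw [degree_eq_natDegree hRm.ne_zero, ← hRdeg]; rfl)
  rw [hRm.leadingCoeff] at hGsum
  rw [hGsum, ← sum_filter_add_sum_filter_not W (fun i => ∃ j ∈ W, j ≠ i ∧ Z j = Z i)]
  rw [sum_eq_zero, zero_add]
  · refine sum_congr rfl fun i hi => ?_
    have hi' := mem_filter.1 hi
    have hsplit : ∏ j ∈ W.erase i, (Z i - Z j)
        = (∏ j ∈ D, (Z i - Z j)) * ∏ j ∈ G.erase i, (Z i - Z j) := by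
      rw [← prod_filter_mul_prod_filter_not (W.erase i)
        (fun i => ∃ j ∈ W, j ≠ i ∧ Z j = Z i), filter_erase, filter_erase, erase_eq_of_notMem]
      intro hmem
      exact hi'.2 (mem_filter.1 hmem).2
    have hne : ∏ j ∈ D, (Z i - Z j) ≠ 0 := by
      refine prod_ne_zero_iff.2 fun j hj => ?_
      rw [hD, mem_filter] at hj
      intro e
      refine hi'.2 ⟨j, hj.1, ?_, by linarith⟩
      rintro rfl
      exact hi'.2 hj.2
    rw [hsplit, hR, eval_mul, eval_prod]
    simp only [eval_sub, eval_X, eval_C]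
    rw [mul_div_mul_left _ _ hne]
  · intro i hi
    obtain ⟨hiW, j, hjW, hne, e⟩ := mem_filter.1 hi
    rw [prod_eq_zero (mem_erase.2 ⟨hne, hjW⟩) (by rw [e, sub_self]), div_zero]

/-! ### One row: the cancellation of paths with distinct end -/

/-- A step of an operator that acts on one row of an array: `none` leaves the row unchanged,
`some (j, s)` replaces the `j`-th component `x` by `x + s`, where `s = ±1`. -/
abbrev Step : Type := Option (ℕ × ℤˣ)

/-- The inverse step. -/
def Step.inv : Step → Step
  | none => none
  | some (b, s) => some (b, -s)

/-- The row obtained from `r` by a step. -/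
def moveRow (r : ℕ → ℝ) : Step → ℕ → ℝ
  | none => r
  | some (b, s) => Function.update r b (r b + ((s : ℤ) : ℝ))

/-- The product over the components `r i`, `i ∈ S`, `i ≠ b`, of
`([r i]² - [w]²) ([r i]² - [w + 1]²)`; for `w = ± r b` it is the denominator under the root in the
coefficient of the step that replaces `w` by `w + 1`. -/
def rowDen (q : ℝ) (S : Finset ℕ) (r : ℕ → ℝ) (b : ℕ) (w : ℝ) : ℝ :=
  ∏ i ∈ S.erase b, ((qNum q (r i) ^ 2 - qNum q w ^ 2) * (qNum q (r i) ^ 2 - qNum q (w + 1) ^ 2))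

/-- The coefficients of an operator that acts on one row: the step `(b, s)` depends on `r b` only
through `w = s r b` and the function `F`, and on the other components through `rowDen`. -/
def rowCoef (q : ℝ) (S : Finset ℕ) (F : ℝ → ℝ) (d : ℝ) (r : ℕ → ℝ) : Step → ℝ
  | none => d / ∏ i ∈ S, (qNumPlus q (r i + 1 / 2) * qNumPlus q (r i - 1 / 2))
  | some (b, s) => F ((s : ℤ) * r b) / √|rowDen q S r b ((s : ℤ) * r b)|

/-- The contribution of the path `σ, τ` to `L T² - Q T L T + T² L`, where `T` has the coefficients
`C` before `L` acts and `C'` after it, and `φ` is the coefficient of `L`. -/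
def serreTerm (Q : ℝ) (C C' : (ℕ → ℝ) → Step → ℝ) (φ : (ℕ → ℝ) → ℝ) (r : ℕ → ℝ)
    (σ τ : Step) : ℝ :=
  C r σ * C (moveRow r σ) τ * φ (moveRow (moveRow r σ) τ)
    - Q * (C r σ * φ (moveRow r σ) * C' (moveRow r σ) τ)
    + φ r * C' r σ * C' (moveRow r σ) τ

lemma unit_mul_self (s : ℤˣ) : ((s : ℤ) : ℝ) * ((s : ℤ) : ℝ) = 1 := by
  rcases Int.units_eq_one_or s with rfl | rfl <;> norm_num

lemma even_comp_unit_mul {f : ℝ → ℝ} (hf : ∀ x, f (-x) = f x) (s : ℤˣ) (x : ℝ) :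
    f (((s : ℤ) : ℝ) * x) = f x := by
  rcases Int.units_eq_one_or s with rfl | rfl
  · simp
  · simpa using hf x

lemma even_comp_add_unit {f : ℝ → ℝ} (hf : ∀ x, f (-x) = f x) (s : ℤˣ) (x : ℝ) :
    f (x + ((s : ℤ) : ℝ)) = f (((s : ℤ) : ℝ) * x + 1) := by
  rw [← even_comp_unit_mul hf s (((s : ℤ) : ℝ) * x + 1)]
  congr 1
  linear_combination (-x) * unit_mul_self s

lemma qNum_sq_neg (q x : ℝ) : qNum q (-x) ^ 2 = qNum q x ^ 2 := by rw [qNum_neg, neg_sq]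

lemma sqrt_abs_mul (x y : ℝ) : √|x * y| = √|x| * √|y| := by
  rw [abs_mul, Real.sqrt_mul (abs_nonneg x)]

lemma sqrt_abs_mul_self (x : ℝ) : √|x| * √|x| = |x| := Real.mul_self_sqrt (abs_nonneg x)

section Pair

variable {q : ℝ} {S : Finset ℕ} {r : ℕ → ℝ} {E h h' f H B₀ B₁ : ℝ → ℝ} {d d' : ℝ}

/-- The ratio of the denominators of the two orders of a pair of steps is rational. -/
lemma div_sqrt_pair (hq : 0 < q) (hq1 : q ≠ 1) {x y : ℝ} (hxy : 1 < x - y ∨ x - y < -1) :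
    qNum q (x - y + 1) /
        (√|(qNum q y ^ 2 - qNum q x ^ 2) * (qNum q y ^ 2 - qNum q (x + 1) ^ 2)| *
         √|(qNum q (x + 1) ^ 2 - qNum q y ^ 2) * (qNum q (x + 1) ^ 2 - qNum q (y + 1) ^ 2)|)
      + qNum q (1 - (x - y)) /
        (√|(qNum q x ^ 2 - qNum q y ^ 2) * (qNum q x ^ 2 - qNum q (y + 1) ^ 2)| *
         √|(qNum q (y + 1) ^ 2 - qNum q x ^ 2) * (qNum q (y + 1) ^ 2 - qNum q (x + 1) ^ 2)|)
      = 0 := by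
  simp only [sqrt_abs_mul]
  rw [abs_sub_comm (qNum q y ^ 2) (qNum q x ^ 2), abs_sub_comm (qNum q y ^ 2) (qNum q (x + 1) ^ 2),
    abs_sub_comm (qNum q x ^ 2) (qNum q (y + 1) ^ 2),
    abs_sub_comm (qNum q (y + 1) ^ 2) (qNum q (x + 1) ^ 2)]
  have e1 := sqrt_abs_mul_self (qNum q (x + 1) ^ 2 - qNum q y ^ 2)
  have e2 := sqrt_abs_mul_self (qNum q (y + 1) ^ 2 - qNum q x ^ 2)
  rw [← qNum_add_mul_qNum_sub hq hq1 (x + 1) y] at e1 ⊢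
  rw [← qNum_add_mul_qNum_sub hq hq1 (y + 1) x] at e2 ⊢
  rw [show x + 1 - y = x - y + 1 by ring, show x + 1 + y = x + y + 1 by ring, abs_mul] at e1 ⊢
  rw [show y + 1 - x = 1 - (x - y) by ring, show y + 1 + x = x + y + 1 by ring, abs_mul] at e2 ⊢
  set K := √|qNum q x ^ 2 - qNum q y ^ 2| * √|qNum q (x + 1) ^ 2 - qNum q (y + 1) ^ 2| with hK
  set s := |qNum q (x + y + 1)| with hs
  set A := √(s * |qNum q (x - y + 1)|) with hA
  set B := √(s * |qNum q (1 - (x - y))|) with hB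
  rw [show √|qNum q x ^ 2 - qNum q y ^ 2| * A * (A * √|qNum q (x + 1) ^ 2 - qNum q (y + 1) ^ 2|)
      = K * (s * |qNum q (x - y + 1)|) by rw [← e1, hK]; ring,
    show √|qNum q x ^ 2 - qNum q y ^ 2| * B * (B * √|qNum q (x + 1) ^ 2 - qNum q (y + 1) ^ 2|)
      = K * (s * |qNum q (1 - (x - y))|) by rw [← e2, hK]; ring]
  rcases hxy with h | h
  · have p1 := qNum_pos hq hq1 (x := x - y + 1) (by linarith)
    have p2 := qNum_pos hq hq1 (x := -(1 - (x - y))) (by linarith)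
    rw [qNum_neg] at p2
    rw [abs_of_pos p1, abs_of_neg (by linarith : qNum q (1 - (x - y)) < 0)]
    have n1 := p1.ne'
    have n2 : qNum q (1 - (x - y)) ≠ 0 := by linarith
    rcases eq_or_ne (K * s) 0 with h0 | h0
    · rw [← mul_assoc, ← mul_assoc, h0]; simp
    · have hK0 := left_ne_zero_of_mul h0
      have hs0 := right_ne_zero_of_mul h0
      field_simp; ring
  · have p1 := qNum_pos hq hq1 (x := -(x - y + 1)) (by linarith)
    have p2 := qNum_pos hq hq1 (x := 1 - (x - y)) (by linarith)
    rw [qNum_neg] at p1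
    rw [abs_of_pos p2, abs_of_neg (by linarith : qNum q (x - y + 1) < 0)]
    have n1 := p2.ne'
    have n2 : qNum q (x - y + 1) ≠ 0 := by linarith
    rcases eq_or_ne (K * s) 0 with h0 | h0
    · rw [← mul_assoc, ← mul_assoc, h0]; simp
    · have hK0 := left_ne_zero_of_mul h0
      have hs0 := right_ne_zero_of_mul h0
      field_simp; ring

lemma prod_eq_mul_mul_prod_erase {b c : ℕ} (hb : b ∈ S) (hc : c ∈ S) (hbc : b ≠ c) (g : ℕ → ℝ) :
    ∏ i ∈ S, g i = g b * (g c * ∏ i ∈ (S.erase b).erase c, g i) := by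
  rw [mul_prod_erase (S.erase b) g (mem_erase.2 ⟨hbc.symm, hc⟩), mul_prod_erase S g hb]

/-- The value of one path that changes two different components. The values of `φ` and the
coefficients combine to a factor `H`, the same for both steps in all three terms, and the rational
parts `B₀` (component not yet moved) and `B₁` (component moved). -/
lemma serreTerm_of_ne {b c : ℕ} (hb : b ∈ S) (hc : c ∈ S) (hbc : b ≠ c) (s t : ℤˣ)
    (hf : ∀ x, f (-x) = f x) (Q : ℝ)
    (h1b : h ((s : ℤ) * r b) * f ((s : ℤ) * r b + 1) = H ((s : ℤ) * r b) * B₁ ((s : ℤ) * r b))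
    (h0b : f ((s : ℤ) * r b) * h' ((s : ℤ) * r b) = H ((s : ℤ) * r b) * B₀ ((s : ℤ) * r b))
    (h1c : h ((t : ℤ) * r c) * f ((t : ℤ) * r c + 1) = H ((t : ℤ) * r c) * B₁ ((t : ℤ) * r c))
    (h0c : f ((t : ℤ) * r c) * h' ((t : ℤ) * r c) = H ((t : ℤ) * r c) * B₀ ((t : ℤ) * r c)) :
    serreTerm Q (rowCoef q S (fun w => E w * h w) d) (rowCoef q S (fun w => E w * h' w) d')
      (fun r => ∏ i ∈ S, f (r i)) r (some (b, s)) (some (c, t)) =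
    E ((s : ℤ) * r b) * E ((t : ℤ) * r c) * H ((s : ℤ) * r b) * H ((t : ℤ) * r c) *
      (∏ i ∈ (S.erase b).erase c, f (r i)) /
      (√|∏ i ∈ (S.erase b).erase c, ((qNum q (r i) ^ 2 - qNum q ((s : ℤ) * r b) ^ 2) *
        (qNum q (r i) ^ 2 - qNum q ((s : ℤ) * r b + 1) ^ 2))| *
       √|∏ i ∈ (S.erase b).erase c, ((qNum q (r i) ^ 2 - qNum q ((t : ℤ) * r c) ^ 2) *
        (qNum q (r i) ^ 2 - qNum q ((t : ℤ) * r c + 1) ^ 2))|) *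
      ((B₁ ((s : ℤ) * r b) * B₁ ((t : ℤ) * r c) - Q * (B₁ ((s : ℤ) * r b) * B₀ ((t : ℤ) * r c))
        + B₀ ((s : ℤ) * r b) * B₀ ((t : ℤ) * r c)) /
      (√|(qNum q ((t : ℤ) * r c) ^ 2 - qNum q ((s : ℤ) * r b) ^ 2) *
          (qNum q ((t : ℤ) * r c) ^ 2 - qNum q ((s : ℤ) * r b + 1) ^ 2)| *
       √|(qNum q ((s : ℤ) * r b + 1) ^ 2 - qNum q ((t : ℤ) * r c) ^ 2) *
          (qNum q ((s : ℤ) * r b + 1) ^ 2 - qNum q ((t : ℤ) * r c + 1) ^ 2)|)) := by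
  have hX : ∀ x, qNum q (-x) ^ 2 = qNum q x ^ 2 := qNum_sq_neg q
  have hcb : c ≠ b := hbc.symm
  have hrest : ∀ r' : ℕ → ℝ, (∀ i, i ≠ b → i ≠ c → r' i = r i) →
      ∏ i ∈ S, f (r' i) = f (r' b) * (f (r' c) * ∏ i ∈ (S.erase b).erase c, f (r i)) := by
    intro r' hr'
    rw [prod_eq_mul_mul_prod_erase hb hc hbc]
    congr 2
    refine prod_congr rfl fun i hi => ?_
    rw [mem_erase, mem_erase] at hi
    rw [hr' i hi.2.1 hi.1]
  have hden : rowDen q S r b ((s : ℤ) * r b) =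
      ((qNum q ((t : ℤ) * r c) ^ 2 - qNum q ((s : ℤ) * r b) ^ 2) *
          (qNum q ((t : ℤ) * r c) ^ 2 - qNum q ((s : ℤ) * r b + 1) ^ 2)) *
      ∏ i ∈ (S.erase b).erase c, ((qNum q (r i) ^ 2 - qNum q ((s : ℤ) * r b) ^ 2) *
        (qNum q (r i) ^ 2 - qNum q ((s : ℤ) * r b + 1) ^ 2)) := by
    rw [rowDen, ← mul_prod_erase (S.erase b) _ (mem_erase.2 ⟨hcb, hc⟩),
      even_comp_unit_mul (f := fun x => qNum q x ^ 2) hX t]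
  have hden' : rowDen q S (moveRow r (some (b, s))) c ((t : ℤ) * r c) =
      ((qNum q ((s : ℤ) * r b + 1) ^ 2 - qNum q ((t : ℤ) * r c) ^ 2) *
          (qNum q ((s : ℤ) * r b + 1) ^ 2 - qNum q ((t : ℤ) * r c + 1) ^ 2)) *
      ∏ i ∈ (S.erase b).erase c, ((qNum q (r i) ^ 2 - qNum q ((t : ℤ) * r c) ^ 2) *
        (qNum q (r i) ^ 2 - qNum q ((t : ℤ) * r c + 1) ^ 2)) := by
    rw [rowDen, ← mul_prod_erase (S.erase c) _ (mem_erase.2 ⟨hbc, hb⟩), erase_right_comm]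
    congr 1
    · simp only [moveRow, Function.update_self]
      rw [even_comp_add_unit (f := fun x => qNum q x ^ 2) hX s]
    · refine prod_congr rfl fun i hi => ?_
      rw [mem_erase, mem_erase] at hi
      simp [moveRow, hi.2.1]
  have hrc : moveRow r (some (b, s)) c = r c := by simp [moveRow, hcb]
  have hφ0 := hrest r (fun _ _ _ => rfl)
  have hφ1 := hrest (moveRow r (some (b, s))) (fun i h1 h2 => by simp [moveRow, h1])
  have hφ2 := hrest (moveRow (moveRow r (some (b, s))) (some (c, t)))
    (fun i h1 h2 => by simp [moveRow, h1, h2])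
  have v1 : f (moveRow r (some (b, s)) b) = f ((s : ℤ) * r b + 1) := by
    simp only [moveRow, Function.update_self]; exact even_comp_add_unit hf s _
  have v2 : f (moveRow (moveRow r (some (b, s))) (some (c, t)) b) = f ((s : ℤ) * r b + 1) := by
    rw [← v1]; simp [moveRow, hbc]
  have v3 : f (moveRow (moveRow r (some (b, s))) (some (c, t)) c) = f ((t : ℤ) * r c + 1) := by
    rw [show moveRow (moveRow r (some (b, s))) (some (c, t)) c = r c + ((t : ℤ) : ℝ) by
      simp [moveRow, hcb]]
    exact even_comp_add_unit hf t _
  rw [v1, hrc, ← even_comp_unit_mul hf t (r c)] at hφ1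
  rw [v2, v3] at hφ2
  rw [← even_comp_unit_mul hf t (r c), ← even_comp_unit_mul hf s (r b)] at hφ0
  simp only [serreTerm, hφ0, hφ1, hφ2]
  simp only [rowCoef, hrc, hden, hden', sqrt_abs_mul _ (∏ i ∈ (S.erase b).erase c, _)]
  set x := ((s : ℤ) : ℝ) * r b
  set y := ((t : ℤ) : ℝ) * r c
  generalize (∏ i ∈ (S.erase b).erase c, f (r i)) = Φ
  generalize √|∏ i ∈ (S.erase b).erase c, ((qNum q (r i) ^ 2 - qNum q x ^ 2) *
        (qNum q (r i) ^ 2 - qNum q (x + 1) ^ 2))| = R1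
  generalize √|∏ i ∈ (S.erase b).erase c, ((qNum q (r i) ^ 2 - qNum q y ^ 2) *
        (qNum q (r i) ^ 2 - qNum q (y + 1) ^ 2))| = R2
  generalize √|(qNum q y ^ 2 - qNum q x ^ 2) * (qNum q y ^ 2 - qNum q (x + 1) ^ 2)| = D1
  generalize √|(qNum q (x + 1) ^ 2 - qNum q y ^ 2) *
    (qNum q (x + 1) ^ 2 - qNum q (y + 1) ^ 2)| = D2
  have e1 : h x * f (x + 1) * (h y * f (y + 1)) = H x * B₁ x * (H y * B₁ y) := by rw [h1b, h1c]
  have e2 : h x * f (x + 1) * (f y * h' y) = H x * B₁ x * (H y * B₀ y) := by rw [h1b, h0c]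
  have e3 : f x * h' x * (f y * h' y) = H x * B₀ x * (H y * B₀ y) := by rw [h0b, h0c]
  linear_combination (E x * E y * Φ * (R1⁻¹ * R2⁻¹ * D1⁻¹ * D2⁻¹)) * (e1 - Q * e2 + e3)

/-- Two steps that change different components cancel against the same steps in the other order.
If the components collide on the way, both contributions vanish. -/
lemma serreTerm_add_swap (hq : 0 < q) (hq1 : q ≠ 1)
    {b c : ℕ} (hb : b ∈ S) (hc : c ∈ S) (hbc : b ≠ c) (s t : ℤˣ)
    (hf : ∀ x, f (-x) = f x) (Q η : ℝ)
    (h1b : h ((s : ℤ) * r b) * f ((s : ℤ) * r b + 1) = H ((s : ℤ) * r b) * B₁ ((s : ℤ) * r b))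
    (h0b : f ((s : ℤ) * r b) * h' ((s : ℤ) * r b) = H ((s : ℤ) * r b) * B₀ ((s : ℤ) * r b))
    (h1c : h ((t : ℤ) * r c) * f ((t : ℤ) * r c + 1) = H ((t : ℤ) * r c) * B₁ ((t : ℤ) * r c))
    (h0c : f ((t : ℤ) * r c) * h' ((t : ℤ) * r c) = H ((t : ℤ) * r c) * B₀ ((t : ℤ) * r c))
    (hB : B₁ ((s : ℤ) * r b) * B₁ ((t : ℤ) * r c)
        - Q * (B₁ ((s : ℤ) * r b) * B₀ ((t : ℤ) * r c))
        + B₀ ((s : ℤ) * r b) * B₀ ((t : ℤ) * r c)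
        = η * qNum q ((s : ℤ) * r b - (t : ℤ) * r c + 1))
    (hB' : B₁ ((t : ℤ) * r c) * B₁ ((s : ℤ) * r b)
        - Q * (B₁ ((t : ℤ) * r c) * B₀ ((s : ℤ) * r b))
        + B₀ ((t : ℤ) * r c) * B₀ ((s : ℤ) * r b)
        = η * qNum q (1 - ((s : ℤ) * r b - (t : ℤ) * r c)))
    (hgen : 1 < (s : ℤ) * r b - (t : ℤ) * r c ∨ (s : ℤ) * r b - (t : ℤ) * r c < -1 ∨
      E ((s : ℤ) * r b) = 0 ∨ E ((t : ℤ) * r c) = 0) :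
    serreTerm Q (rowCoef q S (fun w => E w * h w) d) (rowCoef q S (fun w => E w * h' w) d')
      (fun r => ∏ i ∈ S, f (r i)) r (some (b, s)) (some (c, t)) +
    serreTerm Q (rowCoef q S (fun w => E w * h w) d) (rowCoef q S (fun w => E w * h' w) d')
      (fun r => ∏ i ∈ S, f (r i)) r (some (c, t)) (some (b, s)) = 0 := by
  rw [serreTerm_of_ne hb hc hbc s t hf Q h1b h0b h1c h0c,
    serreTerm_of_ne hc hb hbc.symm t s hf Q h1c h0c h1b h0b, hB, hB', erase_right_comm (a := c)]
  set x := ((s : ℤ) : ℝ) * r b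
  set y := ((t : ℤ) : ℝ) * r c
  have key : E x * E y = 0 ∨ (1 < x - y ∨ x - y < -1) := by
    rcases hgen with h | h | h | h
    · exact Or.inr (Or.inl h)
    · exact Or.inr (Or.inr h)
    · left; rw [h, zero_mul]
    · left; rw [h, mul_zero]
  rcases key with h | h
  · rw [mul_comm (E y) (E x), h]; simp
  · have := div_sqrt_pair hq hq1 h
    simp only [div_eq_mul_inv, mul_inv] at this ⊢
    generalize (∏ i ∈ (S.erase b).erase c, f (r i)) = Φ at this ⊢
    linear_combination (E x * E y * H x * H y * Φ * η *
      ((√|∏ i ∈ (S.erase b).erase c, ((qNum q (r i) ^ 2 - qNum q x ^ 2) *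
        (qNum q (r i) ^ 2 - qNum q (x + 1) ^ 2))|)⁻¹ *
       (√|∏ i ∈ (S.erase b).erase c, ((qNum q (r i) ^ 2 - qNum q y ^ 2) *
        (qNum q (r i) ^ 2 - qNum q (y + 1) ^ 2))|)⁻¹)) * this

lemma prod_moveRow {b : ℕ} (hb : b ∈ S) (x : ℝ) (g : ℝ → ℝ) :
    ∏ i ∈ S, g (Function.update r b x i) = g x * ∏ i ∈ S.erase b, g (r i) := by
  rw [← mul_prod_erase S _ hb, Function.update_self]
  congr 1
  refine prod_congr rfl fun i hi => ?_
  rw [Function.update_of_ne (mem_erase.1 hi).1]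

lemma rowDen_update (b : ℕ) (x w : ℝ) :
    rowDen q S (Function.update r b x) b w = rowDen q S r b w := by
  refine prod_congr rfl fun i hi => ?_
  rw [Function.update_of_ne (mem_erase.1 hi).1]

/-- The contribution of the same step taken twice. -/
lemma serreTerm_self {b : ℕ} (hb : b ∈ S) (s : ℤˣ) (hf : ∀ x, f (-x) = f x) (Q : ℝ)
    (hd : h ((s : ℤ) * r b) * h ((s : ℤ) * r b + 1) * f ((s : ℤ) * r b + 2)
      - Q * (h ((s : ℤ) * r b) * f ((s : ℤ) * r b + 1) * h' ((s : ℤ) * r b + 1))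
      + f ((s : ℤ) * r b) * h' ((s : ℤ) * r b) * h' ((s : ℤ) * r b + 1) = 0) :
    serreTerm Q (rowCoef q S (fun w => E w * h w) d) (rowCoef q S (fun w => E w * h' w) d')
      (fun r => ∏ i ∈ S, f (r i)) r (some (b, s)) (some (b, s)) = 0 := by
  have w1 : ((s : ℤ) : ℝ) * (r b + ((s : ℤ) : ℝ)) = (s : ℤ) * r b + 1 := by
    rw [mul_add, unit_mul_self]
  have v1 : f (r b + ((s : ℤ) : ℝ)) = f ((s : ℤ) * r b + 1) := even_comp_add_unit hf s _
  have v2 : f (r b + ((s : ℤ) : ℝ) + ((s : ℤ) : ℝ)) = f ((s : ℤ) * r b + 2) := by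
    rw [even_comp_add_unit hf s, w1]; congr 1; ring
  simp only [serreTerm, rowCoef, moveRow, Function.update_self, Function.update_idem, w1,
    rowDen_update, prod_moveRow hb, v1, v2]
  rw [← mul_prod_erase S _ hb, ← even_comp_unit_mul hf s (r b)]
  linear_combination (E ((s : ℤ) * r b) * E ((s : ℤ) * r b + 1) * (∏ i ∈ S.erase b, f (r i)) *
    ((√|rowDen q S r b ((s : ℤ) * r b)|)⁻¹ * (√|rowDen q S r b ((s : ℤ) * r b + 1)|)⁻¹)) * hd

lemma plus_mul_even (q : ℝ) (x : ℝ) :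
    qNumPlus q (-x + 1 / 2) * qNumPlus q (-x - 1 / 2)
      = qNumPlus q (x + 1 / 2) * qNumPlus q (x - 1 / 2) := by
  rw [← qNumPlus_neg q (-x + 1 / 2), ← qNumPlus_neg q (-x - 1 / 2), mul_comm]
  congr 2 <;> ring

/-- A step that changes a component cancels, in the two orders, against the step that changes
nothing. -/
lemma serreTerm_none_add_swap (hq : 0 < q) (hq1 : q ≠ 1) {b : ℕ} (hb : b ∈ S) (s : ℤˣ)
    (hf : ∀ x, f (-x) = f x) (Q η : ℝ)
    (h1b : h ((s : ℤ) * r b) * f ((s : ℤ) * r b + 1) = H ((s : ℤ) * r b) * B₁ ((s : ℤ) * r b))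
    (h0b : f ((s : ℤ) * r b) * h' ((s : ℤ) * r b) = H ((s : ℤ) * r b) * B₀ ((s : ℤ) * r b))
    (hB : d * B₁ ((s : ℤ) * r b) - Q * (d * B₀ ((s : ℤ) * r b)) + d' * B₀ ((s : ℤ) * r b)
      = -η * qNumPlus q ((s : ℤ) * r b - 1 / 2))
    (hB' : d * B₁ ((s : ℤ) * r b) - Q * (d' * B₁ ((s : ℤ) * r b)) + d' * B₀ ((s : ℤ) * r b)
      = η * qNumPlus q ((s : ℤ) * r b + 3 / 2)) :
    serreTerm Q (rowCoef q S (fun w => E w * h w) d) (rowCoef q S (fun w => E w * h' w) d')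
      (fun r => ∏ i ∈ S, f (r i)) r none (some (b, s)) +
    serreTerm Q (rowCoef q S (fun w => E w * h w) d) (rowCoef q S (fun w => E w * h' w) d')
      (fun r => ∏ i ∈ S, f (r i)) r (some (b, s)) none = 0 := by
  have v1 : f (r b + ((s : ℤ) : ℝ)) = f ((s : ℤ) * r b + 1) := even_comp_add_unit hf s _
  have p0 := even_comp_unit_mul (f := fun x => qNumPlus q (x + 1 / 2) * qNumPlus q (x - 1 / 2))
    (plus_mul_even q) s (r b)
  have p1 := even_comp_add_unit (f := fun x => qNumPlus q (x + 1 / 2) * qNumPlus q (x - 1 / 2))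
    (plus_mul_even q) s (r b)
  simp only [serreTerm, rowCoef, moveRow, prod_moveRow hb, v1]
  rw [prod_moveRow hb (g := fun x => qNumPlus q (x + 1 / 2) * qNumPlus q (x - 1 / 2)),
    ← mul_prod_erase S (fun i => f (r i)) hb,
    ← mul_prod_erase S (fun i => qNumPlus q (r i + 1 / 2) * qNumPlus q (r i - 1 / 2)) hb,
    ← even_comp_unit_mul hf s (r b), ← p0, p1]
  set x := ((s : ℤ) : ℝ) * r b
  have n1 := qNumPlus_ne_zero hq hq1 (x + 1 / 2)
  have n2 := qNumPlus_ne_zero hq hq1 (x - 1 / 2)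
  have n3 := qNumPlus_ne_zero hq hq1 (x + 3 / 2)
  rw [show x + 1 + 1 / 2 = x + 3 / 2 by ring, show x + 1 - 1 / 2 = x + 1 / 2 by ring]
  generalize ∏ i ∈ S.erase b, f (r i) = Φ
  generalize ∏ i ∈ S.erase b, (qNumPlus q (r i + 1 / 2) * qNumPlus q (r i - 1 / 2)) = R
  generalize √|rowDen q S r b x| = D
  generalize qNumPlus q (x + 1 / 2) = a1 at n1 ⊢
  generalize qNumPlus q (x - 1 / 2) = a2 at n2 hB ⊢
  generalize qNumPlus q (x + 3 / 2) = a3 at n3 hB' ⊢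
  have e1 : (-η * a2) / (a1 * a2) + (η * a3) / (a3 * a1) = 0 := by
    field_simp; ring
  rw [← hB, ← hB'] at e1
  simp only [div_eq_mul_inv, mul_inv] at e1 ⊢
  linear_combination (E x * Φ * H x * D⁻¹ * R⁻¹) * e1
    + (E x * Φ * D⁻¹ * R⁻¹) * ((d * a1⁻¹ * a2⁻¹ + (d - Q * d') * a3⁻¹ * a1⁻¹) * h1b
      + (d' * a1⁻¹ * a2⁻¹ - Q * d * a1⁻¹ * a2⁻¹ + d' * a3⁻¹ * a1⁻¹) * h0b)

end Pair

/-! ### One row: the weight of a neighbouring component -/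

section Weights

variable {q : ℝ}

/-- The `q`-numbers of two consecutive integers do not have opposite signs, so one sign `σ` serves
both. -/
lemma abs_qNum_eq (hq : 0 < q) (hq1 : q ≠ 1) {x : ℝ} (hx : ∃ z : ℤ, x = z) :
    ∃ σ : ℝ, σ * σ = 1 ∧ |qNum q (x - 1)| = σ * qNum q (x - 1) ∧ |qNum q x| = σ * qNum q x := by
  obtain ⟨z, rfl⟩ := hx
  rcases le_or_gt 1 z with h | h
  · have h' : (1 : ℝ) ≤ z := by exact_mod_cast h
    exact ⟨1, by norm_num, by rw [abs_of_nonneg (qNum_nonneg hq hq1 (by linarith)), one_mul],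
      by rw [abs_of_nonneg (qNum_nonneg hq hq1 (by linarith)), one_mul]⟩
  · have h' : (z : ℝ) ≤ 0 := by exact_mod_cast (by omega : z ≤ 0)
    exact ⟨-1, by norm_num, by rw [abs_of_nonpos (qNum_nonpos hq hq1 (by linarith))]; ring,
      by rw [abs_of_nonpos (qNum_nonpos hq hq1 (by linarith))]; ring⟩

/-- The product of the roots belonging to a neighbouring component, if that component moves after
the step of the row: the root `√|[a + w][a + w + 1]|` is common to both orders, the rest is rational. -/
lemma weight_mul_up (hq : 0 < q) (hq1 : q ≠ 1) (a w : ℝ) :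
    √|qNum q (a - 1 / 2) ^ 2 - qNum q (w + 1 / 2) ^ 2| * √|qNum q (w + 1) ^ 2 - qNum q a ^ 2|
      = √|qNum q (a + w) * qNum q (a + w + 1)| * |qNum q (a - w - 1)| := by
  rw [abs_sub_comm (qNum q (w + 1) ^ 2), ← qNum_add_mul_qNum_sub hq hq1,
    ← qNum_add_mul_qNum_sub hq hq1, show a - 1 / 2 + (w + 1 / 2) = a + w by ring,
    show a - 1 / 2 - (w + 1 / 2) = a - w - 1 by ring, show a + (w + 1) = a + w + 1 by ring,
    show a - (w + 1) = a - w - 1 by ring, sqrt_abs_mul, sqrt_abs_mul, sqrt_abs_mul]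
  linear_combination (√|qNum q (a + w)| * √|qNum q (a + w + 1)|) *
    sqrt_abs_mul_self (qNum q (a - w - 1))

/-- The product of the roots as in `weight_mul_up`, if the neighbouring component moves before the
step of the row. -/
lemma weight_mul_up' (hq : 0 < q) (hq1 : q ≠ 1) (a w : ℝ) :
    √|qNum q w ^ 2 - qNum q a ^ 2| * √|qNum q (a + 1 / 2) ^ 2 - qNum q (w + 1 / 2) ^ 2|
      = √|qNum q (a + w) * qNum q (a + w + 1)| * |qNum q (a - w)| := by
  rw [abs_sub_comm (qNum q w ^ 2), ← qNum_add_mul_qNum_sub hq hq1,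
    ← qNum_add_mul_qNum_sub hq hq1, show a + 1 / 2 + (w + 1 / 2) = a + w + 1 by ring,
    show a + 1 / 2 - (w + 1 / 2) = a - w by ring, sqrt_abs_mul, sqrt_abs_mul, sqrt_abs_mul]
  linear_combination (√|qNum q (a + w)| * √|qNum q (a + w + 1)|) *
    sqrt_abs_mul_self (qNum q (a - w))

/-- The rational part of the contribution of two steps of different components. -/
lemma weight_pair (hq : 0 < q) (hq1 : q ≠ 1) {a x y σ τ : ℝ}
    (h1 : |qNum q (a - x - 1)| = σ * qNum q (a - x - 1)) (h0 : |qNum q (a - x)| = σ * qNum q (a - x))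
    (k1 : |qNum q (a - y - 1)| = τ * qNum q (a - y - 1))
    (k0 : |qNum q (a - y)| = τ * qNum q (a - y)) :
    |qNum q (a - x - 1)| * |qNum q (a - y - 1)|
      - (q + q⁻¹) * (|qNum q (a - x - 1)| * |qNum q (a - y)|) + |qNum q (a - x)| * |qNum q (a - y)|
      = σ * τ * qNum q (x - y + 1) := by
  rw [h1, h0, k1, k0]
  have e1 := mul_qNum hq hq1 (a - y)
  have e2 := qNum_mul_sub hq hq1 (a - x) (a - y)
  rw [show a - y - (a - x) + 1 = x - y + 1 by ring] at e2
  linear_combination (-σ * τ * qNum q (a - x - 1)) * e1 + σ * τ * e2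

/-- The contribution of the same step taken twice vanishes. -/
lemma weight_self (hq : 0 < q) (hq1 : q ≠ 1) {a w : ℝ} (h : ∃ z : ℤ, a - w = z) :
    √|qNum q (a - 1 / 2) ^ 2 - qNum q (w + 1 / 2) ^ 2| *
        √|qNum q (a - 1 / 2) ^ 2 - qNum q (w + 1 + 1 / 2) ^ 2| * √|qNum q (w + 2) ^ 2 - qNum q a ^ 2|
      - (q + q⁻¹) * (√|qNum q (a - 1 / 2) ^ 2 - qNum q (w + 1 / 2) ^ 2| *
        √|qNum q (w + 1) ^ 2 - qNum q a ^ 2| *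
        √|qNum q (a + 1 / 2) ^ 2 - qNum q (w + 1 + 1 / 2) ^ 2|)
      + √|qNum q w ^ 2 - qNum q a ^ 2| * √|qNum q (a + 1 / 2) ^ 2 - qNum q (w + 1 / 2) ^ 2| *
        √|qNum q (a + 1 / 2) ^ 2 - qNum q (w + 1 + 1 / 2) ^ 2| = 0 := by
  have e1 := weight_mul_up hq hq1 a (w + 1)
  have e2 := weight_mul_up' hq hq1 a (w + 1)
  have e3 := weight_mul_up' hq hq1 a w
  rw [show w + 1 + 1 = w + 2 by ring, show a + (w + 1) = a + w + 1 by ring,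
    show a - (w + 1) - 1 = a - w - 2 by ring] at e1
  rw [show a + (w + 1) = a + w + 1 by ring, show a - (w + 1) = a - w - 1 by ring] at e2
  have e4 : √|qNum q (a - 1 / 2) ^ 2 - qNum q (w + 1 / 2) ^ 2| =
      √|qNum q (a + w)| * √|qNum q (a - w - 1)| := by
    rw [← qNum_add_mul_qNum_sub hq hq1, show a - 1 / 2 + (w + 1 / 2) = a + w by ring,
      show a - 1 / 2 - (w + 1 / 2) = a - w - 1 by ring, sqrt_abs_mul]
  have e5 : √|qNum q (a + 1 / 2) ^ 2 - qNum q (w + 1 + 1 / 2) ^ 2| =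
      √|qNum q (a + w + 2)| * √|qNum q (a - w - 1)| := by
    rw [← qNum_add_mul_qNum_sub hq hq1, show a + 1 / 2 + (w + 1 + 1 / 2) = a + w + 2 by ring,
      show a + 1 / 2 - (w + 1 + 1 / 2) = a - w - 1 by ring, sqrt_abs_mul]
  rw [mul_assoc, e1, mul_assoc √|qNum q (a - 1 / 2) ^ 2 - qNum q (w + 1 / 2) ^ 2|, e2, e3, e4, e5,
    show a + w + 1 + 1 = a + w + 2 by ring, sqrt_abs_mul, sqrt_abs_mul]
  obtain ⟨z, hz⟩ := h
  suffices √|qNum q (a - w - 1)| * (|qNum q (a - w - 2)| - (q + q⁻¹) * |qNum q (a - w - 1)|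
      + |qNum q (a - w)|) = 0 by
    linear_combination (√|qNum q (a + w)| * √|qNum q (a + w + 1)| * √|qNum q (a + w + 2)|) * this
  have key := mul_qNum hq hq1 (a - w - 1)
  rw [show a - w - 1 + 1 = a - w by ring, show a - w - 1 - 1 = a - w - 2 by ring] at key
  -- the three `q`-numbers have the same sign, except for `a - w = 1`, where the root vanishes
  rcases lt_trichotomy z 1 with h | rfl | h
  · have h' : (z : ℝ) ≤ 0 := by exact_mod_cast (by omega : z ≤ 0)
    rw [abs_of_nonpos (qNum_nonpos hq hq1 (x := a - w - 2) (by linarith)),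
      abs_of_nonpos (qNum_nonpos hq hq1 (x := a - w - 1) (by linarith)),
      abs_of_nonpos (qNum_nonpos hq hq1 (x := a - w) (by linarith))]
    linear_combination √(-qNum q (a - w - 1)) * key
  · rw [hz]; simp [qNum_zero]
  · have h' : (2 : ℝ) ≤ z := by exact_mod_cast (by omega : 2 ≤ z)
    rw [abs_of_nonneg (qNum_nonneg hq hq1 (x := a - w - 2) (by linarith)),
      abs_of_nonneg (qNum_nonneg hq hq1 (x := a - w - 1) (by linarith)),
      abs_of_nonneg (qNum_nonneg hq hq1 (x := a - w) (by linarith))]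
    linear_combination -√(qNum q (a - w - 1)) * key

/-- The rational part of the path that first stays and then moves a component; `δ [·]_+` is the
diagonal coefficient as a function of the neighbouring component. -/
lemma weight_none (hq : 0 < q) (hq1 : q ≠ 1) {a w σ δ : ℝ}
    (h1 : |qNum q (a - w - 1)| = σ * qNum q (a - w - 1))
    (h0 : |qNum q (a - w)| = σ * qNum q (a - w)) :
    δ * qNumPlus q (a - 1 / 2) * |qNum q (a - w - 1)|
      - (q + q⁻¹) * (δ * qNumPlus q (a - 1 / 2) * |qNum q (a - w)|)
      + δ * qNumPlus q (a + 1 / 2) * |qNum q (a - w)|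
      = -(δ * σ) * qNumPlus q (w - 1 / 2) := by
  rw [h1, h0]
  have e1 := mul_qNumPlus hq hq1 (a - 1 / 2)
  have e2 := qNum_mul_qNumPlus_sub hq hq1 (a - w) (a - 3 / 2)
  rw [show a - 1 / 2 + 1 = a + 1 / 2 by ring, show a - 1 / 2 - 1 = a - 3 / 2 by ring] at e1
  rw [show a - 3 / 2 + 1 = a - 1 / 2 by ring,
    show a - 3 / 2 - (a - w) + 1 = w - 1 / 2 by ring] at e2
  linear_combination (-δ * σ * qNum q (a - w)) * e1 - δ * σ * e2

/-- The rational part of the path that first moves a component and then stays. -/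
lemma weight_none' (hq : 0 < q) (hq1 : q ≠ 1) {a w σ δ : ℝ}
    (h1 : |qNum q (a - w - 1)| = σ * qNum q (a - w - 1))
    (h0 : |qNum q (a - w)| = σ * qNum q (a - w)) :
    δ * qNumPlus q (a - 1 / 2) * |qNum q (a - w - 1)|
      - (q + q⁻¹) * (δ * qNumPlus q (a + 1 / 2) * |qNum q (a - w - 1)|)
      + δ * qNumPlus q (a + 1 / 2) * |qNum q (a - w)|
      = δ * σ * qNumPlus q (w + 3 / 2) := by
  rw [h1, h0]
  have e1 := mul_qNumPlus hq hq1 (a + 1 / 2)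
  have e2 := qNum_mul_qNumPlus_sub hq hq1 (a - w) (a + 1 / 2)
  rw [show a + 1 / 2 - 1 = a - 1 / 2 by ring] at e1
  rw [show a + 1 / 2 - (a - w) + 1 = w + 3 / 2 by ring] at e2
  linear_combination (-δ * σ * qNum q (a - w - 1)) * e1 + δ * σ * e2

/-- The contribution of `w → w + 1 → w`, up to the coefficients that the neighbouring component
does not enter. The number `m` stands for the product over the other neighbouring components. -/
lemma weight_return (hq : 0 < q) (hq1 : q ≠ 1) {a w m : ℝ} (h : ∃ z : ℤ, a - w = z)
    (h' : ∃ z : ℤ, a + w + 1 = z) (hm : 0 ≤ (qNum q a ^ 2 - qNum q w ^ 2) * m) :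
    |m| * (√|qNum q (a - 1 / 2) ^ 2 - qNum q (w + 1 / 2) ^ 2| *
        √|qNum q (a - 1 / 2) ^ 2 - qNum q (w + 1 / 2) ^ 2| * √|qNum q w ^ 2 - qNum q a ^ 2|
      - (q + q⁻¹) * (√|qNum q (a - 1 / 2) ^ 2 - qNum q (w + 1 / 2) ^ 2| *
        √|qNum q (w + 1) ^ 2 - qNum q a ^ 2| *
        √|qNum q (a + 1 / 2) ^ 2 - qNum q (w + 1 / 2) ^ 2|)
      + √|qNum q w ^ 2 - qNum q a ^ 2| * √|qNum q (a + 1 / 2) ^ 2 - qNum q (w + 1 / 2) ^ 2| *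
        √|qNum q (a + 1 / 2) ^ 2 - qNum q (w + 1 / 2) ^ 2|)
      = m * qNum q (2 * (w + 1)) * √|qNum q w ^ 2 - qNum q a ^ 2| := by
  rw [weight_mul_up hq hq1 a w]
  obtain ⟨σ, hσ, s1, s0⟩ := abs_qNum_eq hq hq1 h
  obtain ⟨τ, hτ, t1, t0⟩ := abs_qNum_eq hq hq1 h'
  rw [show a + w + 1 - 1 = a + w by ring] at t1
  rw [abs_sub_comm (qNum q w ^ 2)]
  rw [← qNum_add_mul_qNum_sub hq hq1 a w] at hm ⊢
  rw [← qNum_add_mul_qNum_sub hq hq1, ← qNum_add_mul_qNum_sub hq hq1,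
    show a + 1 / 2 + (w + 1 / 2) = a + w + 1 by ring,
    show a + 1 / 2 - (w + 1 / 2) = a - w by ring, show a - 1 / 2 + (w + 1 / 2) = a + w by ring,
    show a - 1 / 2 - (w + 1 / 2) = a - w - 1 by ring]
  simp only [sqrt_abs_mul]
  have key := qNum_return hq hq1 a w
  have a0 := (sqrt_abs_mul_self (qNum q (a + w))).trans t1
  have a1 := (sqrt_abs_mul_self (qNum q (a + w + 1))).trans t0
  have b0 := (sqrt_abs_mul_self (qNum q (a - w))).trans s0
  have b1 := (sqrt_abs_mul_self (qNum q (a - w - 1))).trans s1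
  rcases eq_or_ne (qNum q (a + w) * qNum q (a - w)) 0 with h0 | h0
  -- both sides contain the factor `√|[w]² - [a]²| = 0`
  · have h00 : √|qNum q (a + w)| * √|qNum q (a - w)| = 0 := by
      rw [← sqrt_abs_mul, h0]; simp
    linear_combination (|m| * (√|qNum q (a + w)| * √|qNum q (a - w - 1)| * √|qNum q (a + w)|
      * √|qNum q (a - w - 1)| - (q + q⁻¹) * (√|qNum q (a + w + 1)| * |qNum q (a - w - 1)|
      * √|qNum q (a + w + 1)|) + √|qNum q (a + w + 1)| * √|qNum q (a - w)|
      * √|qNum q (a + w + 1)| * √|qNum q (a - w)|) - m * qNum q (2 * (w + 1))) * h00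
  -- `hm` determines the sign of `m`, and all absolute values can be resolved
  · have hpos : 0 < σ * τ * (qNum q (a + w) * qNum q (a - w)) := by
      have : 0 < |qNum q (a + w) * qNum q (a - w)| := abs_pos.2 h0
      rw [abs_mul, t1, s0] at this; linarith
    have hm' : |m| = σ * τ * m := by
      have h2 : 0 ≤ σ * τ * m := by
        by_contra hneg
        push Not at hneg
        have := mul_neg_of_pos_of_neg hpos hneg
        have h3 : σ * τ * (qNum q (a + w) * qNum q (a - w)) * (σ * τ * m)
          = (qNum q (a + w) * qNum q (a - w) * m) * ((σ * σ) * (τ * τ)) := by ring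
        rw [h3, hσ, hτ] at this; linarith
      have h4 : |σ * τ| = 1 := by
        have : (σ * τ) * (σ * τ) = 1 := by linear_combination hσ * (τ * τ) + hτ
        rw [← abs_mul_abs_self] at this
        nlinarith [abs_nonneg (σ * τ)]
      rw [← abs_of_nonneg h2, abs_mul, h4, one_mul]
    rw [hm']
    linear_combination (√|qNum q (a + w)| * √|qNum q (a - w)|) * m * (σ * τ) * (
      (√|qNum q (a - w - 1)| * √|qNum q (a - w - 1)|) * a0 + τ * qNum q (a + w) * b1
      - (q + q⁻¹) * σ * qNum q (a - w - 1) * a1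
      - (q + q⁻¹) * √|qNum q (a + w + 1)| * √|qNum q (a + w + 1)| * s1
      + (√|qNum q (a - w)| * √|qNum q (a - w)|) * a1 + τ * qNum q (a + w + 1) * b0
      + σ * τ * key) + (√|qNum q (a + w)| * √|qNum q (a - w)|) * m * qNum q (2 * (w + 1)) *
        (hσ * (τ * τ) + hτ)

end Weights

/-! ### One row: the Serre relation -/

/-- The steps of a row with the components `r i`, `i ∈ S`. -/
def stepsOf (S : Finset ℕ) : Finset Step := insertNone (S ×ˢ (univ : Finset ℤˣ))

lemma some_mem_stepsOf {S : Finset ℕ} {b : ℕ} {s : ℤˣ} : some (b, s) ∈ stepsOf S ↔ b ∈ S := by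
  rw [stepsOf, some_mem_insertNone, mem_product]; simp only [mem_univ, and_true]

lemma none_mem_stepsOf (S : Finset ℕ) : none ∈ stepsOf S := by simp [stepsOf]

lemma sum_stepsOf {M : Type*} [AddCommMonoid M] (S : Finset ℕ) (g : Step → M) :
    ∑ σ ∈ stepsOf S, g σ = g none + ∑ b ∈ S, ∑ s : ℤˣ, g (some (b, s)) := by
  rw [stepsOf, sum_insertNone, sum_product]

/-- The factor of the coefficient of a step of row `k` that depends on the moving component
alone. -/
def pref (q : ℝ) (k : ℕ) (w : ℝ) : ℝ :=
  if Even k then 1 / (q ^ w - q ^ (-w)) else 1 / (qNum q (2 * w) * qNumPlus q (w + 1 / 2))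

section Row

variable {q : ℝ} {S : Finset ℕ} {r : ℕ → ℝ} {E h h' f : ℝ → ℝ} {d d' : ℝ}

/-- The contribution of a step followed by its inverse. -/
lemma serreTerm_inv {b : ℕ} (hb : b ∈ S) (s : ℤˣ) (hf : ∀ x, f (-x) = f x) (Q : ℝ) :
    serreTerm Q (rowCoef q S (fun w => E w * h w) d) (rowCoef q S (fun w => E w * h' w) d')
      (fun r => ∏ i ∈ S, f (r i)) r (some (b, s)) (some (b, -s)) =
    E ((s : ℤ) * r b) * E (-((s : ℤ) * r b) - 1) / |rowDen q S r b ((s : ℤ) * r b)| *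
      (∏ i ∈ S.erase b, f (r i)) *
      (h ((s : ℤ) * r b) * h (-((s : ℤ) * r b) - 1) * f ((s : ℤ) * r b)
      - Q * (h ((s : ℤ) * r b) * f ((s : ℤ) * r b + 1) * h' (-((s : ℤ) * r b) - 1))
      + f ((s : ℤ) * r b) * h' ((s : ℤ) * r b) * h' (-((s : ℤ) * r b) - 1)) := by
  have w1 : (((-s : ℤˣ) : ℤ) : ℝ) * (r b + ((s : ℤ) : ℝ)) = -((s : ℤ) * r b) - 1 := by
    push_cast
    linear_combination -unit_mul_self s
  have v1 : f (r b + ((s : ℤ) : ℝ)) = f ((s : ℤ) * r b + 1) := even_comp_add_unit hf s _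
  have v2 : f (r b + ((s : ℤ) : ℝ) + (((-s : ℤˣ) : ℤ) : ℝ)) = f ((s : ℤ) * r b) := by
    rw [even_comp_unit_mul hf]; congr 1; push_cast; ring
  have hD : rowDen q S r b (-((s : ℤ) * r b) - 1) = rowDen q S r b ((s : ℤ) * r b) := by
    refine prod_congr rfl fun i _ => ?_
    rw [show -(((s : ℤ) : ℝ) * r b) - 1 = -(((s : ℤ) : ℝ) * r b + 1) by ring,
      show -(((s : ℤ) : ℝ) * r b + 1) + 1 = -(((s : ℤ) : ℝ) * r b) by ring,
      qNum_sq_neg, qNum_sq_neg, mul_comm]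
  simp only [serreTerm, rowCoef, moveRow, Function.update_self, Function.update_idem, w1,
    rowDen_update, prod_moveRow hb, v1, v2, hD]
  rw [← mul_prod_erase S _ hb, ← even_comp_unit_mul hf s (r b)]
  have e : (√|rowDen q S r b ((s : ℤ) * r b)|)⁻¹ * (√|rowDen q S r b ((s : ℤ) * r b)|)⁻¹ =
      |rowDen q S r b ((s : ℤ) * r b)|⁻¹ := by rw [← mul_inv, sqrt_abs_mul_self]
  set x := ((s : ℤ) : ℝ) * r b
  generalize ∏ i ∈ S.erase b, f (r i) = Φ
  simp only [div_eq_mul_inv]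
  linear_combination (E x * E (-x - 1) * Φ * (h x * h (-x - 1) * f x
      - Q * (h x * f (x + 1) * h' (-x - 1)) + f x * h' x * h' (-x - 1))) * e

variable {k : ℕ} {M : ℝ → ℝ} {a δ : ℝ}

/-- In the Serre relation with a step of a neighbouring component from `a - 1/2` to `a + 1/2`,
the contributions of paths with a nonzero total displacement cancel. -/
theorem serreTerm_add_swap_of_ne_inv (hq : 0 < q) (hq1 : q ≠ 1)
    (hint : ∀ b ∈ S, ∀ s : ℤˣ, ∃ z : ℤ, a - (s : ℤ) * r b = z)
    (hgen : ∀ b ∈ S, ∀ c ∈ S, b ≠ c → ∀ s t : ℤˣ, 1 < (s : ℤ) * r b - (t : ℤ) * r c ∨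
      (s : ℤ) * r b - (t : ℤ) * r c < -1 ∨ M ((s : ℤ) * r b) = 0 ∨ M ((t : ℤ) * r c) = 0)
    {σ τ : Step} (hσ : σ ∈ stepsOf S) (hτ : τ ∈ stepsOf S) (hne : τ ≠ σ.inv) :
    let C := fun v => rowCoef q S (fun w => pref q k w * √|M w| *
      √|qNum q v ^ 2 - qNum q (w + 1 / 2) ^ 2|) (δ * qNumPlus q v)
    let φ := fun r : ℕ → ℝ => ∏ i ∈ S, √|qNum q (r i) ^ 2 - qNum q a ^ 2|
    serreTerm (q + q⁻¹) (C (a - 1 / 2)) (C (a + 1 / 2)) φ r σ τ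
      + serreTerm (q + q⁻¹) (C (a - 1 / 2)) (C (a + 1 / 2)) φ r τ σ = 0 := by
  intro C φ
  have hf : ∀ x, √|qNum q (-x) ^ 2 - qNum q a ^ 2| = √|qNum q x ^ 2 - qNum q a ^ 2| := by
    intro x; rw [qNum_sq_neg]
  have habs : ∀ b ∈ S, ∀ s : ℤˣ, ∃ σ : ℝ,
      |qNum q (a - (s : ℤ) * r b - 1)| = σ * qNum q (a - (s : ℤ) * r b - 1) ∧
      |qNum q (a - (s : ℤ) * r b)| = σ * qNum q (a - (s : ℤ) * r b) := by
    intro b hb s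
    obtain ⟨σ, -, h1, h2⟩ := abs_qNum_eq hq hq1 (hint b hb s)
    exact ⟨σ, h1, h2⟩
  have hnone : ∀ b ∈ S, ∀ s : ℤˣ,
      serreTerm (q + q⁻¹) (C (a - 1 / 2)) (C (a + 1 / 2)) φ r none (some (b, s))
      + serreTerm (q + q⁻¹) (C (a - 1 / 2)) (C (a + 1 / 2)) φ r (some (b, s)) none = 0 := by
    intro b hb s
    obtain ⟨σ, h1, h0⟩ := habs b hb s
    exact serreTerm_none_add_swap (f := fun x => √|qNum q x ^ 2 - qNum q a ^ 2|)
      (H := fun w => √|qNum q (a + w) * qNum q (a + w + 1)|)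
      (B₁ := fun w => |qNum q (a - w - 1)|) (B₀ := fun w => |qNum q (a - w)|) (η := δ * σ)
      hq hq1 hb s hf _ (weight_mul_up hq hq1 a _) (weight_mul_up' hq hq1 a _)
      (weight_none hq hq1 h1 h0) (weight_none' hq hq1 h1 h0)
  match σ, τ with
  | none, none => exact absurd rfl hne
  | none, some (b, s) => exact hnone b (some_mem_stepsOf.1 hτ) s
  | some (b, s), none => rw [add_comm]; exact hnone b (some_mem_stepsOf.1 hσ) s
  | some (b, s), some (c, t) =>
    rw [some_mem_stepsOf] at hσ hτ
    by_cases hbc : b = c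
    · subst hbc
      have hst : t = s := by
        by_contra h
        exact hne (by rw [Step.inv, Int.units_ne_iff_eq_neg.1 h])
      subst hst
      rw [serreTerm_self (f := fun x => √|qNum q x ^ 2 - qNum q a ^ 2|) hσ t hf _
        (weight_self hq hq1 (hint b hσ t)), add_zero]
    · obtain ⟨σ, h1, h0⟩ := habs b hσ s
      obtain ⟨τ, k1, k0⟩ := habs c hτ t
      have e2 := weight_pair hq hq1 k1 k0 h1 h0
      refine serreTerm_add_swap (f := fun x => √|qNum q x ^ 2 - qNum q a ^ 2|)
        (H := fun w => √|qNum q (a + w) * qNum q (a + w + 1)|)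
        (B₁ := fun w => |qNum q (a - w - 1)|) (B₀ := fun w => |qNum q (a - w)|) (η := σ * τ)
        hq hq1 hσ hτ hbc s t hf _ (weight_mul_up hq hq1 a _) (weight_mul_up' hq hq1 a _)
        (weight_mul_up hq hq1 a _) (weight_mul_up' hq hq1 a _)
        (weight_pair hq hq1 h1 h0 k1 k0) ?_ ?_
      · rw [e2, mul_comm τ σ]; congr 2; ring
      · rcases hgen b hσ c hτ hbc s t with h | h | h | h
        · exact Or.inl h
        · exact Or.inr (Or.inl h)
        · right; right; left; simp [h]
        · right; right; right; simp [h]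

/-- The same cancellation for the diagonal coefficient `∏ [r i]_+` of the neighbouring odd row. -/
theorem serreTerm_plus_add_swap_of_ne_inv (hq : 0 < q) (hq1 : q ≠ 1)
    (hgen : ∀ b ∈ S, ∀ c ∈ S, b ≠ c → ∀ s t : ℤˣ, 1 < (s : ℤ) * r b - (t : ℤ) * r c ∨
      (s : ℤ) * r b - (t : ℤ) * r c < -1 ∨ M ((s : ℤ) * r b) = 0 ∨ M ((t : ℤ) * r c) = 0)
    {σ τ : Step} (hσ : σ ∈ stepsOf S) (hτ : τ ∈ stepsOf S) (hne : τ ≠ σ.inv) :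
    let C := rowCoef q S (fun w => pref q k w * √|M w|) 0
    let φ := fun r : ℕ → ℝ => ∏ i ∈ S, qNumPlus q (r i)
    serreTerm (q + q⁻¹) C C φ r σ τ + serreTerm (q + q⁻¹) C C φ r τ σ = 0 := by
  intro C φ
  have hC : C = rowCoef q S (fun w => pref q k w * √|M w| * 1) 0 := by simp only [mul_one]; rfl
  have hnone : ∀ b ∈ S, ∀ s : ℤˣ,
      serreTerm (q + q⁻¹) C C φ r none (some (b, s))
      + serreTerm (q + q⁻¹) C C φ r (some (b, s)) none = 0 := by
    intro b hb s
    rw [hC]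
    exact serreTerm_none_add_swap (f := fun x => qNumPlus q x) (h := fun _ => 1) (h' := fun _ => 1)
      (H := fun _ => 1) (B₁ := fun w => qNumPlus q (w + 1)) (B₀ := fun w => qNumPlus q w) (η := 0)
      hq hq1 hb s (qNumPlus_neg q) _ rfl (mul_comm _ _) (by simp) (by simp)
  match σ, τ with
  | none, none => exact absurd rfl hne
  | none, some (b, s) => exact hnone b (some_mem_stepsOf.1 hτ) s
  | some (b, s), none => rw [add_comm]; exact hnone b (some_mem_stepsOf.1 hσ) s
  | some (b, s), some (c, t) =>
    rw [some_mem_stepsOf] at hσ hτ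
    by_cases hbc : b = c
    · subst hbc
      have hst : t = s := by
        by_contra h
        exact hne (by rw [Step.inv, Int.units_ne_iff_eq_neg.1 h])
      subst hst
      have key := mul_qNumPlus hq hq1 ((t : ℤ) * r b + 1)
      rw [show ((t : ℤ) : ℝ) * r b + 1 + 1 = (t : ℤ) * r b + 2 by ring, add_sub_cancel_right] at key
      rw [hC, serreTerm_self (f := fun x => qNumPlus q x) (h := fun _ => 1) (h' := fun _ => 1)
        hσ t (qNumPlus_neg q) _ (by linear_combination -key), add_zero]
    · rw [hC]
      have key : ∀ x y : ℝ, qNumPlus q (x + 1) * qNumPlus q (y + 1)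
          - (q + q⁻¹) * (qNumPlus q (x + 1) * qNumPlus q y) + qNumPlus q x * qNumPlus q y
          = -1 * qNum q (x - y + 1) := by
        intro x y
        linear_combination (-qNumPlus q (x + 1)) * mul_qNumPlus hq hq1 y
          + qNumPlus_mul_sub hq hq1 x y
      refine serreTerm_add_swap (f := fun x => qNumPlus q x) (h := fun _ => 1) (h' := fun _ => 1)
        (H := fun _ => 1)
        (B₁ := fun w => qNumPlus q (w + 1)) (B₀ := fun w => qNumPlus q w) (η := -1)
        hq hq1 hσ hτ hbc s t (qNumPlus_neg q) _ rfl (mul_comm _ _) rfl (mul_comm _ _)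
        (key _ _) ((key _ _).trans (by congr 2; ring)) ?_
      rcases hgen b hσ c hτ hbc s t with h | h | h | h
      · exact Or.inl h
      · exact Or.inr (Or.inl h)
      · right; right; left; simp [h]
      · right; right; right; simp [h]

lemma pref_mul_pref_even (hq : 0 < q) (hq1 : q ≠ 1) (hk : Even k) {w : ℝ} (hw : w ≠ 0)
    (hw1 : w + 1 ≠ 0) :
    pref q k w * pref q k (-w - 1) * qNum q (2 * (w + 1))
      = -((qNum q (w + 1 / 2) ^ 2 + qNumPlus q (1 / 2) ^ 2) / qNum q (2 * w)) := by
  have h0 := q_sub_inv_ne_zero hq hq1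
  have h1 := qNum_ne_zero hq hq1 hw
  have h2 := qNum_ne_zero hq hq1 hw1
  have h3 := qNumPlus_ne_zero hq hq1 w
  rw [← qNumPlus_add_mul_qNumPlus_sub hq hq1, pref, pref, if_pos hk, if_pos hk,
    rpow_sub_rpow_neg hq hq1, rpow_sub_rpow_neg hq hq1, qNum_two_mul hq hq1, qNum_two_mul hq hq1,
    show -w - 1 = -(w + 1) by ring, qNum_neg, show w + 1 / 2 + 1 / 2 = w + 1 by ring,
    show w + 1 / 2 - 1 / 2 = w by ring]
  field_simp

lemma pref_mul_pref_odd (hq : 0 < q) (hq1 : q ≠ 1) (hk : ¬ Even k) {w : ℝ} (hw1 : w + 1 ≠ 0) :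
    pref q k w * pref q k (-w - 1) * qNum q (2 * (w + 1))
      = -(1 / (qNum q (2 * w) * qNumPlus q (w + 1 / 2) ^ 2)) := by
  have h2 := qNum_ne_zero hq hq1 (x := 2 * (w + 1)) (by simpa using hw1)
  have h3 := qNumPlus_ne_zero hq hq1 (w + 1 / 2)
  rw [pref, pref, if_neg hk, if_neg hk, show 2 * (-w - 1) = -(2 * (w + 1)) by ring, qNum_neg,
    show -w - 1 + 1 / 2 = -(w + 1 / 2) by ring, qNumPlus_neg]
  field_simp

/-- The contribution of a step followed by its inverse is `φ` times a rational expression: the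
term of Lagrange's formula that belongs to the node `[s r_b + 1/2]²`. -/
lemma serreTerm_shift_inv (hq : 0 < q) (hq1 : q ≠ 1) {b : ℕ} (hb : b ∈ S) (s : ℤˣ)
    (hint : ∀ s : ℤˣ, ∃ z : ℤ, a - (s : ℤ) * r b = z) (hM : ∀ w, M (-w - 1) = M w)
    (hm : 0 ≤ (qNum q a ^ 2 - qNum q ((s : ℤ) * r b) ^ 2) * M ((s : ℤ) * r b))
    (hD : 0 ≤ rowDen q S r b ((s : ℤ) * r b)) :
    let C := fun v => rowCoef q S (fun w => pref q k w * √|M w| *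
      √|qNum q v ^ 2 - qNum q (w + 1 / 2) ^ 2|) (δ * qNumPlus q v)
    let φ := fun r : ℕ → ℝ => ∏ i ∈ S, √|qNum q (r i) ^ 2 - qNum q a ^ 2|
    serreTerm (q + q⁻¹) (C (a - 1 / 2)) (C (a + 1 / 2)) φ r (some (b, s)) (some (b, -s)) =
      φ r * ((pref q k ((s : ℤ) * r b) * pref q k (-((s : ℤ) * r b) - 1)
        * qNum q (2 * ((s : ℤ) * r b + 1))) * (M ((s : ℤ) * r b) /
          rowDen q S r b ((s : ℤ) * r b))) := by
  intro C φ
  have hf : ∀ x, √|qNum q (-x) ^ 2 - qNum q a ^ 2| = √|qNum q x ^ 2 - qNum q a ^ 2| := by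
    intro x; rw [qNum_sq_neg]
  have hint' : ∃ z : ℤ, a + (s : ℤ) * r b + 1 = z := by
    obtain ⟨z, hz⟩ := hint (-s)
    refine ⟨z + 1, ?_⟩
    push_cast at hz ⊢
    linarith
  rw [show φ r = √|qNum q (r b) ^ 2 - qNum q a ^ 2| * ∏ i ∈ S.erase b, _ from
    (mul_prod_erase S _ hb).symm,
    ← even_comp_unit_mul (f := fun x => √|qNum q x ^ 2 - qNum q a ^ 2|) hf s (r b)]
  refine (serreTerm_inv (E := fun w => pref q k w * √|M w|)
    (f := fun x => √|qNum q x ^ 2 - qNum q a ^ 2|) hb s hf _).trans ?_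
  have key := weight_return hq hq1 (hint s) hint' hm
  simp only [hM, show ∀ v w, √|qNum q v ^ 2 - qNum q (-w - 1 + 1 / 2) ^ 2|
    = √|qNum q v ^ 2 - qNum q (w + 1 / 2) ^ 2| from fun v w => by
      rw [show -w - 1 + 1 / 2 = -(w + 1 / 2) by ring, qNum_sq_neg], abs_of_nonneg hD]
  set x := ((s : ℤ) : ℝ) * r b
  have e := sqrt_abs_mul_self (M x)
  generalize ∏ i ∈ S.erase b, √|qNum q (r i) ^ 2 - qNum q a ^ 2| = Φ
  rw [← e] at key
  generalize √|qNum q (a - 1 / 2) ^ 2 - qNum q (x + 1 / 2) ^ 2| = A1 at key ⊢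
  generalize √|qNum q (a + 1 / 2) ^ 2 - qNum q (x + 1 / 2) ^ 2| = A2 at key ⊢
  simp only [div_eq_mul_inv]
  linear_combination (pref q k x * pref q k (-x - 1) * (rowDen q S r b x)⁻¹ * Φ) * key

/-- The contribution of a step followed by its inverse vanishes if `φ` does. This includes the
moving component `b` itself. -/
lemma serreTerm_shift_inv_of_eq (hq : 0 < q) (hq1 : q ≠ 1) {b c : ℕ} (hb : b ∈ S) (s : ℤˣ)
    (hc : c ∈ S) (hcφ : qNum q (r c) ^ 2 = qNum q a ^ 2) :
    let C := fun v => rowCoef q S (fun w => pref q k w * √|M w| *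
      √|qNum q v ^ 2 - qNum q (w + 1 / 2) ^ 2|) (δ * qNumPlus q v)
    let φ := fun r : ℕ → ℝ => ∏ i ∈ S, √|qNum q (r i) ^ 2 - qNum q a ^ 2|
    serreTerm (q + q⁻¹) (C (a - 1 / 2)) (C (a + 1 / 2)) φ r (some (b, s)) (some (b, -s)) = 0 := by
  intro C φ
  have hφ0 : φ r = 0 := prod_eq_zero hc (by rw [hcφ]; simp)
  have hret : φ (moveRow (moveRow r (some (b, s))) (some (b, -s))) = φ r := by
    congr 1
    ext i
    by_cases hi : i = b
    · subst hi; simp [moveRow]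
    · simp [moveRow, hi]
  by_cases hcb : c = b
  · subst hcb
    refine (serreTerm_inv (E := fun w => pref q k w * √|M w|)
      (f := fun x => √|qNum q x ^ 2 - qNum q a ^ 2|) hc s
      (fun x => by rw [qNum_sq_neg]) _).trans ?_
    have h0 : √|qNum q ((s : ℤ) * r c) ^ 2 - qNum q a ^ 2| = 0 := by
      rw [even_comp_unit_mul (f := fun x => qNum q x ^ 2) (qNum_sq_neg q), hcφ]; simp
    have h1 := weight_mul_up' hq hq1 a ((s : ℤ) * r c)
    have h2 : √|qNum q (a - 1 / 2) ^ 2 - qNum q ((s : ℤ) * r c + 1 / 2) ^ 2| *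
      √|qNum q ((s : ℤ) * r c + 1) ^ 2 - qNum q a ^ 2| *
      √|qNum q (a + 1 / 2) ^ 2 - qNum q (-((s : ℤ) * r c) - 1 + 1 / 2) ^ 2| = 0 := by
      rw [show -(((s : ℤ) : ℝ) * r c) - 1 + 1 / 2 = -((s : ℤ) * r c + 1 / 2) by ring, qNum_sq_neg,
        weight_mul_up hq hq1, ← qNum_add_mul_qNum_sub hq hq1 (a + 1 / 2),
        show a + 1 / 2 + (((s : ℤ) : ℝ) * r c + 1 / 2) = a + (s : ℤ) * r c + 1 by ring,
        show a + 1 / 2 - (((s : ℤ) : ℝ) * r c + 1 / 2) = a - (s : ℤ) * r c by ring,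
        sqrt_abs_mul, sqrt_abs_mul]
      have h3 : √|qNum q (a + (s : ℤ) * r c)| * √|qNum q (a - (s : ℤ) * r c)| = 0 := by
        rw [← sqrt_abs_mul, qNum_add_mul_qNum_sub hq hq1, abs_sub_comm]; exact h0
      linear_combination (√|qNum q (a + (s : ℤ) * r c + 1)| * |qNum q (a - (s : ℤ) * r c - 1)| *
        √|qNum q (a + (s : ℤ) * r c + 1)|) * h3
    rw [h0, h2]; ring
  · have hφ1 : φ (moveRow r (some (b, s))) = 0 :=
      prod_eq_zero hc (by
        rw [show moveRow r (some (b, s)) c = r c by simp [moveRow, hcb], hcφ]; simp)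
    simp only [serreTerm]
    rw [hret, hφ0, hφ1]; ring

/-- In the Serre relation with a step of a neighbouring component from `a - 1/2` to `a + 1/2`,
the paths that return add up to `-φ`. Here row `k` is even, and `hL` is Lagrange's identity for the
nodes `[s r_b + 1/2]²`. -/
theorem sum_serreTerm_inv_even (hq : 0 < q) (hq1 : q ≠ 1) (hk : Even k)
    (hint : ∀ b ∈ S, ∀ s : ℤˣ, ∃ z : ℤ, a - (s : ℤ) * r b = z) (hM : ∀ w, M (-w - 1) = M w)
    (hm : (∀ b ∈ S, qNum q (r b) ^ 2 ≠ qNum q a ^ 2) → ∀ b ∈ S, ∀ s : ℤˣ,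
      0 ≤ (qNum q a ^ 2 - qNum q ((s : ℤ) * r b) ^ 2) * M ((s : ℤ) * r b))
    (hD : ∀ b ∈ S, ∀ s : ℤˣ, 0 ≤ rowDen q S r b ((s : ℤ) * r b))
    (hne : ∀ b ∈ S, ∀ s : ℤˣ, (s : ℤ) * r b ≠ 0 ∧ (s : ℤ) * r b + 1 ≠ 0)
    (hL : (∀ b ∈ S, qNum q (r b) ^ 2 ≠ qNum q a ^ 2) → ∑ b ∈ S, ∑ s : ℤˣ,
      (qNum q ((s : ℤ) * r b + 1 / 2) ^ 2 + qNumPlus q (1 / 2) ^ 2) * M ((s : ℤ) * r b) /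
        (qNum q (2 * ((s : ℤ) * r b)) * rowDen q S r b ((s : ℤ) * r b)) = 1) :
    let C := fun v => rowCoef q S (fun w => pref q k w * √|M w| *
      √|qNum q v ^ 2 - qNum q (w + 1 / 2) ^ 2|) (0 * qNumPlus q v)
    let φ := fun r : ℕ → ℝ => ∏ i ∈ S, √|qNum q (r i) ^ 2 - qNum q a ^ 2|
    ∑ σ ∈ stepsOf S, serreTerm (q + q⁻¹) (C (a - 1 / 2)) (C (a + 1 / 2)) φ r σ σ.inv = -φ r := by
  intro C φ
  have h00 : serreTerm (q + q⁻¹) (C (a - 1 / 2)) (C (a + 1 / 2)) φ r none (Step.inv none) = 0 := by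
    simp [serreTerm, C, rowCoef, Step.inv]
  rw [sum_stepsOf, h00, zero_add]
  by_cases hφ : ∀ b ∈ S, qNum q (r b) ^ 2 ≠ qNum q a ^ 2
  · have e := hL hφ
    have e' : φ r * -(∑ b ∈ S, ∑ s : ℤˣ,
      (qNum q ((s : ℤ) * r b + 1 / 2) ^ 2 + qNumPlus q (1 / 2) ^ 2) * M ((s : ℤ) * r b) /
        (qNum q (2 * ((s : ℤ) * r b)) * rowDen q S r b ((s : ℤ) * r b))) = -φ r := by
      rw [e]; ring
    rw [← e', ← sum_neg_distrib, mul_sum]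
    refine sum_congr rfl fun b hb => ?_
    rw [← sum_neg_distrib, mul_sum]
    refine sum_congr rfl fun s _ => ?_
    refine (serreTerm_shift_inv hq hq1 hb s (hint b hb) hM (hm hφ b hb s) (hD b hb s)).trans ?_
    rw [pref_mul_pref_even hq hq1 hk (hne b hb s).1 (hne b hb s).2]
    simp only [div_eq_mul_inv, mul_inv, φ]
    ring
  · push Not at hφ
    obtain ⟨c, hc, hcφ⟩ := hφ
    have hφ0 : φ r = 0 := prod_eq_zero hc (by rw [hcφ]; simp)
    rw [hφ0, neg_zero]
    refine sum_eq_zero fun b hb => sum_eq_zero fun s _ => ?_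
    exact serreTerm_shift_inv_of_eq hq hq1 hb s hc hcφ

/-- The analogue of `sum_serreTerm_inv_even` for an odd row; the diagonal coefficient is the term of
Lagrange's identity at the additional node `-(2 / (q - q⁻¹))²`. -/
theorem sum_serreTerm_inv_odd (hq : 0 < q) (hq1 : q ≠ 1) (hk : ¬ Even k)
    (hint : ∀ b ∈ S, ∀ s : ℤˣ, ∃ z : ℤ, a - (s : ℤ) * r b = z) (hM : ∀ w, M (-w - 1) = M w)
    (hm : (∀ b ∈ S, qNum q (r b) ^ 2 ≠ qNum q a ^ 2) → ∀ b ∈ S, ∀ s : ℤˣ,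
      0 ≤ (qNum q a ^ 2 - qNum q ((s : ℤ) * r b) ^ 2) * M ((s : ℤ) * r b))
    (hD : ∀ b ∈ S, ∀ s : ℤˣ, 0 ≤ rowDen q S r b ((s : ℤ) * r b))
    (hne : (∀ b ∈ S, qNum q (r b) ^ 2 ≠ qNum q a ^ 2) →
      ∀ b ∈ S, ∀ s : ℤˣ, (s : ℤ) * r b + 1 = 0 → M ((s : ℤ) * r b) = 0)
    (hL : (∀ b ∈ S, qNum q (r b) ^ 2 ≠ qNum q a ^ 2) →
      δ ^ 2 / (∏ i ∈ S, (qNumPlus q (r i + 1 / 2) * qNumPlus q (r i - 1 / 2))) ^ 2 +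
      ∑ b ∈ S, ∑ s : ℤˣ, M ((s : ℤ) * r b) /
        (qNum q (2 * ((s : ℤ) * r b)) * qNumPlus q ((s : ℤ) * r b + 1 / 2) ^ 2 *
          rowDen q S r b ((s : ℤ) * r b)) = 1) :
    let C := fun v => rowCoef q S (fun w => pref q k w * √|M w| *
      √|qNum q v ^ 2 - qNum q (w + 1 / 2) ^ 2|) (δ * qNumPlus q v)
    let φ := fun r : ℕ → ℝ => ∏ i ∈ S, √|qNum q (r i) ^ 2 - qNum q a ^ 2|
    ∑ σ ∈ stepsOf S, serreTerm (q + q⁻¹) (C (a - 1 / 2)) (C (a + 1 / 2)) φ r σ σ.inv = -φ r := by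
  intro C φ
  have h00 : serreTerm (q + q⁻¹) (C (a - 1 / 2)) (C (a + 1 / 2)) φ r none (Step.inv none) =
      φ r * -(δ ^ 2 / (∏ i ∈ S, (qNumPlus q (r i + 1 / 2) * qNumPlus q (r i - 1 / 2))) ^ 2) := by
    have e := qNumPlus_sq_add_sq hq hq1 (a - 1 / 2)
    rw [show a - 1 / 2 + 1 = a + 1 / 2 by ring] at e
    simp only [serreTerm, C, rowCoef, Step.inv, moveRow]
    generalize qNumPlus q (a - 1 / 2) = Q0 at e ⊢
    generalize qNumPlus q (a + 1 / 2) = Q1 at e ⊢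
    generalize ∏ i ∈ S, (qNumPlus q (r i + 1 / 2) * qNumPlus q (r i - 1 / 2)) = R
    simp only [div_eq_mul_inv, ← inv_pow]
    linear_combination (φ r * δ ^ 2 * R⁻¹ ^ 2) * e
  rw [sum_stepsOf, h00]
  by_cases hφ : ∀ b ∈ S, qNum q (r b) ^ 2 ≠ qNum q a ^ 2
  · have e := hL hφ
    have e' : φ r * -(δ ^ 2 / (∏ i ∈ S, (qNumPlus q (r i + 1 / 2) * qNumPlus q (r i - 1 / 2))) ^ 2)
      + φ r * -(∑ b ∈ S, ∑ s : ℤˣ, M ((s : ℤ) * r b) /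
        (qNum q (2 * ((s : ℤ) * r b)) * qNumPlus q ((s : ℤ) * r b + 1 / 2) ^ 2 *
          rowDen q S r b ((s : ℤ) * r b))) = -φ r := by
      linear_combination (-φ r) * e
    rw [← e', ← sum_neg_distrib, mul_sum]
    congr 1
    refine sum_congr rfl fun b hb => ?_
    rw [← sum_neg_distrib, mul_sum]
    refine sum_congr rfl fun s _ => ?_
    refine (serreTerm_shift_inv hq hq1 hb s (hint b hb) hM (hm hφ b hb s) (hD b hb s)).trans ?_
    by_cases h1 : (s : ℤ) * r b + 1 = 0
    · rw [hne hφ b hb s h1]; simp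
    · rw [pref_mul_pref_odd hq hq1 hk h1]
      simp only [div_eq_mul_inv, mul_inv]
      ring
  · push Not at hφ
    obtain ⟨c, hc, hcφ⟩ := hφ
    have hφ0 : φ r = 0 := prod_eq_zero hc (by rw [hcφ]; simp)
    rw [hφ0, neg_zero, zero_mul, zero_add]
    refine sum_eq_zero fun b hb => sum_eq_zero fun s _ => ?_
    exact serreTerm_shift_inv_of_eq hq hq1 hb s hc hcφ

/-- The analogue of `sum_serreTerm_inv_even` for the diagonal coefficient `∏ [r i]_+` of the
neighbouring odd row. -/
theorem sum_serreTerm_plus_inv (hq : 0 < q) (hq1 : q ≠ 1) (hk : Even k)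
    (hM : ∀ w, M (-w - 1) = M w) (hm : ∀ b ∈ S, ∀ s : ℤˣ, 0 ≤ M ((s : ℤ) * r b))
    (hD : ∀ b ∈ S, ∀ s : ℤˣ, 0 ≤ rowDen q S r b ((s : ℤ) * r b))
    (hne : ∀ b ∈ S, ∀ s : ℤˣ, (s : ℤ) * r b ≠ 0 ∧ (s : ℤ) * r b + 1 ≠ 0)
    (hL : ∑ b ∈ S, ∑ s : ℤˣ, M ((s : ℤ) * r b) /
        (qNum q (2 * ((s : ℤ) * r b)) * rowDen q S r b ((s : ℤ) * r b)) = -1) :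
    let C := rowCoef q S (fun w => pref q k w * √|M w|) 0
    let φ := fun r : ℕ → ℝ => ∏ i ∈ S, qNumPlus q (r i)
    ∑ σ ∈ stepsOf S, serreTerm (q + q⁻¹) C C φ r σ σ.inv = -φ r := by
  intro C φ
  have hC : C = rowCoef q S (fun w => pref q k w * √|M w| * 1) 0 := by simp only [mul_one]; rfl
  have h00 : serreTerm (q + q⁻¹) C C φ r none (Step.inv none) = 0 := by
    simp [serreTerm, C, rowCoef, Step.inv]
  rw [sum_stepsOf, h00, zero_add]
  have e' : φ r * (∑ b ∈ S, ∑ s : ℤˣ, M ((s : ℤ) * r b) /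
        (qNum q (2 * ((s : ℤ) * r b)) * rowDen q S r b ((s : ℤ) * r b))) = -φ r := by
    rw [hL]; ring
  rw [← e', mul_sum]
  refine sum_congr rfl fun b hb => ?_
  rw [mul_sum]
  refine sum_congr rfl fun s _ => ?_
  rw [hC]
  refine (serreTerm_inv (f := fun x => qNumPlus q x) (h := fun _ => 1) (h' := fun _ => 1)
    hb s (qNumPlus_neg q) _).trans ?_
  rw [show φ r = qNumPlus q (r b) * ∏ i ∈ S.erase b, qNumPlus q (r i) from
    (mul_prod_erase S _ hb).symm, ← even_comp_unit_mul (qNumPlus_neg q) s (r b), hM,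
    abs_of_nonneg (hD b hb s)]
  have hmb := hm b hb s
  obtain ⟨n0, n1⟩ := hne b hb s
  set x := ((s : ℤ) : ℝ) * r b
  have e := sqrt_abs_mul_self (M x)
  rw [abs_of_nonneg hmb] at e
  have e2 := two_mul_qNumPlus_sub hq hq1 x
  have e3 : pref q k x * pref q k (-x - 1) * -((q - q⁻¹) * qNum q (x + 1)) =
      qNumPlus q x * (1 / qNum q (2 * x)) := by
    have h0 := q_sub_inv_ne_zero hq hq1
    have h1 := qNum_ne_zero hq hq1 n0
    have h2 := qNum_ne_zero hq hq1 n1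
    have h3 := qNumPlus_ne_zero hq hq1 x
    rw [pref, pref, if_pos hk, if_pos hk, rpow_sub_rpow_neg hq hq1, rpow_sub_rpow_neg hq hq1,
      qNum_two_mul hq hq1, show -x - 1 = -(x + 1) by ring, qNum_neg]
    field_simp
  rw [abs_of_nonneg hmb]
  generalize ∏ i ∈ S.erase b, qNumPlus q (r i) = Φ
  simp only [div_eq_mul_inv, mul_inv, one_mul] at e3 ⊢
  linear_combination (Φ * (rowDen q S r b x)⁻¹) * (pref q k x * pref q k (-x - 1) *
    (2 * qNumPlus q x - (q + q⁻¹) * qNumPlus q (x + 1)) * e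
    + pref q k x * pref q k (-x - 1) * M x * e2 + M x * e3)

end Row

/-! ### Interlacing arrays -/

/-- Arrays of the numbers `u_{j,k} = m_{j,k} + k/2 - j`, `1 ≤ j ≤ k/2`, `k ≤ n`, that belong to a
tableau. In these coordinates adjacent rows interlace strictly, all entries are positive, and row
`k` lies in `ℤ + (k + 1)/2`. -/
structure Interlacing (n : ℕ) (u : ℕ → ℕ → ℝ) : Prop where
  lat : ∀ k j, k ≤ n → 1 ≤ j → j ≤ k / 2 → ∃ z : ℤ, u k j = z + ((k : ℝ) + 1) / 2
  pos : ∀ k j, k ≤ n → 1 ≤ j → j ≤ k / 2 → 0 < u k j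
  up : ∀ k j, k + 1 ≤ n → 1 ≤ j → j ≤ k / 2 → u k j < u (k + 1) j
  down : ∀ k j, k + 1 ≤ n → 1 ≤ j → j + 1 ≤ (k + 1) / 2 → u (k + 1) (j + 1) < u k j

/-- The positions in the rows `k + 1` and `k - 1`. -/
def nbrs (k : ℕ) : Finset (ℕ × ℕ) :=
  ({k + 1} ×ˢ Icc 1 ((k + 1) / 2)) ∪ ({k - 1} ×ˢ Icc 1 ((k - 1) / 2))

lemma mem_nbrs {k : ℕ} {p : ℕ × ℕ} : p ∈ nbrs k ↔
    (p.1 = k + 1 ∧ 1 ≤ p.2 ∧ p.2 ≤ (k + 1) / 2) ∨ (p.1 = k - 1 ∧ 1 ≤ p.2 ∧ p.2 ≤ (k - 1) / 2) := by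
  rw [nbrs, mem_union, mem_product, mem_product]; simp only [mem_singleton, mem_Icc]

lemma succ_mem_nbrs {k i : ℕ} (h1 : 1 ≤ i) (h2 : i ≤ (k + 1) / 2) : (k + 1, i) ∈ nbrs k :=
  mem_nbrs.2 (Or.inl ⟨rfl, h1, h2⟩)

lemma pred_mem_nbrs {k i : ℕ} (h1 : 1 ≤ i) (h2 : i ≤ (k - 1) / 2) : (k - 1, i) ∈ nbrs k :=
  mem_nbrs.2 (Or.inr ⟨rfl, h1, h2⟩)

lemma disjoint_nbrs (k : ℕ) :
    Disjoint (({k + 1} : Finset ℕ) ×ˢ Icc 1 ((k + 1) / 2)) ({k - 1} ×ˢ Icc 1 ((k - 1) / 2)) := by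
  rw [disjoint_left]
  intro p h1 h2
  simp only [mem_product, mem_singleton] at h1 h2
  omega

lemma card_nbrs (k : ℕ) : #(nbrs k) = (k + 1) / 2 + (k - 1) / 2 := by
  rw [nbrs, card_union_of_disjoint (disjoint_nbrs k)]; simp

lemma prod_nbrs (k : ℕ) (g : ℕ × ℕ → ℝ) :
    ∏ p ∈ nbrs k, g p = (∏ i ∈ Icc 1 ((k + 1) / 2), g (k + 1, i)) *
      ∏ i ∈ Icc 1 ((k - 1) / 2), g (k - 1, i) := by
  rw [nbrs, prod_union (disjoint_nbrs k), prod_product, prod_product]; simp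

/-- A row-`k` entry is a lattice point: two of them that differ are at distance at least `1`. -/
lemma add_one_le_of_lat {c x y : ℝ} (hx : ∃ z : ℤ, x = z + c) (hy : ∃ z : ℤ, y = z + c)
    (h : x < y) : x + 1 ≤ y := by
  obtain ⟨z, rfl⟩ := hx
  obtain ⟨z', rfl⟩ := hy
  have : z < z' := by exact_mod_cast (by linarith : (z : ℝ) < z')
  have : (z : ℝ) + 1 ≤ z' := by exact_mod_cast this
  linarith

lemma add_half_le_of_lat {c c' x y : ℝ} (hx : ∃ z : ℤ, x = z + c) (hy : ∃ z : ℤ, y = z + c')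
    (hc : c' = c + 1 / 2 ∨ c = c' + 1 / 2) (h : x < y) : x + 1 / 2 ≤ y := by
  obtain ⟨z, rfl⟩ := hx
  obtain ⟨z', rfl⟩ := hy
  rcases hc with rfl | rfl
  · have : z < z' + 1 := by
      have : (z : ℝ) < ((z' + 1 : ℤ) : ℝ) := by push_cast; linarith
      exact_mod_cast this
    have : (z : ℝ) ≤ z' := by exact_mod_cast (by omega : z ≤ z')
    linarith
  · have : (z : ℝ) < z' := by linarith
    have : z < z' := by exact_mod_cast this
    have : (z : ℝ) + 1 ≤ z' := by exact_mod_cast this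
    linarith

namespace Interlacing

variable {n : ℕ} {u : ℕ → ℕ → ℝ} (hu : Interlacing n u) {k : ℕ}
include hu

lemma half_le {j : ℕ} (hk : k ≤ n) (h1 : 1 ≤ j) (h2 : j ≤ k / 2) : 1 / 2 ≤ u k j := by
  obtain ⟨z, hz⟩ := hu.lat k j hk h1 h2
  have := hu.pos k j hk h1 h2
  have h3 : 0 < 2 * z + k + 1 := by
    have : (0 : ℝ) < ((2 * z + k + 1 : ℤ) : ℝ) := by push_cast; linarith
    exact_mod_cast this
  have h4 : (1 : ℝ) ≤ ((2 * z + k + 1 : ℤ) : ℝ) := by exact_mod_cast h3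
  push_cast at h4
  linarith

lemma up_half {j : ℕ} (hk : k + 1 ≤ n) (h1 : 1 ≤ j) (h2 : j ≤ k / 2) :
    u k j + 1 / 2 ≤ u (k + 1) j :=
  add_half_le_of_lat (hu.lat k j (by omega) h1 h2) (hu.lat (k + 1) j hk h1 (by omega))
    (Or.inl (by push_cast; ring)) (hu.up k j hk h1 h2)

lemma down_half {j : ℕ} (hk : k + 1 ≤ n) (h1 : 1 ≤ j) (h2 : j + 1 ≤ (k + 1) / 2) :
    u (k + 1) (j + 1) + 1 / 2 ≤ u k j :=
  add_half_le_of_lat (hu.lat (k + 1) (j + 1) hk (by omega) h2) (hu.lat k j (by omega) h1 (by omega))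
    (Or.inr (by push_cast; ring)) (hu.down k j hk h1 h2)

lemma row_gap {i j : ℕ} (hk : k + 1 ≤ n) (h1 : 1 ≤ i) (hij : i < j) (h2 : j ≤ k / 2) :
    u k j + 1 ≤ u k i := by
  induction j, hij using Nat.le_induction with
  | base =>
    have e1 := hu.up_half hk (j := i + 1) (by omega) h2
    have e2 := hu.down_half hk (j := i) h1 (by omega)
    linarith
  | succ j hij ih =>
    have e1 := hu.up_half hk (j := j + 1) (by omega) h2
    have e2 := hu.down_half hk (j := j) (by omega) (by omega)
    have := ih (by omega)
    linarith

/-- The entries above the `b`-th entry of row `k`. -/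
lemma le_nbr {b : ℕ} (hk1 : 1 ≤ k) (hk : k + 1 ≤ n) (h1 : 1 ≤ b) (h2 : b ≤ k / 2) {p : ℕ × ℕ}
    (hp : p ∈ nbrs k) (h : (p.1 = k + 1 ∧ p.2 ≤ b) ∨ (p.1 = k - 1 ∧ p.2 < b)) :
    u k b + 1 / 2 ≤ u p.1 p.2 := by
  obtain ⟨p1, i⟩ := p
  rw [mem_nbrs] at hp
  simp only at hp h ⊢
  rcases h with ⟨rfl, h⟩ | ⟨rfl, h⟩
  · have e1 := hu.up_half hk (j := i) (by omega) (by omega)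
    rcases h.eq_or_lt with rfl | h
    · exact e1
    · have := hu.row_gap hk (i := i) (j := b) (by omega) h h2
      linarith
  · obtain ⟨k, rfl⟩ : ∃ k', k = k' + 1 := ⟨k - 1, by omega⟩
    simp only [add_tsub_cancel_right] at hp ⊢
    have e1 := hu.down_half (k := k) (by omega) (j := i) (by omega) (by omega)
    rcases (show i + 1 ≤ b by omega).eq_or_lt with rfl | h
    · exact e1
    · have := hu.row_gap hk (i := i + 1) (j := b) (by omega) h h2
      linarith

/-- The entries below the `b`-th entry of row `k`. -/
lemma nbr_le {b : ℕ} (hk1 : 1 ≤ k) (hk : k + 1 ≤ n) (h1 : 1 ≤ b) (h2 : b ≤ k / 2) {p : ℕ × ℕ}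
    (hp : p ∈ nbrs k) (h : (p.1 = k + 1 ∧ b < p.2) ∨ (p.1 = k - 1 ∧ b ≤ p.2)) :
    u p.1 p.2 ≤ u k b - 1 / 2 := by
  obtain ⟨p1, i⟩ := p
  rw [mem_nbrs] at hp
  simp only at hp h ⊢
  rcases h with ⟨rfl, h⟩ | ⟨rfl, h⟩
  · obtain ⟨i, rfl⟩ : ∃ i', i = i' + 1 := ⟨i - 1, by omega⟩
    have e1 := hu.down_half hk (j := i) (by omega) (by omega)
    rcases (show b ≤ i by omega).eq_or_lt with rfl | h
    · linarith
    · have := hu.row_gap hk (i := b) (j := i) (by omega) h (by omega)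
      linarith
  · obtain ⟨k, rfl⟩ : ∃ k', k = k' + 1 := ⟨k - 1, by omega⟩
    simp only [add_tsub_cancel_right] at hp ⊢
    have e1 := hu.up_half (k := k) (by omega) (j := i) (by omega) (by omega)
    rcases h.eq_or_lt with rfl | h
    · linarith
    · have := hu.row_gap hk (i := b) (j := i) (by omega) h (by omega)
      linarith

lemma mem_nbrs_pos {p : ℕ × ℕ} (hk : k + 1 ≤ n) (hp : p ∈ nbrs k) :
    1 / 2 ≤ u p.1 p.2 := by
  rw [mem_nbrs] at hp
  rcases hp with ⟨h, h1, h2⟩ | ⟨h, h1, h2⟩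
  · exact hu.half_le (by omega) h1 (by omega)
  · exact hu.half_le (by omega) h1 (by omega)

lemma mem_nbrs_lat {p : ℕ × ℕ} (hk1 : 1 ≤ k) (hk : k + 1 ≤ n) (hp : p ∈ nbrs k) :
    ∃ z : ℤ, u p.1 p.2 = z + ((k : ℝ) / 2) := by
  rw [mem_nbrs] at hp
  rcases hp with ⟨h, h1, h2⟩ | ⟨h, h1, h2⟩
  · obtain ⟨z, hz⟩ := hu.lat p.1 p.2 (by omega) h1 (by omega)
    refine ⟨z + 1, ?_⟩
    rw [hz, h]; push_cast; ring
  · obtain ⟨z, hz⟩ := hu.lat p.1 p.2 (by omega) h1 (by omega)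
    refine ⟨z, ?_⟩
    rw [hz, h, Nat.cast_sub hk1]; push_cast; ring

/-- If two entries of row `k` are at distance `1`, the entries between them in the rows `k + 1` and
`k - 1` are determined. -/
lemma squeeze {b c : ℕ} (hk1 : 1 ≤ k) (hk : k + 1 ≤ n) (h1 : 1 ≤ b) (hbc : b < c) (h2 : c ≤ k / 2)
    (h : u k b = u k c + 1) :
    c = b + 1 ∧ u (k + 1) (b + 1) = u k b - 1 / 2 ∧ u (k - 1) b = u k b - 1 / 2 := by
  have hc : c = b + 1 := by
    by_contra hne
    have e1 := hu.row_gap hk (i := b) (j := b + 1) h1 (by omega) (by omega)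
    have e2 := hu.row_gap hk (i := b + 1) (j := c) (by omega) (by omega) h2
    linarith
  subst hc
  refine ⟨rfl, ?_, ?_⟩
  · have e1 := hu.up_half hk (j := b + 1) (by omega) h2
    have e2 := hu.down_half hk (j := b) h1 (by omega)
    linarith
  · have e1 := hu.le_nbr hk1 hk (b := b + 1) (by omega) h2 (p := (k - 1, b))
      (pred_mem_nbrs h1 (by omega)) (Or.inr ⟨rfl, by simp⟩)
    have e2 := hu.nbr_le hk1 hk (b := b) h1 (by omega) (p := (k - 1, b))
      (pred_mem_nbrs h1 (by omega)) (Or.inr ⟨rfl, le_rfl⟩)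
    simp only at e1 e2
    linarith

end Interlacing

lemma unit_cast_eq (s : ℤˣ) : ((s : ℤ) : ℝ) = 1 ∨ ((s : ℤ) : ℝ) = -1 := by
  rcases Int.units_eq_one_or s with rfl | rfl <;> simp

lemma abs_unit_mul_add_half {x : ℝ} (hx : 1 / 2 ≤ x) (s : ℤˣ) :
    |((s : ℤ) : ℝ) * x + 1 / 2| = x + ((s : ℤ) : ℝ) / 2 := by
  rcases unit_cast_eq s with h | h <;> rw [h]
  · rw [abs_of_nonneg (by linarith)]; ring
  · rw [abs_of_nonpos (by linarith)]; ring

lemma abs_unit_mul (s : ℤˣ) (x : ℝ) : |((s : ℤ) : ℝ) * x| = |x| := by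
  rcases unit_cast_eq s with h | h <;> rw [h] <;> simp

lemma abs_unit_mul_add_one (s : ℤˣ) (x : ℝ) :
    |((s : ℤ) : ℝ) * x + 1| = |x + ((s : ℤ) : ℝ)| := by
  rcases unit_cast_eq s with h | h <;> rw [h]
  · simp
  · rw [← abs_neg]; congr 1; ring

lemma prod_Icc_one_succ (m : ℕ) (f : ℕ → ℝ) :
    ∏ i ∈ Icc 1 (m + 1), f i = f 1 * ∏ i ∈ Icc 1 m, f (i + 1) := by
  induction m with
  | zero => simp
  | succ m ih => rw [prod_Icc_succ_top (by omega), ih, prod_Icc_succ_top (by omega), mul_assoc]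

/-- The signs in a product over the rows adjacent to row `k` cancel: each gap between two
consecutive entries of row `k` contains one entry of row `k + 1` and one of row `k - 1`. -/
lemma prod_nbrs_sub_nonneg {k : ℕ} (hk : 1 ≤ k) (b : ℕ) (hb : 1 ≤ b) (T : ℕ × ℕ → ℝ) (t : ℝ)
    (hge : ∀ p ∈ nbrs k, ((p.1 = k + 1 ∧ p.2 ≤ b) ∨ (p.1 = k - 1 ∧ p.2 < b)) → t ≤ T p)
    (hle : ∀ p ∈ nbrs k, ((p.1 = k + 1 ∧ b < p.2) ∨ (p.1 = k - 1 ∧ b ≤ p.2)) → T p ≤ t) :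
    0 ≤ ∏ p ∈ nbrs k, (T p - t) := by
  rw [prod_nbrs, show (k + 1) / 2 = (k - 1) / 2 + 1 by omega, prod_Icc_one_succ, mul_assoc,
    ← prod_mul_distrib]
  refine mul_nonneg ?_ (prod_nonneg fun i hi => ?_)
  · exact sub_nonneg.2 (hge _ (succ_mem_nbrs le_rfl (by omega)) (Or.inl ⟨rfl, hb⟩))
  · rw [mem_Icc] at hi
    have m1 : (k + 1, i + 1) ∈ nbrs k := succ_mem_nbrs (by omega) (by omega)
    have m2 : (k - 1, i) ∈ nbrs k := pred_mem_nbrs hi.1 hi.2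
    rcases lt_or_ge i b with h | h
    · exact mul_nonneg (sub_nonneg.2 (hge _ m1 (Or.inl ⟨rfl, h⟩)))
        (sub_nonneg.2 (hge _ m2 (Or.inr ⟨rfl, h⟩)))
    · exact mul_nonneg_of_nonpos_of_nonpos (sub_nonpos.2 (hle _ m1 (Or.inl ⟨rfl, by simp; omega⟩)))
        (sub_nonpos.2 (hle _ m2 (Or.inr ⟨rfl, h⟩)))

/-! ### Lagrange's identity for the entries of a row -/

/-- The product of the differences between the node `[s r_b + 1/2]²` and the other nodes; the factor
`[2 s r_b]` comes from the node `(b, -s)`. -/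
lemma prod_nodes {q : ℝ} (hq : 0 < q) (hq1 : q ≠ 1) (S : Finset ℕ) (r : ℕ → ℝ) {b : ℕ} (hb : b ∈ S)
    (s : ℤˣ) :
    ∏ j ∈ (S ×ˢ (univ : Finset ℤˣ)).erase (b, s),
      (qNum q ((s : ℤ) * r b + 1 / 2) ^ 2 - qNum q ((j.2 : ℤ) * r j.1 + 1 / 2) ^ 2)
      = qNum q (2 * ((s : ℤ) * r b)) * rowDen q S r b ((s : ℤ) * r b) := by
  have hsplit : (S ×ˢ (univ : Finset ℤˣ)).erase (b, s)
      = insert (b, -s) ((S.erase b) ×ˢ (univ : Finset ℤˣ)) := by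
    ext ⟨i, t⟩
    simp only [mem_erase, mem_insert, mem_product, mem_univ, and_true, Prod.mk.injEq, ne_eq]
    have := @Int.units_ne_iff_eq_neg t s
    by_cases hi : i = b
    · subst hi; simp only [hb, true_and, and_true, not_true, or_false]; exact this
    · simp [hi]
  rw [hsplit, prod_insert (by simp), prod_product, rowDen]
  congr 1
  · rw [← qNum_sq_sub_sq_eq hq hq1]
    congr 1
    rw [← qNum_sq_neg]
    congr 2
    push_cast; ring
  · refine prod_congr rfl fun i _ => ?_
    rw [show (univ : Finset ℤˣ) = {1, -1} from rfl, prod_pair (by decide)]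
    set x := ((s : ℤ) : ℝ) * r b
    simp only [Units.val_one, Int.cast_one, one_mul, Units.val_neg, Int.cast_neg, neg_mul]
    rw [← qNum_add_mul_qNum_sub hq hq1, ← qNum_add_mul_qNum_sub hq hq1,
      ← qNum_add_mul_qNum_sub hq hq1, ← qNum_add_mul_qNum_sub hq hq1,
      show x + 1 / 2 + (r i + 1 / 2) = r i + (x + 1) by ring,
      show x + 1 / 2 - (r i + 1 / 2) = -(r i - x) by ring,
      show x + 1 / 2 + (-r i + 1 / 2) = -(r i - (x + 1)) by ring,
      show x + 1 / 2 - (-r i + 1 / 2) = r i + x by ring, qNum_neg, qNum_neg]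
    ring

/-- The product over the entries of the adjacent rows other than the one at `p` in the coefficient
of the step `w → w + 1` in row `k`. -/
def restProd (q : ℝ) (k : ℕ) (u : ℕ → ℕ → ℝ) (p : ℕ × ℕ) (w : ℝ) : ℝ :=
  ∏ x ∈ (nbrs k).erase p, (qNum q (u x.1 x.2) ^ 2 - qNum q (w + 1 / 2) ^ 2)

lemma restProd_neg (q : ℝ) (k : ℕ) (u : ℕ → ℕ → ℝ) (p : ℕ × ℕ) (w : ℝ) :
    restProd q k u p (-w - 1) = restProd q k u p w := by
  rw [restProd, show -w - 1 + 1 / 2 = -(w + 1 / 2) by ring, qNum_sq_neg, restProd]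

/-- The neighbour that lies in the gap at which the node `(b, s)` may collide with another one. -/
def gapNbr (k : ℕ) (x : ℕ × ℤˣ) : ℕ × ℕ :=
  if x.2 = 1 then (k - 1, x.1 - 1) else (k + 1, x.1 + 1)

namespace Interlacing

variable {n : ℕ} {u : ℕ → ℕ → ℝ} (hu : Interlacing n u) {k : ℕ} {q : ℝ}
include hu

lemma rowDen_nonneg (hq : 0 < q) (hq1 : q ≠ 1) (hk : k + 1 ≤ n) {b : ℕ} (hb : b ∈ Icc 1 (k / 2))
    (s : ℤˣ) : 0 ≤ rowDen q (Icc 1 (k / 2)) (u k) b ((s : ℤ) * u k b) := by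
  refine prod_nonneg fun i hi => ?_
  rw [mem_erase, mem_Icc] at hi
  rw [mem_Icc] at hb
  have pb := hu.half_le (by omega) hb.1 hb.2
  have pi := hu.half_le (by omega) hi.2.1 hi.2.2
  rcases lt_or_gt_of_ne hi.1 with h | h
  · have := hu.row_gap hk hi.2.1 h hb.2
    refine mul_nonneg (sub_nonneg.2 (qNum_sq_le hq hq1 ?_)) (sub_nonneg.2 (qNum_sq_le hq hq1 ?_))
    · rw [abs_unit_mul, abs_of_pos (by linarith), abs_of_pos (by linarith)]; linarith
    · rw [abs_unit_mul_add_one, abs_of_pos (a := u k i) (by linarith)]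
      rcases unit_cast_eq s with h | h <;> rw [h, abs_le] <;> constructor <;> linarith
  · have := hu.row_gap hk hb.1 h hi.2.2
    refine mul_nonneg_of_nonpos_of_nonpos (sub_nonpos.2 (qNum_sq_le hq hq1 ?_))
      (sub_nonpos.2 (qNum_sq_le hq hq1 ?_))
    · rw [abs_unit_mul, abs_of_pos (by linarith), abs_of_pos (by linarith)]; linarith
    · rw [abs_unit_mul_add_one, abs_of_pos (a := u k i) (by linarith)]
      refine le_trans ?_ (le_abs_self _)
      rcases unit_cast_eq s with h | h <;> rw [h] <;> linarith

/-- Two entries of row `k` at distance `1` have two equal neighbours between them, so that the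
product over the neighbours vanishes there even if one factor is removed. -/
lemma restProd_eq_zero (hk1 : 1 ≤ k) (hk : k + 1 ≤ n) {b c : ℕ} (h1 : 1 ≤ b) (hbc : b < c)
    (h2 : c ≤ k / 2) (h : u k b = u k c + 1) (p : ℕ × ℕ) {w : ℝ}
    (hw : qNum q (w + 1 / 2) ^ 2 = qNum q (u k b - 1 / 2) ^ 2) : restProd q k u p w = 0 := by
  obtain ⟨rfl, e1, e2⟩ := hu.squeeze hk1 hk h1 hbc h2 h
  by_cases hp : p = (k + 1, b + 1)
  · refine prod_eq_zero (i := (k - 1, b)) (mem_erase.2 ⟨?_, pred_mem_nbrs h1 (by omega)⟩) ?_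
    · rw [hp]; intro e; simp only [Prod.mk.injEq] at e; omega
    · rw [hw, e2, sub_self]
  · refine prod_eq_zero (i := (k + 1, b + 1))
      (mem_erase.2 ⟨Ne.symm hp, succ_mem_nbrs (by omega) (by omega)⟩) ?_
    rw [hw, e1, sub_self]

/-- For two steps of different components, either `x = s u_b` and `y = t u_c` are at distance
greater than `1`, so that `[x - y + 1]` and `[1 - x + y]` have opposite signs, or one of the steps is
blocked. -/
lemma steps_generic_of_lt (hk1 : 1 ≤ k) (hk : k + 1 ≤ n) {b c : ℕ} (h1 : 1 ≤ b) (hbc : b < c)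
    (h2 : c ≤ k / 2) (p : ℕ × ℕ) (s t : ℤˣ) :
    1 < (s : ℤ) * u k b - (t : ℤ) * u k c ∨ (s : ℤ) * u k b - (t : ℤ) * u k c < -1 ∨
      restProd q k u p ((s : ℤ) * u k b) = 0 ∨ restProd q k u p ((t : ℤ) * u k c) = 0 := by
  have e1 := hu.row_gap hk h1 hbc h2
  have pc := hu.half_le (by omega) (by omega) h2
  rcases Int.units_eq_one_or s with rfl | rfl <;> rcases Int.units_eq_one_or t with rfl | rfl <;>
    simp only [Units.val_one, Int.cast_one, one_mul, Units.val_neg, Int.cast_neg, neg_mul]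
  · rcases e1.lt_or_eq with h | h
    · left; linarith
    · right; right; right
      refine hu.restProd_eq_zero hk1 hk h1 hbc h2 h.symm p ?_
      congr 2; linarith
  · left; linarith
  · right; left; linarith
  · rcases e1.lt_or_eq with h | h
    · right; left; linarith
    · right; right; left
      refine hu.restProd_eq_zero hk1 hk h1 hbc h2 h.symm p ?_
      rw [← qNum_sq_neg]; congr 2; linarith

lemma steps_generic (hk1 : 1 ≤ k) (hk : k + 1 ≤ n) (p : ℕ × ℕ) :
    ∀ b ∈ Icc 1 (k / 2), ∀ c ∈ Icc 1 (k / 2), b ≠ c → ∀ s t : ℤˣ,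
      1 < (s : ℤ) * u k b - (t : ℤ) * u k c ∨ (s : ℤ) * u k b - (t : ℤ) * u k c < -1 ∨
      restProd q k u p ((s : ℤ) * u k b) = 0 ∨ restProd q k u p ((t : ℤ) * u k c) = 0 := by
  intro b hb c hc hbc s t
  rw [mem_Icc] at hb hc
  rcases lt_or_gt_of_ne hbc with h | h
  · exact hu.steps_generic_of_lt hk1 hk hb.1 h hc.2 p s t
  · rcases hu.steps_generic_of_lt (q := q) hk1 hk hc.1 h hb.2 p t s with h | h | h | h
    · right; left; linarith
    · left; linarith
    · exact Or.inr (Or.inr (Or.inr h))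
    · exact Or.inr (Or.inr (Or.inl h))

lemma exists_int_sub (hk1 : 1 ≤ k) (hk : k + 1 ≤ n) {p : ℕ × ℕ} (hp : p ∈ nbrs k) (s' : ℤˣ) :
    ∀ b ∈ Icc 1 (k / 2), ∀ s : ℤˣ, ∃ z : ℤ,
      (s' : ℤ) * u p.1 p.2 + 1 / 2 - (s : ℤ) * u k b = z := by
  intro b hb s
  rw [mem_Icc] at hb
  obtain ⟨z, hz⟩ := hu.mem_nbrs_lat hk1 hk hp
  obtain ⟨z', hz'⟩ := hu.lat k b (by omega) hb.1 hb.2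
  rw [hz, hz']
  rcases Int.units_eq_one_or s with rfl | rfl <;> rcases Int.units_eq_one_or s' with rfl | rfl
  · exact ⟨z - z', by push_cast; ring⟩
  · exact ⟨-z - z' - k, by push_cast; ring⟩
  · exact ⟨z + z' + k + 1, by push_cast; ring⟩
  · exact ⟨-z + z' + 1, by push_cast; ring⟩

/-- An entry moved by half a step stays on the same side of the entries of row `k`, unless it
meets one. -/
lemma moved_nbr (hk1 : 1 ≤ k) (hk : k + 1 ≤ n) {p : ℕ × ℕ} (hp : p ∈ nbrs k) (s' : ℤˣ) {b : ℕ}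
    (hb : b ∈ Icc 1 (k / 2)) (hne : u k b ≠ u p.1 p.2 + ((s' : ℤ) : ℝ) / 2) :
    (((p.1 = k + 1 ∧ p.2 ≤ b) ∨ (p.1 = k - 1 ∧ p.2 < b)) →
      u k b + 1 ≤ u p.1 p.2 + ((s' : ℤ) : ℝ) / 2) ∧
    (((p.1 = k + 1 ∧ b < p.2) ∨ (p.1 = k - 1 ∧ b ≤ p.2)) →
      u p.1 p.2 + ((s' : ℤ) : ℝ) / 2 ≤ u k b - 1) := by
  rw [mem_Icc] at hb
  have hl1 : ∃ z : ℤ, u p.1 p.2 + ((s' : ℤ) : ℝ) / 2 = z + ((k : ℝ) + 1) / 2 := by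
    obtain ⟨z, hz⟩ := hu.mem_nbrs_lat hk1 hk hp
    rcases unit_cast_eq s' with h | h
    · exact ⟨z, by rw [hz, h]; ring⟩
    · exact ⟨z - 1, by rw [hz, h]; push_cast; ring⟩
  have hl2 := hu.lat k b (by omega) hb.1 hb.2
  have hs : -(1 / 2) ≤ ((s' : ℤ) : ℝ) / 2 ∧ ((s' : ℤ) : ℝ) / 2 ≤ 1 / 2 := by
    rcases unit_cast_eq s' with h | h <;> rw [h] <;> constructor <;> norm_num
  constructor
  · intro h
    have := hu.le_nbr hk1 hk hb.1 hb.2 hp h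
    exact add_one_le_of_lat hl2 hl1 (lt_of_le_of_ne (by linarith) hne)
  · intro h
    have := hu.nbr_le hk1 hk hb.1 hb.2 hp h
    have := add_one_le_of_lat hl1 hl2 (lt_of_le_of_ne (by linarith) (Ne.symm hne))
    linarith

/-- The sign of the product over the neighbours, with the entry at `p` moved by half a step: by
interlacing it agrees with the sign of `[a]² - [u_b]²`. -/
lemma restProd_sign (hq : 0 < q) (hq1 : q ≠ 1) (hk1 : 1 ≤ k) (hk : k + 1 ≤ n) {p : ℕ × ℕ}
    (hp : p ∈ nbrs k) (s' : ℤˣ) {b : ℕ} (hb : b ∈ Icc 1 (k / 2)) (s : ℤˣ)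
    (hne : qNum q (u k b) ^ 2 ≠ qNum q ((s' : ℤ) * u p.1 p.2 + 1 / 2) ^ 2) :
    0 ≤ (qNum q ((s' : ℤ) * u p.1 p.2 + 1 / 2) ^ 2 - qNum q ((s : ℤ) * u k b) ^ 2) *
      restProd q k u p ((s : ℤ) * u k b) := by
  have hb' := mem_Icc.1 hb
  have pb := hu.half_le (by omega) hb'.1 hb'.2
  have pp := hu.mem_nbrs_pos hk hp
  have habs := abs_unit_mul_add_half pp s'
  have habs' := abs_unit_mul_add_half pb s
  have hs : -(1 / 2) ≤ ((s : ℤ) : ℝ) / 2 ∧ ((s : ℤ) : ℝ) / 2 ≤ 1 / 2 := by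
    rcases unit_cast_eq s with h | h <;> rw [h] <;> constructor <;> norm_num
  have hs' : -(1 / 2) ≤ ((s' : ℤ) : ℝ) / 2 ∧ ((s' : ℤ) : ℝ) / 2 ≤ 1 / 2 := by
    rcases unit_cast_eq s' with h | h <;> rw [h] <;> constructor <;> norm_num
  have hne' : u k b ≠ u p.1 p.2 + ((s' : ℤ) : ℝ) / 2 := by
    intro e
    refine hne ((qNum_sq_eq_iff hq hq1).2 ?_)
    rw [habs, ← e, abs_of_pos (by linarith)]
  obtain ⟨m1, m2⟩ := hu.moved_nbr hk1 hk hp s' hb hne'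
  set t := qNum q ((s : ℤ) * u k b + 1 / 2) ^ 2 with ht
  set A := qNum q ((s' : ℤ) * u p.1 p.2 + 1 / 2) ^ 2 with hA
  -- the product over all neighbours, with the entry at `p` moved by half a step
  have hprod : 0 ≤ (A - t) * restProd q k u p ((s : ℤ) * u k b) := by
    have h0 := prod_nbrs_sub_nonneg hk1 b hb'.1
      (Function.update (fun x : ℕ × ℕ => qNum q (u x.1 x.2) ^ 2) p A) t ?_ ?_
    · rw [← mul_prod_erase _ _ hp, Function.update_self] at h0
      convert h0 using 2
      refine prod_congr rfl fun x hx => ?_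
      rw [Function.update_of_ne (mem_erase.1 hx).1]
    · intro x hx h
      by_cases hxp : x = p
      · subst hxp
        rw [Function.update_self]
        refine qNum_sq_le hq hq1 ?_
        rw [habs, habs']
        have := m1 h
        linarith
      · rw [Function.update_of_ne hxp]
        refine qNum_sq_le hq hq1 ?_
        have := hu.le_nbr hk1 hk hb'.1 hb'.2 hx h
        rw [habs', abs_of_pos (by linarith)]
        linarith
    · intro x hx h
      by_cases hxp : x = p
      · subst hxp
        rw [Function.update_self]
        refine qNum_sq_le hq hq1 ?_
        rw [habs, habs']
        have := m2 h
        linarith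
      · rw [Function.update_of_ne hxp]
        refine qNum_sq_le hq hq1 ?_
        have := hu.nbr_le hk1 hk hb'.1 hb'.2 hx h
        have := hu.mem_nbrs_pos hk hx
        rw [habs', abs_of_pos (by linarith)]
        linarith
  have hside : ((p.1 = k + 1 ∧ p.2 ≤ b) ∨ (p.1 = k - 1 ∧ p.2 < b)) ∨
      ((p.1 = k + 1 ∧ b < p.2) ∨ (p.1 = k - 1 ∧ b ≤ p.2)) := by
    rw [mem_nbrs] at hp; omega
  have hw : |((s : ℤ) : ℝ) * u k b| = u k b := by rw [abs_unit_mul, abs_of_pos (by linarith)]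
  rcases hside with h | h
  · have hm := m1 h
    have l1 : t < A := qNum_sq_lt hq hq1 (by rw [habs, habs']; linarith)
    have l2 : qNum q ((s : ℤ) * u k b) ^ 2 < A := qNum_sq_lt hq hq1 (by rw [habs, hw]; linarith)
    have := nonneg_of_mul_nonneg_right hprod (sub_pos.2 l1)
    exact mul_nonneg (by linarith) this
  · have hm := m2 h
    have l1 : A < t := qNum_sq_lt hq hq1 (by rw [habs, habs']; linarith)
    have l2 : A < qNum q ((s : ℤ) * u k b) ^ 2 := qNum_sq_lt hq hq1 (by rw [habs, hw]; linarith)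
    have : restProd q k u p ((s : ℤ) * u k b) ≤ 0 := by
      by_contra hneg
      push Not at hneg
      have := mul_neg_of_neg_of_pos (sub_neg.2 l1) hneg
      linarith
    exact mul_nonneg_of_nonpos_of_nonpos (by linarith) this

lemma prod_nbrs_nonneg (hq : 0 < q) (hq1 : q ≠ 1) (hk1 : 1 ≤ k) (hk : k + 1 ≤ n) {b : ℕ}
    (hb : b ∈ Icc 1 (k / 2)) (s : ℤˣ) :
    0 ≤ ∏ x ∈ nbrs k, (qNum q (u x.1 x.2) ^ 2 - qNum q ((s : ℤ) * u k b + 1 / 2) ^ 2) := by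
  have hb' := mem_Icc.1 hb
  have pb := hu.half_le (by omega) hb'.1 hb'.2
  have habs' := abs_unit_mul_add_half pb s
  have hs : -(1 / 2) ≤ ((s : ℤ) : ℝ) / 2 ∧ ((s : ℤ) : ℝ) / 2 ≤ 1 / 2 := by
    rcases unit_cast_eq s with h | h <;> rw [h] <;> constructor <;> norm_num
  refine prod_nbrs_sub_nonneg hk1 b hb'.1 (fun x => qNum q (u x.1 x.2) ^ 2) _ ?_ ?_
  · intro x hx h
    refine qNum_sq_le hq hq1 ?_
    have := hu.le_nbr hk1 hk hb'.1 hb'.2 hx h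
    rw [habs', abs_of_pos (by linarith)]
    linarith
  · intro x hx h
    refine qNum_sq_le hq hq1 ?_
    have := hu.nbr_le hk1 hk hb'.1 hb'.2 hx h
    have := hu.mem_nbrs_pos hk hx
    rw [habs', abs_of_pos (by linarith)]
    linarith

/-- If two nodes collide, then two entries of row `k` are at distance `1`, and the neighbours squeezed
between them have the value of the node. The hypothesis `hp` says that `p` is not one of these
neighbours, so that they survive in the product without `p`. -/
lemma gapNbr_of_collision (hq : 0 < q) (hq1 : q ≠ 1) (hk1 : 1 ≤ k) (hk : k + 1 ≤ n) {p : ℕ × ℕ}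
    (hp : ∀ b c, 1 ≤ b → b < c → c ≤ k / 2 → u k b = u k c + 1 →
      p ≠ (k + 1, b + 1) ∧ p ≠ (k - 1, b))
    {b c : ℕ} (hb : b ∈ Icc 1 (k / 2)) (hc : c ∈ Icc 1 (k / 2)) {s t : ℤˣ} (hne : (c, t) ≠ (b, s))
    (h : qNum q ((t : ℤ) * u k c + 1 / 2) ^ 2 = qNum q ((s : ℤ) * u k b + 1 / 2) ^ 2) :
    gapNbr k (b, s) ∈ (nbrs k).erase p ∧
      qNum q (u (gapNbr k (b, s)).1 (gapNbr k (b, s)).2) ^ 2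
        = qNum q ((s : ℤ) * u k b + 1 / 2) ^ 2 := by
  rw [mem_Icc] at hb hc
  have pb := hu.half_le (by omega) hb.1 hb.2
  have pc := hu.half_le (by omega) hc.1 hc.2
  rw [qNum_sq_eq_iff hq hq1, abs_unit_mul_add_half pb, abs_unit_mul_add_half pc] at h
  have hbc : b ≠ c := by
    rintro rfl
    have : ((t : ℤ) : ℝ) = ((s : ℤ) : ℝ) := by linarith
    have : t = s := by exact_mod_cast this
    exact hne (by rw [this])
  rcases lt_or_gt_of_ne hbc with hlt | hlt
  · have e := hu.row_gap hk hb.1 hlt hc.2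
    have hs : s = -1 ∧ u k b = u k c + 1 := by
      rcases Int.units_eq_one_or s with rfl | rfl <;>
        rcases Int.units_eq_one_or t with rfl | rfl <;> push_cast at h
      · linarith
      · linarith
      · exact ⟨rfl, by linarith⟩
      · linarith
    obtain ⟨rfl, e⟩ := hs
    obtain ⟨rfl, e1, e2⟩ := hu.squeeze hk1 hk hb.1 hlt hc.2 e
    have hg : gapNbr k (b, -1) = (k + 1, b + 1) := by
      rw [gapNbr, if_neg (show (-1 : ℤˣ) ≠ 1 by decide)]
    rw [hg]
    refine ⟨mem_erase.2 ⟨(hp b (b + 1) hb.1 hlt hc.2 e).1.symm,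
      succ_mem_nbrs (by omega) (by omega)⟩, ?_⟩
    rw [e1, ← qNum_sq_neg]
    congr 2
    push_cast; ring
  · have e := hu.row_gap hk hc.1 hlt hb.2
    have hs : s = 1 ∧ u k c = u k b + 1 := by
      rcases Int.units_eq_one_or s with rfl | rfl <;>
        rcases Int.units_eq_one_or t with rfl | rfl <;> push_cast at h
      · linarith
      · exact ⟨rfl, by linarith⟩
      · linarith
      · linarith
    obtain ⟨rfl, e⟩ := hs
    obtain ⟨rfl, e1, e2⟩ := hu.squeeze hk1 hk hc.1 hlt hb.2 e
    have hg : gapNbr k (c + 1, 1) = (k - 1, c) := by rw [gapNbr, if_pos rfl, Nat.add_sub_cancel]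
    rw [hg]
    refine ⟨mem_erase.2 ⟨(hp c (c + 1) hc.1 hlt hb.2 e).2.symm,
      pred_mem_nbrs hc.1 (by omega)⟩, ?_⟩
    rw [e2, e]
    congr 2
    push_cast; ring

omit hu in
lemma gapNbr_injOn {b b' : ℕ} (hb : 1 ≤ b) (hb' : 1 ≤ b') {s s' : ℤˣ}
    (h : gapNbr k (b, s) = gapNbr k (b', s')) : (b, s) = (b', s') := by
  have h1 : (-1 : ℤˣ) ≠ 1 := by decide
  rcases Int.units_eq_one_or s with rfl | rfl <;> rcases Int.units_eq_one_or s' with rfl | rfl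
  · have e := (Prod.ext_iff.1 h).2
    simp only [gapNbr, if_true] at e
    rw [show b = b' by omega]
  · have e := (Prod.ext_iff.1 h).1
    simp only [gapNbr, if_true, if_neg h1] at e
    omega
  · have e := (Prod.ext_iff.1 h).1
    simp only [gapNbr, if_true, if_neg h1] at e
    omega
  · have e := (Prod.ext_iff.1 h).2
    simp only [gapNbr, if_neg h1] at e
    rw [show b = b' by omega]

end Interlacing

open Polynomial in
lemma natDegree_prod_X_sub_C' {κ : Type*} (A : Finset κ) (V : κ → ℝ) :
    (∏ a ∈ A, (X - C (V a))).natDegree = #A := by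
  rw [natDegree_prod_of_monic _ _ fun a _ => monic_X_sub_C _]; simp

lemma prod_sub_comm {κ : Type*} (A : Finset κ) (V : κ → ℝ) (z : ℝ) :
    ∏ a ∈ A, (z - V a) = (-1) ^ #A * ∏ a ∈ A, (V a - z) := by
  rw [← prod_const, ← prod_mul_distrib]
  exact prod_congr rfl fun a _ => by ring

namespace Interlacing

variable {n : ℕ} {u : ℕ → ℕ → ℝ} (hu : Interlacing n u) {k : ℕ} {q : ℝ}
include hu

open Polynomial in
/-- Lagrange's identity for the nodes `[s u_b + 1/2]²` of row `k`. -/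
lemma sum_eval_div_rowDen (hq : 0 < q) (hq1 : q ≠ 1) (hk1 : 1 ≤ k) (hk : k + 1 ≤ n) {p : ℕ × ℕ}
    (hp : ∀ b c, 1 ≤ b → b < c → c ≤ k / 2 → u k b = u k c + 1 →
      p ≠ (k + 1, b + 1) ∧ p ≠ (k - 1, b))
    (P : ℝ[X]) (hP : P.Monic) (hdeg : P.natDegree + 1 = 2 * (k / 2))
    (hdvd : (∏ x ∈ (nbrs k).erase p, (X - C (qNum q (u x.1 x.2) ^ 2))) ∣ P) :
    ∑ b ∈ Icc 1 (k / 2), ∑ s : ℤˣ, P.eval (qNum q ((s : ℤ) * u k b + 1 / 2) ^ 2) /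
        (qNum q (2 * ((s : ℤ) * u k b)) * rowDen q (Icc 1 (k / 2)) (u k) b ((s : ℤ) * u k b))
      = 1 := by
  refine Eq.trans ?_ (sum_eval_div_prod_sub_eq_one (Icc 1 (k / 2) ×ˢ (univ : Finset ℤˣ))
    (fun x => qNum q ((x.2 : ℤ) * u k x.1 + 1 / 2) ^ 2) ((nbrs k).erase p)
    (fun x => qNum q (u x.1 x.2) ^ 2) P hP ?_ hdvd (gapNbr k) ?_ ?_)
  · rw [sum_product]
    refine sum_congr rfl fun b hb => sum_congr rfl fun s _ => ?_
    rw [prod_nodes hq hq1 _ _ hb]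
  · rw [hdeg, card_product]; simp [mul_comm]
  · rintro ⟨b, s⟩ hb ⟨⟨c, t⟩, hc, hne, h⟩
    exact hu.gapNbr_of_collision hq hq1 hk1 hk hp (mem_product.1 hb).1 (mem_product.1 hc).1 hne h
  · rintro ⟨b, s⟩ hb ⟨c, t⟩ hc - - h
    exact gapNbr_injOn (mem_Icc.1 (mem_product.1 hb).1).1 (mem_Icc.1 (mem_product.1 hc).1).1 h

open Polynomial in
/-- Lagrange's formula for an even row: the prefactors supply the polynomial `X + [1/2]_+²`, which
makes up for the missing neighbour `p`. -/
lemma lagrange_even (hq : 0 < q) (hq1 : q ≠ 1) (hk1 : 1 ≤ k) (hk : k + 1 ≤ n) (hkE : Even k)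
    {p : ℕ × ℕ} (hpn : p ∈ nbrs k)
    (hp : ∀ b c, 1 ≤ b → b < c → c ≤ k / 2 → u k b = u k c + 1 →
      p ≠ (k + 1, b + 1) ∧ p ≠ (k - 1, b)) :
    ∑ b ∈ Icc 1 (k / 2), ∑ s : ℤˣ,
      (qNum q ((s : ℤ) * u k b + 1 / 2) ^ 2 + qNumPlus q (1 / 2) ^ 2) *
        restProd q k u p ((s : ℤ) * u k b) /
        (qNum q (2 * ((s : ℤ) * u k b)) * rowDen q (Icc 1 (k / 2)) (u k) b ((s : ℤ) * u k b))
      = 1 := by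
  obtain ⟨m, hm⟩ := hkE
  have hcard : #((nbrs k).erase p) = k - 2 := by
    rw [card_erase_of_mem hpn, card_nbrs]; omega
  refine Eq.trans ?_ (hu.sum_eval_div_rowDen hq hq1 hk1 hk hp
    ((X + C (qNumPlus q (1 / 2) ^ 2)) *
      ∏ x ∈ (nbrs k).erase p, (X - C (qNum q (u x.1 x.2) ^ 2))) ?_ ?_ (dvd_mul_left _ _))
  · refine sum_congr rfl fun b _ => sum_congr rfl fun s _ => ?_
    rw [eval_mul, eval_prod]
    simp only [eval_add, eval_X, eval_C, eval_sub]
    rw [prod_sub_comm, hcard, Even.neg_one_pow ⟨m - 1, by omega⟩, one_mul, restProd]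
  · exact (monic_X_add_C _).mul (monic_prod_of_monic _ _ fun x _ => monic_X_sub_C _)
  · rw [Monic.natDegree_mul (monic_X_add_C _) (monic_prod_of_monic _ _ fun x _ => monic_X_sub_C _),
      natDegree_X_add_C, natDegree_prod_X_sub_C', hcard]
    have : 1 ≤ m := by omega
    omega

open Polynomial in
/-- Lagrange's formula for an even row and the product over all neighbours. The position `(0, 0)`
is not a neighbour, so that nothing is removed. -/
lemma lagrange_plus (hq : 0 < q) (hq1 : q ≠ 1) (hk1 : 1 ≤ k) (hk : k + 1 ≤ n) (hkE : Even k) :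
    ∑ b ∈ Icc 1 (k / 2), ∑ s : ℤˣ, restProd q k u (0, 0) ((s : ℤ) * u k b) /
        (qNum q (2 * ((s : ℤ) * u k b)) * rowDen q (Icc 1 (k / 2)) (u k) b ((s : ℤ) * u k b))
      = -1 := by
  obtain ⟨m, hm⟩ := hkE
  have hcard : #((nbrs k).erase (0, 0)) = k - 1 := by
    rw [erase_eq_of_notMem (by simp [mem_nbrs]), card_nbrs]; omega
  rw [← hu.sum_eval_div_rowDen hq hq1 hk1 hk (p := (0, 0)) ?_
    (∏ x ∈ (nbrs k).erase (0, 0), (X - C (qNum q (u x.1 x.2) ^ 2))) ?_ ?_ dvd_rfl]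
  · rw [← sum_neg_distrib]
    refine sum_congr rfl fun b _ => ?_
    rw [← sum_neg_distrib]
    refine sum_congr rfl fun s _ => ?_
    rw [eval_prod]
    simp only [eval_X, eval_C, eval_sub]
    rw [prod_sub_comm, hcard, Odd.neg_one_pow ⟨m - 1, by omega⟩, restProd]
    ring
  · intro b c h1 _ _ _
    constructor <;> intro e <;> simp only [Prod.mk.injEq] at e <;> omega
  · exact monic_prod_of_monic _ _ fun x _ => monic_X_sub_C _
  · rw [natDegree_prod_X_sub_C', hcard]; omega

open Polynomial in
/-- Lagrange's formula for an odd row, with the additional node `-(2 / (q - q⁻¹))²`: the difference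
between it and `[x]²` is `-[x]_+²`. Its term is the square of the diagonal coefficient. -/
lemma lagrange_odd (hq : 0 < q) (hq1 : q ≠ 1) (hk1 : 1 ≤ k) (hk : k + 1 ≤ n) (hkO : ¬ Even k)
    {p : ℕ × ℕ} (hpn : p ∈ nbrs k)
    (hp : ∀ b c, 1 ≤ b → b < c → c ≤ k / 2 → u k b = u k c + 1 →
      p ≠ (k + 1, b + 1) ∧ p ≠ (k - 1, b)) :
    (∏ x ∈ (nbrs k).erase p, qNumPlus q (u x.1 x.2)) ^ 2 /
      (∏ i ∈ Icc 1 (k / 2), (qNumPlus q (u k i + 1 / 2) * qNumPlus q (u k i - 1 / 2))) ^ 2 +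
    ∑ b ∈ Icc 1 (k / 2), ∑ s : ℤˣ, restProd q k u p ((s : ℤ) * u k b) /
        (qNum q (2 * ((s : ℤ) * u k b)) * qNumPlus q ((s : ℤ) * u k b + 1 / 2) ^ 2 *
          rowDen q (Icc 1 (k / 2)) (u k) b ((s : ℤ) * u k b)) = 1 := by
  obtain ⟨m, hm⟩ := Nat.not_even_iff_odd.1 hkO
  have hcard : #((nbrs k).erase p) = 2 * m := by
    rw [card_erase_of_mem hpn, card_nbrs]; omega
  set N : ℝ := (2 / (q - q⁻¹)) ^ 2 with hN
  have hNpos : 0 < N := by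
    have := q_sub_inv_ne_zero hq hq1
    positivity
  set W := Icc 1 (k / 2) ×ˢ (univ : Finset ℤˣ) with hW
  have hcW : #W = 2 * m := by rw [hW, card_product]; simp; omega
  let Z : Option (ℕ × ℤˣ) → ℝ := fun o => o.elim (-N)
    fun x => qNum q ((x.2 : ℤ) * u k x.1 + 1 / 2) ^ 2
  have hZ : ∀ x, Z none ≠ Z (some x) := by
    intro x h
    have : -N = qNum q ((x.2 : ℤ) * u k x.1 + 1 / 2) ^ 2 := h
    have := sq_nonneg (qNum q ((x.2 : ℤ) * u k x.1 + 1 / 2))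
    linarith
  have hmem : ∀ x, some x ∈ insertNone W → x.1 ∈ Icc 1 (k / 2) := by
    intro x hx; rw [some_mem_insertNone] at hx; exact (mem_product.1 hx).1
  have hL := sum_eval_div_prod_sub_eq_one (insertNone W) Z ((nbrs k).erase p)
    (fun x => qNum q (u x.1 x.2) ^ 2)
    (∏ x ∈ (nbrs k).erase p, (X - C (qNum q (u x.1 x.2) ^ 2)))
    (monic_prod_of_monic _ _ fun x _ => monic_X_sub_C _)
    (by rw [natDegree_prod_X_sub_C', hcard, card_insertNone, hcW]) dvd_rfl
    (fun o => o.elim (0, 0) (gapNbr k)) ?_ ?_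
  · rw [sum_insertNone] at hL
    refine Eq.trans ?_ hL
    congr 1
    · rw [show (insertNone W).erase none = W.map Function.Embedding.some by
        ext o; cases o <;> simp, eval_prod]
      simp only [eval_X, eval_C, eval_sub]
      rw [prod_sub_comm, hcard, Even.neg_one_pow ⟨m, by omega⟩, one_mul, prod_map]
      congr 1
      · rw [← prod_pow]
        refine prod_congr rfl fun x _ => ?_
        rw [qNumPlus_sq hq hq1]
        simp only [Z, Option.elim]; ring
      · have : ∀ x ∈ W, Z none - Z (Function.Embedding.some x) =
            (-1) * qNumPlus q ((x.2 : ℤ) * u k x.1 + 1 / 2) ^ 2 := by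
          intro x _
          rw [qNumPlus_sq hq hq1]
          simp only [Z, Option.elim, Function.Embedding.some_apply]; ring
        rw [prod_congr rfl this, show ∏ x ∈ W, (-1 : ℝ) * qNumPlus q ((x.2 : ℤ) * u k x.1 + 1 / 2) ^ 2
            = ∏ x ∈ W, qNumPlus q ((x.2 : ℤ) * u k x.1 + 1 / 2) ^ 2 by
          rw [prod_mul_distrib, prod_const, hcW, Even.neg_one_pow ⟨m, by omega⟩, one_mul],
          hW, prod_product, ← prod_pow]
        refine prod_congr rfl fun b _ => ?_
        rw [show (univ : Finset ℤˣ) = {1, -1} from rfl, prod_pair (by decide)]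
        simp only [Units.val_one, Int.cast_one, one_mul, Units.val_neg, Int.cast_neg, neg_mul]
        rw [← qNumPlus_neg q (-u k b + 1 / 2), show -(-u k b + 1 / 2) = u k b - 1 / 2 by ring]
        ring
    · rw [hW, sum_product]
      refine sum_congr rfl fun b hb => sum_congr rfl fun s _ => ?_
      have he : (insertNone W).erase (some (b, s)) = insertNone (W.erase (b, s)) := by
        ext o; cases o <;> simp
      rw [← hW, he, prod_insertNone, eval_prod]
      simp only [eval_X, eval_C, eval_sub]
      rw [prod_sub_comm, hcard, Even.neg_one_pow ⟨m, by omega⟩, one_mul]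
      have := prod_nodes hq hq1 (Icc 1 (k / 2)) (u k) hb s
      simp only [Z, Option.elim]
      rw [hW, this, qNumPlus_sq hq hq1, ← hN, restProd, sub_neg_eq_add]
      ring
  · rintro (_ | ⟨b, s⟩) ho ⟨(_ | ⟨c, t⟩), hc, hne, h⟩
    · exact absurd rfl hne
    · exact absurd h.symm (hZ _)
    · exact absurd h (hZ _)
    · exact hu.gapNbr_of_collision hq hq1 hk1 hk hp (hmem _ ho) (hmem _ hc)
        (fun e => hne (by rw [e])) h
  · rintro (_ | ⟨b, s⟩) ho (_ | ⟨c, t⟩) ho' ⟨o1, h1, hn1, e1⟩ ⟨o2, h2, hn2, e2⟩ h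
    · rfl
    · rcases o1 with _ | x
      · exact absurd rfl hn1
      · exact absurd e1.symm (hZ _)
    · rcases o2 with _ | x
      · exact absurd rfl hn2
      · exact absurd e2.symm (hZ _)
    · exact congrArg some (gapNbr_injOn (mem_Icc.1 (hmem _ ho)).1 (mem_Icc.1 (hmem _ ho')).1 h)

/-- A step from `1` to `0` in an odd row is blocked: both neighbours below the entry equal `1/2`. -/
lemma restProd_eq_zero_of_one (hk1 : 1 ≤ k) (hk : k + 1 ≤ n) (hkO : ¬ Even k) (p : ℕ × ℕ) {b : ℕ}
    (hb : b ∈ Icc 1 (k / 2)) {s : ℤˣ} (h : (s : ℤ) * u k b + 1 = 0) :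
    restProd q k u p ((s : ℤ) * u k b) = 0 := by
  rw [mem_Icc] at hb
  rw [Nat.not_even_iff] at hkO
  have pb := hu.half_le (by omega) hb.1 hb.2
  have h1 : u k b = 1 := by rcases unit_cast_eq s with e | e <;> rw [e] at h <;> linarith
  have hw : (s : ℤ) * u k b = -1 := by linarith
  have e1 : (k + 1, b + 1) ∈ nbrs k := succ_mem_nbrs (by omega) (by omega)
  have e2 : (k - 1, b) ∈ nbrs k := pred_mem_nbrs hb.1 (by omega)
  have f1 := hu.nbr_le hk1 hk hb.1 hb.2 e1 (Or.inl ⟨rfl, by simp⟩)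
  have f2 := hu.nbr_le hk1 hk hb.1 hb.2 e2 (Or.inr ⟨rfl, le_rfl⟩)
  have g1 := hu.mem_nbrs_pos hk e1
  have g2 := hu.mem_nbrs_pos hk e2
  have key : ∀ x ∈ (nbrs k).erase p, u x.1 x.2 = 1 / 2 → restProd q k u p ((s : ℤ) * u k b) = 0 := by
    intro x hx hx'
    refine prod_eq_zero hx ?_
    rw [hx', hw, ← qNum_sq_neg q (-1 + 1 / 2), show -(-1 + 1 / 2 : ℝ) = 1 / 2 by norm_num, sub_self]
  by_cases hpe : p = (k + 1, b + 1)
  · refine key (k - 1, b) (mem_erase.2 ⟨?_, e2⟩) (by simp only at f2 g2 ⊢; linarith)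
    rw [hpe]; intro e; simp only [Prod.mk.injEq] at e; omega
  · exact key (k + 1, b + 1) (mem_erase.2 ⟨Ne.symm hpe, e1⟩) (by simp only at f1 g1 ⊢; linarith)

end Interlacing

/-! ### The operators on arrays and the Serre relation -/

/-- The coefficient of the step `σ` of row `k` in the action of `I_{k+1,k}` on the array with
coordinates `u`; `e` stands for the sign `ε_{k+1}`, which matters for odd `k`. -/
def stepCoef (q e : ℝ) (k : ℕ) (u : ℕ → ℕ → ℝ) : Step → ℝ :=
  rowCoef q (Icc 1 (k / 2))
    (fun w => pref q k w * √|∏ x ∈ nbrs k, (qNum q (u x.1 x.2) ^ 2 - qNum q (w + 1 / 2) ^ 2)|)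
    (if Even k then 0 else e * ∏ x ∈ nbrs k, qNumPlus q (u x.1 x.2)) (u k)

/-- The array obtained from `u` by a step in row `k`. -/
def moveArr (u : ℕ → ℕ → ℝ) (k : ℕ) (σ : Step) : ℕ → ℕ → ℝ :=
  Function.update u k (moveRow (u k) σ)

lemma ne_of_mem_nbrs {k : ℕ} (hk1 : 1 ≤ k) {x : ℕ × ℕ} (hx : x ∈ nbrs k) : x.1 ≠ k := by
  rw [mem_nbrs] at hx; omega

/-- The coefficients of row `k` as functions of this row `r` and of one neighbour, which enters
only through the squares of its `q`-numbers. -/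
lemma stepCoef_update {q e : ℝ} {k : ℕ} (hk1 : 1 ≤ k) (u : ℕ → ℕ → ℝ) (r : ℕ → ℝ) {p : ℕ × ℕ}
    (hp : p ∈ nbrs k) {v : ℝ} (hv : qNum q (u p.1 p.2) ^ 2 = qNum q v ^ 2)
    (hv' : qNumPlus q (u p.1 p.2) = qNumPlus q v) :
    stepCoef q e k (Function.update u k r) =
      rowCoef q (Icc 1 (k / 2)) (fun w => pref q k w * √|restProd q k u p w| *
        √|qNum q v ^ 2 - qNum q (w + 1 / 2) ^ 2|)
        ((if Even k then 0 else e * ∏ x ∈ (nbrs k).erase p, qNumPlus q (u x.1 x.2)) *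
          qNumPlus q v) r := by
  have h : ∀ g : ℝ → ℝ, ∏ x ∈ nbrs k, g (Function.update u k r x.1 x.2) =
      g (u p.1 p.2) * ∏ x ∈ (nbrs k).erase p, g (u x.1 x.2) := by
    intro g
    rw [← mul_prod_erase _ _ hp, Function.update_of_ne (ne_of_mem_nbrs hk1 hp)]
    congr 1
    refine prod_congr rfl fun x hx => ?_
    rw [Function.update_of_ne (ne_of_mem_nbrs hk1 (mem_erase.1 hx).2)]
  have hA : (fun w => pref q k w * √|∏ x ∈ nbrs k,
        (qNum q (Function.update u k r x.1 x.2) ^ 2 - qNum q (w + 1 / 2) ^ 2)|) =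
      fun w => pref q k w * √|restProd q k u p w| *
        √|qNum q v ^ 2 - qNum q (w + 1 / 2) ^ 2| := by
    funext w
    rw [h fun y => qNum q y ^ 2 - qNum q (w + 1 / 2) ^ 2, sqrt_abs_mul, hv, restProd]
    ring
  have hB : (if Even k then 0 else e * ∏ x ∈ nbrs k, qNumPlus q (Function.update u k r x.1 x.2)) =
      (if Even k then 0 else e * ∏ x ∈ (nbrs k).erase p, qNumPlus q (u x.1 x.2)) *
          qNumPlus q v := by
    split_ifs
    · rw [zero_mul]
    · rw [h fun y => qNumPlus q y, hv']; ring
  rw [stepCoef, hA, hB, Function.update_self]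

lemma stepCoef_update_even {q e : ℝ} {k : ℕ} (hk1 : 1 ≤ k) (hk : Even k) (u : ℕ → ℕ → ℝ)
    (r : ℕ → ℝ) :
    stepCoef q e k (Function.update u k r) =
      rowCoef q (Icc 1 (k / 2)) (fun w => pref q k w * √|restProd q k u (0, 0) w|) 0 r := by
  have hA : (fun w => pref q k w * √|∏ x ∈ nbrs k,
        (qNum q (Function.update u k r x.1 x.2) ^ 2 - qNum q (w + 1 / 2) ^ 2)|) =
      fun w => pref q k w * √|restProd q k u (0, 0) w| := by
    funext w
    rw [restProd, erase_eq_of_notMem (by simp [mem_nbrs])]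
    exact congrArg (fun y : ℝ => pref q k w * √|y|) (prod_congr rfl fun x hx => by
      rw [Function.update_of_ne (ne_of_mem_nbrs hk1 hx)])
  rw [stepCoef, hA, if_pos hk, Function.update_self]

/-- The neighbours of a row split into an adjacent row and the row on the other side. -/
lemma exists_prod_nbrs {k k' : ℕ} (hk1 : 1 ≤ k') (h : k' = k + 1 ∨ k = k' + 1) :
    ∃ o, o ≠ k ∧ ∀ g : ℕ × ℕ → ℝ, ∏ x ∈ nbrs k', g x =
      (∏ i ∈ Icc 1 (o / 2), g (o, i)) * ∏ i ∈ Icc 1 (k / 2), g (k, i) := by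
  rcases h with rfl | rfl
  · exact ⟨k + 1 + 1, by omega, fun g => by rw [prod_nbrs, Nat.add_sub_cancel]⟩
  · exact ⟨k' - 1, by omega, fun g => by rw [prod_nbrs, mul_comm]⟩

/-- The coefficient of a step in row `k'` as a function of the adjacent row `k`. -/
lemma stepCoef_adjacent {q e : ℝ} {k k' : ℕ} (hk1 : 1 ≤ k') (h : k' = k + 1 ∨ k = k' + 1)
    (u : ℕ → ℕ → ℝ) (b : ℕ) (s : ℤˣ) : ∃ Γ, ∀ r,
      stepCoef q e k' (Function.update u k r) (some (b, s)) =
        Γ * ∏ i ∈ Icc 1 (k / 2),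
          √|qNum q (r i) ^ 2 - qNum q ((s : ℤ) * u k' b + 1 / 2) ^ 2| := by
  obtain ⟨o, ho, hprod⟩ := exists_prod_nbrs hk1 h
  refine ⟨pref q k' ((s : ℤ) * u k' b) * √|∏ i ∈ Icc 1 (o / 2),
    (qNum q (u o i) ^ 2 - qNum q ((s : ℤ) * u k' b + 1 / 2) ^ 2)| /
    √|rowDen q (Icc 1 (k' / 2)) (u k') b ((s : ℤ) * u k' b)|, fun r => ?_⟩
  have hne : k' ≠ k := by omega
  simp only [stepCoef, rowCoef, Function.update_of_ne hne, hprod, Function.update_of_ne ho,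
    Function.update_self, sqrt_abs_mul, abs_prod, Real.sqrt_prod _ fun i _ => abs_nonneg _]
  ring

lemma stepCoef_adjacent_none {q e : ℝ} {k k' : ℕ} (hk1 : 1 ≤ k') (h : k' = k + 1 ∨ k = k' + 1)
    (u : ℕ → ℕ → ℝ) : ∃ Γ, (Even k' → Γ = 0) ∧ ∀ r,
      stepCoef q e k' (Function.update u k r) none =
        Γ * ∏ i ∈ Icc 1 (k / 2), qNumPlus q (r i) := by
  obtain ⟨o, ho, hprod⟩ := exists_prod_nbrs hk1 h
  have hne : k' ≠ k := by omega
  by_cases hE : Even k'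
  · exact ⟨0, fun _ => rfl, fun r => by simp [stepCoef, rowCoef, hE]⟩
  · refine ⟨e * (∏ i ∈ Icc 1 (o / 2), qNumPlus q (u o i)) /
      ∏ i ∈ Icc 1 (k' / 2), (qNumPlus q (u k' i + 1 / 2) * qNumPlus q (u k' i - 1 / 2)),
      fun h => absurd h hE, fun r => ?_⟩
    simp only [stepCoef, rowCoef, Function.update_of_ne hne, hprod, Function.update_of_ne ho,
      Function.update_self, if_neg hE]
    ring

lemma serreTerm_mul (Q Γ : ℝ) (C C' : (ℕ → ℝ) → Step → ℝ) (φ : (ℕ → ℝ) → ℝ) (r : ℕ → ℝ)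
    (σ τ : Step) :
    serreTerm Q C C' (fun r => Γ * φ r) r σ τ = Γ * serreTerm Q C C' φ r σ τ := by
  simp only [serreTerm]; ring

lemma moveArr_none (u : ℕ → ℕ → ℝ) (k : ℕ) : moveArr u k none = u := by
  rw [moveArr, moveRow, Function.update_eq_self]

namespace Interlacing

variable {n : ℕ} {u : ℕ → ℕ → ℝ} (hu : Interlacing n u) {k k' : ℕ} {q e e' : ℝ}
include hu

/-- The entries of an even row are not integers. -/
lemma half_ne (hk : k + 1 ≤ n) (hkE : Even k) {b : ℕ} (hb : b ∈ Icc 1 (k / 2)) (s : ℤˣ) :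
    (s : ℤ) * u k b ≠ 0 ∧ (s : ℤ) * u k b + 1 ≠ 0 := by
  rw [mem_Icc] at hb
  have pb := hu.half_le (by omega) hb.1 hb.2
  obtain ⟨z, hz⟩ := hu.lat k b (by omega) hb.1 hb.2
  obtain ⟨m, rfl⟩ := hkE
  have h1 : u (m + m) b ≠ 1 := by
    intro h
    rw [h] at hz
    push_cast at hz
    have : ((2 * z + 2 * m : ℤ) : ℝ) = ((1 : ℤ) : ℝ) := by push_cast; linarith
    have : 2 * z + 2 * m = 1 := by exact_mod_cast this
    omega
  rcases unit_cast_eq s with h | h <;> rw [h] <;> constructor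
  · linarith
  · linarith
  · linarith
  · intro h; exact h1 (by linarith)

/-- The Serre relation between adjacent rows `k` and `k'`, for the step `σ'` of row `k'`. -/
theorem serre (hq : 0 < q) (hq1 : q ≠ 1) (hk1 : 1 ≤ k) (hk'1 : 1 ≤ k') (hk : k + 1 ≤ n)
    (hadj : k' = k + 1 ∨ k = k' + 1) (he : e ^ 2 = 1) {σ' : Step}
    (hσ' : σ' ∈ stepsOf (Icc 1 (k' / 2))) :
    let C := fun r => stepCoef q e k (Function.update u k r)
    let C' := fun r => stepCoef q e k (Function.update (moveArr u k' σ') k r)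
    let φ := fun r => stepCoef q e' k' (Function.update u k r) σ'
    (∀ σ ∈ stepsOf (Icc 1 (k / 2)), ∀ τ ∈ stepsOf (Icc 1 (k / 2)), τ ≠ σ.inv →
      serreTerm (q + q⁻¹) C C' φ (u k) σ τ + serreTerm (q + q⁻¹) C C' φ (u k) τ σ = 0) ∧
    ∑ σ ∈ stepsOf (Icc 1 (k / 2)), serreTerm (q + q⁻¹) C C' φ (u k) σ σ.inv = -φ (u k) := by
  intro C C' φ
  rcases σ' with _ | ⟨b', s'⟩
  -- row `k'` stays: the coefficient vanishes unless `k'` is odd, and then it is `Γ ∏ [r i]_+`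
  · obtain ⟨Γ, hΓ, hφ⟩ := stepCoef_adjacent_none (q := q) (e := e') hk'1 hadj u
    have hφ' : φ = fun r => Γ * ∏ i ∈ Icc 1 (k / 2), qNumPlus q (r i) := funext hφ
    rw [hφ']
    simp only [serreTerm_mul, ← mul_add, ← mul_sum, ← mul_neg]
    by_cases hE : Even k'
    · simp [hΓ hE]
    have hkE : Even k := by
      rw [Nat.even_iff] at hE ⊢; omega
    have hC : C = rowCoef q (Icc 1 (k / 2))
        (fun w => pref q k w * √|restProd q k u (0, 0) w|) 0 := by
      funext r; exact stepCoef_update_even hk1 hkE u r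
    have hC' : C' = C := by
      simp only [C', C, moveArr_none]
    rw [hC', hC]
    constructor
    · intro σ hσ τ hτ hne
      have h0 := serreTerm_plus_add_swap_of_ne_inv (k := k) (r := u k)
        (M := restProd q k u (0, 0)) hq hq1 (hu.steps_generic hk1 hk (0, 0)) hσ hτ hne
      exact (congrArg (Γ * ·) h0).trans (mul_zero _)
    · have h0 := sum_serreTerm_plus_inv (k := k) (r := u k)
        (M := restProd q k u (0, 0)) hq hq1 hkE (restProd_neg q k u (0, 0)) ?_
        (fun b hb s => hu.rowDen_nonneg hq hq1 hk hb s) (fun b hb s => hu.half_ne hk hkE hb s)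
        (hu.lagrange_plus hq hq1 hk1 hk hkE)
      · exact congrArg (Γ * ·) h0
      · intro b hb s
        rw [restProd, erase_eq_of_notMem (by simp [mem_nbrs])]
        exact hu.prod_nbrs_nonneg hq hq1 hk1 hk hb s
  -- an entry of row `k'` moves from `a - 1/2` to `a + 1/2`, up to the sign `s'`
  · obtain ⟨Γ, hφ⟩ := stepCoef_adjacent (q := q) (e := e') hk'1 hadj u b' s'
    have hφ' : φ = fun r => Γ * ∏ i ∈ Icc 1 (k / 2),
        √|qNum q (r i) ^ 2 - qNum q ((s' : ℤ) * u k' b' + 1 / 2) ^ 2| := funext hφ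
    rw [some_mem_stepsOf, mem_Icc] at hσ'
    have hp : (k', b') ∈ nbrs k := by
      rcases hadj with rfl | rfl
      · exact succ_mem_nbrs hσ'.1 hσ'.2
      · exact pred_mem_nbrs hσ'.1 hσ'.2
    have hkne : k ≠ k' := by omega
    set a := (s' : ℤ) * u k' b' + 1 / 2 with ha
    set δ := if Even k then 0 else e * ∏ x ∈ (nbrs k).erase (k', b'), qNumPlus q (u x.1 x.2) with hδ
    have hC : C = rowCoef q (Icc 1 (k / 2)) (fun w => pref q k w * √|restProd q k u (k', b') w| *
        √|qNum q (a - 1 / 2) ^ 2 - qNum q (w + 1 / 2) ^ 2|) (δ * qNumPlus q (a - 1 / 2)) := by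
      funext r
      refine stepCoef_update hk1 u r hp ?_ ?_
      · rw [ha, add_sub_cancel_right, even_comp_unit_mul (f := fun x => qNum q x ^ 2)
          (qNum_sq_neg q)]
      · rw [ha, add_sub_cancel_right, even_comp_unit_mul (f := fun x => qNumPlus q x)
          (qNumPlus_neg q)]
    have hC' : C' = rowCoef q (Icc 1 (k / 2)) (fun w => pref q k w * √|restProd q k u (k', b') w| *
        √|qNum q (a + 1 / 2) ^ 2 - qNum q (w + 1 / 2) ^ 2|) (δ * qNumPlus q (a + 1 / 2)) := by
      funext r
      have hout : ∀ x ∈ (nbrs k).erase (k', b'),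
          moveArr u k' (some (b', s')) x.1 x.2 = u x.1 x.2 := by
        rintro ⟨x1, x2⟩ hx
        by_cases hx1 : x1 = k'
        · subst hx1
          have : x2 ≠ b' := fun e => (mem_erase.1 hx).1 (by rw [e])
          simp [moveArr, moveRow, this]
        · simp [moveArr, hx1]
      have hval : moveArr u k' (some (b', s')) k' b' = u k' b' + ((s' : ℤ) : ℝ) := by
        simp [moveArr, moveRow]
      have e1 := stepCoef_update (q := q) (e := e) hk1 (moveArr u k' (some (b', s'))) r hp
        (v := a + 1 / 2) ?_ ?_
      · rw [show restProd q k (moveArr u k' (some (b', s'))) (k', b') = restProd q k u (k', b') by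
            funext w
            exact prod_congr rfl fun x hx => by rw [hout x hx],
          show ∏ x ∈ (nbrs k).erase (k', b'), qNumPlus q (moveArr u k' (some (b', s')) x.1 x.2) =
            ∏ x ∈ (nbrs k).erase (k', b'), qNumPlus q (u x.1 x.2) from
            prod_congr rfl fun x hx => by rw [hout x hx]] at e1
        exact e1
      · rw [hval, even_comp_add_unit (f := fun x => qNum q x ^ 2) (qNum_sq_neg q), ha]
        congr 2; ring
      · rw [hval, even_comp_add_unit (f := fun x => qNumPlus q x) (qNumPlus_neg q), ha]
        congr 1; ring
    rw [hφ', hC, hC']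
    simp only [serreTerm_mul, ← mul_add, ← mul_sum, ← mul_neg]
    have hint := hu.exists_int_sub hk1 hk hp s'
    constructor
    · intro σ hσ τ hτ hne
      have h0 := serreTerm_add_swap_of_ne_inv (k := k) (r := u k) (a := a) (δ := δ)
        (M := restProd q k u (k', b')) hq hq1 hint (hu.steps_generic hk1 hk (k', b')) hσ hτ hne
      exact (congrArg (Γ * ·) h0).trans (mul_zero _)
    -- if the moving entry of row `k'` is squeezed between two entries of row `k`, then `φ` vanishes
    · have hsq : (∀ b ∈ Icc 1 (k / 2), qNum q (u k b) ^ 2 ≠ qNum q a ^ 2) →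
          ∀ b c, 1 ≤ b → b < c → c ≤ k / 2 → u k b = u k c + 1 →
            (k', b') ≠ (k + 1, b + 1) ∧ (k', b') ≠ (k - 1, b) := by
        intro hne b c h1 hbc h2 h
        obtain ⟨-, e1, e2⟩ := hu.squeeze hk1 hk h1 hbc h2 h
        have pc := hu.half_le (k := k) (by omega) (by omega) h2
        have hv : u k' b' ≠ u k b - 1 / 2 := by
          intro hv
          have habs := abs_unit_mul_add_half (x := u k' b') (by linarith) s'
          rw [← ha] at habs
          rcases unit_cast_eq s' with h' | h'
          · refine hne b (mem_Icc.2 ⟨h1, by omega⟩) ((qNum_sq_eq_iff hq hq1).2 ?_)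
            rw [habs, h', abs_of_pos (by linarith)]; linarith
          · refine hne c (mem_Icc.2 ⟨by omega, h2⟩) ((qNum_sq_eq_iff hq hq1).2 ?_)
            rw [habs, h', abs_of_pos (by linarith)]; linarith
        constructor
        · intro e; simp only [Prod.mk.injEq] at e; exact hv (by rw [e.1, e.2, e1])
        · intro e; simp only [Prod.mk.injEq] at e; exact hv (by rw [e.1, e.2, e2])
      have hm : (∀ b ∈ Icc 1 (k / 2), qNum q (u k b) ^ 2 ≠ qNum q a ^ 2) →
          ∀ b ∈ Icc 1 (k / 2), ∀ s : ℤˣ, 0 ≤ (qNum q a ^ 2 - qNum q ((s : ℤ) * u k b) ^ 2) *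
            restProd q k u (k', b') ((s : ℤ) * u k b) := fun hne b hb s =>
        hu.restProd_sign hq hq1 hk1 hk hp s' hb s (hne b hb)
      have hD := fun b (hb : b ∈ Icc 1 (k / 2)) s => hu.rowDen_nonneg hq hq1 hk hb s
      by_cases hE : Even k
      · have hδ0 : δ = 0 := by rw [hδ, if_pos hE]
        have h0 := sum_serreTerm_inv_even (k := k) (r := u k) (a := a)
          (M := restProd q k u (k', b')) hq hq1 hE hint (restProd_neg q k u (k', b')) hm hD
          (fun b hb s => hu.half_ne hk hE hb s)
          (fun hne => hu.lagrange_even hq hq1 hk1 hk hE hp (hsq hne))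
        rw [hδ0]
        exact congrArg (Γ * ·) h0
      · have h0 := sum_serreTerm_inv_odd (k := k) (r := u k) (a := a) (δ := δ)
          (M := restProd q k u (k', b')) hq hq1 hE hint (restProd_neg q k u (k', b')) hm hD
          (fun _ b hb s h => hu.restProd_eq_zero_of_one hk1 hk hE _ hb h) ?_
        · exact congrArg (Γ * ·) h0
        · intro hne
          rw [hδ, if_neg hE, mul_pow, he, one_mul]
          exact hu.lagrange_odd hq hq1 hk1 hk hE hp (hsq hne)

end Interlacing

/-! ### Steps and interlacing -/

lemma moveArr_some_self (u : ℕ → ℕ → ℝ) (k b : ℕ) (s : ℤˣ) :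
    moveArr u k (some (b, s)) k b = u k b + ((s : ℤ) : ℝ) := by simp [moveArr, moveRow]

lemma moveArr_some_of_ne (u : ℕ → ℕ → ℝ) {k b : ℕ} (s : ℤˣ) {i j : ℕ} (h : i = k → j ≠ b) :
    moveArr u k (some (b, s)) i j = u i j := by
  by_cases hi : i = k
  · subst hi; simp [moveArr, moveRow, h rfl]
  · simp [moveArr, hi]

lemma moveArr_of_ne (u : ℕ → ℕ → ℝ) {k i : ℕ} (σ : Step) (h : i ≠ k) : moveArr u k σ i = u i :=
  Function.update_of_ne h _ _

namespace Interlacing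

variable {n : ℕ} {u : ℕ → ℕ → ℝ} (hu : Interlacing n u) {k : ℕ} {q e : ℝ}
include hu

/-- A step leads to a tableau if the new entry is positive and stays on the same side of its
neighbours. -/
lemma move {b : ℕ} {s : ℤˣ} (hk1 : 1 ≤ k) (hb : b ∈ Icc 1 (k / 2))
    (hpos : 0 < u k b + ((s : ℤ) : ℝ))
    (hge : ∀ p ∈ nbrs k, ((p.1 = k + 1 ∧ p.2 ≤ b) ∨ (p.1 = k - 1 ∧ p.2 < b)) →
      u k b + ((s : ℤ) : ℝ) < u p.1 p.2)
    (hle : ∀ p ∈ nbrs k, ((p.1 = k + 1 ∧ b < p.2) ∨ (p.1 = k - 1 ∧ b ≤ p.2)) →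
      u p.1 p.2 < u k b + ((s : ℤ) : ℝ)) : Interlacing n (moveArr u k (some (b, s))) := by
  rw [mem_Icc] at hb
  constructor
  · intro i j hi h1 h2
    obtain ⟨z, hz⟩ := hu.lat i j hi h1 h2
    by_cases h : i = k ∧ j = b
    · obtain ⟨rfl, rfl⟩ := h
      rw [moveArr_some_self, hz]
      exact ⟨z + s, by push_cast; ring⟩
    · rw [moveArr_some_of_ne u s fun e1 e2 => h ⟨e1, e2⟩]
      exact ⟨z, hz⟩
  · intro i j hi h1 h2
    by_cases h : i = k ∧ j = b
    · obtain ⟨rfl, rfl⟩ := h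
      rwa [moveArr_some_self]
    · rw [moveArr_some_of_ne u s fun e1 e2 => h ⟨e1, e2⟩]
      exact hu.pos i j hi h1 h2
  · intro i j hi h1 h2
    by_cases h : i = k ∧ j = b
    · obtain ⟨rfl, rfl⟩ := h
      rw [moveArr_some_self, moveArr_some_of_ne u s (by omega)]
      exact hge _ (succ_mem_nbrs h1 (by omega)) (Or.inl ⟨rfl, le_rfl⟩)
    rw [moveArr_some_of_ne u s fun e1 e2 => h ⟨e1, e2⟩]
    by_cases h' : i + 1 = k ∧ j = b
    · obtain ⟨rfl, rfl⟩ := h'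
      rw [moveArr_some_self]
      exact hle _ (pred_mem_nbrs h1 (by simpa using h2)) (Or.inr ⟨rfl, le_rfl⟩)
    rw [moveArr_some_of_ne u s fun e1 e2 => h' ⟨e1, e2⟩]
    exact hu.up i j hi h1 h2
  · intro i j hi h1 h2
    by_cases h : i = k ∧ j = b
    · obtain ⟨rfl, rfl⟩ := h
      rw [moveArr_some_self, moveArr_some_of_ne u s (by omega)]
      exact hle _ (succ_mem_nbrs (by omega) (by omega)) (Or.inl ⟨rfl, by simp⟩)
    rw [moveArr_some_of_ne u s (i := i) fun e1 e2 => h ⟨e1, e2⟩]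
    by_cases h' : i + 1 = k ∧ j + 1 = b
    · obtain ⟨rfl, rfl⟩ := h'
      rw [moveArr_some_self]
      exact hge _ (pred_mem_nbrs h1 (by simp; omega)) (Or.inr ⟨rfl, by simp⟩)
    rw [moveArr_some_of_ne u s fun e1 e2 => h' ⟨e1, e2⟩]
    exact hu.down i j hi h1 h2

/-- A step with nonzero coefficient is not blocked by the neighbours of the entry. -/
lemma move_of_stepCoef_ne_zero (hk1 : 1 ≤ k) (hk : k + 1 ≤ n) {b : ℕ}
    {s : ℤˣ} (hb : b ∈ Icc 1 (k / 2)) (hpos : 0 < u k b + ((s : ℤ) : ℝ))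
    (h : stepCoef q e k u (some (b, s)) ≠ 0) : Interlacing n (moveArr u k (some (b, s))) := by
  have hne : ∀ p ∈ nbrs k, u k b ≠ u p.1 p.2 + (((-s : ℤˣ) : ℤ) : ℝ) / 2 := by
    intro p hp heq
    refine h ?_
    have h0 : ∏ x ∈ nbrs k, (qNum q (u x.1 x.2) ^ 2 - qNum q ((s : ℤ) * u k b + 1 / 2) ^ 2) = 0 := by
      refine prod_eq_zero hp ?_
      rw [show u p.1 p.2 = u k b + ((s : ℤ) : ℝ) / 2 by rw [heq]; push_cast; ring,
        ← even_comp_unit_mul (f := fun x => qNum q x ^ 2) (qNum_sq_neg q) s,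
        show ((s : ℤ) : ℝ) * (u k b + ((s : ℤ) : ℝ) / 2) = (s : ℤ) * u k b + 1 / 2 by
          linear_combination (1 / 2) * unit_mul_self s, sub_self]
    simp only [stepCoef, rowCoef, h0]
    simp
  refine hu.move hk1 hb hpos ?_ ?_
  · intro p hp hside
    have := (hu.moved_nbr hk1 hk hp (-s) hb (hne p hp)).1 hside
    push_cast at this
    rcases unit_cast_eq s with h | h <;> rw [h] at this ⊢ <;> linarith
  · intro p hp hside
    have := (hu.moved_nbr hk1 hk hp (-s) hb (hne p hp)).2 hside
    push_cast at this
    rcases unit_cast_eq s with h | h <;> rw [h] at this ⊢ <;> linarith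

/-- An entry that a step with nonzero coefficient makes nonpositive is the last entry of an even
row, and equals `1/2`. -/
lemma eq_half_of_stepCoef_ne_zero (hk1 : 1 ≤ k) (hk : k + 1 ≤ n) {b : ℕ}
    {s : ℤˣ} (hb : b ∈ Icc 1 (k / 2)) (hpos : ¬ 0 < u k b + ((s : ℤ) : ℝ))
    (h : stepCoef q e k u (some (b, s)) ≠ 0) : Even k ∧ b = k / 2 ∧ s = -1 ∧ u k b = 1 / 2 := by
  have hb' := mem_Icc.1 hb
  have pb := hu.half_le (by omega) hb'.1 hb'.2
  have hs : s = -1 := by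
    rcases Int.units_eq_one_or s with rfl | rfl
    · push_cast at hpos; linarith
    · rfl
  subst hs
  push_cast at hpos
  have hbk : b = k / 2 := by
    by_contra hne
    have := hu.row_gap hk hb'.1 (show b < b + 1 by omega) (by omega)
    have := hu.half_le (k := k) (j := b + 1) (by omega) (by omega) (by omega)
    linarith
  have hE : Even k := by
    by_contra hO
    obtain ⟨m, hm⟩ := Nat.not_even_iff_odd.1 hO
    have h1 : u k b = 1 := by
      obtain ⟨z, hz⟩ := hu.lat k b (by omega) hb'.1 hb'.2
      have l1 : (1 : ℝ) / 2 ≤ ((z + m + 1 : ℤ) : ℝ) := by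
        rw [hz, hm] at pb; push_cast at pb ⊢; linarith
      have l2 : ((z + m + 1 : ℤ) : ℝ) ≤ 1 := by
        rw [hz, hm] at hpos; push_cast at hpos ⊢; linarith
      have l3 : z + m + 1 ≤ 1 := by exact_mod_cast l2
      have l4 : 0 < z + m + 1 := by
        have : (0 : ℝ) < ((z + m + 1 : ℤ) : ℝ) := by linarith
        exact_mod_cast this
      have l5 : z + m + 1 = 1 := by omega
      rw [hz, hm]
      have : ((z + m + 1 : ℤ) : ℝ) = 1 := by rw [l5]; simp
      push_cast at this ⊢
      linarith
    refine h ?_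
    have h0 := hu.restProd_eq_zero_of_one (q := q) hk1 hk hO (0, 0) hb (s := -1)
      (by push_cast; linarith)
    rw [restProd, erase_eq_of_notMem (by simp [mem_nbrs])] at h0
    simp only [stepCoef, rowCoef, h0]
    simp
  refine ⟨hE, hbk, rfl, ?_⟩
  obtain ⟨m, rfl⟩ := hE
  obtain ⟨z, hz⟩ := hu.lat _ b (by omega) hb'.1 hb'.2
  have l2 : z + m < 1 := by
    have : ((z + m : ℤ) : ℝ) < 1 := by rw [hz] at hpos; push_cast at hpos ⊢; linarith
    exact_mod_cast this
  have l3 : 0 ≤ z + m := by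
    have : (0 : ℝ) ≤ ((z + m : ℤ) : ℝ) := by rw [hz] at pb; push_cast at pb ⊢; linarith
    exact_mod_cast this
  have l4 : ((z + m : ℤ) : ℝ) = 0 := by rw [show z + m = 0 by omega]; simp
  rw [hz]; push_cast at l4 ⊢; linarith

omit hu in
lemma pref_ne_zero (hq : 0 < q) (hq1 : q ≠ 1) {w : ℝ} (hw : w ≠ 0) : pref q k w ≠ 0 := by
  rw [pref]
  split_ifs
  · rw [rpow_sub_rpow_neg hq hq1]
    exact one_div_ne_zero (mul_ne_zero (q_sub_inv_ne_zero hq hq1) (qNum_ne_zero hq hq1 hw))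
  · exact one_div_ne_zero (mul_ne_zero (qNum_ne_zero hq hq1 (by simpa using hw))
      (qNumPlus_ne_zero hq hq1 _))

/-- A step has a nonzero coefficient if no neighbour lies at its midpoint and its end, up to sign,
is not another entry of the row; the latter would make the denominator vanish. -/
lemma stepCoef_ne_zero (hq : 0 < q) (hq1 : q ≠ 1) (hk : k + 1 ≤ n) {b : ℕ}
    {s : ℤˣ} (hb : b ∈ Icc 1 (k / 2))
    (hM : ∀ p ∈ nbrs k, u p.1 p.2 ≠ u k b + ((s : ℤ) : ℝ) / 2)
    (hD : ∀ i ∈ (Icc 1 (k / 2)).erase b, u k i ≠ |u k b + ((s : ℤ) : ℝ)|) :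
    stepCoef q e k u (some (b, s)) ≠ 0 := by
  have hb' := mem_Icc.1 hb
  have pb := hu.half_le (by omega) hb'.1 hb'.2
  have hw : ((s : ℤ) : ℝ) * u k b ≠ 0 := by
    rcases unit_cast_eq s with h | h <;> rw [h] <;> intro h <;> linarith
  rw [stepCoef, rowCoef]
  refine div_ne_zero (mul_ne_zero (pref_ne_zero hq hq1 hw) ?_) ?_
  · refine Real.sqrt_ne_zero'.2 (abs_pos.2 (prod_ne_zero_iff.2 fun p hp h0 => hM p hp ?_))
    have h1 := (qNum_sq_eq_iff hq hq1).1 (sub_eq_zero.1 h0)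
    have := hu.mem_nbrs_pos hk hp
    rwa [abs_unit_mul_add_half pb, abs_of_pos (by linarith)] at h1
  · refine Real.sqrt_ne_zero'.2 (abs_pos.2 (prod_ne_zero_iff.2 fun i hi => ?_))
    have hi' := mem_Icc.1 (mem_erase.1 hi).2
    have pi := hu.half_le (k := k) (by omega) hi'.1 hi'.2
    refine mul_ne_zero (fun h0 => ?_) (fun h0 => hD i hi ?_)
    · have h1 := (qNum_sq_eq_iff hq hq1).1 (sub_eq_zero.1 h0)
      rw [abs_unit_mul, abs_of_pos (by linarith), abs_of_pos (by linarith)] at h1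
      rcases lt_or_gt_of_ne (mem_erase.1 hi).1 with h | h
      · have := hu.row_gap hk hi'.1 h hb'.2; linarith
      · have := hu.row_gap hk hb'.1 h hi'.2; linarith
    · have h1 := (qNum_sq_eq_iff hq hq1).1 (sub_eq_zero.1 h0)
      rwa [abs_unit_mul_add_one, abs_of_pos (by linarith)] at h1

/-- The coefficient of a step between two tableaux does not vanish. -/
lemma stepCoef_ne_zero_of_moveArr (hq : 0 < q) (hq1 : q ≠ 1) (hk1 : 1 ≤ k) (hk : k + 1 ≤ n) {b : ℕ}
    {s : ℤˣ} (hb : b ∈ Icc 1 (k / 2)) (hu' : Interlacing n (moveArr u k (some (b, s)))) :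
    stepCoef q e k u (some (b, s)) ≠ 0 := by
  have hb' := mem_Icc.1 hb
  have pb := hu'.half_le (k := k) (by omega) hb'.1 hb'.2
  rw [moveArr_some_self] at pb
  refine hu.stepCoef_ne_zero hq hq1 hk hb (fun p hp heq => ?_) (fun i hi heq => ?_)
  · have hside : ((p.1 = k + 1 ∧ p.2 ≤ b) ∨ (p.1 = k - 1 ∧ p.2 < b)) ∨
        ((p.1 = k + 1 ∧ b < p.2) ∨ (p.1 = k - 1 ∧ b ≤ p.2)) := by
      rw [mem_nbrs] at hp; omega
    have hpk : p.1 ≠ k := ne_of_mem_nbrs hk1 hp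
    rcases hside with h | h
    · have h1 := hu.le_nbr hk1 hk hb'.1 hb'.2 hp h
      have h2 := hu'.le_nbr hk1 hk hb'.1 hb'.2 hp h
      rw [moveArr_some_self, moveArr_some_of_ne u s fun h => absurd h hpk] at h2
      rcases unit_cast_eq s with h | h <;> rw [h] at heq h2 <;> linarith
    · have h1 := hu.nbr_le hk1 hk hb'.1 hb'.2 hp h
      have h2 := hu'.nbr_le hk1 hk hb'.1 hb'.2 hp h
      rw [moveArr_some_self, moveArr_some_of_ne u s fun h => absurd h hpk] at h2
      rcases unit_cast_eq s with h | h <;> rw [h] at heq h2 <;> linarith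
  · rw [mem_erase, mem_Icc] at hi
    rw [abs_of_pos (by linarith)] at heq
    rcases lt_or_gt_of_ne hi.1 with h | h
    · have := hu'.row_gap hk hi.2.1 h hb'.2
      rw [moveArr_some_self, moveArr_some_of_ne u s fun _ => hi.1] at this
      linarith
    · have := hu'.row_gap hk hb'.1 h hi.2.2
      rw [moveArr_some_self, moveArr_some_of_ne u s fun _ => hi.1] at this
      linarith

/-- The coefficient of the reflected step at an entry `1/2` does not vanish. -/
lemma stepCoef_half_ne_zero (hq : 0 < q) (hq1 : q ≠ 1) (hk2 : 2 ≤ k) (hk : k + 1 ≤ n)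
    (h : u k (k / 2) = 1 / 2) : stepCoef q e k u (some (k / 2, -1)) ≠ 0 := by
  refine hu.stepCoef_ne_zero hq hq1 hk (mem_Icc.2 ⟨by omega, le_rfl⟩) (fun p hp heq => ?_)
    (fun i hi heq => ?_)
  · have := hu.mem_nbrs_pos hk hp
    push_cast at heq; linarith
  · rw [mem_erase, mem_Icc] at hi
    have := hu.row_gap hk (i := i) (j := k / 2) hi.2.1 (by omega) le_rfl
    rw [h] at heq this
    push_cast at heq
    norm_num [abs_of_neg] at heq
    linarith

end Interlacing

/-! ### Folding -/

/-- The matrix elements of `I_{k+1,k}` between tableaux: the step of an even row that would replace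
the last entry `1/2` by `-1/2` contributes to the diagonal, with the sign `-e`. -/
def foldCoef (q e : ℝ) (k : ℕ) (u : ℕ → ℕ → ℝ) : Step → ℝ
  | none => stepCoef q e k u none -
      if Even k ∧ u k (k / 2) = 1 / 2 then e * stepCoef q e k u (some (k / 2, -1)) else 0
  | some (b, s) => if 0 < u k b + ((s : ℤ) : ℝ) then stepCoef q e k u (some (b, s)) else 0

lemma stepCoef_congr {q e : ℝ} {k : ℕ} {u v : ℕ → ℕ → ℝ} (h : u k = v k) (h1 : u (k + 1) = v (k + 1))
    (h2 : u (k - 1) = v (k - 1)) : stepCoef q e k u = stepCoef q e k v := by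
  have hp : ∀ g : ℝ → ℝ, ∏ x ∈ nbrs k, g (u x.1 x.2) = ∏ x ∈ nbrs k, g (v x.1 x.2) := by
    intro g
    refine prod_congr rfl fun x hx => ?_
    rw [mem_nbrs] at hx
    rcases hx with ⟨hx, -⟩ | ⟨hx, -⟩ <;> rw [hx]
    · rw [h1]
    · rw [h2]
  have hA : ∀ w : ℝ, ∏ x ∈ nbrs k, (qNum q (u x.1 x.2) ^ 2 - qNum q (w + 1 / 2) ^ 2) =
      ∏ x ∈ nbrs k, (qNum q (v x.1 x.2) ^ 2 - qNum q (w + 1 / 2) ^ 2) := fun w =>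
    hp fun y => qNum q y ^ 2 - qNum q (w + 1 / 2) ^ 2
  simp only [stepCoef, hA, hp fun y => qNumPlus q y, h]

lemma foldCoef_congr {q e : ℝ} {k : ℕ} {u v : ℕ → ℕ → ℝ} (h : u k = v k) (h1 : u (k + 1) = v (k + 1))
    (h2 : u (k - 1) = v (k - 1)) : foldCoef q e k u = foldCoef q e k v := by
  funext σ
  rcases σ with _ | ⟨b, s⟩ <;> simp only [foldCoef, stepCoef_congr h h1 h2, h]

/-- The reflection of row `k`: the last entry changes its sign. -/
def reflArr (u : ℕ → ℕ → ℝ) (k : ℕ) : ℕ → ℕ → ℝ :=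
  Function.update u k (Function.update (u k) (k / 2) (-u k (k / 2)))

/-- The action of the reflection of row `κ` on the steps of row `k`. -/
def reflStep (κ k : ℕ) : Step → Step
  | none => none
  | some (b, s) => if k = κ ∧ b = κ / 2 then some (b, -s) else some (b, s)

lemma reflStep_reflStep (κ k : ℕ) (σ : Step) : reflStep κ k (reflStep κ k σ) = σ := by
  rcases σ with _ | ⟨b, s⟩
  · rfl
  · by_cases h : k = κ ∧ b = κ / 2 <;> simp [reflStep, h]

lemma reflStep_mem {κ k : ℕ} {S : Finset ℕ} {σ : Step} (h : σ ∈ stepsOf S) :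
    reflStep κ k σ ∈ stepsOf S := by
  rcases σ with _ | ⟨b, s⟩
  · exact h
  · rw [reflStep]; split_ifs
    · exact some_mem_stepsOf.2 (some_mem_stepsOf.1 h)
    · exact h

lemma sum_reflStep {M : Type*} [AddCommMonoid M] (κ k : ℕ) (S : Finset ℕ) (g : Step → M) :
    ∑ σ ∈ stepsOf S, g (reflStep κ k σ) = ∑ σ ∈ stepsOf S, g σ :=
  sum_nbij' (reflStep κ k) (reflStep κ k) (fun _ h => reflStep_mem h) (fun _ h => reflStep_mem h)
    (fun σ _ => reflStep_reflStep κ k σ) (fun σ _ => reflStep_reflStep κ k σ) fun _ _ => rfl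

lemma reflArr_self (u : ℕ → ℕ → ℝ) (k : ℕ) : reflArr u k k (k / 2) = -u k (k / 2) := by
  simp [reflArr]

lemma reflArr_of_ne (u : ℕ → ℕ → ℝ) {k i j : ℕ} (h : i = k → j ≠ k / 2) :
    reflArr u k i j = u i j := by
  by_cases hi : i = k
  · subst hi; simp [reflArr, h rfl]
  · simp [reflArr, hi]

lemma reflArr_row (u : ℕ → ℕ → ℝ) {k i : ℕ} (h : i ≠ k) : reflArr u k i = u i :=
  Function.update_of_ne h _ _

lemma reflArr_reflArr (u : ℕ → ℕ → ℝ) (k : ℕ) : reflArr (reflArr u k) k = u := by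
  ext i j
  by_cases h : i = k ∧ j = k / 2
  · obtain ⟨rfl, rfl⟩ := h
    rw [reflArr_self, reflArr_self, neg_neg]
  · rw [reflArr_of_ne _ fun h1 h2 => h ⟨h1, h2⟩, reflArr_of_ne _ fun h1 h2 => h ⟨h1, h2⟩]

lemma even_reflArr {f : ℝ → ℝ} (hf : ∀ x, f (-x) = f x) (u : ℕ → ℕ → ℝ) (κ i j : ℕ) :
    f (reflArr u κ i j) = f (u i j) := by
  by_cases h : i = κ ∧ j = κ / 2
  · obtain ⟨rfl, rfl⟩ := h
    rw [reflArr_self, hf]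
  · rw [reflArr_of_ne _ fun h1 h2 => h ⟨h1, h2⟩]

lemma moveArr_reflArr (u : ℕ → ℕ → ℝ) (κ k : ℕ) (σ : Step) :
    moveArr (reflArr u κ) k σ = reflArr (moveArr u k (reflStep κ k σ)) κ := by
  rcases σ with _ | ⟨b, s⟩
  · rw [reflStep, moveArr_none, moveArr_none]
  rw [reflStep]
  by_cases h : k = κ ∧ b = κ / 2
  · rw [if_pos h]
    obtain ⟨rfl, rfl⟩ := h
    ext i j
    by_cases hij : i = k ∧ j = k / 2
    · obtain ⟨rfl, rfl⟩ := hij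
      rw [moveArr_some_self, reflArr_self, reflArr_self, moveArr_some_self]
      push_cast; ring
    · have h' : i = k → j ≠ k / 2 := fun h1 h2 => hij ⟨h1, h2⟩
      rw [moveArr_some_of_ne _ _ h', reflArr_of_ne _ h', reflArr_of_ne _ h',
        moveArr_some_of_ne _ _ h']
  · rw [if_neg h]
    ext i j
    by_cases hij : i = κ ∧ j = κ / 2
    · obtain ⟨rfl, rfl⟩ := hij
      have h' : i = k → i / 2 ≠ b := by rintro rfl h2; exact h ⟨rfl, h2.symm⟩
      rw [moveArr_some_of_ne _ _ h', reflArr_self, reflArr_self, moveArr_some_of_ne _ _ h']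
    · have h' : i = κ → j ≠ κ / 2 := fun h1 h2 => hij ⟨h1, h2⟩
      rw [reflArr_of_ne _ h']
      by_cases hm : i = k ∧ j = b
      · obtain ⟨rfl, rfl⟩ := hm
        rw [moveArr_some_self, moveArr_some_self, reflArr_of_ne _ h']
      · have hm' : i = k → j ≠ b := fun h1 h2 => hm ⟨h1, h2⟩
        rw [moveArr_some_of_ne _ _ hm', moveArr_some_of_ne _ _ hm', reflArr_of_ne _ h']

/-- The coefficients of a reflected array are those of the reflected steps, since they are even in
the entries. -/
lemma stepCoef_reflArr {q e : ℝ} {κ k : ℕ} (u : ℕ → ℕ → ℝ) (h : k = κ → Even k) (σ : Step) :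
    stepCoef q e k (reflArr u κ) σ = stepCoef q e k u (reflStep κ k σ) := by
  have hA : ∀ w, ∏ x ∈ nbrs k, (qNum q (reflArr u κ x.1 x.2) ^ 2 - qNum q (w + 1 / 2) ^ 2) =
      ∏ x ∈ nbrs k, (qNum q (u x.1 x.2) ^ 2 - qNum q (w + 1 / 2) ^ 2) := fun w =>
    prod_congr rfl fun x _ => by rw [even_reflArr (f := fun y => qNum q y ^ 2) (qNum_sq_neg q)]
  have hB : ∏ x ∈ nbrs k, qNumPlus q (reflArr u κ x.1 x.2) = ∏ x ∈ nbrs k, qNumPlus q (u x.1 x.2) :=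
    prod_congr rfl fun x _ => by rw [even_reflArr (f := fun y => qNumPlus q y) (qNumPlus_neg q)]
  have hD : ∀ b w, rowDen q (Icc 1 (k / 2)) (reflArr u κ k) b w =
      rowDen q (Icc 1 (k / 2)) (u k) b w := fun b w => prod_congr rfl fun i _ => by
    rw [even_reflArr (f := fun y => qNum q y ^ 2) (qNum_sq_neg q)]
  simp only [stepCoef, hA, hB]
  rcases σ with _ | ⟨b, s⟩
  · rw [reflStep]
    simp only [rowCoef]
    by_cases hE : Even k
    · simp [hE]
    · rw [reflArr_row u fun h' => hE (h h')]
  · rw [reflStep]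
    by_cases hb : k = κ ∧ b = κ / 2
    · rw [if_pos hb]
      obtain ⟨rfl, rfl⟩ := hb
      have : ((s : ℤ) : ℝ) * reflArr u k k (k / 2) = (((-s : ℤˣ) : ℤ) : ℝ) * u k (k / 2) := by
        rw [reflArr_self]; push_cast; ring
      simp only [rowCoef, hD, this]
    · rw [if_neg hb]
      simp only [rowCoef, hD, reflArr_of_ne u (fun h1 h2 => hb ⟨h1, h2⟩ : k = κ → b ≠ κ / 2)]

/-! ### The operators on the space of all tableaux -/

/-- The coordinates `u_{j,k} = m_{j,k} + k/2 - j`. -/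
def uCoord (ξ : ℕ → ℕ → ℝ) (k j : ℕ) : ℝ := ξ k j + (k : ℝ) / 2 - j

/-- The nonclassical tableaux with `n - 1` rows and an arbitrary top row. -/
def Adm (n : ℕ) (ξ : ℕ → ℕ → ℝ) : Prop :=
  (∀ k j, ¬ IsPosition n k j → ξ k j = 0) ∧ Interlacing n (uCoord ξ)

lemma uCoord_moveArr (ξ : ℕ → ℕ → ℝ) (k : ℕ) (σ : Step) :
    uCoord (moveArr ξ k σ) = moveArr (uCoord ξ) k σ := by
  rcases σ with _ | ⟨b, s⟩
  · rw [moveArr_none, moveArr_none]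
  ext i j
  by_cases h : i = k ∧ j = b
  · obtain ⟨rfl, rfl⟩ := h
    rw [moveArr_some_self, uCoord, moveArr_some_self, uCoord]; ring
  · have h' : i = k → j ≠ b := fun h1 h2 => h ⟨h1, h2⟩
    rw [moveArr_some_of_ne _ _ h', uCoord, moveArr_some_of_ne _ _ h', uCoord]

lemma uCoord_reflArr (ξ : ℕ → ℕ → ℝ) {k : ℕ} (hk : Even k) :
    uCoord (reflArr ξ k) = reflArr (uCoord ξ) k := by
  ext i j
  by_cases h : i = k ∧ j = k / 2
  · obtain ⟨rfl, rfl⟩ := h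
    obtain ⟨m, rfl⟩ := hk
    rw [reflArr_self, uCoord, reflArr_self, uCoord, show (m + m) / 2 = m by omega]
    push_cast; ring
  · have h' : i = k → j ≠ k / 2 := fun h1 h2 => h ⟨h1, h2⟩
    rw [reflArr_of_ne _ h', uCoord, reflArr_of_ne _ h', uCoord]

lemma uCoord_row_congr {ξ η : ℕ → ℕ → ℝ} {k : ℕ} (h : ξ k = η k) : uCoord ξ k = uCoord η k := by
  funext j; rw [uCoord, uCoord, h]

lemma moveArr_comm (u : ℕ → ℕ → ℝ) {k k' : ℕ} (h : k ≠ k') (σ σ' : Step) :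
    moveArr (moveArr u k σ) k' σ' = moveArr (moveArr u k' σ') k σ := by
  simp only [moveArr, Function.update_of_ne h, Function.update_of_ne h.symm]
  exact Function.update_comm h _ _ _

/-- Two steps in the same row commute. -/
lemma moveArr_swap (u : ℕ → ℕ → ℝ) (k : ℕ) (σ τ : Step) :
    moveArr (moveArr u k σ) k τ = moveArr (moveArr u k τ) k σ := by
  rcases σ with _ | ⟨b, s⟩
  · rw [moveArr_none, moveArr_none]
  rcases τ with _ | ⟨c, t⟩
  · rw [moveArr_none, moveArr_none]
  ext i j
  by_cases h1 : i = k ∧ j = b <;> by_cases h2 : i = k ∧ j = c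
  · obtain ⟨rfl, rfl⟩ := h1
    obtain ⟨-, rfl⟩ := h2
    rw [moveArr_some_self, moveArr_some_self, moveArr_some_self, moveArr_some_self]; ring
  · have h2' : i = k → j ≠ c := fun e1 e2 => h2 ⟨e1, e2⟩
    obtain ⟨rfl, rfl⟩ := h1
    rw [moveArr_some_self, moveArr_some_of_ne _ _ h2', moveArr_some_of_ne _ _ h2',
      moveArr_some_self]
  · have h1' : i = k → j ≠ b := fun e1 e2 => h1 ⟨e1, e2⟩
    obtain ⟨rfl, rfl⟩ := h2
    rw [moveArr_some_self, moveArr_some_of_ne _ _ h1', moveArr_some_of_ne _ _ h1',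
      moveArr_some_self]
  · have h1' : i = k → j ≠ b := fun e1 e2 => h1 ⟨e1, e2⟩
    have h2' : i = k → j ≠ c := fun e1 e2 => h2 ⟨e1, e2⟩
    rw [moveArr_some_of_ne _ _ h1', moveArr_some_of_ne _ _ h2', moveArr_some_of_ne _ _ h2',
      moveArr_some_of_ne _ _ h1']

lemma moveArr_inv (u : ℕ → ℕ → ℝ) (k : ℕ) (σ : Step) :
    moveArr (moveArr u k σ) k σ.inv = u := by
  rcases σ with _ | ⟨b, s⟩
  · rw [Step.inv, moveArr_none, moveArr_none]
  ext i j
  rw [Step.inv]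
  by_cases h1 : i = k ∧ j = b
  · obtain ⟨rfl, rfl⟩ := h1
    rw [moveArr_some_self, moveArr_some_self]; push_cast; ring
  · have h1' : i = k → j ≠ b := fun e1 e2 => h1 ⟨e1, e2⟩
    rw [moveArr_some_of_ne _ _ h1', moveArr_some_of_ne _ _ h1']

lemma Step.inv_inv (σ : Step) : σ.inv.inv = σ := by
  rcases σ with _ | ⟨b, s⟩ <;> simp [Step.inv]

lemma Step.inv_mem {S : Finset ℕ} {σ : Step} (h : σ ∈ stepsOf S) : σ.inv ∈ stepsOf S := by
  rcases σ with _ | ⟨b, s⟩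
  · exact h
  · exact some_mem_stepsOf.2 (some_mem_stepsOf.1 h)

lemma adm_moveArr {n : ℕ} {ξ : ℕ → ℕ → ℝ} (hξ : Adm n ξ) {k : ℕ} (hk : k ≤ n) {σ : Step}
    (hσ : σ ∈ stepsOf (Icc 1 (k / 2))) (h : Interlacing n (moveArr (uCoord ξ) k σ)) :
    Adm n (moveArr ξ k σ) := by
  refine ⟨fun i j hij => ?_, by rwa [uCoord_moveArr]⟩
  rcases σ with _ | ⟨b, s⟩
  · rw [moveArr_none]; exact hξ.1 i j hij
  · rw [some_mem_stepsOf, mem_Icc] at hσ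
    rw [moveArr_some_of_ne]
    · exact hξ.1 i j hij
    · rintro rfl rfl
      exact hij ⟨by omega, hk, hσ.1, hσ.2⟩

section Ambient

variable {q : ℝ} {n : ℕ} {e : ℕ → ℝ}

/-- The operator of `I_{k+1,k}` on the space of all tableaux; `e k` stands for `ε_{k+1}`. -/
def ambientOp (q : ℝ) (n : ℕ) (e : ℕ → ℝ) (k : ℕ) :
    ({ξ : ℕ → ℕ → ℝ // Adm n ξ} →₀ ℂ) →ₗ[ℂ] ({ξ : ℕ → ℕ → ℝ // Adm n ξ} →₀ ℂ) :=
  Finsupp.linearCombination ℂ fun ξ => ∑ σ ∈ stepsOf (Icc 1 (k / 2)),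
    foldCoef q (e k) k (uCoord ξ.1) σ • ket (Adm n) (moveArr ξ.1 k σ)

lemma ket_of_not {P : (ℕ → ℕ → ℝ) → Prop} {ξ : ℕ → ℕ → ℝ} (h : ¬ P ξ) : ket P ξ = 0 := dif_neg h

lemma ket_of {P : (ℕ → ℕ → ℝ) → Prop} {ξ : ℕ → ℕ → ℝ} (h : P ξ) :
    ket P ξ = Finsupp.single ⟨ξ, h⟩ 1 := dif_pos h

lemma ambientOp_ket {ξ : ℕ → ℕ → ℝ} (hξ : Adm n ξ) (k : ℕ) :
    ambientOp q n e k (ket (Adm n) ξ) = ∑ σ ∈ stepsOf (Icc 1 (k / 2)),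
      foldCoef q (e k) k (uCoord ξ) σ • ket (Adm n) (moveArr ξ k σ) := by
  rw [ket_of hξ, ambientOp, Finsupp.linearCombination_single, one_smul]

/-- The basis vectors extended to arrays in which the last entry of row `κ` may be negative: such an
array stands for `-e` times the tableau obtained by reflection. -/
def foldKet (n : ℕ) (e : ℝ) (κ : ℕ) (ξ : ℕ → ℕ → ℝ) : {ξ : ℕ → ℕ → ℝ // Adm n ξ} →₀ ℂ :=
  ket (Adm n) ξ - e • ket (Adm n) (reflArr ξ κ)

lemma foldKet_reflArr {e : ℝ} (he : e ^ 2 = 1) (κ : ℕ) (ξ : ℕ → ℕ → ℝ) :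
    foldKet n e κ (reflArr ξ κ) = -e • foldKet n e κ ξ := by
  rw [foldKet, foldKet, reflArr_reflArr, smul_sub, smul_smul, neg_mul, ← sq, he]
  module

lemma not_adm_of_neg {ξ : ℕ → ℕ → ℝ} {κ : ℕ} (hκ : Even κ) (hκ2 : 2 ≤ κ) (hκn : κ ≤ n)
    (h : uCoord ξ κ (κ / 2) ≤ 0) : ¬ Adm n ξ := fun hξ =>
  (hξ.2.pos κ (κ / 2) hκn (by obtain ⟨m, rfl⟩ := hκ; omega) le_rfl).not_ge h

lemma not_adm_reflArr {ξ : ℕ → ℕ → ℝ} {κ : ℕ} (hκ : Even κ) (hκ2 : 2 ≤ κ) (hκn : κ ≤ n)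
    (h : 0 ≤ uCoord ξ κ (κ / 2)) : ¬ Adm n (reflArr ξ κ) := by
  refine not_adm_of_neg hκ hκ2 hκn ?_
  rw [uCoord_reflArr _ hκ, reflArr_self]; linarith

lemma foldKet_of_adm {e : ℝ} {ξ : ℕ → ℕ → ℝ} {κ : ℕ} (hκ : Even κ) (hκ2 : 2 ≤ κ) (hκn : κ ≤ n)
    (hξ : Adm n ξ) : foldKet n e κ ξ = ket (Adm n) ξ := by
  have := (hξ.2.pos κ (κ / 2) hκn (by obtain ⟨m, rfl⟩ := hκ; omega) le_rfl).le
  rw [foldKet, ket_of_not (not_adm_reflArr hκ hκ2 hκn this), smul_zero, sub_zero]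

/-- The step from `1/2` to `-1/2` followed by the reflection leads back. -/
lemma reflArr_moveArr_half {ξ : ℕ → ℕ → ℝ} {k : ℕ} (hk : Even k)
    (h : uCoord ξ k (k / 2) = 1 / 2) : reflArr (moveArr ξ k (some (k / 2, -1))) k = ξ := by
  have h' : ξ k (k / 2) = 1 / 2 := by
    obtain ⟨m, rfl⟩ := hk
    rw [uCoord, show (m + m) / 2 = m by omega] at h
    rw [show (m + m) / 2 = m by omega]
    push_cast at h; linarith
  ext i j
  by_cases hij : i = k ∧ j = k / 2
  · obtain ⟨rfl, rfl⟩ := hij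
    rw [reflArr_self, moveArr_some_self, h']; push_cast; norm_num
  · have hij' : i = k → j ≠ k / 2 := fun h1 h2 => hij ⟨h1, h2⟩
    rw [reflArr_of_ne _ hij', moveArr_some_of_ne _ _ hij']

/-- In terms of the folded vectors, the operators have the coefficients `stepCoef`. -/
lemma ambientOp_foldKet_of_adm {κ k : ℕ} (hκ : Even κ) (hκ2 : 2 ≤ κ)
    (hκn : κ ≤ n) (hk1 : 1 ≤ k) (hk : k + 1 ≤ n) (hkκ : k = κ ∨ ¬ Even k) {ξ : ℕ → ℕ → ℝ}
    (hξ : Adm n ξ) :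
    ambientOp q n e k (foldKet n (e κ) κ ξ) = ∑ σ ∈ stepsOf (Icc 1 (k / 2)),
      stepCoef q (e k) k (uCoord ξ) σ • foldKet n (e κ) κ (moveArr ξ k σ) := by
  have hκ1 : 1 ≤ κ / 2 := by omega
  have hlast : 1 / 2 ≤ uCoord ξ κ (κ / 2) := hξ.2.half_le hκn hκ1 le_rfl
  rw [foldKet_of_adm hκ hκ2 hκn hξ, ambientOp_ket hξ]
  -- the terms that are not affected by the reflection
  have hterm : ∀ b ∈ Icc 1 (k / 2), ∀ s : ℤˣ,
      ¬ (Even k ∧ b = k / 2 ∧ s = -1 ∧ uCoord ξ k b = 1 / 2) →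
      foldCoef q (e k) k (uCoord ξ) (some (b, s)) • ket (Adm n) (moveArr ξ k (some (b, s))) =
      stepCoef q (e k) k (uCoord ξ) (some (b, s)) •
        foldKet n (e κ) κ (moveArr ξ k (some (b, s))) := by
    intro b hb s hne
    by_cases h0 : stepCoef q (e k) k (uCoord ξ) (some (b, s)) = 0
    · rw [foldCoef, h0]; simp
    have hpos : 0 < uCoord ξ k b + ((s : ℤ) : ℝ) := by
      by_contra hpos
      exact hne (hξ.2.eq_half_of_stepCoef_ne_zero hk1 hk hb hpos h0)
    have := adm_moveArr hξ (by omega) (some_mem_stepsOf.2 hb)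
      (hξ.2.move_of_stepCoef_ne_zero hk1 hk hb hpos h0)
    rw [foldCoef, if_pos hpos, foldKet_of_adm hκ hκ2 hκn this]
  by_cases hhalf : Even k ∧ uCoord ξ k (k / 2) = 1 / 2
  · have hkκ' : k = κ := hkκ.resolve_right fun h => h hhalf.1
    subst hkκ'
    have hmem : some (k / 2, -1) ∈ stepsOf (Icc 1 (k / 2)) :=
      some_mem_stepsOf.2 (mem_Icc.2 ⟨hκ1, le_rfl⟩)
    have hmem2 : none ∈ (stepsOf (Icc 1 (k / 2))).erase (some (k / 2, -1)) :=
      mem_erase.2 ⟨by simp, none_mem_stepsOf _⟩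
    rw [← add_sum_erase _ _ hmem, ← add_sum_erase _ _ hmem2, ← add_sum_erase _ _ hmem,
      ← add_sum_erase _ _ hmem2, ← add_assoc, ← add_assoc]
    congr 1
    -- the step from `1/2` to `-1/2`, reflected, gives the diagonal term
    · have hneg : uCoord (moveArr ξ k (some (k / 2, -1))) k (k / 2) ≤ 0 := by
        rw [uCoord_moveArr, moveArr_some_self, hhalf.2]; push_cast; norm_num
      have h0 : stepCoef q (e k) k (uCoord ξ) none = 0 := by simp [stepCoef, rowCoef, hκ]
      rw [foldKet, reflArr_moveArr_half hκ hhalf.2, ket_of_not (not_adm_of_neg hκ hκ2 hκn hneg),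
        foldCoef, foldCoef, if_pos hhalf, moveArr_none, h0]
      module
    · refine sum_congr rfl fun σ hσ => ?_
      rw [mem_erase, mem_erase] at hσ
      rcases σ with _ | ⟨b, s⟩
      · exact absurd rfl hσ.1
      · refine hterm b (some_mem_stepsOf.1 hσ.2.2) s ?_
        rintro ⟨-, rfl, rfl, -⟩
        exact hσ.2.1 rfl
  · refine sum_congr rfl fun σ hσ => ?_
    rcases σ with _ | ⟨b, s⟩
    · rw [foldCoef, if_neg hhalf, sub_zero, moveArr_none, foldKet_of_adm hκ hκ2 hκn hξ]
    · refine hterm b (some_mem_stepsOf.1 hσ) s ?_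
      rintro ⟨h1, rfl, -, h2⟩
      exact hhalf ⟨h1, h2⟩

/-- Tableaux and their images under the reflection of row `κ`. -/
def AdmFold (n κ : ℕ) (ξ : ℕ → ℕ → ℝ) : Prop := Adm n ξ ∨ Adm n (reflArr ξ κ)

/-- The operators have the coefficients `stepCoef` on the folded vectors, also for arrays with a
negative last entry. This needs `e κ = ±1`. -/
lemma ambientOp_foldKet (he : ∀ k, e k ^ 2 = 1) {κ k : ℕ} (hκ : Even κ) (hκ2 : 2 ≤ κ)
    (hκn : κ ≤ n) (hk1 : 1 ≤ k) (hk : k + 1 ≤ n) (hkκ : k = κ ∨ ¬ Even k) {ξ : ℕ → ℕ → ℝ}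
    (hξ : AdmFold n κ ξ) :
    ambientOp q n e k (foldKet n (e κ) κ ξ) = ∑ σ ∈ stepsOf (Icc 1 (k / 2)),
      stepCoef q (e k) k (uCoord ξ) σ • foldKet n (e κ) κ (moveArr ξ k σ) := by
  rcases hξ with hξ | hξ
  · exact ambientOp_foldKet_of_adm hκ hκ2 hκn hk1 hk hkκ hξ
  -- reflecting, applying the operator, and reflecting back
  · have hkE : k = κ → Even k := fun h => h ▸ hκ
    have h1 := ambientOp_foldKet_of_adm (q := q) (e := e) hκ hκ2 hκn hk1 hk hkκ hξ
    rw [foldKet_reflArr (he κ)] at h1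
    have h2 : ambientOp q n e k (foldKet n (e κ) κ ξ) =
        -e κ • ambientOp q n e k (-e κ • foldKet n (e κ) κ ξ) := by
      rw [LinearMap.map_smul_of_tower, smul_smul, neg_mul_neg, ← sq, he, one_smul]
    rw [h2, h1, smul_sum, ← sum_reflStep κ k]
    refine sum_congr rfl fun σ _ => ?_
    rw [uCoord_reflArr _ hκ, stepCoef_reflArr _ hkE, reflStep_reflStep, moveArr_reflArr,
      reflStep_reflStep, foldKet_reflArr (he κ), smul_comm, smul_smul (-e κ), neg_mul_neg, ← sq, he,
      one_smul]

lemma admFold_moveArr_of_adm {κ k : ℕ} {e : ℝ} (hk1 : 1 ≤ k) (hk : k + 1 ≤ n)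
    (hkκ : k = κ ∨ ¬ Even k) {ξ : ℕ → ℕ → ℝ} (hξ : Adm n ξ) {σ : Step}
    (hσ : σ ∈ stepsOf (Icc 1 (k / 2))) (h : stepCoef q e k (uCoord ξ) σ ≠ 0) :
    AdmFold n κ (moveArr ξ k σ) := by
  rcases σ with _ | ⟨b, s⟩
  · rw [moveArr_none]; exact Or.inl hξ
  have hb := some_mem_stepsOf.1 hσ
  by_cases hpos : 0 < uCoord ξ k b + ((s : ℤ) : ℝ)
  · exact Or.inl (adm_moveArr hξ (by omega) hσ (hξ.2.move_of_stepCoef_ne_zero hk1 hk hb hpos h))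
  · obtain ⟨hE, rfl, rfl, h2⟩ := hξ.2.eq_half_of_stepCoef_ne_zero hk1 hk hb hpos h
    obtain rfl := hkκ.resolve_right fun h => h hE
    right
    rwa [reflArr_moveArr_half hE h2]

/-- Steps with nonzero coefficients do not leave the tableaux and their reflections. -/
lemma admFold_moveArr {κ k : ℕ} {e : ℝ} (hκ : Even κ) (hk1 : 1 ≤ k) (hk : k + 1 ≤ n)
    (hkκ : k = κ ∨ ¬ Even k) {ξ : ℕ → ℕ → ℝ} (hξ : AdmFold n κ ξ) {σ : Step}
    (hσ : σ ∈ stepsOf (Icc 1 (k / 2))) (h : stepCoef q e k (uCoord ξ) σ ≠ 0) :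
    AdmFold n κ (moveArr ξ k σ) := by
  rcases hξ with hξ | hξ
  · exact admFold_moveArr_of_adm hk1 hk hkκ hξ hσ h
  · have hkE : k = κ → Even k := fun h => h ▸ hκ
    have h1 := admFold_moveArr_of_adm (q := q) (e := e) hk1 hk hkκ hξ
      (reflStep_mem (κ := κ) (k := k) hσ) ?_
    · rw [moveArr_reflArr, reflStep_reflStep] at h1
      rcases h1 with h1 | h1
      · exact Or.inr h1
      · rw [reflArr_reflArr] at h1
        exact Or.inl h1
    · rwa [uCoord_reflArr _ hκ, stepCoef_reflArr _ hkE, reflStep_reflStep]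

end Ambient

/-! ### The defining relations on the space of all tableaux -/

section Ambient

variable {q : ℝ} {n : ℕ} {e : ℕ → ℝ}

/-- A linear combination of folded vectors is mapped term by term, provided that the coefficients
vanish outside the folded tableaux. -/
lemma ambientOp_sum (he : ∀ k, e k ^ 2 = 1) {κ k : ℕ} (hκ : Even κ) (hκ2 : 2 ≤ κ)
    (hκn : κ ≤ n) (hk1 : 1 ≤ k) (hk : k + 1 ≤ n) (hkκ : k = κ ∨ ¬ Even k) {ι : Type*}
    (A : Finset ι) (c : ι → ℝ) (η : ι → ℕ → ℕ → ℝ) (h : ∀ i ∈ A, c i ≠ 0 → AdmFold n κ (η i)) :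
    ambientOp q n e k (∑ i ∈ A, c i • foldKet n (e κ) κ (η i)) =
      ∑ x ∈ A ×ˢ stepsOf (Icc 1 (k / 2)),
        (c x.1 * stepCoef q (e k) k (uCoord (η x.1)) x.2) •
          foldKet n (e κ) κ (moveArr (η x.1) k x.2) := by
  rw [map_sum, sum_product]
  refine sum_congr rfl fun i hi => ?_
  rw [LinearMap.map_smul_of_tower]
  by_cases h0 : c i = 0
  · simp [h0]
  · rw [ambientOp_foldKet he hκ hκ2 hκn hk1 hk hkκ (h i hi h0), smul_sum]
    exact sum_congr rfl fun σ _ => smul_smul _ _ _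

/-- Three operators in succession. -/
lemma ambientOp_comp₃ (he : ∀ k, e k ^ 2 = 1) {κ : ℕ} (hκ : Even κ) (hκ2 : 2 ≤ κ)
    (hκn : κ ≤ n) {k₀ k₁ k₂ : ℕ} (h₀ : 1 ≤ k₀ ∧ k₀ + 1 ≤ n ∧ (k₀ = κ ∨ ¬ Even k₀))
    (h₁ : 1 ≤ k₁ ∧ k₁ + 1 ≤ n ∧ (k₁ = κ ∨ ¬ Even k₁))
    (h₂ : 1 ≤ k₂ ∧ k₂ + 1 ≤ n ∧ (k₂ = κ ∨ ¬ Even k₂)) {ξ : ℕ → ℕ → ℝ} (hξ : Adm n ξ) :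
    ambientOp q n e k₂ (ambientOp q n e k₁ (ambientOp q n e k₀ (ket (Adm n) ξ))) =
      ∑ σ₀ ∈ stepsOf (Icc 1 (k₀ / 2)), ∑ σ₁ ∈ stepsOf (Icc 1 (k₁ / 2)),
        ∑ σ₂ ∈ stepsOf (Icc 1 (k₂ / 2)),
        (stepCoef q (e k₀) k₀ (uCoord ξ) σ₀ *
          stepCoef q (e k₁) k₁ (moveArr (uCoord ξ) k₀ σ₀) σ₁ *
          stepCoef q (e k₂) k₂ (moveArr (moveArr (uCoord ξ) k₀ σ₀) k₁ σ₁) σ₂) •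
          foldKet n (e κ) κ (moveArr (moveArr (moveArr ξ k₀ σ₀) k₁ σ₁) k₂ σ₂) := by
  have g0 : AdmFold n κ ξ := Or.inl hξ
  have g1 : ∀ σ ∈ stepsOf (Icc 1 (k₀ / 2)), stepCoef q (e k₀) k₀ (uCoord ξ) σ ≠ 0 →
      AdmFold n κ (moveArr ξ k₀ σ) := fun σ hσ h =>
    admFold_moveArr hκ h₀.1 h₀.2.1 h₀.2.2 g0 hσ h
  rw [← foldKet_of_adm (e := e κ) hκ hκ2 hκn hξ,
    ambientOp_foldKet he hκ hκ2 hκn h₀.1 h₀.2.1 h₀.2.2 g0,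
    ambientOp_sum he hκ hκ2 hκn h₁.1 h₁.2.1 h₁.2.2 _ _ _ g1,
    ambientOp_sum he hκ hκ2 hκn h₂.1 h₂.2.1 h₂.2.2 _ _ _ ?_]
  · simp only [sum_product, uCoord_moveArr]
  · rintro ⟨σ, τ⟩ hx h
    rw [mem_product] at hx
    exact admFold_moveArr hκ h₁.1 h₁.2.1 h₁.2.2 (g1 σ hx.1 (left_ne_zero_of_mul h)) hx.2
      (right_ne_zero_of_mul h)

/-- A sum over pairs of steps in which the pairs cancel against the swapped pairs, except for the
pairs of inverse steps. The end point `v` of a path does not depend on the order of the steps. -/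
lemma sum_serre_paths {M : Type*} [AddCommGroup M] [Module ℝ M] {S : Finset ℕ}
    (t : Step → Step → ℝ) (v : Step → Step → M) (v₀ : M) (c : ℝ)
    (hv : ∀ σ τ, v σ τ = v τ σ) (hv₀ : ∀ σ, v σ σ.inv = v₀)
    (h0 : ∀ σ ∈ stepsOf S, ∀ τ ∈ stepsOf S, τ ≠ σ.inv → t σ τ + t τ σ = 0)
    (h1 : ∑ σ ∈ stepsOf S, t σ σ.inv = c) :
    ∑ σ ∈ stepsOf S, ∑ τ ∈ stepsOf S, t σ τ • v σ τ = c • v₀ := by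
  have hinv : ∑ σ ∈ stepsOf S, t σ.inv σ = c := by
    rw [← h1]
    refine sum_nbij' Step.inv Step.inv (fun _ h => Step.inv_mem h) (fun _ h => Step.inv_mem h)
      (fun σ _ => σ.inv_inv) (fun σ _ => σ.inv_inv) fun σ _ => by rw [Step.inv_inv]
  have hsum : ∑ σ ∈ stepsOf S, ∑ τ ∈ stepsOf S, (t σ τ + t τ σ) • v σ τ = (2 * c) • v₀ := by
    calc _ = ∑ σ ∈ stepsOf S, (t σ σ.inv + t σ.inv σ) • v₀ := by
          refine sum_congr rfl fun σ hσ => ?_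
          rw [← hv₀ σ]
          refine sum_eq_single_of_mem _ (Step.inv_mem hσ) fun τ hτ hne => ?_
          rw [h0 σ hσ τ hτ hne, zero_smul]
      _ = _ := by rw [← sum_smul, sum_add_distrib, h1, hinv, two_mul]
  have hsymm : ∑ σ ∈ stepsOf S, ∑ τ ∈ stepsOf S, t τ σ • v σ τ =
      ∑ σ ∈ stepsOf S, ∑ τ ∈ stepsOf S, t σ τ • v σ τ := by
    rw [sum_comm]
    exact sum_congr rfl fun σ _ => sum_congr rfl fun τ _ => by rw [hv]
  simp only [add_smul, sum_add_distrib, hsymm] at hsum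
  rw [← two_smul ℝ, mul_smul] at hsum
  exact smul_right_injective M (two_ne_zero (α := ℝ)) hsum

/-- The cubic relations on a basis vector. -/
lemma ambientOp_serre_ket (hq : 0 < q) (hq1 : q ≠ 1) (he : ∀ k, e k ^ 2 = 1) {k k' : ℕ}
    (hk1 : 1 ≤ k) (hk'1 : 1 ≤ k') (hk : k + 1 ≤ n) (hk' : k' + 1 ≤ n)
    (hadj : k' = k + 1 ∨ k = k' + 1) {ξ : ℕ → ℕ → ℝ} (hξ : Adm n ξ) :
    let T := ambientOp q n e k
    let L := ambientOp q n e k'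
    L (T (T (ket (Adm n) ξ))) - (q + q⁻¹) • T (L (T (ket (Adm n) ξ))) + T (T (L (ket (Adm n) ξ))) =
      -L (ket (Adm n) ξ) := by
  intro T L
  -- `κ` is the even one of the two rows
  obtain ⟨κ, hκ, hκ2, hκn, hkκ, hk'κ⟩ : ∃ κ, Even κ ∧ 2 ≤ κ ∧ κ ≤ n ∧ (k = κ ∨ ¬ Even k) ∧
      (k' = κ ∨ ¬ Even k') := by
    by_cases hE : Even k
    · refine ⟨k, hE, ?_, by omega, Or.inl rfl, Or.inr ?_⟩
      · rw [Nat.even_iff] at hE; omega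
      · rw [Nat.even_iff] at hE ⊢; omega
    · refine ⟨k', ?_, ?_, by omega, Or.inr hE, Or.inl rfl⟩
      · rw [Nat.even_iff] at hE ⊢; omega
      · rw [Nat.even_iff] at hE; omega
  have hne : k ≠ k' := by omega
  have hK : 1 ≤ k ∧ k + 1 ≤ n ∧ (k = κ ∨ ¬ Even k) := ⟨hk1, hk, hkκ⟩
  have hK' : 1 ≤ k' ∧ k' + 1 ≤ n ∧ (k' = κ ∨ ¬ Even k') := ⟨hk'1, hk', hk'κ⟩
  set S := stepsOf (Icc 1 (k / 2)) with hS
  set S' := stepsOf (Icc 1 (k' / 2)) with hS'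
  set u := uCoord ξ with hu
  let v : Step → Step → Step → ({ξ : ℕ → ℕ → ℝ // Adm n ξ} →₀ ℂ) := fun σ' σ τ =>
    foldKet n (e κ) κ (moveArr (moveArr (moveArr ξ k' σ') k σ) k τ)
  let C := fun r => stepCoef q (e k) k (Function.update u k r)
  let C' := fun σ' r => stepCoef q (e k) k (Function.update (moveArr u k' σ') k r)
  let φ := fun σ' r => stepCoef q (e k') k' (Function.update u k r) σ'
  have hC : stepCoef q (e k) k u = C (u k) := by
    simp only [C, Function.update_eq_self]
  have hC' : ∀ σ', stepCoef q (e k) k (moveArr u k' σ') = C' σ' (u k) := by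
    intro σ'
    simp only [C']
    rw [show u k = moveArr u k' σ' k from (moveArr_of_ne u σ' hne).symm,
      Function.update_eq_self]
  have hC2 : ∀ σ' σ, stepCoef q (e k) k (moveArr (moveArr u k' σ') k σ) =
      C' σ' (moveRow (u k) σ) := by
    intro σ' σ
    rw [moveArr, moveArr_of_ne u σ' hne]
  have hφ : ∀ σ', stepCoef q (e k') k' u σ' = φ σ' (u k) := by
    intro σ'; simp only [φ, Function.update_eq_self]
  have hφ2 : ∀ σ τ σ', stepCoef q (e k') k' (moveArr (moveArr u k σ) k τ) σ' =
      φ σ' (moveRow (moveRow (u k) σ) τ) := by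
    intro σ τ σ'
    simp only [φ, moveArr, Function.update_self, Function.update_idem]
  -- the operators of different rows move the array independently, so all paths end at `v σ' σ τ`
  have r1 : L (T (T (ket (Adm n) ξ))) = ∑ σ' ∈ S', ∑ σ ∈ S, ∑ τ ∈ S,
      (C (u k) σ * C (moveRow (u k) σ) τ * φ σ' (moveRow (moveRow (u k) σ) τ)) • v σ' σ τ := by
    refine (ambientOp_comp₃ (q := q) he hκ hκ2 hκn hK hK hK' hξ).trans ?_
    rw [sum_comm, sum_congr rfl fun σ _ => sum_comm, sum_comm]
    refine sum_congr rfl fun σ' _ => ?_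
    rw [sum_comm]
    refine sum_congr rfl fun σ _ => sum_congr rfl fun τ _ => ?_
    rw [hC, hφ2, moveArr_comm _ hne, moveArr_comm _ hne]
    rfl
  have r2 : T (L (T (ket (Adm n) ξ))) = ∑ σ' ∈ S', ∑ σ ∈ S, ∑ τ ∈ S,
      (C (u k) σ * φ σ' (moveRow (u k) σ) * C' σ' (moveRow (u k) σ) τ) • v σ' σ τ := by
    refine (ambientOp_comp₃ (q := q) he hκ hκ2 hκn hK hK' hK hξ).trans ?_
    rw [sum_comm]
    refine sum_congr rfl fun σ' _ => sum_congr rfl fun σ _ => sum_congr rfl fun τ _ => ?_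
    rw [hC, moveArr_comm u hne, moveArr_comm ξ hne, hC2]
    rfl
  have r3 : T (T (L (ket (Adm n) ξ))) = ∑ σ' ∈ S', ∑ σ ∈ S, ∑ τ ∈ S,
      (φ σ' (u k) * C' σ' (u k) σ * C' σ' (moveRow (u k) σ) τ) • v σ' σ τ := by
    refine (ambientOp_comp₃ (q := q) he hκ hκ2 hκn hK' hK hK hξ).trans ?_
    refine sum_congr rfl fun σ' _ => sum_congr rfl fun σ _ => sum_congr rfl fun τ _ => ?_
    rw [hφ, hC', hC2]
  have r4 : L (ket (Adm n) ξ) = ∑ σ' ∈ S', φ σ' (u k) • foldKet n (e κ) κ (moveArr ξ k' σ') := by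
    have := ambientOp_foldKet (q := q) he hκ hκ2 hκn hk'1 hk' hk'κ (Or.inl hξ)
    rw [foldKet_of_adm hκ hκ2 hκn hξ] at this
    refine this.trans (sum_congr rfl fun σ' _ => ?_)
    rw [hφ]
  rw [r1, r2, r3, r4, smul_sum, ← sum_sub_distrib, ← sum_add_distrib, ← sum_neg_distrib]
  refine sum_congr rfl fun σ' hσ' => ?_
  obtain ⟨h0, h1⟩ := hξ.2.serre (e := e k) (e' := e k') hq hq1 hk1 hk'1 hk hadj (he k) hσ'
  rw [← neg_smul, ← sum_serre_paths (v := v σ') _ _ _ (fun σ τ => ?_) (fun σ => ?_) h0 h1, smul_sum,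
    ← sum_sub_distrib, ← sum_add_distrib]
  · refine sum_congr rfl fun σ _ => ?_
    rw [smul_sum, ← sum_sub_distrib, ← sum_add_distrib]
    refine sum_congr rfl fun τ _ => ?_
    rw [smul_smul, ← sub_smul, ← add_smul, serreTerm]
  · simp only [v]; rw [moveArr_swap]
  · simp only [v]; rw [moveArr_inv]

lemma ambient_hom_ext {M : Type*} [AddCommMonoid M] [Module ℂ M]
    {f g : ({ξ : ℕ → ℕ → ℝ // Adm n ξ} →₀ ℂ) →ₗ[ℂ] M}
    (h : ∀ ξ, Adm n ξ → f (ket (Adm n) ξ) = g (ket (Adm n) ξ)) : f = g :=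
  Finsupp.lhom_ext' fun ⟨ξ, hξ⟩ => LinearMap.ext_ring (by
    have := h ξ hξ
    rwa [ket_of hξ] at this)

/-- The cubic relations. -/
theorem ambientOp_serre (hq : 0 < q) (hq1 : q ≠ 1) (he : ∀ k, e k ^ 2 = 1) {k k' : ℕ}
    (hk1 : 1 ≤ k) (hk'1 : 1 ≤ k') (hk : k + 1 ≤ n) (hk' : k' + 1 ≤ n)
    (hadj : k' = k + 1 ∨ k = k' + 1) :
    ambientOp q n e k' * ambientOp q n e k ^ 2
      - ((q + q⁻¹ : ℝ) : ℂ) • (ambientOp q n e k * ambientOp q n e k' * ambientOp q n e k)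
      + ambientOp q n e k ^ 2 * ambientOp q n e k' = -ambientOp q n e k' := by
  refine ambient_hom_ext fun ξ hξ => ?_
  simp only [LinearMap.add_apply, LinearMap.sub_apply, LinearMap.smul_apply, LinearMap.neg_apply,
    Module.End.mul_apply, pow_two]
  rw [Complex.coe_smul]
  exact ambientOp_serre_ket hq hq1 he hk1 hk'1 hk hk' hadj hξ

lemma adm_moveArr_of_foldCoef_ne_zero {q e : ℝ} {k : ℕ} (hk1 : 1 ≤ k) (hk : k + 1 ≤ n) {ξ : ℕ → ℕ → ℝ}
    (hξ : Adm n ξ) {σ : Step} (hσ : σ ∈ stepsOf (Icc 1 (k / 2)))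
    (h : foldCoef q e k (uCoord ξ) σ ≠ 0) : Adm n (moveArr ξ k σ) := by
  rcases σ with _ | ⟨b, s⟩
  · rwa [moveArr_none]
  rw [foldCoef] at h
  split_ifs at h with hpos
  · exact adm_moveArr hξ (by omega) hσ
      (hξ.2.move_of_stepCoef_ne_zero hk1 hk (some_mem_stepsOf.1 hσ) hpos h)
  · exact absurd rfl h

lemma ambientOp_comp {k k' : ℕ} (hk1 : 1 ≤ k) (hk : k + 1 ≤ n) (h : k + 1 < k' ∨ k' + 1 < k)
    {ξ : ℕ → ℕ → ℝ} (hξ : Adm n ξ) :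
    ambientOp q n e k' (ambientOp q n e k (ket (Adm n) ξ)) =
      ∑ σ ∈ stepsOf (Icc 1 (k / 2)), ∑ σ' ∈ stepsOf (Icc 1 (k' / 2)),
        (foldCoef q (e k) k (uCoord ξ) σ * foldCoef q (e k') k' (uCoord ξ) σ') •
          ket (Adm n) (moveArr (moveArr ξ k σ) k' σ') := by
  rw [ambientOp_ket hξ, map_sum]
  refine sum_congr rfl fun σ hσ => ?_
  rw [LinearMap.map_smul_of_tower]
  by_cases h0 : foldCoef q (e k) k (uCoord ξ) σ = 0
  · simp [h0]
  · rw [ambientOp_ket (adm_moveArr_of_foldCoef_ne_zero hk1 hk hξ hσ h0), smul_sum]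
    refine sum_congr rfl fun σ' _ => ?_
    have e1 : ∀ i, i ≠ k → uCoord (moveArr ξ k σ) i = uCoord ξ i := fun i hi =>
      uCoord_row_congr (moveArr_of_ne ξ σ hi)
    rw [smul_smul, foldCoef_congr (e1 k' (by omega)) (e1 (k' + 1) (by omega))
      (e1 (k' - 1) (by omega))]

/-- The operators of rows that are not adjacent commute. -/
theorem ambientOp_commute {k k' : ℕ} (hk1 : 1 ≤ k) (hk'1 : 1 ≤ k') (hk : k + 1 ≤ n)
    (hk' : k' + 1 ≤ n) (h : k + 1 < k' ∨ k' + 1 < k) :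
    ambientOp q n e k * ambientOp q n e k' = ambientOp q n e k' * ambientOp q n e k := by
  refine ambient_hom_ext fun ξ hξ => ?_
  rw [Module.End.mul_apply, Module.End.mul_apply, ambientOp_comp hk1 hk h hξ,
    ambientOp_comp hk'1 hk' h.symm hξ, sum_comm]
  refine sum_congr rfl fun σ _ => sum_congr rfl fun σ' _ => ?_
  rw [mul_comm, moveArr_comm _ (by omega)]

end Ambient

/-! ### The coefficients of the representations -/

lemma lCoord_of_even (ξ : ℕ → ℕ → ℝ) {k : ℕ} (hk : Even k) (j : ℕ) :
    lCoord ξ k j = uCoord ξ k j := by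
  obtain ⟨m, rfl⟩ := hk
  rw [lCoord, uCoord, show (m + m + 1) / 2 = m by omega]
  push_cast; ring

lemma lCoord_of_odd (ξ : ℕ → ℕ → ℝ) {k : ℕ} (hk : Odd k) (j : ℕ) :
    lCoord ξ k j = uCoord ξ k j + 1 / 2 := by
  obtain ⟨m, rfl⟩ := hk
  rw [lCoord, uCoord, show (2 * m + 1 + 1) / 2 = m + 1 by omega]
  push_cast; ring

lemma rowDen_neg (q : ℝ) (S : Finset ℕ) (r : ℕ → ℝ) (b : ℕ) (w : ℝ) :
    rowDen q S r b (-w - 1) = rowDen q S r b w := by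
  refine prod_congr rfl fun i _ => ?_
  rw [show -w - 1 = -(w + 1) by ring, show -(w + 1) + 1 = -w by ring,
    qNum_sq_neg, qNum_sq_neg, mul_comm]

/-- The quotient under the root in the coefficient of the step `w → w + 1`. -/
def stepQuot (q : ℝ) (k : ℕ) (u : ℕ → ℕ → ℝ) (b : ℕ) (w : ℝ) : ℝ :=
  (∏ x ∈ nbrs k, (qNum q (u x.1 x.2) ^ 2 - qNum q (w + 1 / 2) ^ 2)) /
    rowDen q (Icc 1 (k / 2)) (u k) b w

lemma stepQuot_neg (q : ℝ) (k : ℕ) (u : ℕ → ℕ → ℝ) (b : ℕ) (w : ℝ) :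
    stepQuot q k u b (-w - 1) = stepQuot q k u b w := by
  rw [stepQuot, rowDen_neg, show -w - 1 + 1 / 2 = -(w + 1 / 2) by ring, qNum_sq_neg, stepQuot]

lemma stepQuot_moveArr {q : ℝ} {k : ℕ} (hk1 : 1 ≤ k) (u : ℕ → ℕ → ℝ) (b : ℕ) (s : ℤˣ) (w : ℝ) :
    stepQuot q k (moveArr u k (some (b, s))) b w = stepQuot q k u b w := by
  rw [stepQuot, stepQuot]
  congr 1
  · exact prod_congr rfl fun x hx => by rw [moveArr_of_ne _ _ (ne_of_mem_nbrs hk1 hx)]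
  · rw [moveArr, Function.update_self]; exact rowDen_update _ _ _

/-- By interlacing, the absolute values under the roots can be omitted. -/
lemma Interlacing.stepCoef_eq {q e : ℝ} (hq : 0 < q) (hq1 : q ≠ 1) {n k : ℕ} {u : ℕ → ℕ → ℝ}
    (hu : Interlacing n u) (hk1 : 1 ≤ k) (hk : k + 1 ≤ n) {b : ℕ} (hb : b ∈ Icc 1 (k / 2))
    (s : ℤˣ) : stepCoef q e k u (some (b, s)) =
      pref q k ((s : ℤ) * u k b) * √(stepQuot q k u b ((s : ℤ) * u k b)) := by
  have h1 := hu.prod_nbrs_nonneg hq hq1 hk1 hk hb s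
  have h2 := hu.rowDen_nonneg hq hq1 hk hb s
  rw [stepCoef, rowCoef, abs_of_nonneg h1, abs_of_nonneg h2, stepQuot, Real.sqrt_div h1]
  ring

lemma coeffA_eq {q : ℝ} (hq : 0 < q) (hq1 : q ≠ 1) (ξ : ℕ → ℕ → ℝ) {p : ℕ} (hp : 1 ≤ p) (j : ℕ) :
    coeffA q ξ p j = √(stepQuot q (2 * p) (uCoord ξ) j (uCoord ξ (2 * p) j)) := by
  have h1 : ∀ i, lCoord ξ (2 * p + 1) i = uCoord ξ (2 * p + 1) i + 1 / 2 :=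
    lCoord_of_odd ξ ⟨p, rfl⟩
  have h2 : ∀ i, lCoord ξ (2 * p - 1) i = uCoord ξ (2 * p - 1) i + 1 / 2 :=
    lCoord_of_odd ξ ⟨p - 1, by omega⟩
  have h3 : ∀ i, lCoord ξ (2 * p) i = uCoord ξ (2 * p) i := lCoord_of_even ξ ⟨p, by omega⟩
  rw [coeffA, stepQuot, prod_nbrs, rowDen, show (2 * p + 1) / 2 = p by omega,
    show (2 * p - 1) / 2 = p - 1 by omega, show 2 * p / 2 = p by omega]
  simp only [h1, h2, h3, ← qNum_add_mul_qNum_sub hq hq1]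
  congr 2
  · congr 1 <;> refine prod_congr rfl fun i _ => ?_
    · congr 2 <;> ring
    · congr 2 <;> ring
  · refine prod_congr rfl fun i _ => ?_
    rw [show ∀ x y : ℝ, x + (y + 1) = x + y + 1 by intros; ring,
      show ∀ x y : ℝ, x - (y + 1) = x - y - 1 by intros; ring]
    ring

lemma coeffB_eq {q : ℝ} (hq : 0 < q) (hq1 : q ≠ 1) (ξ : ℕ → ℕ → ℝ) {p : ℕ} (hp : 1 ≤ p) (j : ℕ) :
    coeffB q ξ p j = √(stepQuot q (2 * p - 1) (uCoord ξ) j (uCoord ξ (2 * p - 1) j)) := by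
  have h1 : ∀ i, lCoord ξ (2 * p - 2) i = uCoord ξ (2 * p - 2) i :=
    lCoord_of_even ξ ⟨p - 1, by omega⟩
  have h2 : ∀ i, lCoord ξ (2 * p - 1) i = uCoord ξ (2 * p - 1) i + 1 / 2 :=
    lCoord_of_odd ξ ⟨p - 1, by omega⟩
  have h3 : ∀ i, lCoord ξ (2 * p) i = uCoord ξ (2 * p) i := lCoord_of_even ξ ⟨p, by omega⟩
  rw [coeffB, stepQuot, prod_nbrs, rowDen, show 2 * p - 1 + 1 = 2 * p by omega,
    show 2 * p - 1 - 1 = 2 * p - 2 by omega, show (2 * p - 1) / 2 = p - 1 by omega,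
    show 2 * p / 2 = p by omega, show (2 * p - 2) / 2 = p - 1 by omega]
  simp only [h1, h2, h3, ← qNum_add_mul_qNum_sub hq hq1]
  congr 2
  refine prod_congr rfl fun i _ => ?_
  rw [show ∀ x y : ℝ, x + 1 / 2 + (y + 1 / 2) - 1 = x + y by intros; ring,
    show ∀ x y : ℝ, x + 1 / 2 + (y + 1 / 2) = x + (y + 1) by intros; ring,
    show ∀ x y : ℝ, x + 1 / 2 - (y + 1 / 2) - 1 = x - (y + 1) by intros; ring,
    show ∀ x y : ℝ, x + 1 / 2 - (y + 1 / 2) = x - y by intros; ring]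
  ring

lemma shift_one (ξ : ℕ → ℕ → ℝ) (k j : ℕ) : shift ξ k j 1 = moveArr ξ k (some (j, 1)) := by
  simp [shift, moveArr, moveRow]

lemma shift_neg_one (ξ : ℕ → ℕ → ℝ) (k j : ℕ) :
    shift ξ k j (-1) = moveArr ξ k (some (j, -1)) := by
  simp [shift, moveArr, moveRow]

lemma stepQuot_shift {q : ℝ} {k : ℕ} (hk1 : 1 ≤ k) (ξ : ℕ → ℕ → ℝ) (j : ℕ) :
    stepQuot q k (uCoord (shift ξ k j (-1))) j (uCoord (shift ξ k j (-1)) k j) =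
      stepQuot q k (uCoord ξ) j (-uCoord ξ k j) := by
  rw [shift_neg_one, uCoord_moveArr, stepQuot_moveArr hk1, moveArr_some_self, ← stepQuot_neg]
  congr 1
  push_cast; ring

section Coeff

variable {q e : ℝ} {n : ℕ} {ξ : ℕ → ℕ → ℝ} {p j : ℕ}

lemma coeffA_up (hq : 0 < q) (hq1 : q ≠ 1) (hξ : Adm n ξ) (hpn : 2 * p + 1 ≤ n)
    (hj : j ∈ Icc 1 p) :
    coeffA q ξ p j / (q ^ lCoord ξ (2 * p) j - q ^ (-lCoord ξ (2 * p) j)) =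
      stepCoef q e (2 * p) (uCoord ξ) (some (j, 1)) := by
  have hp : 1 ≤ p := by rw [mem_Icc] at hj; omega
  have hE : Even (2 * p) := ⟨p, by omega⟩
  rw [hξ.2.stepCoef_eq hq hq1 (by omega) hpn (by rwa [show 2 * p / 2 = p by omega]),
    coeffA_eq hq hq1 ξ hp, lCoord_of_even ξ hE, pref, if_pos hE]
  simp only [Units.val_one, Int.cast_one, one_mul]
  ring

lemma coeffA_down (hq : 0 < q) (hq1 : q ≠ 1) (hξ : Adm n ξ) (hpn : 2 * p + 1 ≤ n)
    (hj : j ∈ Icc 1 p) :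
    coeffA q (shift ξ (2 * p) j (-1)) p j / (q ^ lCoord ξ (2 * p) j - q ^ (-lCoord ξ (2 * p) j)) =
      -stepCoef q e (2 * p) (uCoord ξ) (some (j, -1)) := by
  have hp : 1 ≤ p := by rw [mem_Icc] at hj; omega
  have hE : Even (2 * p) := ⟨p, by omega⟩
  rw [hξ.2.stepCoef_eq hq hq1 (by omega) hpn (by rwa [show 2 * p / 2 = p by omega]),
    coeffA_eq hq hq1 _ hp, stepQuot_shift (by omega), lCoord_of_even ξ hE, pref, if_pos hE]
  simp only [Units.val_neg, Units.val_one, Int.cast_neg, Int.cast_one, neg_mul, one_mul, neg_neg]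
  rw [← neg_sub (q ^ uCoord ξ (2 * p) j), one_div, inv_neg]
  ring

lemma coeffB_up (hq : 0 < q) (hq1 : q ≠ 1) (hξ : Adm n ξ) (hpn : 2 * p ≤ n)
    (hj : j ∈ Icc 1 (p - 1)) :
    coeffB q ξ p j / (qNum q (2 * lCoord ξ (2 * p - 1) j - 1) * qNumPlus q (lCoord ξ (2 * p - 1) j))
      = stepCoef q e (2 * p - 1) (uCoord ξ) (some (j, 1)) := by
  have hp : 2 ≤ p := by rw [mem_Icc] at hj; omega
  have hO : Odd (2 * p - 1) := ⟨p - 1, by omega⟩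
  rw [hξ.2.stepCoef_eq hq hq1 (by omega) (by omega)
    (by rwa [show (2 * p - 1) / 2 = p - 1 by omega]),
    coeffB_eq hq hq1 ξ (by omega), lCoord_of_odd ξ hO, pref, if_neg (Nat.not_even_iff_odd.2 hO)]
  simp only [Units.val_one, Int.cast_one, one_mul]
  rw [show 2 * (uCoord ξ (2 * p - 1) j + 1 / 2) - 1 = 2 * uCoord ξ (2 * p - 1) j by ring]
  ring

lemma coeffB_down (hq : 0 < q) (hq1 : q ≠ 1) (hξ : Adm n ξ) (hpn : 2 * p ≤ n)
    (hj : j ∈ Icc 1 (p - 1)) :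
    coeffB q (shift ξ (2 * p - 1) j (-1)) p j /
      (qNum q (2 * lCoord ξ (2 * p - 1) j - 1) * qNumPlus q (lCoord ξ (2 * p - 1) j - 1)) =
      -stepCoef q e (2 * p - 1) (uCoord ξ) (some (j, -1)) := by
  have hp : 2 ≤ p := by rw [mem_Icc] at hj; omega
  have hO : Odd (2 * p - 1) := ⟨p - 1, by omega⟩
  rw [hξ.2.stepCoef_eq hq hq1 (by omega) (by omega)
    (by rwa [show (2 * p - 1) / 2 = p - 1 by omega]),
    coeffB_eq hq hq1 _ (by omega), stepQuot_shift (by omega), lCoord_of_odd ξ hO, pref,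
    if_neg (Nat.not_even_iff_odd.2 hO)]
  simp only [Units.val_neg, Units.val_one, Int.cast_neg, Int.cast_one, neg_mul, one_mul]
  rw [show 2 * (uCoord ξ (2 * p - 1) j + 1 / 2) - 1 = 2 * uCoord ξ (2 * p - 1) j by ring,
    show 2 * -uCoord ξ (2 * p - 1) j = -(2 * uCoord ξ (2 * p - 1) j) by ring, qNum_neg,
    show uCoord ξ (2 * p - 1) j + 1 / 2 - 1 = -(-uCoord ξ (2 * p - 1) j + 1 / 2) by ring,
    qNumPlus_neg, neg_mul, div_neg]
  ring

lemma coeffCHat_eq (hp : 1 ≤ p) : e * coeffCHat q ξ p =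
    stepCoef q e (2 * p - 1) (uCoord ξ) none := by
  have hO : Odd (2 * p - 1) := ⟨p - 1, by omega⟩
  have h1 : ∀ i, lCoord ξ (2 * p - 2) i = uCoord ξ (2 * p - 2) i :=
    lCoord_of_even ξ ⟨p - 1, by omega⟩
  have h2 : ∀ i, lCoord ξ (2 * p - 1) i = uCoord ξ (2 * p - 1) i + 1 / 2 :=
    lCoord_of_odd ξ ⟨p - 1, by omega⟩
  have h3 : ∀ i, lCoord ξ (2 * p) i = uCoord ξ (2 * p) i := lCoord_of_even ξ ⟨p, by omega⟩
  rw [coeffCHat, stepCoef, rowCoef, if_neg (Nat.not_even_iff_odd.2 hO), prod_nbrs,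
    show 2 * p - 1 + 1 = 2 * p by omega, show 2 * p - 1 - 1 = 2 * p - 2 by omega,
    show (2 * p - 1) / 2 = p - 1 by omega, show 2 * p / 2 = p by omega,
    show (2 * p - 2) / 2 = p - 1 by omega, ← mul_div_assoc]
  simp only [h1, h2, h3, show ∀ x : ℝ, x + 1 / 2 - 1 = x - 1 / 2 by intro x; ring]

/-- For `m_{p,2p} = 1/2` the quotient under the root in the coefficient of the step from `1/2` to
`-1/2` is the square of `D`. -/
lemma coeffD_eq (hq : 0 < q) (hq1 : q ≠ 1) (hξ : Adm n ξ) (hp : 1 ≤ p) (hpn : 2 * p + 1 ≤ n)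
    (h : uCoord ξ (2 * p) p = 1 / 2) :
    e / (q ^ (1 / 2 : ℝ) - q ^ (-(1 / 2) : ℝ)) * coeffD q ξ p =
      -(e * stepCoef q e (2 * p) (uCoord ξ) (some (p, -1))) := by
  have hE : Even (2 * p) := ⟨p, by omega⟩
  have h1 : ∀ i, lCoord ξ (2 * p + 1) i = uCoord ξ (2 * p + 1) i + 1 / 2 :=
    lCoord_of_odd ξ ⟨p, rfl⟩
  have h2 : ∀ i, lCoord ξ (2 * p - 1) i = uCoord ξ (2 * p - 1) i + 1 / 2 :=
    lCoord_of_odd ξ ⟨p - 1, by omega⟩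
  have h3 : ∀ i, lCoord ξ (2 * p) i = uCoord ξ (2 * p) i := lCoord_of_even ξ hE
  set D1 := ∏ x ∈ nbrs (2 * p), qNum q (uCoord ξ x.1 x.2) with hD1
  set D2 := ∏ i ∈ Icc 1 (p - 1), qNum q (uCoord ξ (2 * p) i + 1 / 2) *
    qNum q (uCoord ξ (2 * p) i - 1 / 2) with hD2
  have hD : coeffD q ξ p = D1 / D2 := by
    rw [coeffD, hD1, prod_nbrs, show (2 * p + 1) / 2 = p by omega,
      show (2 * p - 1) / 2 = p - 1 by omega]
    simp only [h1, h2, h3, add_sub_cancel_right]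
    rfl
  have p1 : 0 ≤ D1 := prod_nonneg fun x hx =>
    qNum_nonneg hq hq1 (by have := hξ.2.mem_nbrs_pos hpn hx; linarith)
  have p2 : 0 ≤ D2 := prod_nonneg fun i hi => by
    rw [mem_Icc] at hi
    have := hξ.2.half_le (k := 2 * p) (j := i) (by omega) (by omega) (by omega)
    exact mul_nonneg (qNum_nonneg hq hq1 (by linarith)) (qNum_nonneg hq hq1 (by linarith))
  have hQ : stepQuot q (2 * p) (uCoord ξ) p (-(1 / 2)) = (D1 / D2) ^ 2 := by
    rw [stepQuot, div_pow, hD1, hD2, ← prod_pow, ← prod_pow, rowDen, show 2 * p / 2 = p by omega,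
      show (Icc 1 p).erase p = Icc 1 (p - 1) by ext i; simp only [mem_erase, mem_Icc]; omega]
    congr 1
    · refine prod_congr rfl fun x _ => ?_
      rw [neg_add_cancel, qNum_zero]; ring
    · refine prod_congr rfl fun i _ => ?_
      rw [qNum_sq_neg, show -(1 / 2 : ℝ) + 1 = 1 / 2 by norm_num,
        ← qNum_add_mul_qNum_sub hq hq1]
      ring
  rw [hξ.2.stepCoef_eq hq hq1 (by omega) hpn (mem_Icc.2 ⟨hp, by omega⟩), h, hD]
  simp only [Units.val_neg, Units.val_one, Int.cast_neg, Int.cast_one, neg_mul, one_mul]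
  rw [hQ, Real.sqrt_sq (div_nonneg p1 p2), pref, if_pos hE, neg_neg,
    ← neg_sub (q ^ (1 / 2 : ℝ)), div_neg]
  ring

end Coeff

/-! ### The representation spaces inside the space of all tableaux -/

section Embed

variable {n : ℕ} {m : WeightIndex n → ℝ}

lemma IsNonclassicalTableau.half_le (hm : IsNonclassicalWeight n m) {ξ : ℕ → ℕ → ℝ}
    (h : IsNonclassicalTableau n m ξ) {k j : ℕ} (hk : k ≤ n) (h1 : 1 ≤ j) (h2 : j ≤ k / 2) :
    1 / 2 ≤ ξ k j := by
  have heven : ∀ p, 1 ≤ p → 2 * p + 1 ≤ n → ∀ d, d < p → 1 / 2 ≤ ξ (2 * p) (p - d) := by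
    intro p hp hpn d
    obtain ⟨ha, hb, hc⟩ := h.2.2.1 p hp hpn
    induction d with
    | zero => intro _; exact hc
    | succ d ih =>
      intro hd
      have e1 := hb (p - (d + 1)) (mem_Icc.2 ⟨by omega, by omega⟩)
      have e2 := ha (p - d) (mem_Icc.2 ⟨by omega, by omega⟩)
      rw [show p - (d + 1) + 1 = p - d by omega] at e1
      have := ih (by omega)
      linarith
  rcases Nat.even_or_odd' k with ⟨p, rfl | rfl⟩
  · rcases hk.lt_or_eq with hk | rfl
    · have := heven p (by omega) hk (p - j) (by omega)
      rwa [show p - (p - j) = j by omega] at this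
    · have := h.1.2 ⟨j, mem_Icc.2 ⟨h1, h2⟩⟩
      rw [this]; exact hm.2.2 _
  · have e := (h.2.2.1 p (by omega) hk).1 j (mem_Icc.2 ⟨h1, by omega⟩)
    have := heven p (by omega) hk (p - j) (by omega)
    rw [show p - (p - j) = j by omega] at this
    linarith

lemma IsNonclassicalTableau.adm (hm : IsNonclassicalWeight n m) {ξ : ℕ → ℕ → ℝ}
    (h : IsNonclassicalTableau n m ξ) : Adm n ξ := by
  refine ⟨h.1.1, ⟨?_, ?_, ?_, ?_⟩⟩
  · intro k j hk h1 h2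
    obtain ⟨z, hz⟩ := h.2.1 k j ⟨by omega, hk, h1, h2⟩
    refine ⟨z - j, ?_⟩
    rw [uCoord, hz]; push_cast; ring
  · intro k j hk h1 h2
    have := h.half_le hm hk h1 h2
    have h3 : (j : ℝ) ≤ (k : ℝ) / 2 := by
      have : ((2 * j : ℕ) : ℝ) ≤ k := by exact_mod_cast (by omega : 2 * j ≤ k)
      push_cast at this; linarith
    rw [uCoord]; linarith
  · intro k j hk h1 h2
    have : ξ k j ≤ ξ (k + 1) j := by
      rcases Nat.even_or_odd' k with ⟨p, rfl | rfl⟩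
      · exact (h.2.2.1 p (by omega) hk).1 j (mem_Icc.2 ⟨h1, by omega⟩)
      · have := (h.2.2.2 (p + 1) (by omega) (by omega) j (mem_Icc.2 ⟨h1, by omega⟩)).1
        rwa [show 2 * (p + 1) - 1 = 2 * p + 1 by omega] at this
    rw [uCoord, uCoord]; push_cast; linarith
  · intro k j hk h1 h2
    have : ξ (k + 1) (j + 1) ≤ ξ k j := by
      rcases Nat.even_or_odd' k with ⟨p, rfl | rfl⟩
      · exact (h.2.2.1 p (by omega) hk).2.1 j (mem_Icc.2 ⟨h1, by omega⟩)
      · have := (h.2.2.2 (p + 1) (by omega) (by omega) j (mem_Icc.2 ⟨h1, by omega⟩)).2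
        rwa [show 2 * (p + 1) - 1 = 2 * p + 1 by omega] at this
    rw [uCoord, uCoord]; push_cast; linarith

lemma isNonclassicalTableau_iff (hm : IsNonclassicalWeight n m) {ξ : ℕ → ℕ → ℝ} :
    IsNonclassicalTableau n m ξ ↔ Adm n ξ ∧ ∀ j : WeightIndex n, ξ n j.1 = m j := by
  refine ⟨fun h => ⟨h.adm hm, h.1.2⟩, fun ⟨h, ht⟩ => ⟨⟨h.1, ht⟩, ?_, ?_, ?_⟩⟩
  · rintro k j ⟨-, hk, h1, h2⟩
    obtain ⟨z, hz⟩ := h.2.lat k j hk h1 h2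
    refine ⟨z + j, ?_⟩
    rw [uCoord] at hz
    push_cast; linarith
  · intro p hp hpn
    refine ⟨fun j hj => ?_, fun j hj => ?_, ?_⟩
    · rw [mem_Icc] at hj
      have := h.2.up_half hpn hj.1 (by omega)
      rw [uCoord, uCoord] at this; push_cast at this; linarith
    · rw [mem_Icc] at hj
      have := h.2.down_half hpn hj.1 (by omega)
      rw [uCoord, uCoord] at this; push_cast at this; linarith
    · have := h.2.half_le (k := 2 * p) (j := p) (by omega) hp (by omega)
      rw [uCoord] at this; push_cast at this; linarith
  · intro p hp hpn j hj
    rw [mem_Icc] at hj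
    obtain ⟨k, hk⟩ : ∃ k, 2 * p = k + 1 := ⟨2 * p - 1, by omega⟩
    have h1 := h.2.up_half (k := k) (by omega) hj.1 (by omega)
    have h2 := h.2.down_half (k := k) (by omega) hj.1 (by omega)
    rw [hk, Nat.add_sub_cancel]
    rw [uCoord, uCoord] at h1 h2; push_cast at h1 h2
    constructor <;> linarith

/-- The inclusion of a representation space into the space of all tableaux. -/
def embed (hm : IsNonclassicalWeight n m) :
    NonclassicalSpace n m →ₗ[ℂ] ({ξ : ℕ → ℕ → ℝ // Adm n ξ} →₀ ℂ) :=
  Finsupp.lmapDomain ℂ ℂ fun ξ => ⟨ξ.1, ξ.2.adm hm⟩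

lemma embed_injective (hm : IsNonclassicalWeight n m) : Function.Injective (embed hm) :=
  Finsupp.mapDomain_injective fun _ _ h => Subtype.ext (congrArg (fun x => x.1) h)

lemma embed_ket (hm : IsNonclassicalWeight n m) {ξ : ℕ → ℕ → ℝ}
    (ht : ∀ j : WeightIndex n, ξ n j.1 = m j) :
    embed hm (ket (IsNonclassicalTableau n m) ξ) = ket (Adm n) ξ := by
  by_cases h : Adm n ξ
  · have h' := (isNonclassicalTableau_iff hm).2 ⟨h, ht⟩
    rw [ket_of h, ket_of h', embed]
    simp
  · rw [ket_of_not h, ket_of_not fun h' => h (h'.adm hm), map_zero]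

variable {q : ℝ} {ε : GenIndex n → ℤˣ}

/-- The signs `ε_{k+1}`, indexed by the row `k`. -/
def rowSign (ε : GenIndex n → ℤˣ) (k : ℕ) : ℝ :=
  if h : k + 1 ∈ Icc 2 n then ((ε ⟨k + 1, h⟩ : ℤ) : ℝ) else 1

lemma rowSign_sq (ε : GenIndex n → ℤˣ) (k : ℕ) : rowSign ε k ^ 2 = 1 := by
  rw [rowSign]
  split_ifs
  · rw [sq, unit_mul_self]
  · norm_num

lemma rowSign_pred (ε : GenIndex n → ℤˣ) (i : GenIndex n) {k : ℕ} (h : i.1 = k + 1) :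
    rowSign ε k = ((ε i : ℤ) : ℝ) := by
  obtain ⟨i, hi⟩ := i
  simp only at h
  subst h
  rw [rowSign, dif_pos hi]

lemma top_moveArr {ξ : ℕ → ℕ → ℝ} {k : ℕ} (hk : k + 1 ≤ n) (σ : Step)
    (ht : ∀ j : WeightIndex n, ξ n j.1 = m j) (j : WeightIndex n) : moveArr ξ k σ n j.1 = m j := by
  rw [moveArr_of_ne _ _ (by omega), ht]

lemma embed_oddImage (hq : 0 < q) (hq1 : q ≠ 1) (hm : IsNonclassicalWeight n m) {p : ℕ} (hp : 1 ≤ p)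
    (hpn : 2 * p + 1 ≤ n) (s : ℤˣ) {e : ℕ → ℝ} (hs : e (2 * p) = ((s : ℤ) : ℝ)) {ξ : ℕ → ℕ → ℝ}
    (hξ : IsNonclassicalTableau n m ξ) :
    embed hm (nonclassicalOddImage q n m s p ξ) = ambientOp q n e (2 * p) (ket (Adm n) ξ) := by
  have hA := hξ.adm hm
  have ht := hξ.1.2
  have hE : Even (2 * p) := ⟨p, by omega⟩
  have hu : uCoord ξ (2 * p) p = ξ (2 * p) p := by rw [uCoord]; push_cast; ring
  have hpp : 2 * p / 2 = p := by omega
  rw [ambientOp_ket hA, sum_stepsOf, nonclassicalOddImage]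
  simp only [map_sub, map_add, map_sum, map_smul, shift_one, shift_neg_one, apply_ite (embed hm),
    map_zero, embed_ket hm ht, embed_ket hm (top_moveArr hpn _ ht), hpp]
  simp only [Complex.coe_smul]
  rw [add_sub_assoc, ← sum_sub_distrib]
  congr 1
  · have h0 : stepCoef q (e (2 * p)) (2 * p) (uCoord ξ) none = 0 := by simp [stepCoef, rowCoef, hE]
    rw [moveArr_none, foldCoef, h0, hpp, hu]
    by_cases h : ξ (2 * p) p = 1 / 2
    · rw [if_pos h, if_pos ⟨hE, h⟩, ← hs, coeffD_eq hq hq1 hA hp hpn (hu.trans h), zero_sub]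
    · rw [if_neg h, if_neg fun h' => h h'.2, sub_zero, zero_smul]
  · refine sum_congr rfl fun j hj => ?_
    have hj' := mem_Icc.1 hj
    have pj := hA.2.half_le (k := 2 * p) (by omega) hj'.1 (by omega)
    rw [show (univ : Finset ℤˣ) = {1, -1} from rfl, sum_pair (by decide), ← shift_neg_one,
      coeffA_up (e := e (2 * p)) hq hq1 hA hpn hj,
      coeffA_down (e := e (2 * p)) hq hq1 hA hpn hj, foldCoef, foldCoef,
      if_pos (by push_cast; linarith), neg_smul, sub_neg_eq_add]
    congr 1
    split_ifs with hpos
    · rfl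
    -- a step to a nonpositive entry leads to the zero vector, whatever its coefficient
    · rw [shift_neg_one, ket_of_not, smul_zero, smul_zero]
      intro hA'
      have := hA'.2.pos (2 * p) j (by omega) hj'.1 (by omega)
      rw [uCoord_moveArr, moveArr_some_self] at this
      exact hpos this

lemma embed_evenImage (hq : 0 < q) (hq1 : q ≠ 1) (hm : IsNonclassicalWeight n m) {p : ℕ} (hp : 1 ≤ p)
    (hpn : 2 * p ≤ n) (s : ℤˣ) {e : ℕ → ℝ} (hs : e (2 * p - 1) = ((s : ℤ) : ℝ)) {ξ : ℕ → ℕ → ℝ}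
    (hξ : IsNonclassicalTableau n m ξ) :
    embed hm (nonclassicalEvenImage q n m s p ξ) = ambientOp q n e (2 * p - 1) (ket (Adm n) ξ) := by
  have hA := hξ.adm hm
  have ht := hξ.1.2
  have hO : ¬ Even (2 * p - 1) := Nat.not_even_iff_odd.2 ⟨p - 1, by omega⟩
  have hpp : (2 * p - 1) / 2 = p - 1 := by omega
  rw [ambientOp_ket hA, sum_stepsOf, nonclassicalEvenImage]
  simp only [map_sub, map_add, map_sum, map_smul, shift_one, shift_neg_one,
    embed_ket hm ht, embed_ket hm (top_moveArr (show 2 * p - 1 + 1 ≤ n by omega) _ ht), hpp]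
  simp only [Complex.coe_smul]
  rw [← sum_sub_distrib, add_comm]
  congr 1
  · rw [← hs, coeffCHat_eq hp, moveArr_none, foldCoef, if_neg fun h => hO h.1, sub_zero]
  · refine sum_congr rfl fun j hj => ?_
    have hj' := mem_Icc.1 hj
    have pj := hA.2.half_le (k := 2 * p - 1) (by omega) hj'.1 (by omega)
    rw [show (univ : Finset ℤˣ) = {1, -1} from rfl, sum_pair (by decide), ← shift_neg_one,
      coeffB_up (e := e (2 * p - 1)) hq hq1 hA hpn hj,
      coeffB_down (e := e (2 * p - 1)) hq hq1 hA hpn hj, foldCoef, foldCoef,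
      if_pos (by push_cast; linarith), neg_smul, sub_neg_eq_add]
    congr 1
    split_ifs with hpos
    · rfl
    · rw [shift_neg_one, ket_of_not, smul_zero, smul_zero]
      intro hA'
      have := hA'.2.pos (2 * p - 1) j (by omega) hj'.1 (by omega)
      rw [uCoord_moveArr, moveArr_some_self] at this
      exact hpos this

/-- The operators of the representation are the restrictions of the operators on the space of all
tableaux. -/
theorem embed_nonclassicalOp (hq : 0 < q) (hq1 : q ≠ 1) (hm : IsNonclassicalWeight n m)
    (i : GenIndex n) {k : ℕ} (hi : i.1 = k + 1) (v : NonclassicalSpace n m) :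
    embed hm (nonclassicalOp q n ε m i v) = ambientOp q n (rowSign ε) k (embed hm v) := by
  have hmem := mem_Icc.1 i.2
  have hs := rowSign_pred ε i hi
  suffices h : (embed hm) ∘ₗ (nonclassicalOp q n ε m i) =
      (ambientOp q n (rowSign ε) k) ∘ₗ (embed hm) from LinearMap.congr_fun h v
  refine Finsupp.lhom_ext' fun ⟨ξ, hξ⟩ => LinearMap.ext_ring ?_
  have h1 : Finsupp.single ⟨ξ, hξ⟩ 1 = ket (IsNonclassicalTableau n m) ξ := (ket_of hξ).symm
  simp only [LinearMap.comp_apply, Finsupp.lsingle_apply]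
  rw [nonclassicalOp, Finsupp.linearCombination_single, one_smul, h1, embed_ket hm hξ.1.2]
  rcases Nat.even_or_odd' i.1 with ⟨p, hp | hp⟩
  · obtain rfl : k = 2 * p - 1 := by omega
    rw [if_pos (by rw [hp]; exact even_two_mul p), hp, Nat.mul_div_cancel_left _ two_pos]
    exact embed_evenImage hq hq1 hm (by omega) (by omega) _ hs hξ
  · obtain rfl : k = 2 * p := by omega
    rw [if_neg (by rw [hp, Nat.not_even_iff_odd]; exact odd_two_mul_add_one p), hp,
      show (2 * p + 1) / 2 = p by omega]
    exact embed_oddImage hq hq1 hm (by omega) (by omega) _ hs hξ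

/-! ### The representations -/

lemma nonclassicalOp_serre (hq : 0 < q) (hq1 : q ≠ 1) (hm : IsNonclassicalWeight n m)
    (i j : GenIndex n) (h : i.1 = j.1 + 1 ∨ j.1 = i.1 + 1) :
    nonclassicalOp q n ε m i * nonclassicalOp q n ε m j ^ 2
      - ((q + q⁻¹ : ℝ) : ℂ) •
        (nonclassicalOp q n ε m j * nonclassicalOp q n ε m i * nonclassicalOp q n ε m j)
      + nonclassicalOp q n ε m j ^ 2 * nonclassicalOp q n ε m i = -nonclassicalOp q n ε m i := by
  have hi := mem_Icc.1 i.2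
  have hj := mem_Icc.1 j.2
  obtain ⟨k, hk⟩ : ∃ k, j.1 = k + 1 := ⟨j.1 - 1, by omega⟩
  obtain ⟨k', hk'⟩ : ∃ k', i.1 = k' + 1 := ⟨i.1 - 1, by omega⟩
  ext1 ξ
  refine LinearMap.ext_ring (embed_injective hm ?_)
  have key := LinearMap.congr_fun (ambientOp_serre (n := n) hq hq1 (rowSign_sq ε)
    (k := k) (k' := k') (by omega) (by omega) (by omega) (by omega) (by omega))
    (embed hm (Finsupp.single ξ 1))
  simp only [LinearMap.add_apply, LinearMap.sub_apply, LinearMap.smul_apply, LinearMap.neg_apply,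
    Module.End.mul_apply, pow_two, LinearMap.comp_apply, Finsupp.lsingle_apply, map_add, map_sub,
    map_smul, map_neg, embed_nonclassicalOp hq hq1 hm i hk',
    embed_nonclassicalOp hq hq1 hm j hk] at key ⊢
  exact key

lemma nonclassicalOp_commute (hq : 0 < q) (hq1 : q ≠ 1) (hm : IsNonclassicalWeight n m)
    (i j : GenIndex n) (h : i.1 + 1 < j.1 ∨ j.1 + 1 < i.1) :
    nonclassicalOp q n ε m i * nonclassicalOp q n ε m j =
      nonclassicalOp q n ε m j * nonclassicalOp q n ε m i := by
  have hi := mem_Icc.1 i.2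
  have hj := mem_Icc.1 j.2
  obtain ⟨k, hk⟩ : ∃ k, j.1 = k + 1 := ⟨j.1 - 1, by omega⟩
  obtain ⟨k', hk'⟩ : ∃ k', i.1 = k' + 1 := ⟨i.1 - 1, by omega⟩
  ext1 ξ
  refine LinearMap.ext_ring (embed_injective hm ?_)
  have key := LinearMap.congr_fun (ambientOp_commute (q := q) (n := n) (e := rowSign ε)
    (k := k') (k' := k) (by omega) (by omega) (by omega) (by omega) (by omega))
    (embed hm (Finsupp.single ξ 1))
  simp only [Module.End.mul_apply, LinearMap.comp_apply, Finsupp.lsingle_apply,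
    embed_nonclassicalOp hq hq1 hm i hk', embed_nonclassicalOp hq hq1 hm j hk] at key ⊢
  exact key

/-- The representation `T_{ε,m}`. -/
def nonclassicalRep (hq : 0 < q) (hq1 : q ≠ 1) (ε : GenIndex n → ℤˣ)
    (hm : IsNonclassicalWeight n m) : USo q n →ₐ[ℂ] Module.End ℂ (NonclassicalSpace n m) :=
  RingQuot.liftAlgHom ℂ ⟨FreeAlgebra.lift ℂ (nonclassicalOp q n ε m), fun x y hxy => by
    cases hxy with
    | serre_left i j h =>
      simp only [map_add, map_sub, map_mul, map_smul, map_pow, map_neg, FreeAlgebra.lift_ι_apply]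
      exact nonclassicalOp_serre hq hq1 hm i j (Or.inl h)
    | serre_right i j h =>
      simp only [map_add, map_sub, map_mul, map_smul, map_pow, map_neg, FreeAlgebra.lift_ι_apply]
      have := nonclassicalOp_serre (ε := ε) hq hq1 hm j i (Or.inr h)
      rw [← this]
      abel
    | commute i j h =>
      simp only [map_mul, FreeAlgebra.lift_ι_apply]
      exact nonclassicalOp_commute hq hq1 hm i j h⟩

lemma nonclassicalRep_gen (hq : 0 < q) (hq1 : q ≠ 1) (ε : GenIndex n → ℤˣ)
    (hm : IsNonclassicalWeight n m) (i : GenIndex n) :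
    nonclassicalRep hq hq1 ε hm (USo.gen q n i) = nonclassicalOp q n ε m i := by
  rw [nonclassicalRep, USo.gen, RingQuot.liftAlgHom_mkAlgHom_apply, FreeAlgebra.lift_ι_apply]

end Embed

/-! ### Changing the lower rows of a tableau -/

/-- The array with the rows `< k` of `ξ` and the rows `≥ k` of `ω`. -/
def graft (k : ℕ) (ξ ω : ℕ → ℕ → ℝ) : ℕ → ℕ → ℝ := fun i => if i < k then ξ i else ω i

/-- The arrays have the same rows up to row `k`. -/
def AgreeUpTo (k : ℕ) (ω ξ : ℕ → ℕ → ℝ) : Prop := ∀ i ≤ k, ω i = ξ i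

lemma graft_of_lt {k i : ℕ} (ξ ω : ℕ → ℕ → ℝ) (h : i < k) : graft k ξ ω i = ξ i := if_pos h

lemma graft_of_le {k i : ℕ} (ξ ω : ℕ → ℕ → ℝ) (h : k ≤ i) : graft k ξ ω i = ω i :=
  if_neg h.not_gt

lemma AgreeUpTo.graft_eq {k : ℕ} {ω ξ : ℕ → ℕ → ℝ} (h : AgreeUpTo k ω ξ) : graft k ξ ω = ω := by
  funext i
  by_cases hi : i < k
  · rw [graft_of_lt _ _ hi, h i hi.le]
  · rw [graft_of_le _ _ (not_lt.1 hi)]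

lemma graft_graft (k : ℕ) (ξ ξ' ω : ℕ → ℕ → ℝ) : graft k ξ (graft k ξ' ω) = graft k ξ ω := by
  funext i
  by_cases hi : i < k
  · rw [graft_of_lt _ _ hi, graft_of_lt _ _ hi]
  · rw [graft_of_le _ _ (not_lt.1 hi), graft_of_le _ _ (not_lt.1 hi), graft_of_le _ _ (not_lt.1 hi)]

lemma agreeUpTo_graft {k : ℕ} {ξ ω : ℕ → ℕ → ℝ} (h : ω k = ξ k) : AgreeUpTo k (graft k ξ ω) ξ := by
  intro i hi
  rcases hi.lt_or_eq with hi | rfl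
  · exact graft_of_lt _ _ hi
  · rw [graft_of_le _ _ le_rfl, h]

lemma AgreeUpTo.moveArr {k : ℕ} {ω ξ : ℕ → ℕ → ℝ} (h : AgreeUpTo k ω ξ) (σ : Step) :
    AgreeUpTo k (moveArr ω k σ) (moveArr ξ k σ) := by
  intro i hi
  by_cases hik : i = k
  · subst hik
    simp only [_root_.moveArr, Function.update_self, h i le_rfl]
  · rw [moveArr_of_ne _ _ hik, moveArr_of_ne _ _ hik, h i hi]

/-- Different steps lead to different rows. -/
lemma moveRow_injective (r : ℕ → ℝ) : Function.Injective (moveRow r) := by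
  have key : ∀ b (s : ℤˣ), moveRow r (some (b, s)) b ≠ r b := by
    intro b s h
    rw [moveRow, Function.update_self] at h
    rcases unit_cast_eq s with e | e <;> rw [e] at h <;> linarith
  intro σ τ h
  rcases σ with _ | ⟨b, s⟩ <;> rcases τ with _ | ⟨c, t⟩
  · rfl
  · exact absurd (congrFun h c).symm (key c t)
  · exact absurd (congrFun h b) (key b s)
  · have hbc : b = c := by
      by_contra hne
      have := congrFun h b
      rw [show moveRow r (some (c, t)) b = r b by rw [moveRow, Function.update_of_ne hne]] at this
      exact key b s this
    subst hbc
    have := congrFun h b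
    rw [moveRow, moveRow, Function.update_self, Function.update_self] at this
    have : ((s : ℤ) : ℝ) = ((t : ℤ) : ℝ) := by linarith
    have : s = t := by exact_mod_cast this
    rw [this]

lemma adm_graft {n k : ℕ} {ξ ω : ℕ → ℕ → ℝ} (hξ : Adm n ξ) (hω : Adm n ω) (h : ω k = ξ k) :
    Adm n (graft k ξ ω) := by
  have hlt : ∀ i, i ≤ k → uCoord (graft k ξ ω) i = uCoord ξ i := fun i hi =>
    uCoord_row_congr (agreeUpTo_graft h i hi)
  have hle : ∀ i, k ≤ i → uCoord (graft k ξ ω) i = uCoord ω i := fun i hi =>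
    uCoord_row_congr (graft_of_le _ _ hi)
  refine ⟨fun i j hij => ?_, ⟨?_, ?_, ?_, ?_⟩⟩
  · rcases lt_or_ge i k with hi | hi
    · rw [graft_of_lt _ _ hi]; exact hξ.1 i j hij
    · rw [graft_of_le _ _ hi]; exact hω.1 i j hij
  all_goals intro i j h1 h2 h3; rcases lt_or_ge i k with hi | hi
  · rw [hlt i hi.le]; exact hξ.2.lat i j h1 h2 h3
  · rw [hle i hi]; exact hω.2.lat i j h1 h2 h3
  · rw [hlt i hi.le]; exact hξ.2.pos i j h1 h2 h3
  · rw [hle i hi]; exact hω.2.pos i j h1 h2 h3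
  · rw [hlt i hi.le, hlt (i + 1) hi]; exact hξ.2.up i j h1 h2 h3
  · rw [hle i hi, hle (i + 1) (by omega)]; exact hω.2.up i j h1 h2 h3
  · rw [hlt i hi.le, hlt (i + 1) hi]; exact hξ.2.down i j h1 h2 h3
  · rw [hle i hi, hle (i + 1) (by omega)]; exact hω.2.down i j h1 h2 h3

namespace Adm

variable {n k : ℕ} {ξ : ℕ → ℕ → ℝ} (hξ : Adm n ξ)
include hξ

lemma half_int {j : ℕ} (hk : k ≤ n) (h1 : 1 ≤ j) (h2 : j ≤ k / 2) : ∃ z : ℤ, ξ k j = z + 1 / 2 := by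
  obtain ⟨z, hz⟩ := hξ.2.lat k j hk h1 h2
  refine ⟨z + j, ?_⟩
  rw [uCoord] at hz; push_cast; linarith

lemma row_antitone {i j : ℕ} (hk : k + 1 ≤ n) (h1 : 1 ≤ i) (hij : i ≤ j) (h2 : j ≤ k / 2) :
    ξ k j ≤ ξ k i := by
  induction j, hij using Nat.le_induction with
  | base => exact le_rfl
  | succ j hij ih =>
    have := hξ.2.row_gap hk (i := j) (j := j + 1) (by omega) (by omega) h2
    rw [uCoord, uCoord] at this
    push_cast at this
    have := ih (by omega)
    linarith

lemma half_le {j : ℕ} (hk : k + 1 ≤ n) (h1 : 1 ≤ j) (h2 : j ≤ k / 2) : 1 / 2 ≤ ξ k j := by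
  refine le_trans ?_ (hξ.row_antitone hk h1 h2 le_rfl)
  obtain ⟨z, hz⟩ := hξ.half_int (k := k) (j := k / 2) (by omega) (by omega) le_rfl
  have hp := hξ.2.half_le (k := k) (j := k / 2) (by omega) (by omega) le_rfl
  have : (k : ℝ) / 2 - ((k / 2 : ℕ) : ℝ) ≤ 1 / 2 := by
    have : ((k : ℕ) : ℝ) ≤ ((2 * (k / 2) + 1 : ℕ) : ℝ) := by exact_mod_cast (by omega)
    push_cast at this; linarith
  rw [uCoord] at hp
  have h0 : (-1 : ℝ) < z := by rw [hz] at hp; linarith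
  have h0' : (-1 : ℤ) < z := by exact_mod_cast h0
  have : (0 : ℝ) ≤ z := by exact_mod_cast (by omega : 0 ≤ z)
  rw [hz]; linarith

lemma le_above {j : ℕ} (hk : k + 1 ≤ n) (h1 : 1 ≤ j) (h2 : j ≤ k / 2) : ξ k j ≤ ξ (k + 1) j := by
  have := hξ.2.up_half hk h1 h2
  rw [uCoord, uCoord] at this; push_cast at this; linarith

lemma above_le {j : ℕ} (hk : k + 1 ≤ n) (h1 : 1 ≤ j) (h2 : j + 1 ≤ (k + 1) / 2) :
    ξ (k + 1) (j + 1) ≤ ξ k j := by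
  have := hξ.2.down_half hk h1 h2
  rw [uCoord, uCoord] at this; push_cast at this; linarith

end Adm

/-- The array whose rows below row `k` repeat the entries of row `k`. -/
def maxBelow (k : ℕ) (ξ : ℕ → ℕ → ℝ) : ℕ → ℕ → ℝ := fun i j =>
  if i < k then (if 1 ≤ j ∧ j ≤ i / 2 then ξ k j else 0) else ξ i j

lemma adm_maxBelow {n k : ℕ} {ξ : ℕ → ℕ → ℝ} (hξ : Adm n ξ) (hk : k + 1 ≤ n) :
    Adm n (maxBelow k ξ) := by
  have hge : ∀ i, k ≤ i → maxBelow k ξ i = ξ i := fun i hi => by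
    funext j; rw [maxBelow, if_neg hi.not_gt]
  have hval : ∀ i j, i ≤ k → 1 ≤ j → j ≤ i / 2 → maxBelow k ξ i j = ξ k j := by
    intro i j hi h1 h2
    rcases hi.lt_or_eq with hi | rfl
    · rw [maxBelow, if_pos hi, if_pos ⟨h1, h2⟩]
    · rw [hge _ le_rfl]
  refine ⟨fun i j hij => ?_, ⟨?_, ?_, ?_, ?_⟩⟩
  · rcases lt_or_ge i k with hi | hi
    · rw [maxBelow, if_pos hi, if_neg]
      intro h
      exact hij ⟨by omega, by omega, h.1, h.2⟩
    · rw [hge i hi]; exact hξ.1 i j hij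
  all_goals intro i j h1 h2 h3; rcases lt_or_ge i k with hi | hi
  · obtain ⟨z, hz⟩ := hξ.half_int (k := k) (by omega) h2 (by omega)
    refine ⟨z - j, ?_⟩
    rw [uCoord, hval i j hi.le h2 h3, hz]; push_cast; ring
  · rw [uCoord_row_congr (hge i hi)]; exact hξ.2.lat i j h1 h2 h3
  · have := hξ.half_le hk h2 (by omega)
    rw [uCoord, hval i j hi.le h2 h3]
    have : (j : ℝ) ≤ (i : ℝ) / 2 := by
      have : ((2 * j : ℕ) : ℝ) ≤ i := by exact_mod_cast (by omega : 2 * j ≤ i)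
      push_cast at this; linarith
    linarith
  · rw [uCoord_row_congr (hge i hi)]; exact hξ.2.pos i j h1 h2 h3
  · rw [uCoord, uCoord, hval i j hi.le h2 h3, hval (i + 1) j hi h2 (by omega)]
    push_cast; linarith
  · rw [uCoord_row_congr (hge i hi), uCoord_row_congr (hge (i + 1) (by omega))]
    exact hξ.2.up i j h1 h2 h3
  · rw [uCoord, uCoord, hval i j hi.le h2 (by omega), hval (i + 1) (j + 1) hi (by omega) h3]
    have := hξ.row_antitone hk h2 (show j ≤ j + 1 by omega) (by omega)
    push_cast; linarith
  · rw [uCoord_row_congr (hge i hi), uCoord_row_congr (hge (i + 1) (by omega))]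
    exact hξ.2.down i j h1 h2 h3

/-- If row `k - 1` repeats row `k`, an entry of row `k` may be raised as long as row `k + 1`
permits. -/
lemma adm_moveArr_up {n k : ℕ} {ζ : ℕ → ℕ → ℝ} (hζ : Adm n ζ) (hk1 : 1 ≤ k) (hk : k + 1 ≤ n) {j : ℕ}
    (hj : j ∈ Icc 1 (k / 2)) (hmax : ∀ l, 1 ≤ l → l ≤ (k - 1) / 2 → ζ (k - 1) l = ζ k l)
    (hup : ζ k j + 1 ≤ ζ (k + 1) j) : Adm n (moveArr ζ k (some (j, 1))) := by
  refine adm_moveArr hζ (by omega) (some_mem_stepsOf.2 hj) (hζ.2.move hk1 hj ?_ ?_ ?_)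
  all_goals rw [mem_Icc] at hj
  · have := hζ.2.pos k j (by omega) hj.1 hj.2
    push_cast; linarith
  · rintro ⟨p1, i⟩ hp h
    rw [mem_nbrs] at hp
    simp only at hp h ⊢
    push_cast
    rcases h with ⟨rfl, h⟩ | ⟨rfl, h⟩
    · rcases h.eq_or_lt with rfl | h
      · rw [uCoord, uCoord]; push_cast; linarith
      · have e1 := hζ.2.row_gap hk (i := i) (j := j) (by omega) h hj.2
        have e2 := hζ.2.up k i hk (by omega) (by omega)
        linarith
    · have e1 := hζ.above_le hk (j := j - 1) (by omega) (by omega)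
      rw [show j - 1 + 1 = j by omega] at e1
      have e2 := hζ.row_antitone hk (i := i) (j := j - 1) (by omega) (by omega) (by omega)
      rw [uCoord, uCoord, hmax i (by omega) (by omega), Nat.cast_sub hk1]
      have : (i : ℝ) + 1 ≤ j := by exact_mod_cast h
      push_cast; linarith
  · intro p hp h
    have := hζ.2.nbr_le hk1 hk hj.1 hj.2 hp h
    push_cast; linarith

/-! ### Matrix units -/

section Units

variable {q : ℝ} {n : ℕ} {e : ℕ → ℝ} {k : ℕ}

/-- The space with basis all tableaux. -/
abbrev Ambient (n : ℕ) : Type := {ξ : ℕ → ℕ → ℝ // Adm n ξ} →₀ ℂ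

/-- The subspace is invariant under the operators of the rows `1, …, k - 1`. -/
def IsRowInvariant (q : ℝ) (n : ℕ) (e : ℕ → ℝ) (k : ℕ) (S : Submodule ℂ (Ambient n)) : Prop :=
  ∀ i, 1 ≤ i → i < k → ∀ x ∈ S, ambientOp q n e i x ∈ S

/-- The algebra of all operators that leave invariant every subspace invariant under the rows
`1, …, k - 1`. It is preferred to the algebra generated by these operators because it is closed under
pointwise approximation. -/
def reflexive (q : ℝ) (n : ℕ) (e : ℕ → ℝ) (k : ℕ) : Subalgebra ℂ (Module.End ℂ (Ambient n)) where
  carrier := {a | ∀ S, IsRowInvariant q n e k S → ∀ x ∈ S, a x ∈ S}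
  mul_mem' ha hb S hS x hx := ha S hS _ (hb S hS x hx)
  add_mem' ha hb S hS x hx := S.add_mem (ha S hS x hx) (hb S hS x hx)
  algebraMap_mem' c S _ x hx := by
    rw [Module.algebraMap_end_apply]; exact S.smul_mem c hx

lemma reflexive_mono {k' : ℕ} (h : k ≤ k') : reflexive q n e k ≤ reflexive q n e k' :=
  fun _ ha S hS => ha S fun i h1 h2 => hS i h1 (by omega)

lemma ambientOp_mem_reflexive (hk1 : 1 ≤ k) : ambientOp q n e k ∈ reflexive q n e (k + 1) :=
  fun _ hS x hx => hS k hk1 (by omega) x hx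

/-- The algebra is closed under pointwise approximation. -/
lemma mem_reflexive_of_forall {a : Module.End ℂ (Ambient n)}
    (h : ∀ x, ∃ b ∈ reflexive q n e k, b x = a x) : a ∈ reflexive q n e k := by
  intro S hS x hx
  obtain ⟨b, hb, hbx⟩ := h x
  rw [← hbx]; exact hb S hS x hx

lemma real_smul_mem_reflexive {a : Module.End ℂ (Ambient n)} (c : ℝ)
    (ha : a ∈ reflexive q n e k) : c • a ∈ reflexive q n e k := by
  intro S hS x hx
  rw [LinearMap.smul_apply, ← Complex.coe_smul]
  exact S.smul_mem _ (ha S hS x hx)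

open Classical in
/-- The matrix unit that replaces the rows `≤ k` of `ξ` by those of `ξ'`, and maps the tableaux that
do not agree with `ξ` up to row `k` to `0`. It is meant for `ξ` and `ξ'` with the same row `k`. -/
def unitOp (n k : ℕ) (ξ' ξ : ℕ → ℕ → ℝ) : Module.End ℂ (Ambient n) :=
  Finsupp.linearCombination ℂ fun ω =>
    if AgreeUpTo k ω.1 ξ then ket (Adm n) (graft k ξ' ω.1) else 0

variable {ξ ξ' ω : ℕ → ℕ → ℝ}

lemma unitOp_ket (hω : Adm n ω) (h : AgreeUpTo k ω ξ) (ξ' : ℕ → ℕ → ℝ) :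
    unitOp n k ξ' ξ (ket (Adm n) ω) = ket (Adm n) (graft k ξ' ω) := by
  rw [ket_of hω, unitOp, Finsupp.linearCombination_single, one_smul, if_pos h]

lemma unitOp_ket_of_not (hω : Adm n ω) (h : ¬ AgreeUpTo k ω ξ) (ξ' : ℕ → ℕ → ℝ) :
    unitOp n k ξ' ξ (ket (Adm n) ω) = 0 := by
  rw [ket_of hω, unitOp, Finsupp.linearCombination_single, one_smul, if_neg h]

lemma unitOp_self_ket (hω : Adm n ω) (h : AgreeUpTo k ω ξ) :
    unitOp n k ξ ξ (ket (Adm n) ω) = ket (Adm n) ω := by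
  rw [unitOp_ket hω h, h.graft_eq]

lemma unitOp_mul_unitOp (hξ' : Adm n ξ') (h : ξ k = ξ' k) (ξ'' : ℕ → ℕ → ℝ) :
    unitOp n k ξ'' ξ' * unitOp n k ξ' ξ = unitOp n k ξ'' ξ := by
  refine ambient_hom_ext fun ω hω => ?_
  rw [Module.End.mul_apply]
  by_cases ha : AgreeUpTo k ω ξ
  · have hr : ω k = ξ' k := (ha k le_rfl).trans h
    rw [unitOp_ket hω ha, unitOp_ket hω ha, unitOp_ket (adm_graft hξ' hω hr) (agreeUpTo_graft hr),
      graft_graft]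
  · rw [unitOp_ket_of_not hω ha, unitOp_ket_of_not hω ha, map_zero]

/-- All matrix units for the rows `≤ k` preserve the invariant subspaces. -/
def HasUnits (q : ℝ) (n : ℕ) (e : ℕ → ℝ) (k : ℕ) : Prop :=
  ∀ ξ ξ', Adm n ξ → Adm n ξ' → ξ k = ξ' k → unitOp n k ξ' ξ ∈ reflexive q n e k

lemma hasUnits_one : HasUnits q n e 1 := by
  intro ξ ξ' hξ hξ' _
  have h0 : ∀ ω, Adm n ω → ∀ i ≤ 1, ω i = 0 := fun ω hω i hi => by
    funext j; exact hω.1 i j fun h => by have := h.1; omega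
  have : unitOp n 1 ξ' ξ = 1 := by
    refine ambient_hom_ext fun ω hω => ?_
    have ha : AgreeUpTo 1 ω ξ := fun i hi => by rw [h0 ω hω i hi, h0 ξ hξ i hi]
    have ha' : AgreeUpTo 1 ω ξ' := fun i hi => by rw [h0 ω hω i hi, h0 ξ' hξ' i hi]
    rw [unitOp_ket hω ha, ha'.graft_eq]; rfl
  rw [this]; exact one_mem _

/-- The part of the operator of row `k` that belongs to one step. -/
lemma exists_stepOp (hU : HasUnits q n e k) (hk1 : 1 ≤ k) {σ : Step}
    (hσ : σ ∈ stepsOf (Icc 1 (k / 2))) (hη : Adm n (moveArr ξ k σ)) :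
    ∃ a ∈ reflexive q n e (k + 1), ∀ ω, Adm n ω → AgreeUpTo k ω ξ →
      a (ket (Adm n) ω) =
        foldCoef q (e k) k (uCoord ω) σ • ket (Adm n) (moveArr ω k σ) := by
  refine ⟨unitOp n k (moveArr ξ k σ) (moveArr ξ k σ) * ambientOp q n e k,
    mul_mem (reflexive_mono (by omega) (hU _ _ hη hη rfl)) (ambientOp_mem_reflexive hk1),
    fun ω hω ha => ?_⟩
  rw [Module.End.mul_apply, ambientOp_ket hω, map_sum]
  rw [sum_eq_single_of_mem σ hσ]
  · rw [LinearMap.map_smul_of_tower]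
    congr 1
    by_cases h : Adm n (moveArr ω k σ)
    · exact unitOp_self_ket h (ha.moveArr σ)
    · rw [ket_of_not h, map_zero]
  · intro τ _ hne
    rw [LinearMap.map_smul_of_tower]
    by_cases h : Adm n (moveArr ω k τ)
    · rw [unitOp_ket_of_not h, smul_zero]
      intro h'
      have := h' k le_rfl
      simp only [moveArr, Function.update_self, ha k le_rfl] at this
      exact hne (moveRow_injective _ this)
    · rw [ket_of_not h, map_zero, smul_zero]

lemma foldCoef_ne_zero (hq : 0 < q) (hq1 : q ≠ 1) {e : ℝ} (hk1 : 1 ≤ k) (hk : k + 1 ≤ n)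
    {b : ℕ} {s : ℤˣ} (hb : b ∈ Icc 1 (k / 2)) (hξ : Adm n ξ)
    (hη : Adm n (moveArr ξ k (some (b, s)))) :
    foldCoef q e k (uCoord ξ) (some (b, s)) ≠ 0 := by
  have h := hη.2
  rw [uCoord_moveArr] at h
  have hpos := h.pos k b (by omega) (mem_Icc.1 hb).1 (mem_Icc.1 hb).2
  rw [moveArr_some_self] at hpos
  rw [foldCoef, if_pos hpos]
  exact hξ.2.stepCoef_ne_zero_of_moveArr hq hq1 hk1 hk hb h

lemma foldCoef_update {e : ℝ} {ζ : ℕ → ℕ → ℝ} (ha : AgreeUpTo k ω ζ) :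
    foldCoef q e k (uCoord (Function.update ζ (k + 1) (ω (k + 1)))) =
      foldCoef q e k (uCoord ω) := by
  refine foldCoef_congr (uCoord_row_congr ?_) (uCoord_row_congr ?_) (uCoord_row_congr ?_)
  · rw [Function.update_of_ne (by omega), ha k le_rfl]
  · rw [Function.update_self]
  · rw [Function.update_of_ne (by omega), ha (k - 1) (by omega)]

/-- Raising the `j`-th entry of row `k` by `N` and lowering it again is a diagonal operator; it
detects whether the entry above is large enough. -/
lemma exists_loopOp (hq : 0 < q) (hq1 : q ≠ 1) (hU : HasUnits q n e k) (hk1 : 1 ≤ k)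
    (hk : k + 1 ≤ n) {j : ℕ} (hj : j ∈ Icc 1 (k / 2)) (N : ℕ) :
    ∀ ξ, Adm n ξ → ξ k j + N ≤ ξ (k + 1) j →
    ∃ a ∈ reflexive q n e (k + 1), ∃ g : (ℕ → ℝ) → ℝ, ∀ ω, Adm n ω → AgreeUpTo k ω ξ →
      a (ket (Adm n) ω) = g (ω (k + 1)) • ket (Adm n) ω ∧
      (g (ω (k + 1)) ≠ 0 ↔ ξ k j + N ≤ ω (k + 1) j) := by
  have hj' := mem_Icc.1 hj
  induction N with
  | zero =>
    intro ξ hξ _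
    refine ⟨1, one_mem _, fun _ => 1, fun ω hω ha => ⟨by simp, ?_⟩⟩
    have := hω.le_above hk hj'.1 hj'.2
    rw [ha k le_rfl] at this
    simpa using this
  | succ N ih =>
    intro ξ hξ hle
    set ξ₁ := maxBelow k ξ with hξ₁
    have hξ₁a : Adm n ξ₁ := adm_maxBelow hξ hk
    have hge : ∀ i, k ≤ i → ξ₁ i = ξ i := fun i hi => by
      funext l; rw [hξ₁, maxBelow, if_neg hi.not_gt]
    have hmax : ∀ l, 1 ≤ l → l ≤ (k - 1) / 2 → ξ₁ (k - 1) l = ξ₁ k l := by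
      intro l h1 h2
      rw [hge k le_rfl, hξ₁, maxBelow, if_pos (by omega), if_pos ⟨h1, h2⟩]
    set σ : Step := some (j, 1) with hσdef
    have hσ : σ ∈ stepsOf (Icc 1 (k / 2)) := some_mem_stepsOf.2 hj
    -- raising the entry in a tableau with these lower rows
    have hmove : ∀ ω₁, Adm n ω₁ → AgreeUpTo k ω₁ ξ₁ → ξ k j + 1 ≤ ω₁ (k + 1) j →
        Adm n (moveArr ω₁ k σ) := by
      intro ω₁ h₁ ha₁ hup
      refine adm_moveArr_up h₁ hk1 hk hj (fun l h1 h2 => ?_) ?_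
      · rw [ha₁ (k - 1) (by omega), ha₁ k le_rfl]; exact hmax l h1 h2
      · rw [ha₁ k le_rfl, hge k le_rfl]; exact hup
    push_cast at hle
    have hN : (0 : ℝ) ≤ N := Nat.cast_nonneg N
    have hη : Adm n (moveArr ξ₁ k σ) := hmove ξ₁ hξ₁a (fun _ _ => rfl) (by
      rw [hge (k + 1) (by omega)]; linarith)
    set η := moveArr ξ₁ k σ with hηdef
    have hηk : η k j = ξ k j + 1 := by
      rw [hηdef, moveArr_some_self, hge k le_rfl]; push_cast; ring
    obtain ⟨a', ha', g', hg'⟩ := ih η hη (by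
      rw [hηk, hηdef, moveArr_of_ne _ _ (by omega), hge (k + 1) (by omega)]; linarith)
    obtain ⟨w, hw, hw'⟩ := exists_stepOp hU hk1 hσ hη
    have hηinv : moveArr η k σ.inv = ξ₁ := moveArr_inv ξ₁ k σ
    obtain ⟨v, hv, hv'⟩ := exists_stepOp hU hk1 (Step.inv_mem hσ) (by rwa [hηinv])
    have hrow : ξ k = ξ₁ k := (hge k le_rfl).symm
    refine ⟨unitOp n k ξ ξ₁ * v * a' * w * unitOp n k ξ₁ ξ,
      mul_mem (mul_mem (mul_mem (mul_mem
        (reflexive_mono (by omega) (hU _ _ hξ₁a hξ hrow.symm)) hv) ha') hw)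
        (reflexive_mono (by omega) (hU _ _ hξ hξ₁a hrow)),
      fun r => foldCoef q (e k) k (uCoord (Function.update ξ₁ (k + 1) r)) σ *
        (g' r * foldCoef q (e k) k (uCoord (Function.update η (k + 1) r)) σ.inv),
      fun ω hω ha => ?_⟩
    simp only [Module.End.mul_apply]
    set ω₁ := graft k ξ₁ ω with hω₁
    have hr : ω k = ξ₁ k := (ha k le_rfl).trans hrow
    have hω₁a : Adm n ω₁ := adm_graft hξ₁a hω hr
    have ha₁ : AgreeUpTo k ω₁ ξ₁ := agreeUpTo_graft hr
    have htop : ω₁ (k + 1) = ω (k + 1) := graft_of_le _ _ (by omega)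
    rw [unitOp_ket hω ha, hw' ω₁ hω₁a ha₁, ← htop, foldCoef_update ha₁]
    by_cases h0 : foldCoef q (e k) k (uCoord ω₁) σ = 0
    · rw [h0]
      refine ⟨by simp, ?_⟩
      simp only [zero_mul, ne_eq, not_true, false_iff]
      intro hcon
      push_cast at hcon
      exact foldCoef_ne_zero hq hq1 hk1 hk hj hω₁a (hmove ω₁ hω₁a ha₁ (by linarith)) h0
    · have hω₂ : Adm n (moveArr ω₁ k σ) :=
        adm_moveArr_of_foldCoef_ne_zero hk1 hk hω₁a hσ h0
      have ha₂ : AgreeUpTo k (moveArr ω₁ k σ) η := ha₁.moveArr σ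
      have htop₂ : moveArr ω₁ k σ (k + 1) = ω₁ (k + 1) := moveArr_of_ne _ _ (by omega)
      obtain ⟨e1, e2⟩ := hg' _ hω₂ ha₂
      have e3 := foldCoef_update (q := q) (e := e k) ha₂
      rw [htop₂] at e1 e2 e3
      have h0' : foldCoef q (e k) k (uCoord (moveArr ω₁ k σ)) σ.inv ≠ 0 :=
        foldCoef_ne_zero hq hq1 hk1 hk hj hω₂ (by
          rw [show some (j, (-1 : ℤˣ)) = σ.inv from rfl, moveArr_inv]; exact hω₁a)
      constructor
      · rw [LinearMap.map_smul_of_tower, e1, LinearMap.map_smul_of_tower,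
          LinearMap.map_smul_of_tower, LinearMap.map_smul_of_tower, hv' _ hω₂ ha₂, moveArr_inv,
          LinearMap.map_smul_of_tower, LinearMap.map_smul_of_tower, unitOp_ket hω₁a ha₁, hω₁, graft_graft, ha.graft_eq,
          smul_smul, smul_smul, ← hω₁, e3, mul_assoc]
      · rw [e3, ne_eq, mul_eq_zero, mul_eq_zero, not_or, not_or]
        rw [hηk] at e2
        push_cast
        constructor
        · rintro ⟨-, h, -⟩
          have := e2.1 h; linarith
        · intro h
          exact ⟨h0, e2.2 (by linarith), h0'⟩

end Units

/-! ### Matrix units by induction on the rows -/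

section Induction

variable {q : ℝ} {n : ℕ} {e : ℕ → ℝ} {k : ℕ} {ξ ξ' ω : ℕ → ℕ → ℝ}

/-- For odd `k` the diagonal coefficient determines the last entry of row `k + 1` once the rest of
the rows `k - 1`, `k`, `k + 1` is given. -/
lemma eq_of_foldCoef_none_eq (hq : 0 < q) (hq1 : q ≠ 1) {c : ℝ} (hc : c ≠ 0) (hk : k + 1 ≤ n)
    (hodd : ¬ Even k) (hξ : Adm n ξ) (hξ' : Adm n ξ') (ha : AgreeUpTo k ξ' ξ)
    (hrow : ∀ j, 1 ≤ j → j ≤ k / 2 → ξ' (k + 1) j = ξ (k + 1) j)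
    (h : foldCoef q c k (uCoord ξ') none = foldCoef q c k (uCoord ξ) none) :
    ξ' (k + 1) ((k + 1) / 2) = ξ (k + 1) ((k + 1) / 2) := by
  have hp : (k + 1, (k + 1) / 2) ∈ nbrs k := by
    rw [Nat.not_even_iff_odd] at hodd
    obtain ⟨m, rfl⟩ := hodd
    exact succ_mem_nbrs (by omega) le_rfl
  have hrest : ∏ x ∈ (nbrs k).erase (k + 1, (k + 1) / 2), qNumPlus q (uCoord ξ' x.1 x.2) =
      ∏ x ∈ (nbrs k).erase (k + 1, (k + 1) / 2), qNumPlus q (uCoord ξ x.1 x.2) := by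
    refine prod_congr rfl fun x hx => ?_
    rw [mem_erase, mem_nbrs] at hx
    rcases hx with ⟨hne, ⟨h1, h2, h3⟩ | ⟨h1, -, -⟩⟩
    · have : x.2 ≠ (k + 1) / 2 := fun h => hne (Prod.ext h1 h)
      rw [uCoord, uCoord, h1, hrow x.2 h2 (by omega)]
    · rw [uCoord, uCoord, h1, ha (k - 1) (by omega)]
  simp only [foldCoef, stepCoef, rowCoef, hodd, false_and, if_false, sub_zero,
    uCoord_row_congr (ha k le_rfl)] at h
  rw [div_left_inj' (prod_ne_zero_iff.2 fun i _ =>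
    mul_ne_zero (qNumPlus_ne_zero hq hq1 _) (qNumPlus_ne_zero hq hq1 _)),
    mul_right_inj' hc, ← mul_prod_erase _ _ hp, ← mul_prod_erase _ _ hp, hrest,
    mul_left_inj' (prod_ne_zero_iff.2 fun i _ => qNumPlus_ne_zero hq hq1 _)] at h
  have h2 := congrArg (· ^ 2) h
  simp only [qNumPlus_sq hq hq1, add_left_inj, qNum_sq_eq_iff hq hq1] at h2
  rw [mem_nbrs] at hp
  rw [abs_of_pos (hξ.2.pos _ _ hk (by omega) le_rfl),
    abs_of_pos (hξ'.2.pos _ _ hk (by omega) le_rfl), uCoord, uCoord] at h2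
  linarith

/-- Among the tableaux with given rows `≤ k`, a diagonal operator separates two given rows
`k + 1`. -/
lemma exists_separator (hq : 0 < q) (hq1 : q ≠ 1) (he : e k ≠ 0) (hU : HasUnits q n e k)
    (hk1 : 1 ≤ k) (hk : k + 1 ≤ n) (hξ : Adm n ξ) (hξ' : Adm n ξ') (ha : AgreeUpTo k ξ' ξ)
    (hne : ξ' (k + 1) ≠ ξ (k + 1)) :
    ∃ a ∈ reflexive q n e (k + 1), ∃ g : (ℕ → ℝ) → ℝ,
      (∀ ω, Adm n ω → AgreeUpTo k ω ξ → a (ket (Adm n) ω) = g (ω (k + 1)) • ket (Adm n) ω) ∧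
      g (ξ (k + 1)) = 1 ∧ g (ξ' (k + 1)) = 0 := by
  -- it suffices that a diagonal operator takes different values at the two rows
  suffices h : ∃ a ∈ reflexive q n e (k + 1), ∃ g : (ℕ → ℝ) → ℝ,
      (∀ ω, Adm n ω → AgreeUpTo k ω ξ → a (ket (Adm n) ω) = g (ω (k + 1)) • ket (Adm n) ω) ∧
      g (ξ (k + 1)) ≠ g (ξ' (k + 1)) by
    obtain ⟨a, hmem, g, hg, hd⟩ := h
    have h1 : a + (-g (ξ' (k + 1))) • (1 : Module.End ℂ (Ambient n)) ∈ reflexive q n e (k + 1) :=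
      add_mem hmem (real_smul_mem_reflexive _ (one_mem _))
    refine ⟨(g (ξ (k + 1)) - g (ξ' (k + 1)))⁻¹ • (a + (-g (ξ' (k + 1))) • 1),
      real_smul_mem_reflexive _ h1,
      fun r => (g (ξ (k + 1)) - g (ξ' (k + 1)))⁻¹ * (g r - g (ξ' (k + 1))),
      fun ω hω hag => ?_, inv_mul_cancel₀ (sub_ne_zero.2 hd), by simp⟩
    rw [LinearMap.smul_apply, LinearMap.add_apply, LinearMap.smul_apply, hg ω hω hag,
      Module.End.one_apply, ← add_smul, smul_smul, ← sub_eq_add_neg]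
  have ha' : AgreeUpTo k ξ ξ' := fun i hi => (ha i hi).symm
  by_contra! hcon
  -- the entries above row `k` agree, by raising and lowering
  have key : ∀ {η η' : ℕ → ℕ → ℝ}, Adm n η → Adm n η' → AgreeUpTo k η ξ → AgreeUpTo k η' η →
      (∀ g : (ℕ → ℝ) → ℝ, g (ξ (k + 1)) = g (ξ' (k + 1)) → g (η (k + 1)) = g (η' (k + 1))) →
      ∀ j, 1 ≤ j → j ≤ k / 2 → η (k + 1) j ≤ η' (k + 1) j := by
    intro η η' hη hη' hηξ haη hgη j h1 h2
    obtain ⟨z, hz⟩ := hη.half_int (k := k) (j := j) (by omega) h1 h2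
    obtain ⟨w, hw⟩ := hη.half_int (k := k + 1) (j := j) hk h1 (by omega)
    have hle := hη.le_above hk h1 h2
    have hzw : z ≤ w := by rw [hz, hw] at hle; exact_mod_cast (by linarith : (z : ℝ) ≤ w)
    obtain ⟨N, hN⟩ := Int.eq_ofNat_of_zero_le (sub_nonneg.2 hzw)
    have hN' : (N : ℝ) = w - z := by exact_mod_cast hN.symm
    obtain ⟨a, hmem, g, hg⟩ := exists_loopOp hq hq1 hU hk1 hk (mem_Icc.2 ⟨h1, h2⟩) N η hη
      (by rw [hz, hw, hN']; linarith)
    have e1 := (hg η hη fun _ _ => rfl).2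
    have e2 := (hg η' hη' haη).2
    have e3 := hcon a hmem g fun ω hω hag => (hg ω hω fun i hi => by
      rw [hag i hi, hηξ i hi]).1
    rw [← hgη g e3] at e2
    have := e2.1 (e1.2 (by rw [hz, hw, hN']; linarith))
    rw [hz, hN'] at this; rw [hw]; linarith
  have hrow : ∀ j, 1 ≤ j → j ≤ k / 2 → ξ' (k + 1) j = ξ (k + 1) j := fun j h1 h2 =>
    le_antisymm (key hξ' hξ ha ha' (fun g h => h.symm) j h1 h2)
      (key hξ hξ' (fun _ _ => rfl) ha (fun g h => h) j h1 h2)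
  refine hne (funext fun j => ?_)
  by_cases hj : 1 ≤ j ∧ j ≤ (k + 1) / 2
  · by_cases hj' : j ≤ k / 2
    · exact hrow j hj.1 hj'
    · have hodd : ¬ Even k := fun ⟨m, hm⟩ => by omega
      obtain rfl : j = (k + 1) / 2 := by omega
      obtain ⟨a, hmem, hw⟩ := exists_stepOp hU hk1 (none_mem_stepsOf _) (ξ := ξ)
        (by rwa [moveArr_none])
      refine eq_of_foldCoef_none_eq hq hq1 he hk hodd hξ hξ' ha hrow ?_
      have := hcon a hmem
        (fun r => foldCoef q (e k) k (uCoord (Function.update ξ (k + 1) r)) none)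
        fun ω hω hag => by rw [hw ω hω hag, moveArr_none, foldCoef_update hag]
      rw [foldCoef_update fun _ _ => rfl, foldCoef_update ha] at this
      exact this.symm
  · rw [hξ.1 _ _ fun h => hj ⟨h.2.2.1, h.2.2.2⟩, hξ'.1 _ _ fun h => hj ⟨h.2.2.1, h.2.2.2⟩]

lemma agreeUpTo_succ : AgreeUpTo (k + 1) ω ξ ↔ AgreeUpTo k ω ξ ∧ ω (k + 1) = ξ (k + 1) := by
  refine ⟨fun h => ⟨fun i hi => h i (by omega), h _ le_rfl⟩, fun h i hi => ?_⟩
  rcases Nat.lt_or_eq_of_le hi with hi | rfl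
  · exact h.1 i (by omega)
  · exact h.2

/-- Two operators that agree on the basis vectors in the support of `x` agree at `x`. -/
lemma apply_eq_of_forall_support {M : Type*} [AddCommMonoid M] [Module ℂ M]
    {f g : Ambient n →ₗ[ℂ] M} {x : Ambient n}
    (h : ∀ ω ∈ x.support, f (ket (Adm n) ω.1) = g (ket (Adm n) ω.1)) : f x = g x := by
  rw [← Finsupp.sum_single x, Finsupp.sum, map_sum, map_sum]
  refine sum_congr rfl fun ω hω => ?_
  have := h ω hω
  rw [ket_of ω.2] at this
  rw [← mul_one (x ω), ← smul_eq_mul, ← Finsupp.smul_single, map_smul, map_smul, this]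

/-- The projections to the tableaux with given rows `≤ k + 1`. -/
lemma unitOp_self_mem (hq : 0 < q) (hq1 : q ≠ 1) (he : e k ≠ 0) (hU : HasUnits q n e k)
    (hk1 : 1 ≤ k) (hk : k + 1 ≤ n) (hξ : Adm n ξ) :
    unitOp n (k + 1) ξ ξ ∈ reflexive q n e (k + 1) := by
  classical
  have hsep : ∀ s : Finset {ξ : ℕ → ℕ → ℝ // Adm n ξ},
      ∃ a ∈ reflexive q n e (k + 1), ∃ g : (ℕ → ℝ) → ℝ,
        (∀ ω, Adm n ω → AgreeUpTo k ω ξ → a (ket (Adm n) ω) = g (ω (k + 1)) • ket (Adm n) ω) ∧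
        g (ξ (k + 1)) = 1 ∧
        ∀ ω ∈ s, AgreeUpTo k ω.1 ξ → ω.1 (k + 1) ≠ ξ (k + 1) → g (ω.1 (k + 1)) = 0 := by
    intro s
    induction s using Finset.induction_on with
    | empty => exact ⟨1, one_mem _, fun _ => 1, by simp, rfl, by simp⟩
    | insert ζ s _ ih =>
      obtain ⟨a, hmem, g, hg, h1, h0⟩ := ih
      by_cases hζ : AgreeUpTo k ζ.1 ξ ∧ ζ.1 (k + 1) ≠ ξ (k + 1)
      · obtain ⟨a', hmem', g', hg', h1', h0'⟩ :=
          exists_separator hq hq1 he hU hk1 hk hξ ζ.2 hζ.1 hζ.2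
        refine ⟨a * a', mul_mem hmem hmem', fun r => g' r * g r, fun ω hω hag => ?_, ?_, ?_⟩
        · rw [Module.End.mul_apply, hg' ω hω hag, LinearMap.map_smul_of_tower, hg ω hω hag,
            smul_smul]
        · simp only [h1, h1', mul_one]
        · intro ω hω hag hne
          rcases mem_insert.1 hω with rfl | hω
          · simp only [h0', zero_mul]
          · simp only [h0 ω hω hag hne, mul_zero]
      · refine ⟨a, hmem, g, hg, h1, fun ω hω hag hne => ?_⟩
        rcases mem_insert.1 hω with rfl | hω
        · exact absurd ⟨hag, hne⟩ hζ
        · exact h0 ω hω hag hne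
  refine mem_reflexive_of_forall fun x => ?_
  obtain ⟨a, hmem, g, hg, h1, h0⟩ := hsep x.support
  refine ⟨a * unitOp n k ξ ξ, mul_mem hmem (reflexive_mono (by omega) (hU _ _ hξ hξ rfl)),
    apply_eq_of_forall_support fun ω hω => ?_⟩
  rw [Module.End.mul_apply]
  by_cases hag : AgreeUpTo k ω.1 ξ
  · rw [unitOp_self_ket ω.2 hag, hg _ ω.2 hag]
    by_cases htop : ω.1 (k + 1) = ξ (k + 1)
    · rw [unitOp_self_ket ω.2 (agreeUpTo_succ.2 ⟨hag, htop⟩), htop, h1, one_smul]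
    · rw [unitOp_ket_of_not ω.2 fun h => htop (agreeUpTo_succ.1 h).2, h0 ω hω hag htop, zero_smul]
  · rw [unitOp_ket_of_not ω.2 hag, map_zero,
      unitOp_ket_of_not ω.2 fun h => hag (agreeUpTo_succ.1 h).1]

/-- The matrix units for the rows `≤ k + 1` between tableaux with the same row `k`. -/
lemma unitOp_mem_of_row_eq (hq : 0 < q) (hq1 : q ≠ 1) (he : e k ≠ 0) (hU : HasUnits q n e k)
    (hk1 : 1 ≤ k) (hk : k + 1 ≤ n) (hξ : Adm n ξ) (hξ' : Adm n ξ') (h : ξ k = ξ' k) :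
    unitOp n (k + 1) ξ' ξ ∈ reflexive q n e (k + 1) := by
  have : unitOp n (k + 1) ξ' ξ = unitOp n k ξ' ξ * unitOp n (k + 1) ξ ξ := by
    refine ambient_hom_ext fun ω hω => ?_
    rw [Module.End.mul_apply]
    by_cases ha : AgreeUpTo (k + 1) ω ξ
    · have ha' := (agreeUpTo_succ.1 ha).1
      rw [unitOp_self_ket hω ha, unitOp_ket hω ha, unitOp_ket hω ha']
      congr 1
      funext i
      rcases lt_trichotomy i k with hi | rfl | hi
      · rw [graft_of_lt _ _ hi, graft_of_lt _ _ (by omega)]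
      · rw [graft_of_lt _ _ (by omega), graft_of_le _ _ le_rfl, ha' i le_rfl, h]
      · rw [graft_of_le _ _ (by omega), graft_of_le _ _ hi.le]
    · rw [unitOp_ket_of_not hω ha, unitOp_ket_of_not hω ha, map_zero]
  rw [this]
  exact mul_mem (reflexive_mono (by omega) (hU _ _ hξ hξ' h))
    (unitOp_self_mem hq hq1 he hU hk1 hk hξ)

/-- The matrix units for the rows `≤ k + 1` between tableaux connected by a step in row `k`. -/
lemma unitOp_mem_of_step (hq : 0 < q) (hq1 : q ≠ 1) (he : e k ≠ 0) (hU : HasUnits q n e k)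
    (hk1 : 1 ≤ k) (hk : k + 1 ≤ n) {b : ℕ} {s : ℤˣ} (hb : b ∈ Icc 1 (k / 2)) (hξ : Adm n ξ)
    (hη : Adm n (moveArr ξ k (some (b, s)))) :
    unitOp n (k + 1) (moveArr ξ k (some (b, s))) ξ ∈ reflexive q n e (k + 1) := by
  obtain ⟨a, hmem, ha⟩ := exists_stepOp hU hk1 (some_mem_stepsOf.2 hb) hη
  have h0 := foldCoef_ne_zero (e := e k) hq hq1 hk1 hk hb hξ hη
  have : unitOp n (k + 1) (moveArr ξ k (some (b, s))) ξ =
      (foldCoef q (e k) k (uCoord ξ) (some (b, s)))⁻¹ • (a * unitOp n (k + 1) ξ ξ) := by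
    refine ambient_hom_ext fun ω hω => ?_
    rw [LinearMap.smul_apply, Module.End.mul_apply]
    by_cases hag : AgreeUpTo (k + 1) ω ξ
    · rw [unitOp_self_ket hω hag, unitOp_ket hω hag, ha ω hω (agreeUpTo_succ.1 hag).1,
        foldCoef_congr (uCoord_row_congr (hag k (by omega))) (uCoord_row_congr (hag (k + 1) le_rfl))
          (uCoord_row_congr (hag (k - 1) (by omega))), smul_smul, inv_mul_cancel₀ h0, one_smul]
      congr 1
      funext i
      rcases lt_or_ge i (k + 1) with hi | hi
      · rw [graft_of_lt _ _ hi]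
        exact ((agreeUpTo_succ.1 hag).1.moveArr _ i (by omega)).symm
      · rw [graft_of_le _ _ hi, moveArr_of_ne _ _ (by omega)]
    · rw [unitOp_ket_of_not hω hag, unitOp_ket_of_not hω hag, map_zero, smul_zero]
  rw [this]
  exact real_smul_mem_reflexive _ (mul_mem hmem (unitOp_self_mem hq hq1 he hU hk1 hk hξ))

/-- Every tableau is connected with one in which row `k` is as large as row `k + 1` permits. -/
lemma exists_maximal_row (hq : 0 < q) (hq1 : q ≠ 1) (he : e k ≠ 0) (hU : HasUnits q n e k)
    (hk1 : 1 ≤ k) (hk : k + 1 ≤ n) (N : ℕ) :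
    ∀ ξ, Adm n ξ → ∑ j ∈ Icc 1 (k / 2), (ξ (k + 1) j - ξ k j) ≤ N →
      ∃ ζ, Adm n ζ ∧ ζ (k + 1) = ξ (k + 1) ∧ (∀ j ∈ Icc 1 (k / 2), ζ k j = ξ (k + 1) j) ∧
        unitOp n (k + 1) ζ ξ ∈ reflexive q n e (k + 1) ∧
        unitOp n (k + 1) ξ ζ ∈ reflexive q n e (k + 1) := by
  have hgap : ∀ ξ, Adm n ξ → (∀ j ∈ Icc 1 (k / 2), ξ k j = ξ (k + 1) j) ∨
      ∃ j ∈ Icc 1 (k / 2), ξ k j + 1 ≤ ξ (k + 1) j := by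
    intro ξ hξ
    by_contra! h
    obtain ⟨⟨j, hj, hne⟩, h⟩ := h
    have hj' := mem_Icc.1 hj
    obtain ⟨z, hz⟩ := hξ.half_int (k := k) (j := j) (by omega) hj'.1 hj'.2
    obtain ⟨w, hw⟩ := hξ.half_int (k := k + 1) (j := j) hk hj'.1 (by omega)
    have h1 := hξ.le_above hk hj'.1 hj'.2
    have h2 := h j hj
    rw [hz, hw] at h1 h2 hne
    have h1' : z ≤ w := by exact_mod_cast (by linarith : (z : ℝ) ≤ w)
    have h2' : w < z + 1 := by exact_mod_cast (by linarith : (w : ℝ) < z + 1)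
    exact hne (by rw [show z = w by omega])
  have hnn : ∀ ξ, Adm n ξ → ∀ j ∈ Icc 1 (k / 2), 0 ≤ ξ (k + 1) j - ξ k j := fun ξ hξ j hj =>
    sub_nonneg.2 (hξ.le_above hk (mem_Icc.1 hj).1 (mem_Icc.1 hj).2)
  induction N with
  | zero =>
    intro ξ hξ hsum
    rcases hgap ξ hξ with h | ⟨j, hj, h⟩
    · exact ⟨ξ, hξ, rfl, h, unitOp_self_mem hq hq1 he hU hk1 hk hξ,
        unitOp_self_mem hq hq1 he hU hk1 hk hξ⟩
    · have := single_le_sum (hnn ξ hξ) hj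
      push_cast at hsum
      linarith
  | succ N ih =>
    intro ξ hξ hsum
    rcases hgap ξ hξ with h | ⟨j, hj, h⟩
    · exact ⟨ξ, hξ, rfl, h, unitOp_self_mem hq hq1 he hU hk1 hk hξ,
        unitOp_self_mem hq hq1 he hU hk1 hk hξ⟩
    -- an entry can be raised once the rows below are made as large as possible
    · set ξ₁ := maxBelow k ξ with hξ₁
      have h₁ : Adm n ξ₁ := adm_maxBelow hξ hk
      have hge : ∀ i, k ≤ i → ξ₁ i = ξ i := fun i hi => by
        funext l; rw [hξ₁, maxBelow, if_neg hi.not_gt]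
      have hη : Adm n (moveArr ξ₁ k (some (j, 1))) := by
        refine adm_moveArr_up h₁ hk1 hk hj (fun l h1 h2 => ?_) ?_
        · rw [hge k le_rfl, hξ₁, maxBelow, if_pos (by omega), if_pos ⟨h1, h2⟩]
        · rw [hge k le_rfl, hge (k + 1) (by omega)]; exact h
      set η := moveArr ξ₁ k (some (j, 1)) with hηdef
      have htop : η (k + 1) = ξ (k + 1) := by
        rw [hηdef, moveArr_of_ne _ _ (by omega), hge (k + 1) (by omega)]
      have hinv : moveArr η k (some (j, -1)) = ξ₁ := moveArr_inv ξ₁ k (some (j, 1))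
      obtain ⟨ζ, hζ, hζt, hζk, hζ1, hζ2⟩ := ih η hη (by
        have e1 := add_sum_erase (Icc 1 (k / 2)) (fun i => ξ (k + 1) i - ξ k i) hj
        have e2 := add_sum_erase (Icc 1 (k / 2)) (fun i => η (k + 1) i - η k i) hj
        have e3 : ∑ i ∈ (Icc 1 (k / 2)).erase j, (η (k + 1) i - η k i) =
            ∑ i ∈ (Icc 1 (k / 2)).erase j, (ξ (k + 1) i - ξ k i) := by
          refine sum_congr rfl fun i hi => ?_
          rw [htop, hηdef, moveArr_some_of_ne _ _ fun _ => ne_of_mem_erase hi, hge k le_rfl]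
        have e4 : η k j = ξ k j + 1 := by
          rw [hηdef, moveArr_some_self, hge k le_rfl]; push_cast; ring
        simp only [htop, e4] at e1 e2 e3 ⊢
        push_cast at hsum
        linarith)
      rw [htop] at hζt hζk
      refine ⟨ζ, hζ, hζt, hζk, ?_, ?_⟩
      · rw [← unitOp_mul_unitOp hη (show ξ (k + 1) = η (k + 1) from htop.symm),
          ← unitOp_mul_unitOp (ξ := ξ) h₁ (hge (k + 1) (by omega)).symm]
        exact mul_mem hζ1 (mul_mem (unitOp_mem_of_step hq hq1 he hU hk1 hk hj h₁ hη)
          (unitOp_mem_of_row_eq hq hq1 he hU hk1 hk hξ h₁ (hge k le_rfl).symm))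
      · rw [← unitOp_mul_unitOp h₁ (hζt.trans (hge (k + 1) (by omega)).symm),
          ← unitOp_mul_unitOp (ξ := ζ) hη (hζt.trans htop.symm)]
        refine mul_mem (unitOp_mem_of_row_eq hq hq1 he hU hk1 hk h₁ hξ (hge k le_rfl))
          (mul_mem ?_ hζ2)
        have := unitOp_mem_of_step hq hq1 he hU hk1 hk hj hη (s := -1) (by rwa [hinv])
        rwa [hinv] at this

lemma HasUnits.succ (hq : 0 < q) (hq1 : q ≠ 1) (he : e k ≠ 0) (hU : HasUnits q n e k)
    (hk1 : 1 ≤ k) (hk : k + 1 ≤ n) : HasUnits q n e (k + 1) := by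
  intro ξ ξ' hξ hξ' h
  obtain ⟨N, hN⟩ := exists_nat_ge (∑ j ∈ Icc 1 (k / 2), (ξ (k + 1) j - ξ k j))
  obtain ⟨N', hN'⟩ := exists_nat_ge (∑ j ∈ Icc 1 (k / 2), (ξ' (k + 1) j - ξ' k j))
  obtain ⟨ζ, hζ, hζt, hζk, hζ1, -⟩ := exists_maximal_row hq hq1 he hU hk1 hk N ξ hξ hN
  obtain ⟨ζ', hζ', hζt', hζk', -, hζ2⟩ := exists_maximal_row hq hq1 he hU hk1 hk N' ξ' hξ' hN'
  have hrow : ζ k = ζ' k := by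
    funext j
    by_cases hj : j ∈ Icc 1 (k / 2)
    · rw [hζk j hj, hζk' j hj, h]
    · rw [mem_Icc] at hj
      rw [hζ.1 _ _ fun h => hj ⟨h.2.2.1, h.2.2.2⟩, hζ'.1 _ _ fun h => hj ⟨h.2.2.1, h.2.2.2⟩]
  rw [← unitOp_mul_unitOp hζ hζt.symm, ← unitOp_mul_unitOp (ξ := ζ) hζ'
    (hζt.trans (h.trans hζt'.symm))]
  exact mul_mem (mul_mem hζ2 (unitOp_mem_of_row_eq hq hq1 he hU hk1 hk hζ hζ' hrow)) hζ1

/-- The subspaces invariant under all rows are invariant under all matrix units. -/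
theorem hasUnits (hq : 0 < q) (hq1 : q ≠ 1) (he : ∀ k, e k ≠ 0) (hk1 : 1 ≤ k) (hk : k ≤ n) :
    HasUnits q n e k := by
  induction k, hk1 using Nat.le_induction with
  | base => exact hasUnits_one
  | succ k hk1 ih => exact (ih (by omega)).succ hq hq1 (he k) hk1 hk

end Induction

/-! ### Existence and finiteness of tableaux -/

section Tableaux

variable {n : ℕ} {m : WeightIndex n → ℝ}

open Classical in
/-- The array in which every row repeats the weight, except that the last entry of row `k` is
`1/2`. -/
def loweredArr (m : WeightIndex n → ℝ) (k : ℕ) : ℕ → ℕ → ℝ := fun i j =>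
  if h : IsPosition n i j then
    (if i = k ∧ j = k / 2 then 1 / 2 else m ⟨j, mem_Icc.2 ⟨h.2.2.1, by
      have := h.2.1; have := h.2.2.2; omega⟩⟩)
  else 0

lemma isNonclassicalTableau_loweredArr (hm : IsNonclassicalWeight n m) {k : ℕ} (hk : Even k)
    (hkn : k + 1 ≤ n) (hk2 : 2 ≤ k) : IsNonclassicalTableau n m (loweredArr m k) := by
  obtain ⟨r, hr⟩ := hk
  have hval : ∀ {i j : ℕ} (h : j ∈ Icc 1 (n / 2)), IsPosition n i j → ¬ (i = k ∧ j = k / 2) →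
      loweredArr m k i j = m ⟨j, h⟩ := fun h hp hne => by rw [loweredArr, dif_pos hp, if_neg hne]
  have hlow : ∀ {i j : ℕ}, IsPosition n i j → i = k ∧ j = k / 2 → loweredArr m k i j = 1 / 2 :=
    fun hp he => by rw [loweredArr, dif_pos hp, if_pos he]
  have hmem : ∀ {i j : ℕ}, IsPosition n i j → j ∈ Icc 1 (n / 2) := fun h => by
    have := h.2.1; have := h.2.2.2; exact mem_Icc.2 ⟨h.2.2.1, by omega⟩
  have hge : ∀ {i j : ℕ}, IsPosition n i j → 1 / 2 ≤ loweredArr m k i j := fun {i j} h => by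
    by_cases he : i = k ∧ j = k / 2
    · rw [hlow h he]
    · rw [hval (hmem h) h he]; exact hm.2.2 _
  -- the entry `j'` of one row is at most the entry `j ≤ j'` of another row
  have hle : ∀ {i j i' j' : ℕ}, IsPosition n i j → IsPosition n i' j' → j ≤ j' →
      (i = k → j = k / 2 → i' = k ∧ j' = k / 2) → loweredArr m k i' j' ≤ loweredArr m k i j := by
    intro i j i' j' hp hp' hjj himp
    by_cases he' : i' = k ∧ j' = k / 2
    · rw [hlow hp' he']; exact hge hp
    · rw [hval (hmem hp') hp' he', hval (hmem hp) hp fun he => he' (himp he.1 he.2)]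
      exact hm.2.1 hjj
  refine ⟨⟨fun i j h => dif_neg h, fun j => ?_⟩, fun i j h => ?_, fun p hp hpn => ⟨?_, ?_, ?_⟩,
    fun p hp hpn j hj => ?_⟩
  · have := mem_Icc.1 j.2
    exact hval j.2 ⟨by omega, le_rfl, this.1, this.2⟩ (by omega)
  · by_cases he : i = k ∧ j = k / 2
    · rw [hlow h he]; exact ⟨0, by norm_num⟩
    · rw [hval (hmem h) h he]; exact hm.1 _
  · intro j hj
    rw [mem_Icc] at hj
    exact hle ⟨by omega, by omega, by omega, by omega⟩ ⟨by omega, by omega, by omega, by omega⟩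
      le_rfl (by omega)
  · intro j hj
    rw [mem_Icc] at hj
    exact hle ⟨by omega, by omega, by omega, by omega⟩ ⟨by omega, by omega, by omega, by omega⟩
      (by omega) (by omega)
  · exact hge ⟨by omega, by omega, by omega, by omega⟩
  · rw [mem_Icc] at hj
    constructor
    · exact hle ⟨by omega, by omega, by omega, by omega⟩ ⟨by omega, by omega, by omega, by omega⟩
        le_rfl (by omega)
    · exact hle ⟨by omega, by omega, by omega, by omega⟩ ⟨by omega, by omega, by omega, by omega⟩
        (by omega) (by omega)

lemma loweredArr_self {k : ℕ} (hkn : k ≤ n) (hk2 : 2 ≤ k) :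
    loweredArr m k k (k / 2) = 1 / 2 := by
  rw [loweredArr, dif_pos ⟨hk2, hkn, by omega, le_rfl⟩, if_pos ⟨rfl, rfl⟩]

lemma Adm.le_top {ξ : ℕ → ℕ → ℝ} (hξ : Adm n ξ) {k j : ℕ} (hk : k ≤ n) (h1 : 1 ≤ j)
    (h2 : j ≤ k / 2) : ξ k j ≤ ξ n j := by
  suffices h : ∀ i, k ≤ i → i ≤ n → ξ k j ≤ ξ i j from h n hk le_rfl
  intro i hi
  induction i, hi using Nat.le_induction with
  | base => exact fun _ => le_rfl
  | succ i hi ih => exact fun h => (ih (by omega)).trans (hξ.le_above h h1 (by omega))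

/-- The entries of a tableau lie between `1/2` and the entries of the top row. -/
lemma finite_nonclassicalTableau (hm : IsNonclassicalWeight n m) :
    Finite {ξ : ℕ → ℕ → ℝ // IsNonclassicalTableau n m ξ} := by
  obtain ⟨M, hM⟩ := (Set.finite_range m).bddAbove
  obtain ⟨N, hN⟩ := exists_nat_ge M
  let F : Set ℝ := insert 0 ((fun z : ℤ => (z : ℝ) + 1 / 2) '' Set.Icc 0 (N : ℤ))
  have hF : F.Finite := ((Set.finite_Icc _ _).image _).insert 0
  have : Finite (Fin (n + 1) × Fin (n + 1) → F) := by
    have := hF.to_subtype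
    infer_instance
  have hmemF : ∀ ξ, IsNonclassicalTableau n m ξ → ∀ i j, ξ i j ∈ F := by
    intro ξ hξ i j
    by_cases h : IsPosition n i j
    · obtain ⟨h0, h1, h2, h3⟩ := h
      have hA := hξ.adm hm
      have hj : j ∈ Icc 1 (n / 2) := mem_Icc.2 ⟨h2, by omega⟩
      have htop : ξ n j = m ⟨j, hj⟩ := hξ.1.2 ⟨j, hj⟩
      have hle := hA.le_top h1 h2 h3
      have hlow : 1 / 2 ≤ ξ i j := by
        rcases h1.lt_or_eq with h | rfl
        · exact hA.half_le h h2 h3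
        · rw [htop]; exact hm.2.2 _
      have hMj := hM (Set.mem_range_self (⟨j, hj⟩ : WeightIndex n))
      obtain ⟨z, hz⟩ := hξ.2.1 i j ⟨h0, h1, h2, h3⟩
      refine Or.inr ⟨z, ⟨?_, ?_⟩, hz.symm⟩
      · have : (0 : ℝ) ≤ z := by linarith
        exact_mod_cast this
      · have : (z : ℝ) ≤ N := by linarith
        exact_mod_cast this
    · rw [hξ.1.1 i j h]; exact Or.inl rfl
  refine Finite.of_injective (β := Fin (n + 1) × Fin (n + 1) → F)
    (fun ξ p => ⟨ξ.1 p.1 p.2, hmemF ξ.1 ξ.2 _ _⟩) fun ξ η h => Subtype.ext ?_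
  funext i j
  by_cases hp : IsPosition n i j
  · have := congrFun h (⟨i, by have := hp.2.1; omega⟩, ⟨j, by
      have := hp.2.1; have := hp.2.2.2; omega⟩)
    exact congrArg Subtype.val this
  · rw [ξ.2.1.1 i j hp, η.2.1.1 i j hp]

end Tableaux

/-! ### Irreducibility and the separation of weights -/

section Irreducible

variable {q : ℝ} {n : ℕ} {m m' : WeightIndex n → ℝ} {ε : GenIndex n → ℤˣ} {ξ ξ' : ℕ → ℕ → ℝ}

/-- For the top row `k = n`, `unitOp` is a matrix unit in the usual sense. -/
lemma unitOp_top_apply (hξ : Adm n ξ) (hξ' : Adm n ξ') (h : ξ n = ξ' n)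
    (x : Ambient n) : unitOp n n ξ' ξ x = x ⟨ξ, hξ⟩ • ket (Adm n) ξ' := by
  have hrow : ∀ {ω η : ℕ → ℕ → ℝ}, Adm n ω → Adm n η → ∀ i, n < i → ω i = η i :=
    fun hω hη i hi => funext fun j => by
      rw [hω.1 i j fun h => by have := h.2.1; omega, hη.1 i j fun h => by have := h.2.1; omega]
  suffices hs : unitOp n n ξ' ξ =
      (Finsupp.lapply (⟨ξ, hξ⟩ : {ξ : ℕ → ℕ → ℝ // Adm n ξ})).smulRight (ket (Adm n) ξ') from
    LinearMap.congr_fun hs x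
  refine ambient_hom_ext fun ω hω => ?_
  rw [LinearMap.smulRight_apply, Finsupp.lapply_apply]
  by_cases ha : AgreeUpTo n ω ξ
  · obtain rfl : ω = ξ := funext fun i =>
      (le_or_gt i n).elim (ha i) (hrow hω hξ i)
    have hg : graft n ξ' ω = ξ' := by
      funext i
      rcases lt_trichotomy i n with hi | rfl | hi
      · exact graft_of_lt _ _ hi
      · rw [graft_of_le _ _ le_rfl, h]
      · rw [graft_of_le _ _ hi.le, hrow hω hξ' i hi]
    rw [unitOp_ket hω ha, hg, ket_of hω, Finsupp.single_eq_same, one_smul]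
  · rw [unitOp_ket_of_not hω ha, ket_of hω, Finsupp.single_eq_of_ne, zero_smul]
    intro heq
    exact ha fun i _ => congrFun (congrArg Subtype.val heq).symm i

lemma embed_apply (hm : IsNonclassicalWeight n m) (v : NonclassicalSpace n m)
    (h : IsNonclassicalTableau n m ξ) : embed hm v ⟨ξ, h.adm hm⟩ = v ⟨ξ, h⟩ :=
  Finsupp.mapDomain_apply (f := fun ξ : {ξ : ℕ → ℕ → ℝ // IsNonclassicalTableau n m ξ} =>
    (⟨ξ.1, ξ.2.adm hm⟩ : {ξ : ℕ → ℕ → ℝ // Adm n ξ}))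
    (fun _ _ h => Subtype.ext (congrArg (fun x => x.1) h)) v ⟨ξ, h⟩

lemma embed_apply_of_top_ne (hm : IsNonclassicalWeight n m) (v : NonclassicalSpace n m)
    (hξ : Adm n ξ) {j : WeightIndex n} (h : ξ n j.1 ≠ m j) : embed hm v ⟨ξ, hξ⟩ = 0 := by
  refine Finsupp.mapDomain_of_notMem_range _ _ ?_
  rintro ⟨ζ, hζ⟩
  have : ζ.1 = ξ := congrArg Subtype.val hζ
  exact h (this ▸ ζ.2.1.2 j)

/-- An invariant subspace of a representation space is invariant in the space of all tableaux, even
if the embedding is twisted by an intertwining map. -/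
lemma isRowInvariant_of_intertwining {V : Type*} [AddCommGroup V]
    [Module ℂ V] {T : GenIndex n → Module.End ℂ V} {g : V →ₗ[ℂ] Ambient n}
    (hg : ∀ (i : GenIndex n) (k : ℕ), i.1 = k + 1 → ∀ v,
      g (T i v) = ambientOp q n (rowSign ε) k (g v))
    {S : Submodule ℂ V} (hS : ∀ i, ∀ v ∈ S, T i v ∈ S) :
    IsRowInvariant q n (rowSign ε) n (S.map g) := by
  rintro k hk1 hk _ ⟨v, hv, rfl⟩
  refine ⟨T ⟨k + 1, mem_Icc.2 ⟨by omega, hk⟩⟩ v, hS _ v hv, hg _ k rfl v⟩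

lemma rowSign_ne_zero (ε : GenIndex n → ℤˣ) (k : ℕ) : rowSign ε k ≠ 0 := fun h => by
  have := rowSign_sq ε k
  rw [h] at this; norm_num at this

/-- A row-invariant subspace contains, with a vector whose coefficient at `ξ` does not vanish, all
basis vectors with the top row of `ξ`. -/
lemma IsRowInvariant.ket_mem (hq : 0 < q) (hq1 : q ≠ 1) (hn : 1 ≤ n) {S : Submodule ℂ (Ambient n)}
    (hS : IsRowInvariant q n (rowSign ε) n S) {x : Ambient n} (hx : x ∈ S) (hξ : Adm n ξ)
    (hξ' : Adm n ξ') (h : ξ n = ξ' n) (h0 : x ⟨ξ, hξ⟩ ≠ 0) : ket (Adm n) ξ' ∈ S := by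
  have := hasUnits (n := n) hq hq1 (rowSign_ne_zero ε) hn le_rfl ξ ξ' hξ hξ' h S hS x hx
  rw [unitOp_top_apply hξ hξ' h] at this
  exact (S.smul_mem_iff h0).1 this

lemma top_eq (hξ : IsNonclassicalTableau n m ξ) (hξ' : IsNonclassicalTableau n m ξ') :
    ξ n = ξ' n := by
  funext j
  by_cases hj : j ∈ Icc 1 (n / 2)
  · exact (hξ.1.2 ⟨j, hj⟩).trans (hξ'.1.2 ⟨j, hj⟩).symm
  · rw [mem_Icc] at hj
    rw [hξ.1.1 _ _ fun h => hj ⟨h.2.2.1, h.2.2.2⟩, hξ'.1.1 _ _ fun h => hj ⟨h.2.2.1, h.2.2.2⟩]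

theorem isIrreducibleRep_nonclassicalRep (hq : 0 < q) (hq1 : q ≠ 1) (hn : 3 ≤ n)
    (ε : GenIndex n → ℤˣ) (hm : IsNonclassicalWeight n m) :
    IsIrreducibleRep (nonclassicalRep hq hq1 ε hm) := by
  constructor
  · have : Nonempty {ξ : ℕ → ℕ → ℝ // IsNonclassicalTableau n m ξ} :=
      ⟨⟨_, isNonclassicalTableau_loweredArr hm even_two hn le_rfl⟩⟩
    infer_instance
  · intro S hS
    refine or_iff_not_imp_left.2 fun hne => ?_
    obtain ⟨x, hx, hx0⟩ := S.exists_mem_ne_zero_of_ne_bot hne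
    obtain ⟨⟨ξ, hξ⟩, h0⟩ := Finsupp.ne_iff.1 hx0
    have hinv := isRowInvariant_of_intertwining (ε := ε)
      (fun i k hi v => embed_nonclassicalOp (ε := ε) hq hq1 hm i hi v) (S := S)
      fun i v hv => by
        rw [← nonclassicalRep_gen hq hq1 ε hm]; exact hS _ v hv
    have hket : ∀ ζ : {ξ : ℕ → ℕ → ℝ // IsNonclassicalTableau n m ξ}, Finsupp.single ζ 1 ∈ S := by
      rintro ⟨ζ, hζ⟩
      have h1 := hinv.ket_mem hq hq1 (by omega) (Submodule.mem_map_of_mem hx) (hξ.adm hm)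
        (hζ.adm hm) (top_eq hξ hζ) (by rw [embed_apply hm x hξ]; exact h0)
      rw [← embed_ket hm hζ.1.2, ket_of hζ] at h1
      obtain ⟨y, hy, hye⟩ := h1
      rwa [← embed_injective hm hye]
    refine eq_top_iff.2 fun y _ => ?_
    rw [← Finsupp.sum_single y]
    refine S.sum_mem fun ζ _ => ?_
    rw [← mul_one (y ζ), ← smul_eq_mul, ← Finsupp.smul_single]
    exact S.smul_mem _ (hket ζ)

/-- The weight is determined by the operators: otherwise the graph of an intertwining isomorphism
would be a row-invariant subspace that contains none of its components. -/
lemma weight_eq_of_intertwining (hq : 0 < q) (hq1 : q ≠ 1) (hn : 3 ≤ n)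
    (hm : IsNonclassicalWeight n m) (hm' : IsNonclassicalWeight n m')
    (f : NonclassicalSpace n m ≃ₗ[ℂ] NonclassicalSpace n m')
    (hf : ∀ i v, f (nonclassicalOp q n ε m i v) = nonclassicalOp q n ε m' i (f v)) : m = m' := by
  by_contra hne
  obtain ⟨j, hj⟩ := Function.ne_iff.1 hne
  set ξ := loweredArr m 2
  have hξ : IsNonclassicalTableau n m ξ :=
    isNonclassicalTableau_loweredArr hm even_two hn le_rfl
  have hinv := isRowInvariant_of_intertwining (q := q) (ε := ε) (S := ⊤)
    (T := nonclassicalOp q n ε m) (g := embed hm + embed hm' ∘ₗ f.toLinearMap)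
    (fun i k hi v => by
      simp only [LinearMap.add_apply, LinearMap.comp_apply, LinearEquiv.coe_coe, map_add, hf,
        embed_nonclassicalOp hq hq1 hm i hi, embed_nonclassicalOp hq hq1 hm' i hi])
    fun _ _ _ => Submodule.mem_top
  have hξj : ξ n j.1 ≠ m' j := by rw [hξ.1.2 j]; exact hj
  have hmem := hinv.ket_mem hq hq1 (by omega)
    (Submodule.mem_map_of_mem (Submodule.mem_top (x := Finsupp.single ⟨ξ, hξ⟩ 1)))
    (hξ.adm hm) (hξ.adm hm) rfl (by
      rw [LinearMap.add_apply, Finsupp.add_apply, LinearMap.comp_apply, embed_apply hm _ hξ,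
        embed_apply_of_top_ne hm' _ _ hξj]
      simp)
  obtain ⟨w, -, hw⟩ := hmem
  rw [LinearMap.add_apply, LinearMap.comp_apply, LinearEquiv.coe_coe, ket_of (hξ.adm hm)] at hw
  have hfw : f w = 0 := by
    ext ⟨ζ, hζ⟩
    have hζj : ζ n j.1 ≠ m j := by rw [hζ.1.2 j]; exact Ne.symm hj
    have := DFunLike.congr_fun hw ⟨ζ, hζ.adm hm'⟩
    rw [Finsupp.add_apply, embed_apply_of_top_ne hm w _ hζj, embed_apply hm' _ hζ, zero_add,
      Finsupp.single_eq_of_ne] at this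
    · exact this
    · intro h
      have : ζ = ξ := congrArg Subtype.val h
      exact hζj (this ▸ hξ.1.2 j)
  rw [hfw, f.map_eq_zero_iff.1 hfw, map_zero, map_zero, add_zero] at hw
  exact one_ne_zero (Finsupp.single_eq_zero.1 hw.symm)

end Irreducible

/-! ### Traces -/

section Trace

variable {q : ℝ} {n : ℕ} {m m' : WeightIndex n → ℝ} {ε ε' : GenIndex n → ℤˣ}

lemma trace_finsupp {α : Type*} [Fintype α] (T : Module.End ℂ (α →₀ ℂ)) :
    LinearMap.trace ℂ _ T = ∑ a, T (Finsupp.single a 1) a := by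
  classical
  rw [LinearMap.trace_eq_matrix_trace ℂ Finsupp.basisSingleOne, Matrix.trace]
  refine sum_congr rfl fun a _ => ?_
  rw [Matrix.diag_apply, LinearMap.toMatrix_apply]
  simp

/-- The diagonal coefficients of row `k` are `e t` with `c t ≥ 0`, where `c` is the same for all
tableaux; they vanish only if `k` is even and the last entry of the row is not `1/2`. -/
lemma exists_diag_sign (hq : 0 < q) (hq1 : q ≠ 1) {k : ℕ} (hk1 : 1 ≤ k) (hk : k + 1 ≤ n) :
    ∃ c : ℝ, ∀ ξ, Adm n ξ → ∃ t : ℝ, (∀ e, foldCoef q e k (uCoord ξ) none = e * t) ∧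
      0 ≤ c * t ∧ ((Even k → ξ k (k / 2) = 1 / 2) → 0 < c * t) := by
  by_cases hE : Even k
  · have hk2 : 2 ≤ k := by obtain ⟨r, rfl⟩ := hE; omega
    refine ⟨q ^ (1 / 2 : ℝ) - q ^ (-(1 / 2) : ℝ), fun ξ hξ => ?_⟩
    have hu : uCoord ξ k (k / 2) = ξ k (k / 2) := by
      obtain ⟨r, rfl⟩ := hE
      rw [uCoord, show (r + r) / 2 = r by omega]; push_cast; ring
    by_cases h : ξ k (k / 2) = 1 / 2
    · refine ⟨-stepCoef q 1 k (uCoord ξ) (some (k / 2, -1)), fun e => ?_, ?_⟩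
      · rw [foldCoef, if_pos ⟨hE, hu.trans h⟩, stepCoef, rowCoef, if_pos hE, zero_div, zero_sub,
          mul_neg]
        rfl
      · have hpos : 0 < (q ^ (1 / 2 : ℝ) - q ^ (-(1 / 2) : ℝ)) *
            -stepCoef q 1 k (uCoord ξ) (some (k / 2, -1)) := by
          have h0 := hξ.2.stepCoef_half_ne_zero (e := 1) hq hq1 hk2 hk (hu.trans h)
          rw [hξ.2.stepCoef_eq hq hq1 hk1 hk (mem_Icc.2 ⟨by omega, le_rfl⟩), hu, h] at h0 ⊢
          have hp := left_ne_zero_of_mul h0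
          have hs := right_ne_zero_of_mul h0
          rw [pref, if_pos hE] at hp ⊢
          have hw : (((-1 : ℤˣ) : ℤ) : ℝ) * (1 / 2) = -(1 / 2) := by push_cast; ring
          rw [hw] at hp hs ⊢
          rw [neg_neg] at hp ⊢
          have hX : q ^ (-(1 / 2) : ℝ) - q ^ (1 / 2 : ℝ) ≠ 0 := fun h0 => hp (by rw [h0, div_zero])
          rw [← neg_sub (q ^ (-(1 / 2) : ℝ)), neg_mul_neg, ← mul_assoc, mul_one_div_cancel hX,
            one_mul]
          exact lt_of_le_of_ne (Real.sqrt_nonneg _) hs.symm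
        exact ⟨hpos.le, fun _ => hpos⟩
    · refine ⟨0, fun e => ?_, by simp, fun h' => absurd (h' hE) h⟩
      rw [foldCoef, if_neg fun h' => h (hu.symm.trans h'.2), stepCoef, rowCoef, if_pos hE]
      simp
  · refine ⟨(q - q⁻¹) ^ #(nbrs k), fun ξ _ => ⟨(∏ x ∈ nbrs k, qNumPlus q (uCoord ξ x.1 x.2)) /
      ∏ i ∈ Icc 1 (k / 2), (qNumPlus q (uCoord ξ k i + 1 / 2) *
        qNumPlus q (uCoord ξ k i - 1 / 2)), fun e => ?_, ?_⟩⟩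
    · rw [foldCoef, if_neg fun h' => hE h'.1, stepCoef, rowCoef, if_neg hE]
      ring
    · have hden : 0 < ∏ i ∈ Icc 1 (k / 2), (qNumPlus q (uCoord ξ k i + 1 / 2) *
          qNumPlus q (uCoord ξ k i - 1 / 2)) := by
        refine prod_pos fun i _ => ?_
        have h1 := mul_qNumPlus_pos hq hq1 (uCoord ξ k i + 1 / 2)
        have h2 := mul_qNumPlus_pos hq hq1 (uCoord ξ k i - 1 / 2)
        have h3 := mul_pos h1 h2
        rw [mul_mul_mul_comm] at h3
        exact pos_of_mul_pos_right h3 (mul_self_nonneg _)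
      have hpos : 0 < (q - q⁻¹) ^ #(nbrs k) * ((∏ x ∈ nbrs k, qNumPlus q (uCoord ξ x.1 x.2)) /
          ∏ i ∈ Icc 1 (k / 2), (qNumPlus q (uCoord ξ k i + 1 / 2) *
            qNumPlus q (uCoord ξ k i - 1 / 2))) := by
        rw [← mul_div_assoc, ← prod_const, ← prod_mul_distrib]
        exact div_pos (prod_pos fun x _ => mul_qNumPlus_pos hq hq1 _) hden
      exact ⟨hpos.le, fun _ => hpos⟩

lemma nonclassicalOp_diag (hq : 0 < q) (hq1 : q ≠ 1) (hm : IsNonclassicalWeight n m)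
    {i : GenIndex n} {k : ℕ} (hi : i.1 = k + 1)
    (ξ : {ξ : ℕ → ℕ → ℝ // IsNonclassicalTableau n m ξ}) :
    nonclassicalOp q n ε m i (Finsupp.single ξ 1) ξ =
      (foldCoef q ((ε i : ℤ) : ℝ) k (uCoord ξ.1) none : ℂ) := by
  have hA := ξ.2.adm hm
  rw [← embed_apply hm _ ξ.2, embed_nonclassicalOp hq hq1 hm i hi,
    show Finsupp.single ξ 1 = ket (IsNonclassicalTableau n m) ξ.1 from (ket_of ξ.2).symm,
    embed_ket hm ξ.2.1.2, ambientOp_ket hA, Finsupp.finsetSum_apply,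
    sum_eq_single_of_mem none (none_mem_stepsOf _), moveArr_none, ket_of hA, Finsupp.smul_apply,
    Finsupp.single_eq_same, rowSign_pred ε i hi]
  · simp
  · intro σ _ hσ
    rw [Finsupp.smul_apply]
    by_cases h : Adm n (moveArr ξ.1 k σ)
    · rw [ket_of h, Finsupp.single_eq_of_ne, smul_zero]
      intro heq
      have h1 := congrFun (congrArg Subtype.val heq) k
      simp only [moveArr, Function.update_self] at h1
      exact hσ (moveRow_injective (ξ.1 k) h1.symm)
    · rw [ket_of_not h, Finsupp.zero_apply, smul_zero]

/-- The trace of `I_{i,i-1}` is `ε_i` times a nonzero number whose sign depends on `i` only. -/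
lemma exists_trace_sign (hq : 0 < q) (hq1 : q ≠ 1) (hn : 3 ≤ n) (i : GenIndex n) :
    ∃ c : ℝ, ∀ m : WeightIndex n → ℝ, IsNonclassicalWeight n m → ∃ R : ℝ, 0 < c * R ∧
      ∀ ε, LinearMap.trace ℂ _ (nonclassicalOp q n ε m i) = ((((ε i : ℤ) : ℝ) * R : ℝ) : ℂ) := by
  have hmem := mem_Icc.1 i.2
  obtain ⟨k, hk⟩ : ∃ k, i.1 = k + 1 := ⟨i.1 - 1, by omega⟩
  obtain ⟨c, hc⟩ := exists_diag_sign (n := n) hq hq1 (k := k) (by omega) (by omega)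
  refine ⟨c, fun m hm => ?_⟩
  have := finite_nonclassicalTableau hm
  have := Fintype.ofFinite {ξ : ℕ → ℕ → ℝ // IsNonclassicalTableau n m ξ}
  choose t ht h0 hpos using fun ξ : {ξ : ℕ → ℕ → ℝ // IsNonclassicalTableau n m ξ} =>
    hc ξ.1 (ξ.2.adm hm)
  refine ⟨∑ ξ, t ξ, ?_, fun ε => ?_⟩
  · rw [mul_sum]
    -- for even `k` a positive term comes from a tableau with the entry `1/2`
    obtain ⟨ξ, hξ⟩ : ∃ ξ : {ξ : ℕ → ℕ → ℝ // IsNonclassicalTableau n m ξ},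
        Even k → ξ.1 k (k / 2) = 1 / 2 := by
      by_cases hE : Even k
      · have hk2 : 2 ≤ k := by obtain ⟨r, rfl⟩ := hE; omega
        exact ⟨⟨_, isNonclassicalTableau_loweredArr hm hE (by omega) hk2⟩,
          fun _ => loweredArr_self (by omega) hk2⟩
      · exact ⟨⟨_, isNonclassicalTableau_loweredArr hm even_two hn le_rfl⟩, fun h => absurd h hE⟩
    exact sum_pos' (fun ξ _ => h0 ξ) ⟨ξ, mem_univ _, hpos ξ hξ⟩
  · rw [trace_finsupp, mul_sum, Complex.ofReal_sum]
    refine sum_congr rfl fun ξ _ => ?_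
    rw [nonclassicalOp_diag hq hq1 hm hk, ht]

lemma trace_eq_of_intertwining {V W : Type*} [AddCommGroup V] [Module ℂ V] [AddCommGroup W]
    [Module ℂ W] (f : V ≃ₗ[ℂ] W) {S : Module.End ℂ V} {T : Module.End ℂ W}
    (h : ∀ v, f (S v) = T (f v)) : LinearMap.trace ℂ V S = LinearMap.trace ℂ W T := by
  rw [← LinearMap.trace_conj' S f]
  congr 1
  ext w
  rw [LinearEquiv.conj_apply_apply, h, f.apply_symm_apply]

lemma sign_eq_of_intertwining (hq : 0 < q) (hq1 : q ≠ 1) (hn : 3 ≤ n)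
    (hm : IsNonclassicalWeight n m) (hm' : IsNonclassicalWeight n m')
    (f : NonclassicalSpace n m ≃ₗ[ℂ] NonclassicalSpace n m')
    (hf : ∀ i v, f (nonclassicalOp q n ε m i v) = nonclassicalOp q n ε' m' i (f v)) : ε = ε' := by
  funext i
  obtain ⟨c, hc⟩ := exists_trace_sign hq hq1 hn i
  obtain ⟨R, hR, ht⟩ := hc m hm
  obtain ⟨R', hR', ht'⟩ := hc m' hm'
  have h := trace_eq_of_intertwining f (hf i)
  rw [ht, ht', Complex.ofReal_inj] at h
  by_contra hne
  have hs : ε i = -ε' i := Int.units_ne_iff_eq_neg.1 hne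
  rw [hs] at h
  have h1 := unit_mul_self (ε' i)
  push_cast at h
  have h2 : R + R' = 0 := by linear_combination (-(R + R')) * h1 - ((ε' i : ℤ) : ℝ) * h
  have h3 : c * R + c * R' = 0 := by rw [← mul_add, h2, mul_zero]
  linarith

lemma shift_ne (ξ : ℕ → ℕ → ℝ) (k j : ℕ) {d : ℝ} (hd : d ≠ 0) : shift ξ k j d ≠ ξ := by
  intro h
  have := congrFun (congrFun h k) j
  rw [shift, Function.update_self, Function.update_self] at this
  exact hd (by linarith)

lemma ket_apply_of_ne {P : (ℕ → ℕ → ℝ) → Prop} {η : ℕ → ℕ → ℝ} {ξ : {ξ : ℕ → ℕ → ℝ // P ξ}}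
    (h : η ≠ ξ.1) : ket P η ξ = 0 := by
  by_cases hη : P η
  · rw [ket_of hη, Finsupp.single_eq_of_ne]
    rintro rfl
    exact h rfl
  · rw [ket_of_not hη, Finsupp.zero_apply]

/-- In the classical type representations `I_{2p+1,2p}` has no diagonal matrix elements. -/
lemma trace_classicalOp_of_odd {i : GenIndex n} (hi : ¬ Even i.1)
    [Finite {ξ : ℕ → ℕ → ℝ // IsClassicalTableau n m ξ}] :
    LinearMap.trace ℂ _ (classicalOp q n m i) = 0 := by
  have := Fintype.ofFinite {ξ : ℕ → ℕ → ℝ // IsClassicalTableau n m ξ}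
  rw [trace_finsupp]
  refine sum_eq_zero fun ξ _ => ?_
  have h1 : ∀ k j, ket (IsClassicalTableau n m) (shift ξ.1 k j 1) ξ = 0 := fun k j =>
    ket_apply_of_ne (shift_ne _ _ _ one_ne_zero)
  have h2 : ∀ k j, ket (IsClassicalTableau n m) (shift ξ.1 k j (-1)) ξ = 0 := fun k j =>
    ket_apply_of_ne (shift_ne _ _ _ (neg_ne_zero.2 one_ne_zero))
  rw [classicalOp, Finsupp.linearCombination_single, one_smul, if_neg hi, classicalOddImage]
  simp only [Finsupp.sub_apply, Finsupp.finsetSum_apply, Finsupp.smul_apply, h1, h2, smul_zero,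
    sum_const_zero, sub_zero]

/-- The trace of `I_{3,2}` separates the nonclassical representations from those of the classical
type. -/
lemma not_intertwining_classical (hq : 0 < q) (hq1 : q ≠ 1) (hn : 3 ≤ n)
    (hm : IsNonclassicalWeight n m) (f : NonclassicalSpace n m ≃ₗ[ℂ] ClassicalSpace n m')
    (hf : ∀ i v, f (nonclassicalOp q n ε m i v) = classicalOp q n m' i (f v)) : False := by
  let i : GenIndex n := ⟨3, mem_Icc.2 ⟨by omega, hn⟩⟩
  have := finite_nonclassicalTableau hm
  have : FiniteDimensional ℂ (ClassicalSpace n m') := LinearEquiv.finiteDimensional f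
  have : Finite {ξ : ℕ → ℕ → ℝ // IsClassicalTableau n m' ξ} :=
    Module.Finite.finite_basis (R := ℂ) (M := ClassicalSpace n m') Finsupp.basisSingleOne
  obtain ⟨c, hc⟩ := exists_trace_sign hq hq1 hn i
  obtain ⟨R, hR, ht⟩ := hc m hm
  have h := trace_eq_of_intertwining f (hf i)
  rw [ht, trace_classicalOp_of_odd (by simp only [i]; decide), ← Complex.ofReal_zero,
    Complex.ofReal_inj] at h
  have h1 := unit_mul_self (ε i)
  have h2 : R = 0 := by linear_combination (-R) * h1 + ((ε i : ℤ) : ℝ) * h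
  rw [h2, mul_zero] at hR
  exact lt_irrefl _ hR

end Trace

theorem theorem1 (q : ℝ) (hq : 0 < q) (hq1 : q ≠ 1) (n : ℕ) (hn : 3 ≤ n) :
    -- the operators given by the formulas define representations `T ε m` of `U'_q(so_n)`
    ∃ T : ∀ (_ : GenIndex n → ℤˣ) (m : {m : WeightIndex n → ℝ // IsNonclassicalWeight n m}),
        USo q n →ₐ[ℂ] Module.End ℂ (NonclassicalSpace n m.1),
      (∀ ε m i, T ε m (USo.gen q n i) = nonclassicalOp q n ε m.1 i) ∧
      -- they are finite-dimensional and irreducible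
      (∀ m : {m : WeightIndex n → ℝ // IsNonclassicalWeight n m},
        FiniteDimensional ℂ (NonclassicalSpace n m.1)) ∧
      (∀ ε m, IsIrreducibleRep (T ε m)) ∧
      -- distinct parameters give nonequivalent representations
      (∀ ε m ε' m', (ε, m) ≠ (ε', m') → ¬ EquivalentReps (T ε m) (T ε' m')) ∧
      -- none is equivalent to a representation of the classical type (a linear isomorphism
      -- intertwines two representations as soon as it does so on the generators)
      (∀ ε m, ∀ m' : {m' : WeightIndex n → ℝ // IsClassicalWeight n m'},
        ¬ ∃ f : NonclassicalSpace n m.1 ≃ₗ[ℂ] ClassicalSpace n m'.1,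
          ∀ i v, f (T ε m (USo.gen q n i) v) = classicalOp q n m'.1 i (f v)) := by
  refine ⟨fun ε m => nonclassicalRep hq hq1 ε m.2,
    fun ε m i => nonclassicalRep_gen hq hq1 ε m.2 i, fun m => ?_,
    fun ε m => isIrreducibleRep_nonclassicalRep hq hq1 hn ε m.2, ?_, ?_⟩
  · have := finite_nonclassicalTableau m.2
    infer_instance
  · rintro ε m ε' m' hne ⟨f, hf⟩
    have hf' : ∀ i v, f (nonclassicalOp q n ε m.1 i v) = nonclassicalOp q n ε' m'.1 i (f v) := by
      intro i v
      rw [← nonclassicalRep_gen hq hq1 ε m.2, ← nonclassicalRep_gen hq hq1 ε' m'.2]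
      exact hf _ v
    obtain rfl := sign_eq_of_intertwining hq hq1 hn m.2 m'.2 f hf'
    exact hne (by rw [Subtype.ext (weight_eq_of_intertwining hq hq1 hn m.2 m'.2 f hf')])
  · rintro ε m m' ⟨f, hf⟩
    exact not_intertwining_classical (ε := ε) hq hq1 hn m.2 f fun i v => by
      rw [← nonclassicalRep_gen hq hq1 ε m.2]; exact hf i v

end
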